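/- Fix $\alpha\in(0,2)$. All complex powers use the principal branch on $\mathbb C\setminus(-\infty,0]$, and $w^{-\beta}:=(w^{-1})^{\beta}$. Put $\mathbb C^+=\{z:\Im z>0\}$, $$g_\alpha(y)=\int_0^\infty t^{\frac\alpha2-1}e^{-t}e^{-t^{\alpha/2}y}\,dt,\qquad h_\alpha(y)=\int_0^\infty e^{-t}e^{-t^{\alpha/2}y}\,dt,\qquad C_\alpha=i^\alpha\,\frac{\Gamma(1-\frac\alpha2)}{\Gamma(\frac\alpha2)},$$ and $\widehat{\mathcal K}_\alpha=\{\rho e^{i\varphi}:\rho\ge0,\ -\frac{\alpha\pi}2\le\varphi\le0\}$. Let $\mathcal C_\star$ be the set of kernels $\sigma$ for which there are $0=b_0<b_1<\dots<b_q=1$ and a symmetric real $q\times q$ matrix $(\sigma_{rs})$ with $\sigma=\sigma_{rs}$ on $(b_{r-1},b_r]\times(b_{s-1},b_s]$; put $\Delta_s=b_s-b_{s-1}$. For $f:[0,1]^2\to\mathbb R$ let $\|f\|_\star=\limsup_{n\to\infty}\|f(n^{-1}\lceil nx\rceil,n^{-1}\lceil ny\rceil)\|_{L^2([0,1]^2)}$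 and, for measurable $f$, $\|f\|=\operatorname{ess\,sup}_{x\in(0,1]}\int_0^1|f(x,v)|\,dv$. Let $\mathcal F_\alpha$ be the set of symmetric measurable $\sigma:[0,1]^2\to\mathbb R$ with $\|\sigma\|_\star<\infty$ and $\|\,|\sigma|^\alpha\|<\infty$ for which there are $\sigma_p\in\mathcal C_\star$ with $\|\sigma_p-\sigma\|_\star\to0$ and $\|\,|\sigma_p|^\alpha-|\sigma|^\alpha\|\to0$ as $p\to\infty$. Let $(x_{ij})_{1\le i\le j}$ be i.i.d. real random variables with $\mathbb P(|x_{ij}|\ge u)=L(u)u^{-\alpha}$ for all $u>0$, where $L$ is slowly varying at infinity, and put $x_{ij}=x_{ji}$ for $i>j$. Let $a_N=\inf\{u:\mathbb P(|x_{11}|\ge u)\le 1/N\}$, and let $A_N^\sigma$ be the $N\times N$ matrix with entries $a_N^{-1}\sigma(\frac iN,\frac jN)x_{ij}$. For each $N$ let $D_N$ be a diagonal matrix whose $N$ diagonal entries are i.i.d. of law $\mu^D$, a probability measure on $\mathbb R$ with finite second moment, and independent of $(x_{ij})$. For a real symmetric $N\times N$ matrix $M$ with eigenvalues $\lambda_1,\dots,\lambda_N$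 let $\hat\mu_M=\frac1N\sum_{i=1}^N\delta_{\lambda_i}$. **Theorem.** Let $\sigma\in\mathcal F_\alpha$. There is a finite $R=R(\sigma)>0$ (depending on $\alpha$ and $\sigma$ only) such that for every $\mu^D$ as above the following hold. (1) There is a unique analytic map $\widehat X^\sigma:\mathbb C^+\to L^\infty((0,1];\widehat{\mathcal K}_\alpha)$ such that, whenever $\Im z\ge R$, for almost every $x\in(0,1]$ $$\widehat X^\sigma_x(z)=\overline{C_\alpha}\int_0^1|\sigma(x,v)|^\alpha\int(\lambda-z)^{-\frac\alpha2}g_\alpha\big((\lambda-z)^{-\frac\alpha2}\widehat X^\sigma_v(z)\big)\,d\mu^D(\lambda)\,dv.$$ (2) There is a probability measure $\mu^{\sigma,D}$ on $\mathbb R$, depending only on $\alpha,\sigma,\mu^D$, such that $\mathbb E[\hat\mu_{A_N^\sigma+D_N}]$ converges weakly to $\mu^{\sigma,D}$ as $N\to\infty$ and, for all $z\in\mathbb C^+$, $$\int\frac{1}{z-x}\,d\mu^{\sigma,D}(x)=\int\frac1{z-\lambda}\Big(\int_0^1h_\alpha\big((\lambda-z)^{-\frac\alpha2}\widehat X^\sigma_v(z)\big)\,dv\Big)\,d\mu^D(\lambda).$$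 (3) If $\sigma\in\mathcal C_\star$, with $b_r$ and $\sigma_{rs}$ as above, then there is a unique collection $(\widehat X_r)_{1\le r\le q}$ of analytic functions $\mathbb C^+\to\widehat{\mathcal K}_\alpha$ such that for all $z\in\mathbb C^+$ and all $r$ $$\widehat X_r(z)=\overline{C_\alpha}\sum_{s=1}^q|\sigma_{rs}|^\alpha\Delta_s\int(\lambda-z)^{-\frac\alpha2}g_\alpha\big((\lambda-z)^{-\frac\alpha2}\widehat X_s(z)\big)\,d\mu^D(\lambda);$$ it satisfies $|\widehat X_r(z)|\le c\,(\Im z)^{-\alpha/2}$ for some finite $c$, all $r$ and all $z\in\mathbb C^+$; and for every $z\in\mathbb C^+$ and every $r$ one has $\widehat X^\sigma_x(z)=\widehat X_r(z)$ for almost every $x\in(b_{r-1},b_r]$. -/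

import Mathlib

open MeasureTheory ProbabilityTheory Filter Topology Set
open scoped ENNReal

noncomputable section

namespace HeavyTail

/-! ### Special functions and constants -/

/-- The open upper half plane. -/
def upperHalf : Set ℂ := {z | 0 < z.im}

/-- `g_α(y) = ∫₀^∞ t^{α/2-1} e^{-t} exp(-t^{α/2} y) dt`. -/
def gFun (α : ℝ) (y : ℂ) : ℂ :=
  ∫ t in Ioi (0 : ℝ),
    ((t ^ (α / 2 - 1) * Real.exp (-t) : ℝ) : ℂ) * Complex.exp (-((t ^ (α / 2) : ℝ) : ℂ) * y)

/-- `h_α(y) = ∫₀^∞ e^{-t} exp(-t^{α/2} y) dt`. -/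
def hFun (α : ℝ) (y : ℂ) : ℂ :=
  ∫ t in Ioi (0 : ℝ),
    ((Real.exp (-t) : ℝ) : ℂ) * Complex.exp (-((t ^ (α / 2) : ℝ) : ℂ) * y)

/-- `C_α = i^α Γ(1 - α/2) / Γ(α/2)`, with the principal branch of the power. -/
def cConst (α : ℝ) : ℂ :=
  Complex.I ^ (α : ℂ) * ((Real.Gamma (1 - α / 2) / Real.Gamma (α / 2) : ℝ) : ℂ)

/-- `w^{-α/2} := (w⁻¹)^{α/2}`, with the principal branch of the power. -/
def invPow (α : ℝ) (w : ℂ) : ℂ := w⁻¹ ^ ((α / 2 : ℝ) : ℂ)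

/-- The closed cone of all `ρ e^{iφ}` with `ρ ≥ 0` and `-απ/2 ≤ φ ≤ 0`. -/
def cone (α : ℝ) : Set ℂ :=
  {w | ∃ ρ φ : ℝ, 0 ≤ ρ ∧ -(α * Real.pi / 2) ≤ φ ∧ φ ≤ 0 ∧
    w = (ρ : ℂ) * Complex.exp (Complex.I * (φ : ℂ))}

/-! ### Kernels

A kernel on the unit square is a function `ℝ → ℝ → ℝ`, of which only the values on
`(0,1] × (0,1]` are ever used. -/

/-- Lebesgue measure on `(0,1]`. -/
abbrev unitMeasure : Measure ℝ := volume.restrict (Ioc (0 : ℝ) 1)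

/-- `limsup_n ‖f(⌈n x⌉ / n, ⌈n y⌉ / n)‖₂`, the norm being that of `L²` of the unit square. -/
def starNorm (f : ℝ → ℝ → ℝ) : ℝ≥0∞ :=
  limsup (fun n : ℕ =>
    eLpNorm (fun p : ℝ × ℝ => f ((⌈(n : ℝ) * p.1⌉ : ℝ) / n) ((⌈(n : ℝ) * p.2⌉ : ℝ) / n)) 2
      (volume.restrict (Ioc (0 : ℝ) 1 ×ˢ Ioc (0 : ℝ) 1))) atTop

/-- The essential supremum over `x ∈ (0,1]` of `∫₀¹ |f(x,v)| dv`. -/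
def opNorm (f : ℝ → ℝ → ℝ) : ℝ≥0∞ :=
  essSup (fun x => ∫⁻ v, ‖f x v‖ₑ ∂unitMeasure) unitMeasure

/-- `σ` equals `s r t` on `(b_{r-1}, b_r] × (b_{t-1}, b_t]`, where `0 = b_0 < ⋯ < b_q = 1` and `s`
is a symmetric matrix. -/
structure IsStep (σ : ℝ → ℝ → ℝ) (q : ℕ) (b : Fin (q + 1) → ℝ)
    (s : Matrix (Fin q) (Fin q) ℝ) : Prop where
  strictMono : StrictMono b
  first : b 0 = 0
  last : b (Fin.last q) = 1
  symm : s.IsSymm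
  value : ∀ r t : Fin q, ∀ x ∈ Ioc (b r.castSucc) (b r.succ),
    ∀ y ∈ Ioc (b t.castSucc) (b t.succ), σ x y = s r t

/-- The class of piecewise constant symmetric kernels. -/
def PiecewiseConst (σ : ℝ → ℝ → ℝ) : Prop := ∃ q b s, IsStep σ q b s

/-- The class `𝓕_α`. -/
structure FClass (α : ℝ) (σ : ℝ → ℝ → ℝ) : Prop where
  symm : ∀ x ∈ Ioc (0 : ℝ) 1, ∀ y ∈ Ioc (0 : ℝ) 1, σ x y = σ y x
  aemeasurable : AEMeasurable (fun p : ℝ × ℝ => σ p.1 p.2)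
    (volume.restrict (Ioc (0 : ℝ) 1 ×ˢ Ioc (0 : ℝ) 1))
  starNorm_lt_top : starNorm σ < ∞
  opNorm_lt_top : opNorm (fun x v => |σ x v| ^ α) < ∞
  approx : ∃ τ : ℕ → ℝ → ℝ → ℝ, (∀ p, PiecewiseConst (τ p)) ∧
    Tendsto (fun p => starNorm (fun x v => τ p x v - σ x v)) atTop (𝓝 0) ∧
    Tendsto (fun p => opNorm (fun x v => |τ p x v| ^ α - |σ x v| ^ α)) atTop (𝓝 0)

/-! ### The random matrices -/

/-- Slow variation at infinity. -/
def SlowlyVarying (L : ℝ → ℝ) : Prop :=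
  (∀ᶠ u in atTop, 0 < L u) ∧ ∀ c : ℝ, 0 < c → Tendsto (fun u => L (c * u) / L u) atTop (𝓝 1)

/-- The tail of the absolute value is `L(u) u^{-α}` for a slowly varying `L`. -/
def HeavyTailed (α : ℝ) (ν : Measure ℝ) : Prop :=
  ∃ L : ℝ → ℝ, SlowlyVarying L ∧ ∀ u : ℝ, 0 < u → ν.real {t | u ≤ |t|} = L u * u ^ (-α)

/-- `a_N = inf {u : ν(|x| ≥ u) ≤ 1/N}`. -/
def scale (ν : Measure ℝ) (N : ℕ) : ℝ := sInf {u : ℝ | ν.real {t | u ≤ |t|} ≤ 1 / (N : ℝ)}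

/-- The matrix `a⁻¹ (σ(i/N, j/N) x_{ij})_{1 ≤ i,j ≤ N} + diag(d)`, where `x_{ij} := x_{ji}` for
`i > j`. Indices are shifted: the row `i : Fin N` is the row `i + 1`. -/
def perturbedMatrix (σ : ℝ → ℝ → ℝ) (N : ℕ) (a : ℝ) (x : ℕ → ℕ → ℝ) (d : Fin N → ℝ) :
    Matrix (Fin N) (Fin N) ℝ :=
  Matrix.of (fun i j : Fin N =>
    a⁻¹ * (σ (((i : ℕ) + 1 : ℝ) / N) (((j : ℕ) + 1 : ℝ) / N) *
      x (min (i : ℕ) j) (max (i : ℕ) j))) + Matrix.diagonal d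

theorem perturbedMatrix_isHermitian {σ : ℝ → ℝ → ℝ}
    (hσ : ∀ x ∈ Ioc (0 : ℝ) 1, ∀ y ∈ Ioc (0 : ℝ) 1, σ x y = σ y x)
    (N : ℕ) (a : ℝ) (x : ℕ → ℕ → ℝ) (d : Fin N → ℝ) :
    (perturbedMatrix σ N a x d).IsHermitian := by
  have hmem : ∀ i : Fin N, (((i : ℕ) + 1 : ℝ) / N) ∈ Ioc (0 : ℝ) 1 := by
    intro i
    have hi : ((i : ℕ) + 1 : ℝ) ≤ N := by exact_mod_cast i.2
    have hN : (0 : ℝ) < N := lt_of_lt_of_le (by positivity) hi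
    exact ⟨by positivity, (div_le_one hN).2 hi⟩
  refine Matrix.IsHermitian.add ?_ (Matrix.isHermitian_diagonal d)
  ext i j
  simp only [Matrix.conjTranspose_apply, Matrix.of_apply, star_trivial]
  rw [hσ _ (hmem j) _ (hmem i), min_comm, max_comm]

/-- The spectral measure `N⁻¹ ∑ δ_{λ_i}` of a real symmetric matrix. -/
def spectralMeasure {N : ℕ} {A : Matrix (Fin N) (Fin N) ℝ} (hA : A.IsHermitian) : Measure ℝ :=
  (N : ℝ≥0∞)⁻¹ • ∑ i, Measure.dirac (hA.eigenvalues i)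

/-- The mean spectral measure `B ↦ E[μ̂(B)]` of `a⁻¹ Y_N^σ + D_N`. -/
def meanSpectralMeasure {Ω : Type*} [MeasurableSpace Ω] (P : Measure Ω) {σ : ℝ → ℝ → ℝ}
    (hσ : ∀ x ∈ Ioc (0 : ℝ) 1, ∀ y ∈ Ioc (0 : ℝ) 1, σ x y = σ y x)
    (N : ℕ) (a : ℝ) (x : ℕ → ℕ → Ω → ℝ) (d : Fin N → Ω → ℝ) : Measure ℝ :=
  P.bind (fun ω => spectralMeasure
    (perturbedMatrix_isHermitian hσ N a (fun i j => x i j ω) (fun k => d k ω)))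

/-- The probabilistic setting: `(x_{ij})_{i ≤ j}` are i.i.d. of law `ν`, and for each `N` the
variables `D_N(k,k)` are i.i.d. of law `μD`, independent of the `x_{ij}`. -/
structure Model {Ω : Type*} [MeasurableSpace Ω] (P : Measure Ω) (ν μD : Measure ℝ)
    (x : ℕ → ℕ → Ω → ℝ) (D : (N : ℕ) → Fin N → Ω → ℝ) : Prop where
  measurable_x : ∀ i j, i ≤ j → Measurable (x i j)
  law_x : ∀ i j, i ≤ j → P.map (x i j) = ν
  indep_x : iIndepFun (fun (p : {p : ℕ × ℕ // p.1 ≤ p.2}) => x p.1.1 p.1.2) P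
  measurable_D : ∀ N k, Measurable (D N k)
  law_D : ∀ N k, P.map (D N k) = μD
  indep_D : ∀ N, iIndepFun (D N) P
  indep_x_D : ∀ N, IndepFun (fun ω (p : {p : ℕ × ℕ // p.1 ≤ p.2}) => x p.1.1 p.1.2 ω)
    (fun ω k => D N k ω) P

/-- Weak convergence of measures on the line. -/
def WeaklyConverges (m : ℕ → Measure ℝ) (μ : Measure ℝ) : Prop :=
  ∀ f : BoundedContinuousFunction ℝ ℝ,
    Tendsto (fun N => ∫ t, f t ∂(m N)) atTop (𝓝 (∫ t, f t ∂μ))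

/-! ### The limiting equations -/

/-- `∫ (λ-z)^{-α/2} g_α((λ-z)^{-α/2} w) dμD(λ)`. -/
def gAverage (α : ℝ) (μD : Measure ℝ) (z w : ℂ) : ℂ :=
  ∫ l : ℝ, invPow α ((l : ℂ) - z) * gFun α (invPow α ((l : ℂ) - z) * w) ∂μD

/-- `X` is an analytic map from the upper half plane to `L^∞((0,1]; cone α)` which, for
`Im z ≥ R`, solves the fixed point equation for almost every `x ∈ (0,1]`. -/
structure IsSolution (α : ℝ) (σ : ℝ → ℝ → ℝ) (μD : Measure ℝ) (R : ℝ)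
    (X : ℂ → Lp ℂ ∞ unitMeasure) : Prop where
  analytic : AnalyticOnNhd ℂ X upperHalf
  mem_cone : ∀ z ∈ upperHalf, ∀ᵐ x ∂unitMeasure, X z x ∈ cone α
  equation : ∀ z ∈ upperHalf, R ≤ z.im → ∀ᵐ x ∂unitMeasure,
    X z x = starRingEnd ℂ (cConst α) *
      ∫ v, ((|σ x v| ^ α : ℝ) : ℂ) * gAverage α μD z (X z v) ∂unitMeasure

/-- `(X_r)` is a collection of analytic functions from the upper half plane to `cone α` solving
the finite system attached to a piecewise constant kernel. -/
structure IsStepSolution (α : ℝ) (μD : Measure ℝ) (q : ℕ) (b : Fin (q + 1) → ℝ)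
    (s : Matrix (Fin q) (Fin q) ℝ) (X : Fin q → ℂ → ℂ) : Prop where
  analytic : ∀ r, AnalyticOnNhd ℂ (X r) upperHalf
  mem_cone : ∀ r, ∀ z ∈ upperHalf, X r z ∈ cone α
  equation : ∀ r, ∀ z ∈ upperHalf,
    X r z = starRingEnd ℂ (cConst α) *
      ∑ t : Fin q, ((|s r t| ^ α * (b t.succ - b t.castSucc) : ℝ) : ℂ) * gAverage α μD z (X t z)

end HeavyTail

end

open MeasureTheory ProbabilityTheory Filter Topology Set
open scoped ENNReal

noncomputable section

namespace HeavyTail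

/-! ### Holomorphic functions -/

/-! The proof is a cavity argument. Let R = (H − z)⁻¹ be the resolvent of H = A_N^σ + D_N and q_k =
−i R_kk, which has positive real part. Schur's formula (`resol_diag_schur`) says q_k⁻¹ = i(H_kk − z
− uᵀR⁽ᵏ⁾u), where u is row k without its diagonal entry and R⁽ᵏ⁾ belongs to the matrix without row k
and is independent of u. The heavy tailed part of H_kk and the off-diagonal part of the quadratic
form are negligible (`eventually_integral_min_quad_le`). What remains is a sum of the u_j² weighted
by the q_j⁽ᵏ⁾, and the u_j² lie in the domain of attraction of a positive stable law of index α/2.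
Writing w^{-β} Γ(β) = ∫ t^{β-1} e^{-tw} dt turns this into E q_k^β ≈ Γ(β)⁻¹ ψ_β(z, Y_k), where
ψ_β(z, Y) = ∫∫ t^{β-1} e^{-it(λ-z)} exp(-t^{α/2} Y) dt dμ^D(λ) and Y_k = Γ(1-α/2) N⁻¹ ∑_j |σ_kj|^α E
q_j^{α/2}. The random field is replaced by its mean through the Efron–Stein inequality with rows as
blocks, since resampling one row moves the diagonal of the resolvent by O(1) in ℓ¹. For β = α/2 the
system for Y is closed; β = 1 then gives the trace. This is `eventually_norm_meanPow_sub_psi_le`,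
uniform over bounded profiles and over Im z ≥ η.

In the variable Y = i^{α/2} X the cone of the theorem becomes the symmetric sector |arg Y| ≤ απ/4
inside the right half plane, where the Laplace integrals are bounded and Lipschitz. Their constants
involve only Re(i(λ-z)) = Im z and never λ, which is why R does not depend on μ^D. The Lipschitz
constant of the fixed point map decays like (Im z)^{-α}, so the map is a contraction high in the
half plane.

For a kernel constant on blocks, the block averages of E q_j^{α/2} are approximate fixed points.
Contraction makes them Cauchy for large Im z, the three lines theorem carries this down to every z
(`exists_differentiableOn_limit`), and the limit solves the finite system on the whole half plane.
Existence of the solution is thus read off the matrix model itself, run with Pareto entries;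
uniqueness is contraction followed by the identity theorem.

A general kernel in 𝓕_α is approximated by step kernels. Closeness of |σ_p|^α to |σ|^α in the row
norm makes the step solutions converge in L^∞ (`SolvesAt.norm_sub_le`). Closeness in the star norm
controls the resolvent traces (`exists_norm_meanRes_sub_le`): rows with a huge entry are few and are
removed at bounded cost each, and the truncated rest is compared in Frobenius norm. The pointwise
limit of the Stieltjes transforms has full mass at infinity, because X tends to 0 there and the
limit behaves like the transform of μ^D; this gives tightness and weak convergence. The limit
transform does not involve the law of the entries, so neither does the limit measure. -/

theorem isOpen_upperHalf : IsOpen upperHalf := isOpen_lt continuous_const Complex.continuous_im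

/-- Only the function needs a dominating bound: Cauchy's estimate on a circle of radius r/3 converts
it into a domination of the derivative, and such circles around points of the ball of radius r/3
stay inside U. -/
theorem differentiableOn_integral_of_bounded {Ω : Type*} [MeasurableSpace Ω] {μ : Measure Ω}
    {F : ℂ → Ω → ℂ} {U : Set ℂ} (hU : IsOpen U) {bound : Ω → ℝ} (hb : Integrable bound μ)
    (hm : ∀ z ∈ U, AEStronglyMeasurable (F z) μ)
    (hd : ∀ᵐ ω ∂μ, DifferentiableOn ℂ (fun z => F z ω) U)
    (hbd : ∀ᵐ ω ∂μ, ∀ z ∈ U, ‖F z ω‖ ≤ bound ω) :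
    DifferentiableOn ℂ (fun z => ∫ ω, F z ω ∂μ) U := by
  intro z₀ hz₀
  obtain ⟨r, hr, hball⟩ := Metric.isOpen_iff.1 hU z₀ hz₀
  set ρ := r / 3 with hρ
  have hρ0 : 0 < ρ := by positivity
  have hsub : Metric.ball z₀ ρ ⊆ U := fun w hw =>
    hball (Metric.ball_subset_ball (by linarith) hw)
  refine (DifferentiableAt.differentiableWithinAt ?_)
  have key := hasDerivAt_integral_of_dominated_loc_of_deriv_le (μ := μ) (F := F)
    (F' := fun z ω => deriv (fun z => F z ω) z) (x₀ := z₀) (s := Metric.ball z₀ ρ)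
    (bound := fun ω => bound ω / ρ) (Metric.ball_mem_nhds _ hρ0)
    (by filter_upwards [hU.mem_nhds hz₀] with z hz using hm z hz)
    (hb.mono' (hm z₀ hz₀) (by filter_upwards [hbd] with ω hω using hω z₀ hz₀))
    ?_ ?_ (hb.div_const _) ?_
  · exact key.2.differentiableAt
  -- The derivative is measurable in ω as a limit of difference quotients. The offset 2 keeps every
  -- step strictly smaller than ρ, also for n = 0.
  · have hlim : Tendsto (fun n : ℕ => (ρ / ((n : ℝ) + 2) : ℝ)) atTop (𝓝 0) := by
      refine Tendsto.const_div_atTop ?_ _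
      exact tendsto_atTop_add_const_right _ _ tendsto_natCast_atTop_atTop
    have hpos : ∀ n : ℕ, 0 < ρ / ((n : ℝ) + 2) := fun n => by positivity
    have hlt : ∀ n : ℕ, ρ / ((n : ℝ) + 2) < ρ := fun n =>
      div_lt_self hρ0 (by have : (0 : ℝ) ≤ n := n.cast_nonneg
                          linarith)
    refine aestronglyMeasurable_of_tendsto_ae atTop (f := fun (n : ℕ) ω =>
      ((ρ / ((n : ℝ) + 2) : ℝ) : ℂ)⁻¹ • (F (z₀ + ((ρ / ((n : ℝ) + 2) : ℝ) : ℂ)) ω - F z₀ ω)) ?_ ?_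
    · intro n
      refine AEStronglyMeasurable.const_smul ((hm _ (hsub ?_)).sub (hm _ hz₀)) (_ : ℂ)
      rw [Metric.mem_ball, dist_eq_norm, add_sub_cancel_left, Complex.norm_real, Real.norm_eq_abs,
        abs_of_pos (hpos n)]
      exact hlt n
    · filter_upwards [hd] with ω hω
      have h1 := ((hω.differentiableAt (hU.mem_nhds hz₀)).hasDerivAt).tendsto_slope_zero
      refine h1.comp ?_
      refine tendsto_nhdsWithin_iff.2 ⟨?_, Eventually.of_forall fun n => ?_⟩
      · have := (Complex.continuous_ofReal.tendsto 0).comp hlim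
        simpa [Function.comp_def] using this
      · simpa only [mem_compl_iff, mem_singleton_iff, Complex.ofReal_eq_zero] using (hpos n).ne'
  · filter_upwards [hd, hbd] with ω hω hω2 z hz
    refine Complex.norm_deriv_le_of_forall_mem_sphere_norm_le hρ0 ?_ ?_
    · refine DifferentiableOn.diffContOnCl (hω.mono ?_)
      refine (Metric.closure_ball_subset_closedBall).trans fun w hw => hball ?_
      rw [Metric.mem_closedBall] at hw
      rw [Metric.mem_ball] at hz ⊢
      have := dist_triangle w z z₀
      linarith
    · intro w hw
      refine hω2 w (hball ?_)
      rw [Metric.mem_sphere] at hw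
      rw [Metric.mem_ball] at hz ⊢
      have := dist_triangle w z z₀
      linarith
  · filter_upwards [hd] with ω hω z hz
    exact (hω.differentiableAt (hU.mem_nhds (hsub hz))).hasDerivAt

/-- The three lines theorem on a horizontal strip. -/
theorem norm_le_interp_horizontalStrip {E : Type*} [NormedAddCommGroup E] [NormedSpace ℂ E]
    {f : ℂ → E} (hf : DifferentiableOn ℂ f upperHalf) {l u a b : ℝ} (hl : 0 < l) (hlu : l < u)
    (ha : ∀ z : ℂ, l ≤ z.im → ‖f z‖ ≤ a) (hb : ∀ z : ℂ, z.im = u → ‖f z‖ ≤ b)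
    {z : ℂ} (h1 : l ≤ z.im) (h2 : z.im ≤ u) :
    ‖f z‖ ≤ a ^ (1 - (z.im - l) / (u - l)) * b ^ ((z.im - l) / (u - l)) := by
  have him : ∀ w : ℂ, (Complex.I * w).im = w.re := fun w => by simp
  have hz : Complex.I * (-Complex.I * z) = z := by
    rw [← mul_assoc]; simp
  have hre : (-Complex.I * z).re = z.im := by simp
  have key := Complex.HadamardThreeLines.norm_le_interp_of_mem_verticalClosedStrip'
    (f := fun w => f (Complex.I * w)) (z := -Complex.I * z) (a := a) (b := b) hlu
    (by simpa [Complex.HadamardThreeLines.verticalClosedStrip] using ⟨h1, h2⟩)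
    (by
      refine DifferentiableOn.diffContOnCl (hf.comp (by fun_prop) fun w hw => ?_)
      have hw' : l ≤ w.re := by
        refine closure_minimal (fun v hv => ?_) (isClosed_le continuous_const Complex.continuous_re)
          hw
        exact (hv : v.re ∈ Ioo l u).1.le
      change 0 < (Complex.I * w).im
      rw [him]
      linarith)
    (by
      refine ⟨a, ?_⟩
      rintro _ ⟨w, hw, rfl⟩
      exact ha _ (by rw [him]; exact hw.1))
    (fun w hw => ha _ (by rw [him]; exact (hw : w.re = l).ge))
    (fun w hw => hb _ (by rw [him]; exact hw))
  simpa only [hz, hre] using key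

/-- Smallness of f n - f m is known only high up, boundedness everywhere. On the strip between ε/2
and R the three lines theorem interpolates between the two, and at heights at least ε the weight of
the small side is bounded below. So the sequence is uniformly Cauchy on every half plane Im z ≥ ε.
-/
theorem exists_differentiableOn_limit {E : Type*} [NormedAddCommGroup E] [NormedSpace ℂ E]
    [CompleteSpace E] {f : ℕ → ℂ → E} (hf : ∀ n, DifferentiableOn ℂ (f n) upperHalf) {B : ℝ → ℝ}
    (hB : ∀ ε > 0, ∀ n, ∀ z : ℂ, ε ≤ z.im → ‖f n z‖ ≤ B ε) {R : ℝ}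
    (hC : ∀ δ > 0, ∃ N₀, ∀ n ≥ N₀, ∀ m ≥ N₀, ∀ z : ℂ, R ≤ z.im → ‖f n z - f m z‖ ≤ δ) :
    ∃ g : ℂ → E, DifferentiableOn ℂ g upperHalf ∧
      ∀ z ∈ upperHalf, Tendsto (fun n => f n z) atTop (𝓝 (g z)) := by
  have hmain : ∀ ε > 0, ∀ δ > 0, ∃ N₀, ∀ n ≥ N₀, ∀ m ≥ N₀, ∀ z : ℂ, ε ≤ z.im →
      ‖f n z - f m z‖ ≤ δ := by
    intro ε hε δ hδ
    wlog hεR : ε < R generalizing ε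
    · obtain ⟨N₀, h⟩ := hC δ hδ
      exact ⟨N₀, fun n hn m hm z hz => h n hn m hm z ((not_lt.1 hεR).trans hz)⟩
    set l := ε / 2 with hl
    have hl0 : 0 < l := by positivity
    have hlR : l < R := by linarith
    set M := max 1 (2 * B l) with hM
    have hM1 : 1 ≤ M := le_max_left _ _
    -- θ is the interpolation weight at the lowest relevant height ε = 2l; κ below is chosen so that
    -- M κ^θ ≤ δ.
    set θ := l / (R - l) with hθ
    have hθ0 : 0 < θ := div_pos hl0 (by linarith)
    set κ := min 1 ((δ / M) ^ θ⁻¹) with hκ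
    have hκ0 : 0 < κ := lt_min one_pos (by positivity)
    obtain ⟨N₁, h₁⟩ := hC κ hκ0
    obtain ⟨N₂, h₂⟩ := hC δ hδ
    refine ⟨max N₁ N₂, fun n hn m hm z hz => ?_⟩
    rcases le_total R z.im with hRz | hRz
    · exact h₂ n (le_of_max_le_right hn) m (le_of_max_le_right hm) z hRz
    have key := norm_le_interp_horizontalStrip (f := fun z => f n z - f m z) (a := M) (b := κ)
      ((hf n).sub (hf m)) hl0 hlR
      (fun w hw => by
        refine (norm_sub_le _ _).trans (le_trans ?_ (le_max_right _ _))
        linarith [hB l hl0 n w hw, hB l hl0 m w hw])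
      (fun w hw => h₁ n (le_of_max_le_left hn) m (le_of_max_le_left hm) w hw.ge)
      (z := z) (by linarith) hRz
    refine key.trans ?_
    have hRl : 0 < R - l := by linarith
    have hθz : θ ≤ (z.im - l) / (R - l) := by
      rw [hθ]; gcongr; linarith
    have hz1 : (z.im - l) / (R - l) ≤ 1 := by
      rw [div_le_one hRl]; linarith
    calc M ^ (1 - (z.im - l) / (R - l)) * κ ^ ((z.im - l) / (R - l))
        ≤ M ^ (1 : ℝ) * κ ^ θ := by
          refine mul_le_mul (Real.rpow_le_rpow_of_exponent_le hM1 (by linarith))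
            (Real.rpow_le_rpow_of_exponent_ge hκ0 (min_le_left _ _) hθz) (by positivity)
            (by positivity)
      _ ≤ M * ((δ / M) ^ θ⁻¹) ^ θ := by
          rw [Real.rpow_one]
          gcongr
          exact min_le_right _ _
      _ = δ := by
          rw [← Real.rpow_mul (by positivity), inv_mul_cancel₀ hθ0.ne', Real.rpow_one]
          field_simp
  have hlim : ∀ z ∈ upperHalf, ∃ y, Tendsto (fun n => f n z) atTop (𝓝 y) := by
    intro z hz
    refine cauchySeq_tendsto_of_complete (Metric.cauchySeq_iff.2 fun δ hδ => ?_)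
    obtain ⟨N₀, h⟩ := hmain z.im hz (δ / 2) (by positivity)
    refine ⟨N₀, fun n hn m hm => ?_⟩
    rw [dist_eq_norm]
    exact (h n hn m hm z le_rfl).trans_lt (by linarith)
  choose! g hg using hlim
  refine ⟨g, ?_, hg⟩
  refine TendstoLocallyUniformlyOn.differentiableOn (F := f) (φ := atTop) ?_
    (Eventually.of_forall hf) isOpen_upperHalf
  rw [Metric.tendstoLocallyUniformlyOn_iff]
  intro δ hδ z hz
  have hz' : 0 < z.im := hz
  refine ⟨{w | z.im / 2 < w.im}, mem_nhdsWithin_of_mem_nhds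
    ((isOpen_lt continuous_const Complex.continuous_im).mem_nhds (by simpa using hz')), ?_⟩
  obtain ⟨N₀, h⟩ := hmain (z.im / 2) (by positivity) (δ / 2) (by positivity)
  filter_upwards [eventually_ge_atTop N₀] with n hn w hw
  have hw' : z.im / 2 < w.im := hw
  have hwU : w ∈ upperHalf := show 0 < w.im by linarith
  rw [dist_comm, dist_eq_norm]
  have hle : ‖f n w - g w‖ ≤ δ / 2 := by
    refine le_of_tendsto ((tendsto_const_nhds.sub (hg w hwU)).norm) ?_
    filter_upwards [eventually_ge_atTop N₀] with m hm using h n hn m hm w hw'.le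
  linarith

/-! ### Laplace type integrals -/

/-- `∫₀^∞ t^{β-1} e^{-tp} exp(-t^γ Y) dt`. -/
def laplaceInt (β γ : ℝ) (p Y : ℂ) : ℂ :=
  ∫ t in Ioi (0 : ℝ), ((t ^ (β - 1) : ℝ) : ℂ) * Complex.exp (-(t : ℂ) * p) *
    Complex.exp (-((t ^ γ : ℝ) : ℂ) * Y)

/-- The common generalization `∫₀^∞ u^{β-1} e^{-u} exp(-u^γ y) du` of `gFun` and `hFun`. -/
def genFun (β γ : ℝ) (y : ℂ) : ℂ :=
  ∫ u in Ioi (0 : ℝ),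
    ((u ^ (β - 1) * Real.exp (-u) : ℝ) : ℂ) * Complex.exp (-((u ^ γ : ℝ) : ℂ) * y)

theorem gFun_eq_genFun (α : ℝ) (y : ℂ) : gFun α y = genFun (α / 2) (α / 2) y := rfl

theorem hFun_eq_genFun (α : ℝ) (y : ℂ) : hFun α y = genFun 1 (α / 2) y := by
  simp [hFun, genFun]

theorem integrableOn_rpow_mul_exp {β r : ℝ} (hβ : 0 < β) (hr : 0 < r) :
    IntegrableOn (fun t : ℝ => t ^ (β - 1) * Real.exp (-r * t)) (Ioi 0) := by
  have := integrableOn_rpow_mul_exp_neg_mul_rpow (p := 1) (s := β - 1) (b := r) (by linarith)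
    one_pos hr
  simpa using this

theorem integral_rpow_mul_exp {β r : ℝ} (hβ : 0 < β) (hr : 0 < r) :
    ∫ t in Ioi (0 : ℝ), t ^ (β - 1) * Real.exp (-r * t) = Real.Gamma β * r ^ (-β) := by
  have := Real.integral_rpow_mul_exp_neg_mul_Ioi hβ hr
  rw [Real.rpow_neg hr.le, ← Real.inv_rpow hr.le, mul_comm, ← one_div, ← this]
  simp

theorem norm_laplace_integrand_le {β γ t : ℝ} (ht : 0 < t) (p : ℂ) {Y : ℂ} (hY : 0 ≤ Y.re) :
    ‖((t ^ (β - 1) : ℝ) : ℂ) * Complex.exp (-(t : ℂ) * p) *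
      Complex.exp (-((t ^ γ : ℝ) : ℂ) * Y)‖ ≤ t ^ (β - 1) * Real.exp (-p.re * t) := by
  rw [norm_mul, norm_mul, Complex.norm_exp, Complex.norm_exp, Complex.norm_real,
    Real.norm_of_nonneg (by positivity)]
  have h1 : (-(t : ℂ) * p).re = -p.re * t := by simp; ring
  have h2 : (-((t ^ γ : ℝ) : ℂ) * Y).re = -(t ^ γ * Y.re) := by simp
  rw [h1, h2]
  refine mul_le_of_le_one_right (by positivity) (Real.exp_le_one_iff.2 ?_)
  have : 0 ≤ t ^ γ * Y.re := by positivity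
  linarith

theorem measurable_laplace_integrand (β γ : ℝ) (p Y : ℂ) :
    Measurable fun t : ℝ => ((t ^ (β - 1) : ℝ) : ℂ) * Complex.exp (-(t : ℂ) * p) *
      Complex.exp (-((t ^ γ : ℝ) : ℂ) * Y) := by
  fun_prop

theorem differentiableOn_laplaceInt {β γ : ℝ} (hβ : 0 < β) {Y : ℂ} (hY : 0 ≤ Y.re) :
    DifferentiableOn ℂ (fun p => laplaceInt β γ p Y) {p | 0 < p.re} := by
  intro p hp
  have hp' : 0 < p.re := hp
  have hU : IsOpen {q : ℂ | p.re / 2 < q.re} := isOpen_lt continuous_const Complex.continuous_re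
  have hpU : p ∈ {q : ℂ | p.re / 2 < q.re} := show p.re / 2 < p.re by linarith
  refine DifferentiableWithinAt.mono_of_mem_nhdsWithin (t := {p | 0 < p.re})
    (s := {q : ℂ | p.re / 2 < q.re}) ?_ (mem_nhdsWithin_of_mem_nhds (hU.mem_nhds hpU))
  refine differentiableOn_integral_of_bounded hU
    (integrableOn_rpow_mul_exp hβ (half_pos hp')) ?_ ?_ ?_ p hpU
  · intro q _
    exact (measurable_laplace_integrand β γ q Y).aestronglyMeasurable
  · refine Eventually.of_forall fun t => ?_
    fun_prop
  · filter_upwards [ae_restrict_mem measurableSet_Ioi] with t ht q hq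
    have ht' : 0 < t := ht
    refine (norm_laplace_integrand_le ht' q hY).trans ?_
    have : p.re / 2 < q.re := hq
    gcongr

/-- Split at u^{1-γ} = 2M: above this point M u^γ ≤ u/2, and below it u itself is bounded. -/
theorem exists_mul_rpow_le {γ : ℝ} (hγ0 : 0 < γ) (hγ : γ < 1) {M : ℝ} (hM : 0 ≤ M) :
    ∃ C, ∀ u : ℝ, 0 < u → M * u ^ γ ≤ u / 2 + C := by
  refine ⟨M * ((2 * M) ^ (1 / (1 - γ))) ^ γ, fun u hu => ?_⟩
  have h1γ : 0 < 1 - γ := by linarith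
  rcases le_total (2 * M) (u ^ (1 - γ)) with h | h
  · have : u = u ^ (1 - γ) * u ^ γ := by
      rw [← Real.rpow_add hu]; simp
    have h2 : M * u ^ γ ≤ u / 2 := by
      have : 2 * M * u ^ γ ≤ u ^ (1 - γ) * u ^ γ := by gcongr
      linarith
    have : 0 ≤ M * ((2 * M) ^ (1 / (1 - γ))) ^ γ := by positivity
    linarith
  · have h3 : u ≤ (2 * M) ^ (1 / (1 - γ)) := by
      have := Real.rpow_le_rpow (by positivity) h (z := 1 / (1 - γ)) (by positivity)
      rwa [← Real.rpow_mul hu.le, mul_one_div_cancel h1γ.ne', Real.rpow_one] at this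
    have : M * u ^ γ ≤ M * ((2 * M) ^ (1 / (1 - γ))) ^ γ := by gcongr
    linarith

/-- As γ < 1, the factor exp(-u^γ y) is beaten by e^{-u/2} locally uniformly in y, whatever the sign
of Re y. Hence the function is entire, which the analytic continuation below relies on. -/
theorem differentiable_genFun {β γ : ℝ} (hβ : 0 < β) (hγ0 : 0 < γ) (hγ : γ < 1) :
    Differentiable ℂ (genFun β γ) := by
  intro y
  obtain ⟨C, hC⟩ := exists_mul_rpow_le hγ0 hγ (M := ‖y‖ + 1) (by positivity)
  have hy : y ∈ Metric.ball (0 : ℂ) (‖y‖ + 1) := by simp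
  refine (differentiableOn_integral_of_bounded (U := Metric.ball (0 : ℂ) (‖y‖ + 1))
    Metric.isOpen_ball (bound := fun t => Real.exp C * (t ^ (β - 1) * Real.exp (-(1 / 2) * t)))
    ?_ ?_ ?_ ?_ y hy).differentiableAt (Metric.isOpen_ball.mem_nhds hy)
  · exact (integrableOn_rpow_mul_exp hβ (by norm_num : (0 : ℝ) < 1 / 2)).const_mul _
  · intro w _
    refine Measurable.aestronglyMeasurable ?_
    fun_prop
  · refine Eventually.of_forall fun t => ?_
    fun_prop
  · filter_upwards [ae_restrict_mem measurableSet_Ioi] with t ht w hw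
    have ht' : 0 < t := ht
    rw [norm_mul, Complex.norm_real, Real.norm_of_nonneg (by positivity), Complex.norm_exp]
    have h2 : (-((t ^ γ : ℝ) : ℂ) * w).re ≤ (‖y‖ + 1) * t ^ γ := by
      refine (Complex.re_le_norm _).trans ?_
      rw [norm_mul, norm_neg, Complex.norm_real, Real.norm_of_nonneg (by positivity), mul_comm]
      gcongr
      simpa using (mem_ball_zero_iff.1 hw).le
    calc t ^ (β - 1) * Real.exp (-t) * Real.exp (-((t ^ γ : ℝ) : ℂ) * w).re
        ≤ t ^ (β - 1) * Real.exp (-t) * Real.exp (t / 2 + C) := by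
          gcongr
          exact h2.trans (hC t ht')
      _ = Real.exp C * (t ^ (β - 1) * Real.exp (-(1 / 2) * t)) := by
          rw [show -(1 / 2) * t = -t + t / 2 by ring, Real.exp_add, Real.exp_add]
          ring

theorem cpow_ofReal_eq {s : ℝ} (hs : 0 < s) (β : ℝ) :
    ((s : ℂ)⁻¹) ^ (β : ℂ) = ((s ^ (-β) : ℝ) : ℂ) := by
  rw [← Complex.ofReal_inv, ← Complex.ofReal_cpow (by positivity), Real.inv_rpow hs.le,
    Real.rpow_neg hs.le]

theorem laplaceInt_ofReal {β γ s : ℝ} (hs : 0 < s) (Y : ℂ) :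
    laplaceInt β γ s Y = ((s : ℂ)⁻¹) ^ (β : ℂ) * genFun β γ (((s : ℂ)⁻¹) ^ (γ : ℂ) * Y) := by
  rw [cpow_ofReal_eq hs, cpow_ofReal_eq hs]
  have key := integral_comp_mul_left_Ioi (fun u : ℝ =>
    ((u ^ (β - 1) * Real.exp (-u) : ℝ) : ℂ) *
      Complex.exp (-((u ^ γ : ℝ) : ℂ) * (((s ^ (-γ) : ℝ) : ℂ) * Y))) 0 hs
  rw [mul_zero] at key
  have h2 : laplaceInt β γ s Y = ((s ^ (1 - β) : ℝ) : ℂ) * ∫ t in Ioi (0 : ℝ),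
      (((s * t) ^ (β - 1) * Real.exp (-(s * t)) : ℝ) : ℂ) *
      Complex.exp (-(((s * t) ^ γ : ℝ) : ℂ) * (((s ^ (-γ) : ℝ) : ℂ) * Y)) := by
    rw [laplaceInt, ← integral_const_mul]
    refine setIntegral_congr_fun measurableSet_Ioi fun t ht => ?_
    have ht' : 0 < t := ht
    rw [Real.mul_rpow hs.le ht'.le, Real.mul_rpow hs.le ht'.le]
    have e1 : s ^ (1 - β) * s ^ (β - 1) = 1 := by
      rw [← Real.rpow_add hs]; simp
    have e2 : s ^ γ * s ^ (-γ) = 1 := by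
      rw [← Real.rpow_add hs]; simp
    have e3 : -((s ^ γ * t ^ γ : ℝ) : ℂ) * (((s ^ (-γ) : ℝ) : ℂ) * Y) = -((t ^ γ : ℝ) : ℂ) * Y := by
      calc _ = -(((s ^ γ * s ^ (-γ) : ℝ) : ℂ) * ((t ^ γ : ℝ) : ℂ)) * Y := by push_cast; ring
        _ = _ := by rw [e2]; simp
    rw [e3, ← mul_assoc, ← Complex.ofReal_mul]
    congr 1
    rw [show s ^ (1 - β) * (s ^ (β - 1) * t ^ (β - 1) * Real.exp (-(s * t)))
      = (s ^ (1 - β) * s ^ (β - 1)) * t ^ (β - 1) * Real.exp (-(s * t)) by ring, e1, one_mul]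
    push_cast
    congr 2
    ring
  rw [h2, key, genFun, Complex.real_smul, ← mul_assoc, ← Complex.ofReal_mul]
  congr 3
  rw [← Real.rpow_neg_one s, ← Real.rpow_add hs]
  congr 1
  ring

/-- Both sides are holomorphic in p on the right half plane, and for p > 0 they agree by the
substitution u = pt. The identity theorem does the rest, with no rotation of contours. -/
theorem laplaceInt_eq_genFun {β γ : ℝ} (hβ : 0 < β) (hγ0 : 0 < γ) (hγ : γ < 1) {p Y : ℂ}
    (hp : 0 < p.re) (hY : 0 ≤ Y.re) :
    laplaceInt β γ p Y = p⁻¹ ^ (β : ℂ) * genFun β γ (p⁻¹ ^ (γ : ℂ) * Y) := by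
  have hU : IsOpen {p : ℂ | 0 < p.re} := isOpen_lt continuous_const Complex.continuous_re
  have hconn : IsPreconnected {p : ℂ | 0 < p.re} :=
    (convex_halfSpace_re_gt 0).isPreconnected
  have hinv : ∀ c : ℝ, DifferentiableOn ℂ (fun p : ℂ => p⁻¹ ^ (c : ℂ)) {p | 0 < p.re} := by
    intro c q hq
    have hq' : 0 < q.re := hq
    have hq0 : q ≠ 0 := by rintro rfl; simp at hq'
    have : q⁻¹ ∈ Complex.slitPlane := by
      left
      rw [Complex.inv_re]
      exact div_pos hq' (Complex.normSq_pos.2 hq0)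
    exact ((differentiableAt_inv hq0).cpow (differentiableAt_const _) this).differentiableWithinAt
  have h1 := (differentiableOn_laplaceInt (γ := γ) hβ hY).analyticOnNhd hU
  have h2 : AnalyticOnNhd ℂ (fun p : ℂ => p⁻¹ ^ (β : ℂ) * genFun β γ (p⁻¹ ^ (γ : ℂ) * Y))
      {p | 0 < p.re} := by
    refine DifferentiableOn.analyticOnNhd ?_ hU
    refine (hinv β).mul ?_
    exact (differentiable_genFun hβ hγ0 hγ).comp_differentiableOn ((hinv γ).mul_const Y)
  refine h1.eqOn_of_preconnected_of_frequently_eq h2 hconn (z₀ := 1) (by simp) ?_ hp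
  have hfreq : ∃ᶠ s : ℝ in 𝓝[≠] 1, 0 < s := by
    refine Eventually.frequently ?_
    exact eventually_nhdsWithin_of_eventually_nhds (lt_mem_nhds one_pos)
  have hmap : Tendsto (fun s : ℝ => (s : ℂ)) (𝓝[≠] 1) (𝓝[≠] 1) := by
    refine tendsto_nhdsWithin_iff.2 ⟨?_, ?_⟩
    · exact (Complex.continuous_ofReal.tendsto' 1 1 (by simp)).mono_left nhdsWithin_le_nhds
    · filter_upwards [self_mem_nhdsWithin] with s hs
      simpa using hs
  refine hmap.frequently (hfreq.mono fun s hs => ?_)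
  exact laplaceInt_ofReal hs Y

theorem genFun_zero {β γ : ℝ} (hβ : 0 < β) : genFun β γ 0 = Real.Gamma β := by
  have := integral_rpow_mul_exp hβ one_pos
  simp only [genFun, mul_zero, Complex.exp_zero, mul_one]
  rw [integral_complex_ofReal]
  simp only [Real.one_rpow, mul_one] at this
  rw [← this]
  simp

theorem laplaceInt_zero_right {β : ℝ} (γ : ℝ) (hβ : 0 < β) {p : ℂ} (hp : 0 < p.re) :
    laplaceInt β γ p 0 = p⁻¹ ^ (β : ℂ) * Real.Gamma β := by
  -- At Y = 0 the exponent γ has no influence, so any value in (0,1) may be used in place of the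
  -- given one.
  have := laplaceInt_eq_genFun hβ (γ := 1 / 2) (by norm_num) (by norm_num) hp (Y := 0) le_rfl
  rw [mul_zero, genFun_zero hβ] at this
  rw [← this]
  simp [laplaceInt]

theorem norm_exp_sub_exp_le {u v : ℂ} {m : ℝ} (hu : u.re ≤ m) (hv : v.re ≤ m) :
    ‖Complex.exp u - Complex.exp v‖ ≤ Real.exp m * ‖u - v‖ := by
  refine Convex.norm_image_sub_le_of_norm_deriv_le (s := {w : ℂ | w.re ≤ m}) (𝕜 := ℂ)
    (fun w _ => Complex.differentiableAt_exp) (fun w hw => ?_) (convex_halfSpace_re_le m) hv hu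
  rw [Complex.deriv_exp, Complex.norm_exp]
  exact Real.exp_le_exp.2 hw

theorem integrableOn_laplace_integrand {β γ : ℝ} (hβ : 0 < β) {p Y : ℂ} (hp : 0 < p.re)
    (hY : 0 ≤ Y.re) :
    IntegrableOn (fun t : ℝ => ((t ^ (β - 1) : ℝ) : ℂ) * Complex.exp (-(t : ℂ) * p) *
      Complex.exp (-((t ^ γ : ℝ) : ℂ) * Y)) (Ioi 0) := by
  refine (integrableOn_rpow_mul_exp hβ hp).mono'
    (measurable_laplace_integrand β γ p Y).aestronglyMeasurable ?_
  filter_upwards [ae_restrict_mem measurableSet_Ioi] with t ht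
  exact norm_laplace_integrand_le ht p hY

theorem norm_laplaceInt_le {β γ : ℝ} (hβ : 0 < β) {p Y : ℂ} (hp : 0 < p.re) (hY : 0 ≤ Y.re) :
    ‖laplaceInt β γ p Y‖ ≤ Real.Gamma β * p.re ^ (-β) := by
  rw [← integral_rpow_mul_exp hβ hp]
  refine norm_integral_le_of_norm_le (integrableOn_rpow_mul_exp hβ hp) ?_
  filter_upwards [ae_restrict_mem measurableSet_Ioi] with t ht
  exact norm_laplace_integrand_le ht p hY

/-- The exponential is 1-Lipschitz on the left half plane, so a change of Y costs a factor t^γ,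
which raises β to β + γ. The resulting extra decay in Re p is the source of the contraction for
large Im z. -/
theorem norm_laplaceInt_sub_le {β γ : ℝ} (hβ : 0 < β) (hγ : 0 < γ) {p Y Y' : ℂ} (hp : 0 < p.re)
    (hY : 0 ≤ Y.re) (hY' : 0 ≤ Y'.re) :
    ‖laplaceInt β γ p Y - laplaceInt β γ p Y'‖ ≤
      Real.Gamma (β + γ) * p.re ^ (-(β + γ)) * ‖Y - Y'‖ := by
  have hβγ : 0 < β + γ := by linarith
  rw [← integral_rpow_mul_exp hβγ hp, ← integral_mul_const, laplaceInt, laplaceInt,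
    ← integral_sub (integrableOn_laplace_integrand hβ hp hY)
      (integrableOn_laplace_integrand hβ hp hY')]
  refine norm_integral_le_of_norm_le ((integrableOn_rpow_mul_exp hβγ hp).mul_const _) ?_
  filter_upwards [ae_restrict_mem measurableSet_Ioi] with t ht
  have ht' : 0 < t := ht
  have h1 := norm_exp_sub_exp_le (m := 0) (u := -((t ^ γ : ℝ) : ℂ) * Y)
    (v := -((t ^ γ : ℝ) : ℂ) * Y') (by simp; positivity) (by simp; positivity)
  rw [← mul_sub, norm_mul, norm_neg, Complex.norm_real, Real.norm_of_nonneg (by positivity),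
    Real.exp_zero, one_mul] at h1
  rw [← mul_sub, norm_mul, norm_mul, Complex.norm_real, Real.norm_of_nonneg (by positivity),
    Complex.norm_exp]
  have h3 : (-(t : ℂ) * p).re = -p.re * t := by simp; ring
  rw [h3, show β + γ - 1 = β - 1 + γ by ring, Real.rpow_add ht']
  calc _ ≤ t ^ (β - 1) * Real.exp (-p.re * t) * (t ^ γ * ‖Y - Y'‖) := by gcongr
    _ = _ := by ring

/-- Read off the Laplace representation p^{-β} Γ(β) = ∫ t^{β-1} e^{-tp} dt, so that arguments of
complex powers need not be tracked; the Lipschitz bound `norm_inv_cpow_sub_le` is obtained in the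
same way. -/
theorem norm_inv_cpow_le {β : ℝ} (hβ : 0 < β) {p : ℂ} (hp : 0 < p.re) :
    ‖p⁻¹ ^ (β : ℂ)‖ ≤ p.re ^ (-β) := by
  have hΓ := Real.Gamma_pos_of_pos hβ
  have h := norm_laplaceInt_le (γ := 1) hβ hp (Y := 0) le_rfl
  rw [laplaceInt_zero_right 1 hβ hp, norm_mul, Complex.norm_real, Real.norm_of_nonneg hΓ.le,
    mul_comm] at h
  exact le_of_mul_le_mul_left h hΓ

theorem norm_inv_cpow_sub_le {β : ℝ} (hβ : 0 < β) {η : ℝ} (hη : 0 < η) {p p' : ℂ}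
    (hp : η ≤ p.re) (hp' : η ≤ p'.re) :
    ‖p⁻¹ ^ (β : ℂ) - p'⁻¹ ^ (β : ℂ)‖ ≤ β * η ^ (-(β + 1)) * ‖p - p'‖ := by
  have hΓ := Real.Gamma_pos_of_pos hβ
  have h0 : 0 < p.re := hη.trans_le hp
  have h0' : 0 < p'.re := hη.trans_le hp'
  have hβ1 : 0 < β + 1 := by linarith
  have key : ‖laplaceInt β 1 p 0 - laplaceInt β 1 p' 0‖ ≤
      Real.Gamma (β + 1) * η ^ (-(β + 1)) * ‖p - p'‖ := by
    rw [← integral_rpow_mul_exp hβ1 hη, ← integral_mul_const, laplaceInt, laplaceInt,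
      ← integral_sub (integrableOn_laplace_integrand hβ h0 le_rfl)
        (integrableOn_laplace_integrand hβ h0' le_rfl)]
    refine norm_integral_le_of_norm_le ((integrableOn_rpow_mul_exp hβ1 hη).mul_const _) ?_
    filter_upwards [ae_restrict_mem measurableSet_Ioi] with t ht
    have ht' : 0 < t := ht
    have h1 := norm_exp_sub_exp_le (m := -η * t) (u := -(t : ℂ) * p)
      (v := -(t : ℂ) * p') (by simp; nlinarith) (by simp; nlinarith)
    rw [← mul_sub, norm_mul, norm_neg, Complex.norm_real, Real.norm_of_nonneg ht'.le] at h1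
    rw [mul_zero, Complex.exp_zero, mul_one, mul_one, ← mul_sub, norm_mul, Complex.norm_real,
      Real.norm_of_nonneg (by positivity), show β + 1 - 1 = β - 1 + 1 by ring,
      Real.rpow_add ht', Real.rpow_one]
    calc _ ≤ t ^ (β - 1) * (Real.exp (-η * t) * (t * ‖p - p'‖)) := by gcongr
      _ = _ := by ring
  rw [laplaceInt_zero_right 1 hβ h0, laplaceInt_zero_right 1 hβ h0', ← sub_mul, norm_mul,
    Complex.norm_real, Real.norm_of_nonneg hΓ.le, Real.Gamma_add_one hβ.ne', mul_comm,
    mul_comm β, mul_assoc, mul_assoc] at key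
  rw [mul_assoc]
  exact le_of_mul_le_mul_left key hΓ

/-! ### The averaged Laplace integral -/

/-- `∫ ∫₀^∞ t^{β-1} e^{-it(l-z)} exp(-t^γ Y) dt dμD(l)`. -/
def psi (β γ : ℝ) (μD : Measure ℝ) (z Y : ℂ) : ℂ :=
  ∫ l : ℝ, laplaceInt β γ (Complex.I * ((l : ℂ) - z)) Y ∂μD

theorem I_mul_sub_re (l : ℝ) (z : ℂ) : (Complex.I * ((l : ℂ) - z)).re = z.im := by simp

theorem continuous_laplaceInt_sub {β : ℝ} (γ : ℝ) (hβ : 0 < β) {z Y : ℂ} (hz : 0 < z.im)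
    (hY : 0 ≤ Y.re) :
    Continuous fun l : ℝ => laplaceInt β γ (Complex.I * ((l : ℂ) - z)) Y := by
  refine (differentiableOn_laplaceInt (γ := γ) hβ hY).continuousOn.comp_continuous
    (by fun_prop) fun l => ?_
  rwa [mem_ofPred_eq, I_mul_sub_re]

theorem integrable_laplaceInt_sub {β : ℝ} (γ : ℝ) (hβ : 0 < β) (μD : Measure ℝ)
    [IsFiniteMeasure μD] {z Y : ℂ} (hz : 0 < z.im) (hY : 0 ≤ Y.re) :
    Integrable (fun l : ℝ => laplaceInt β γ (Complex.I * ((l : ℂ) - z)) Y) μD := by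
  refine Integrable.of_bound (continuous_laplaceInt_sub γ hβ hz hY).aestronglyMeasurable
    (Real.Gamma β * z.im ^ (-β)) (Eventually.of_forall fun l => ?_)
  have := norm_laplaceInt_le (γ := γ) (p := Complex.I * ((l : ℂ) - z)) hβ (by rwa [I_mul_sub_re]) hY
  rwa [I_mul_sub_re] at this

theorem norm_psi_le {β : ℝ} (γ : ℝ) (hβ : 0 < β) (μD : Measure ℝ) [IsProbabilityMeasure μD]
    {z Y : ℂ} (hz : 0 < z.im) (hY : 0 ≤ Y.re) :
    ‖psi β γ μD z Y‖ ≤ Real.Gamma β * z.im ^ (-β) := by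
  refine (norm_integral_le_of_norm_le_const (C := Real.Gamma β * z.im ^ (-β))
    (Eventually.of_forall fun l => ?_)).trans (by simp)
  have := norm_laplaceInt_le (γ := γ) (p := Complex.I * ((l : ℂ) - z)) hβ (by rwa [I_mul_sub_re]) hY
  rwa [I_mul_sub_re] at this

theorem norm_psi_sub_le {β γ : ℝ} (hβ : 0 < β) (hγ : 0 < γ) (μD : Measure ℝ)
    [IsProbabilityMeasure μD] {z Y Y' : ℂ} (hz : 0 < z.im) (hY : 0 ≤ Y.re) (hY' : 0 ≤ Y'.re) :
    ‖psi β γ μD z Y - psi β γ μD z Y'‖ ≤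
      Real.Gamma (β + γ) * z.im ^ (-(β + γ)) * ‖Y - Y'‖ := by
  rw [psi, psi, ← integral_sub (integrable_laplaceInt_sub γ hβ μD hz hY)
    (integrable_laplaceInt_sub γ hβ μD hz hY')]
  refine (norm_integral_le_of_norm_le_const
    (C := Real.Gamma (β + γ) * z.im ^ (-(β + γ)) * ‖Y - Y'‖)
    (Eventually.of_forall fun l => ?_)).trans (by simp)
  have := norm_laplaceInt_sub_le (p := Complex.I * ((l : ℂ) - z)) hβ hγ (by rwa [I_mul_sub_re])
    hY hY'
  rwa [I_mul_sub_re] at this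

/-! ### Rotation -/

/-- The unimodular number `i^{α/2}`. -/
def rot (α : ℝ) : ℂ := Complex.exp (Complex.I * ((α * Real.pi / 4 : ℝ) : ℂ))

theorem I_cpow_eq (c : ℝ) :
    Complex.I ^ (c : ℂ) = Complex.exp (Complex.I * ((c * Real.pi / 2 : ℝ) : ℂ)) := by
  rw [Complex.cpow_def_of_ne_zero Complex.I_ne_zero, Complex.log_I]
  congr 1
  push_cast
  ring

theorem I_cpow_half (α : ℝ) : Complex.I ^ ((α / 2 : ℝ) : ℂ) = rot α := by
  rw [I_cpow_eq, rot]
  congr 3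
  ring

theorem norm_rot (α : ℝ) : ‖rot α‖ = 1 := by
  rw [rot, mul_comm, Complex.norm_exp_ofReal_mul_I]

theorem rot_ne_zero (α : ℝ) : rot α ≠ 0 := Complex.exp_ne_zero _

theorem norm_conj_cConst {α : ℝ} (hα0 : 0 < α) (hα2 : α < 2) :
    ‖starRingEnd ℂ (cConst α)‖ = Real.Gamma (1 - α / 2) / Real.Gamma (α / 2) := by
  have h1 := Real.Gamma_pos_of_pos (show 0 < 1 - α / 2 by linarith)
  have h2 := Real.Gamma_pos_of_pos (show 0 < α / 2 by linarith)
  rw [RCLike.norm_conj, cConst, norm_mul, I_cpow_eq, mul_comm Complex.I,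
    Complex.norm_exp_ofReal_mul_I, one_mul, Complex.norm_real, Real.norm_of_nonneg (by positivity)]

/-- Of the two inverse rotations, one cancels the factor that `gAverage` carries relative to `psi`,
the other the passage from X to the rotated variable. In rotated coordinates the equation has a
positive real constant. -/
theorem conj_cConst (α : ℝ) :
    starRingEnd ℂ (cConst α) =
      (rot α)⁻¹ ^ 2 * ((Real.Gamma (1 - α / 2) / Real.Gamma (α / 2) : ℝ) : ℂ) := by
  rw [cConst, map_mul, Complex.conj_ofReal, I_cpow_eq, ← Complex.exp_conj, rot, ← Complex.exp_neg,
    ← Complex.exp_nat_mul]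
  congr 2
  rw [map_mul, Complex.conj_I, Complex.conj_ofReal]
  push_cast
  ring

/-- No branch is crossed: arg q lies in (-π/2, π/2), hence π/2 + arg q stays in (0, π). -/
theorem cpow_I_mul {q : ℂ} (hq : 0 < q.re) (c : ℝ) :
    (Complex.I * q) ^ (c : ℂ) = Complex.I ^ (c : ℂ) * q ^ (c : ℂ) := by
  have hq0 : q ≠ 0 := by rintro rfl; simp at hq
  have harg := Complex.abs_arg_lt_pi_div_two_iff.2 (Or.inl hq)
  rw [abs_lt] at harg
  rw [Complex.cpow_def_of_ne_zero (mul_ne_zero Complex.I_ne_zero hq0),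
    Complex.cpow_def_of_ne_zero Complex.I_ne_zero, Complex.cpow_def_of_ne_zero hq0,
    ← Complex.exp_add, Complex.log_mul Complex.I_ne_zero hq0, add_mul]
  rw [Complex.arg_I]
  constructor <;> linarith [Real.pi_pos]

theorem inv_re_pos {q : ℂ} (hq : 0 < q.re) : 0 < (q⁻¹).re := by
  have hq0 : q ≠ 0 := by rintro rfl; simp at hq
  rw [Complex.inv_re]
  exact div_pos hq (Complex.normSq_pos.2 hq0)

theorem invPow_eq (α : ℝ) {w : ℂ} (hw : 0 < (Complex.I * w).re) :
    invPow α w = rot α * (Complex.I * w)⁻¹ ^ ((α / 2 : ℝ) : ℂ) := by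
  have h : w⁻¹ = Complex.I * (Complex.I * w)⁻¹ := by
    rw [mul_inv, ← mul_assoc, mul_inv_cancel₀ Complex.I_ne_zero, one_mul]
  rw [invPow, h, cpow_I_mul (inv_re_pos hw), I_cpow_half]

/-- Rotation by απ/4 centres the sector of arguments [-απ/2, 0] on the positive axis. For α < 2 the
rotated sector lies in the right half plane, where all the Laplace integrals converge. -/
theorem mem_cone_iff_rot {α : ℝ} {w : ℂ} :
    w ∈ cone α ↔ ∃ ρ φ : ℝ, 0 ≤ ρ ∧ |φ| ≤ α * Real.pi / 4 ∧
      rot α * w = (ρ : ℂ) * Complex.exp (Complex.I * (φ : ℂ)) := by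
  constructor
  · rintro ⟨ρ, φ, hρ, h1, h2, rfl⟩
    refine ⟨ρ, φ + α * Real.pi / 4, hρ, abs_le.2 ⟨by linarith, by linarith⟩, ?_⟩
    rw [rot, mul_left_comm, ← Complex.exp_add]
    congr 2
    push_cast
    ring
  · rintro ⟨ρ, φ, hρ, h1, h2⟩
    rw [abs_le] at h1
    refine ⟨ρ, φ - α * Real.pi / 4, hρ, by linarith, by linarith, ?_⟩
    rw [← mul_right_inj' (rot_ne_zero α), h2, rot, mul_left_comm, ← Complex.exp_add]
    congr 2
    push_cast
    ring

theorem rot_mul_re_nonneg {α : ℝ} (hα2 : α < 2) {w : ℂ} (hw : w ∈ cone α) :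
    0 ≤ (rot α * w).re := by
  obtain ⟨ρ, φ, hρ, h1, h2⟩ := mem_cone_iff_rot.1 hw
  rw [abs_le] at h1
  rw [h2, mul_comm Complex.I, Complex.re_ofReal_mul, Complex.exp_ofReal_mul_I_re]
  refine mul_nonneg hρ (Real.cos_nonneg_of_neg_pi_div_two_le_of_le ?_ ?_) <;>
    nlinarith [Real.pi_pos]

/-- Put p = i(l - z), whose real part is Im z. Then (l - z)^{-α/2} = i^{α/2} p^{-α/2}, and the
integrand is the closed form of the Laplace integral with parameter Y = i^{α/2} w. -/
theorem gAverage_eq_psi {α : ℝ} (hα0 : 0 < α) (hα2 : α < 2) (μD : Measure ℝ) {z w : ℂ}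
    (hz : 0 < z.im) (hw : w ∈ cone α) :
    gAverage α μD z w = rot α * psi (α / 2) (α / 2) μD z (rot α * w) := by
  rw [gAverage, psi, ← integral_const_mul]
  refine integral_congr_ae (Eventually.of_forall fun l => ?_)
  have hre : 0 < (Complex.I * ((l : ℂ) - z)).re := by rwa [I_mul_sub_re]
  beta_reduce
  rw [invPow_eq α hre, gFun_eq_genFun, laplaceInt_eq_genFun (by linarith) (by linarith)
    (by linarith) hre (rot_mul_re_nonneg hα2 hw), mul_assoc,
    mul_comm (rot α) (_ ^ _), mul_assoc (_ ^ _) (rot α) w]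

theorem integral_hFun_eq_psi {α : ℝ} (hα0 : 0 < α) (hα2 : α < 2) {z w : ℂ} (l : ℝ)
    (hz : 0 < z.im) (hw : w ∈ cone α) :
    1 / (z - (l : ℂ)) * hFun α (invPow α ((l : ℂ) - z) * w) =
      -Complex.I * laplaceInt 1 (α / 2) (Complex.I * ((l : ℂ) - z)) (rot α * w) := by
  have hre : 0 < (Complex.I * ((l : ℂ) - z)).re := by rwa [I_mul_sub_re]
  have hne : z - l ≠ 0 := by
    intro h
    have := congrArg Complex.im h
    simp at this
    exact hz.ne' this
  have hne' : (l : ℂ) - z ≠ 0 := by rw [← neg_sub]; exact neg_ne_zero.2 hne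
  rw [invPow_eq α hre, hFun_eq_genFun, laplaceInt_eq_genFun one_pos (by linarith)
    (by linarith) hre (rot_mul_re_nonneg hα2 hw), Complex.ofReal_one, Complex.cpow_one,
    mul_comm (rot α) (_ ^ _), mul_assoc (_ ^ _) (rot α) w, ← mul_assoc (-Complex.I)]
  congr 1
  rw [← neg_sub (l : ℂ) z, mul_inv, Complex.inv_I, ← mul_assoc, neg_mul_neg, Complex.I_mul_I,
    one_div, inv_neg, neg_one_mul]

/-! ### Resolvents of real symmetric matrices -/

section Resolvent

variable {n : Type*} [Fintype n] [DecidableEq n]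

/-- The resolvent `(H - z)⁻¹` of a real matrix. -/
def resol (H : Matrix n n ℝ) (z : ℂ) : Matrix n n ℂ :=
  (H.map Complex.ofReal - z • (1 : Matrix n n ℂ))⁻¹

/-- The form y*Hy is real, so the imaginary part comes from the shift alone. Invertibility and every
resolvent bound below follow from this identity. -/
theorem im_star_dotProduct_shift {H : Matrix n n ℝ} (hH : H.IsSymm) (z : ℂ) (y : n → ℂ) :
    (star y ⬝ᵥ ((H.map Complex.ofReal - z • (1 : Matrix n n ℂ)).mulVec y)).im =
      -(z.im * ∑ i, ‖y i‖ ^ 2) := by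
  have hherm : (H.map Complex.ofReal).IsHermitian := by
    ext i j
    simp [hH.apply i j]
  have h1 : (star y ⬝ᵥ ((H.map Complex.ofReal).mulVec y)).im = 0 :=
    hherm.im_star_dotProduct_mulVec_self y
  have h2 : star y ⬝ᵥ y = ((∑ i, ‖y i‖ ^ 2 : ℝ) : ℂ) := by
    simp only [dotProduct, Pi.star_apply, Complex.ofReal_sum]
    refine Finset.sum_congr rfl fun i _ => ?_
    rw [Complex.star_def, Complex.conj_mul']
    norm_cast
  rw [Matrix.sub_mulVec, dotProduct_sub, Complex.sub_im, h1, Matrix.smul_mulVec,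
    Matrix.one_mulVec, dotProduct_smul, h2,
    smul_eq_mul, Complex.im_mul_ofReal]
  ring

theorem isUnit_det_shift {H : Matrix n n ℝ} (hH : H.IsSymm) {z : ℂ} (hz : 0 < z.im) :
    IsUnit (H.map Complex.ofReal - z • (1 : Matrix n n ℂ)).det := by
  rw [isUnit_iff_ne_zero]
  intro h0
  obtain ⟨v, hv, hv0⟩ := Matrix.exists_mulVec_eq_zero_iff.2 h0
  have h := im_star_dotProduct_shift hH z v
  rw [hv0, dotProduct_zero, Complex.zero_im] at h
  have hs : ∑ i, ‖v i‖ ^ 2 = 0 := by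
    have := neg_eq_zero.1 h.symm
    exact (mul_eq_zero.1 this).resolve_left hz.ne'
  rw [Finset.sum_eq_zero_iff_of_nonneg (fun _ _ => by positivity)] at hs
  refine hv (funext fun i => ?_)
  simpa using hs i (Finset.mem_univ i)

theorem shift_mul_resol {H : Matrix n n ℝ} (hH : H.IsSymm) {z : ℂ} (hz : 0 < z.im) :
    (H.map Complex.ofReal - z • (1 : Matrix n n ℂ)) * resol H z = 1 :=
  Matrix.mul_nonsing_inv _ (isUnit_det_shift hH hz)

theorem resol_mul_shift {H : Matrix n n ℝ} (hH : H.IsSymm) {z : ℂ} (hz : 0 < z.im) :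
    resol H z * (H.map Complex.ofReal - z • (1 : Matrix n n ℂ)) = 1 :=
  Matrix.nonsing_inv_mul _ (isUnit_det_shift hH hz)

theorem resol_transpose {H : Matrix n n ℝ} (hH : H.IsSymm) (z : ℂ) :
    (resol H z).transpose = resol H z := by
  rw [resol, Matrix.transpose_nonsing_inv, Matrix.transpose_sub, Matrix.transpose_smul,
    Matrix.transpose_one, ← Matrix.transpose_map, hH.eq]

theorem resol_comm {H : Matrix n n ℝ} (hH : H.IsSymm) (z : ℂ) (i j : n) :
    resol H z i j = resol H z j i := by
  conv_lhs => rw [← resol_transpose hH z]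
  rfl

theorem im_star_resol_mulVec {H : Matrix n n ℝ} (hH : H.IsSymm) {z : ℂ} (hz : 0 < z.im)
    (w : n → ℂ) :
    (star ((resol H z).mulVec w) ⬝ᵥ w).im = -(z.im * ∑ i, ‖(resol H z).mulVec w i‖ ^ 2) := by
  have h := im_star_dotProduct_shift hH z ((resol H z).mulVec w)
  rwa [Matrix.mulVec_mulVec, shift_mul_resol hH hz, Matrix.one_mulVec] at h

theorem norm_dotProduct_le {m : Type*} [Fintype m] (u v : m → ℂ) :
    ‖u ⬝ᵥ v‖ ^ 2 ≤ (∑ i, ‖u i‖ ^ 2) * ∑ i, ‖v i‖ ^ 2 := by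
  refine le_trans ?_ (Finset.sum_mul_sq_le_sq_mul_sq _ _ _)
  gcongr
  refine (norm_sum_le _ _).trans (Finset.sum_le_sum fun i _ => ?_)
  rw [norm_mul]

/-- With S = ‖Rw‖², the identity for the imaginary part and Cauchy–Schwarz give (Im z · S)² ≤ S
‖w‖²; it remains to divide by S when S > 0. -/
theorem sum_norm_resol_mulVec_sq_le {H : Matrix n n ℝ} (hH : H.IsSymm) {z : ℂ} (hz : 0 < z.im)
    (w : n → ℂ) :
    ∑ i, ‖(resol H z).mulVec w i‖ ^ 2 ≤ (∑ i, ‖w i‖ ^ 2) / z.im ^ 2 := by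
  set S := ∑ i, ‖(resol H z).mulVec w i‖ ^ 2 with hS
  have hS0 : 0 ≤ S := Finset.sum_nonneg fun _ _ => by positivity
  have h1 := im_star_resol_mulVec hH hz w
  have h2 := norm_dotProduct_le (star ((resol H z).mulVec w)) w
  have h3 : ∑ i, ‖star ((resol H z).mulVec w) i‖ ^ 2 = S := by simp [hS]
  rw [h3] at h2
  have h4 : (z.im * S) ^ 2 ≤ S * ∑ i, ‖w i‖ ^ 2 := by
    refine le_trans ?_ h2
    rw [sq_le_sq, abs_of_nonneg (norm_nonneg _), ← abs_neg, ← h1]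
    exact Complex.abs_im_le_norm _
  rw [le_div_iff₀ (by positivity)]
  rcases hS0.eq_or_lt with h | h
  · rw [← h, zero_mul]
    exact Finset.sum_nonneg fun _ _ => by positivity
  · refine le_of_mul_le_mul_left ?_ h
    calc S * (S * z.im ^ 2) = (z.im * S) ^ 2 := by ring
      _ ≤ _ := h4

/-- For a real vector the form vᵀRv has nonnegative imaginary part. This keeps i(d - z - vᵀRv) in
the half plane Re ≥ Im z, so Schur's denominator never degenerates. -/
theorem im_dotProduct_resol {H : Matrix n n ℝ} (hH : H.IsSymm) {z : ℂ} (hz : 0 < z.im)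
    (v : n → ℝ) :
    ((fun i => (v i : ℂ)) ⬝ᵥ (resol H z).mulVec fun i => (v i : ℂ)).im =
      z.im * ∑ i, ‖(resol H z).mulVec (fun i => (v i : ℂ)) i‖ ^ 2 := by
  have h := im_star_resol_mulVec hH hz fun i => (v i : ℂ)
  have h2 : star ((resol H z).mulVec fun i => (v i : ℂ)) ⬝ᵥ (fun i => (v i : ℂ)) =
      star ((fun i => (v i : ℂ)) ⬝ᵥ (resol H z).mulVec fun i => (v i : ℂ)) := by
    rw [Matrix.star_dotProduct]
    simp [dotProduct]
  rw [h2, Complex.star_def, Complex.conj_im, neg_inj] at h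
  exact h

/-- The Ward identity: the preceding formula at a basis vector. -/
theorem sum_norm_resol_col_sq {H : Matrix n n ℝ} (hH : H.IsSymm) {z : ℂ} (hz : 0 < z.im) (k : n) :
    z.im * ∑ i, ‖resol H z i k‖ ^ 2 = (resol H z k k).im := by
  have h := im_dotProduct_resol hH hz (Pi.single k 1)
  have h1 : (fun i => ((Pi.single k 1 : n → ℝ) i : ℂ)) = Pi.single k 1 := by
    ext i
    by_cases hi : i = k
    · subst hi; simp
    · simp [hi]
  rw [h1] at h
  simp only [Matrix.mulVec_single_one, single_one_dotProduct] at h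
  exact h.symm

theorem sum_norm_resol_col_sq_le {H : Matrix n n ℝ} (hH : H.IsSymm) {z : ℂ} (hz : 0 < z.im)
    (k : n) : ∑ i, ‖resol H z i k‖ ^ 2 ≤ 1 / z.im ^ 2 := by
  have h := sum_norm_resol_mulVec_sq_le hH hz (Pi.single k 1)
  simp only [Matrix.mulVec_single_one] at h
  refine h.trans (le_of_eq ?_)
  congr 1
  rw [Finset.sum_eq_single k]
  · simp
  · intro b _ hb; simp [hb]
  · simp

theorem im_resol_pos {H : Matrix n n ℝ} (hH : H.IsSymm) {z : ℂ} (hz : 0 < z.im) (k : n) :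
    0 < (resol H z k k).im := by
  rw [← sum_norm_resol_col_sq hH hz]
  refine mul_pos hz (lt_of_le_of_ne (Finset.sum_nonneg fun _ _ => by positivity) fun h0 => ?_)
  rw [eq_comm, Finset.sum_eq_zero_iff_of_nonneg (fun _ _ => by positivity)] at h0
  have h1 := congrFun (congrFun (shift_mul_resol hH hz) k) k
  rw [Matrix.mul_apply, Matrix.one_apply_eq, Finset.sum_eq_zero] at h1
  · exact zero_ne_one h1
  · intro i hi
    have := h0 i hi
    rw [sq_eq_zero_iff, norm_eq_zero] at this
    rw [this, mul_zero]

theorem norm_resol_le {H : Matrix n n ℝ} (hH : H.IsSymm) {z : ℂ} (hz : 0 < z.im) (k : n) :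
    ‖resol H z k k‖ ≤ 1 / z.im := by
  have h := sum_norm_resol_col_sq_le hH hz k
  have h2 : ‖resol H z k k‖ ^ 2 ≤ (1 / z.im) ^ 2 := by
    rw [div_pow, one_pow]
    refine le_trans ?_ h
    exact Finset.single_le_sum (f := fun i => ‖resol H z i k‖ ^ 2) (fun _ _ => by positivity)
      (Finset.mem_univ k)
  exact le_of_sq_le_sq h2 (by positivity)

/-- `-i R_{kk}`, which has positive real part. -/
def qres (H : Matrix n n ℝ) (z : ℂ) (k : n) : ℂ := -Complex.I * resol H z k k

theorem qres_re (H : Matrix n n ℝ) (z : ℂ) (k : n) : (qres H z k).re = (resol H z k k).im := by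
  simp [qres]

theorem qres_re_pos {H : Matrix n n ℝ} (hH : H.IsSymm) {z : ℂ} (hz : 0 < z.im) (k : n) :
    0 < (qres H z k).re := by
  rw [qres_re]; exact im_resol_pos hH hz k

theorem norm_qres (H : Matrix n n ℝ) (z : ℂ) (k : n) : ‖qres H z k‖ = ‖resol H z k k‖ := by
  simp [qres]

theorem norm_qres_le {H : Matrix n n ℝ} (hH : H.IsSymm) {z : ℂ} (hz : 0 < z.im) (k : n) :
    ‖qres H z k‖ ≤ 1 / z.im := by
  rw [norm_qres]; exact norm_resol_le hH hz k

/-! #### Removing rows -/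

/-- `H` with the rows and columns in `I` set to zero. -/
def zeroSet (H : Matrix n n ℝ) (I : Finset n) : Matrix n n ℝ :=
  Matrix.of fun i j => if i ∈ I ∨ j ∈ I then 0 else H i j

theorem zeroSet_isSymm {m : Type*} [DecidableEq m] {H : Matrix m m ℝ} (hH : H.IsSymm)
    (I : Finset m) :
    (zeroSet H I).IsSymm := by
  ext i j
  simp only [Matrix.transpose_apply, zeroSet, Matrix.of_apply, hH.apply i j, or_comm]

theorem zeroSet_zeroSet {m : Type*} [DecidableEq m] (H : Matrix m m ℝ) (I J : Finset m) :
    zeroSet (zeroSet H I) J = zeroSet H (J ∪ I) := by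
  ext i j
  simp only [zeroSet, Matrix.of_apply, Finset.mem_union]
  split_ifs <;> tauto

/-- Once its row and column are zeroed, the index k decouples. Zeroing instead of deleting keeps the
index type fixed. -/
theorem resol_zeroSet_of_ne {H : Matrix n n ℝ} (hH : H.IsSymm) {z : ℂ} (hz : 0 < z.im) {k i : n}
    (hik : i ≠ k) : resol (zeroSet H {k}) z i k = 0 := by
  have hz0 : z ≠ 0 := by rintro rfl; simp at hz
  have h1 := congrFun (congrFun (resol_mul_shift (zeroSet_isSymm hH {k}) hz) i) k
  rw [Matrix.mul_apply, Matrix.one_apply_ne hik, Finset.sum_eq_single k] at h1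
  · simpa [zeroSet, hz0] using h1
  · intro l _ hl
    simp [zeroSet, hl]
  · simp

theorem resol_sub_resol {H H' : Matrix n n ℝ} (hH : H.IsSymm) (hH' : H'.IsSymm) {z : ℂ}
    (hz : 0 < z.im) :
    resol H' z - resol H z = resol H' z * (H - H').map Complex.ofReal * resol H z := by
  have h1 : (H - H').map Complex.ofReal = (H.map Complex.ofReal - z • (1 : Matrix n n ℂ)) -
      (H'.map Complex.ofReal - z • (1 : Matrix n n ℂ)) := by
    ext i j; simp
  rw [h1, mul_sub, sub_mul, resol_mul_shift hH' hz, one_mul, mul_assoc, shift_mul_resol hH hz,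
    mul_one]

/-- The row `k` of `H` without its diagonal entry. -/
def offRow (H : Matrix n n ℝ) (k : n) (l : n) : ℝ := if l = k then 0 else H k l

/-- In the resolvent identity the difference H - H⁽ᵏ⁾ lives on row and column k, and column k of the
resolvent of H⁽ᵏ⁾ vanishes off the diagonal; hence only the row of H through k survives. -/
theorem resol_apply_eq_zeroSet {H : Matrix n n ℝ} (hH : H.IsSymm) {z : ℂ} (hz : 0 < z.im) {k i : n}
    (hik : i ≠ k) (j : n) :
    resol H z i j = resol (zeroSet H {k}) z i j -
      (resol (zeroSet H {k}) z).mulVec (fun l => (offRow H k l : ℂ)) i * resol H z k j := by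
  have h := congrFun (congrFun (resol_sub_resol hH (zeroSet_isSymm hH {k}) hz) i) j
  rw [Matrix.sub_apply] at h
  rw [eq_sub_iff_add_eq, ← eq_sub_iff_add_eq', h, mul_assoc, Matrix.mul_apply, Matrix.mulVec,
    dotProduct, Finset.sum_mul]
  refine Finset.sum_congr rfl fun l _ => ?_
  by_cases hl : l = k
  · subst hl
    rw [resol_zeroSet_of_ne hH hz hik]
    simp
  · rw [mul_assoc]
    congr 1
    rw [Matrix.mul_apply, Finset.sum_eq_single k]
    · simp [zeroSet, offRow, hl, hH.apply k l]
    · intro m _ hm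
      simp [zeroSet, hl, hm]
    · simp

/-- The Schur complement formula, obtained from the (k,k) entry of (H - z)R = 1 after expressing
column k of R through the matrix without row k. -/
theorem resol_diag_schur {H : Matrix n n ℝ} (hH : H.IsSymm) {z : ℂ} (hz : 0 < z.im) (k : n) :
    resol H z k k * ((H k k : ℂ) - z - (fun l => (offRow H k l : ℂ)) ⬝ᵥ
      (resol (zeroSet H {k}) z).mulVec fun l => (offRow H k l : ℂ)) = 1 := by
  have h := congrFun (congrFun (shift_mul_resol hH hz) k) k
  rw [Matrix.mul_apply, Matrix.one_apply_eq, ← Finset.add_sum_erase _ _ (Finset.mem_univ k)] at h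
  rw [← h, mul_sub, sub_eq_add_neg]
  congr 1
  · simp; ring
  · rw [dotProduct, ← Finset.add_sum_erase _ _ (Finset.mem_univ k)]
    simp only [offRow, if_true, Complex.ofReal_zero, zero_mul, zero_add]
    rw [Finset.mul_sum, ← Finset.sum_neg_distrib]
    refine Finset.sum_congr rfl fun l hl => ?_
    have hl' : l ≠ k := Finset.ne_of_mem_erase hl
    rw [resol_apply_eq_zeroSet hH hz hl' k, resol_zeroSet_of_ne hH hz hl']
    simp only [hl', if_false, Matrix.sub_apply, Matrix.map_apply, Matrix.smul_apply,
      Matrix.one_apply_ne hl'.symm, smul_zero, sub_zero, offRow]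
    ring

theorem resol_ne_zero {H : Matrix n n ℝ} (hH : H.IsSymm) {z : ℂ} (hz : 0 < z.im) (k : n) :
    resol H z k k ≠ 0 := by
  intro h
  have := im_resol_pos hH hz k
  rw [h] at this
  simp at this

/-- For i ≠ k one has R_ii - R⁽ᵏ⁾_ii = R_ik² / R_kk, and by the Ward identity these sum in absolute
value to at most Im R_kk / (Im z |R_kk|) ≤ 1 / Im z. The bound does not see how large the removed
row is, which is essential for heavy tails. -/
theorem sum_norm_resol_sub_zeroSet_le {H : Matrix n n ℝ} (hH : H.IsSymm) {z : ℂ} (hz : 0 < z.im)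
    (k : n) :
    ∑ i ∈ Finset.univ.erase k, ‖resol H z i i - resol (zeroSet H {k}) z i i‖ ≤ 1 / z.im := by
  have hne := resol_ne_zero hH hz k
  have h1 : ∀ i ∈ Finset.univ.erase k, ‖resol H z i i - resol (zeroSet H {k}) z i i‖ =
      ‖resol H z i k‖ ^ 2 / ‖resol H z k k‖ := by
    intro i hi
    have hik : i ≠ k := Finset.ne_of_mem_erase hi
    have e1 := resol_apply_eq_zeroSet hH hz hik i
    have e2 := resol_apply_eq_zeroSet hH hz hik k
    rw [resol_zeroSet_of_ne hH hz hik, zero_sub, ← neg_mul] at e2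
    rw [e1, sub_sub_cancel_left, ← neg_mul, eq_div_of_mul_eq hne e2.symm, norm_mul, norm_div,
      resol_comm hH z k i]
    ring
  rw [Finset.sum_congr rfl h1, ← Finset.sum_div, div_le_iff₀ (norm_pos_iff.2 hne),
    div_mul_eq_mul_div, one_mul, le_div_iff₀' hz]
  calc _ ≤ z.im * ∑ i, ‖resol H z i k‖ ^ 2 := by
        gcongr
        exact Finset.erase_subset _ _
    _ ≤ _ := by
        rw [sum_norm_resol_col_sq hH hz]
        exact (le_abs_self _).trans (Complex.abs_im_le_norm _)

/-- The entries other than k pass through the common matrix without row k, at a cost of 1/Im z for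
each side; the two entries at k contribute at most another 1/Im z each. -/
theorem sum_norm_resol_sub_le {H₁ H₂ : Matrix n n ℝ} (h₁ : H₁.IsSymm) (h₂ : H₂.IsSymm) {z : ℂ}
    (hz : 0 < z.im) {k : n} (h : zeroSet H₁ {k} = zeroSet H₂ {k}) :
    ∑ i, ‖resol H₁ z i i - resol H₂ z i i‖ ≤ 4 / z.im := by
  rw [← Finset.add_sum_erase _ _ (Finset.mem_univ k)]
  have e1 := sum_norm_resol_sub_zeroSet_le h₁ hz k
  have e2 := sum_norm_resol_sub_zeroSet_le h₂ hz k
  rw [← h] at e2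
  have e3 : ∑ i ∈ Finset.univ.erase k, ‖resol H₁ z i i - resol H₂ z i i‖ ≤
      ∑ i ∈ Finset.univ.erase k, ‖resol H₁ z i i - resol (zeroSet H₁ {k}) z i i‖ +
      ∑ i ∈ Finset.univ.erase k, ‖resol H₂ z i i - resol (zeroSet H₁ {k}) z i i‖ := by
    rw [← Finset.sum_add_distrib]
    refine Finset.sum_le_sum fun i _ => ?_
    rw [norm_sub_rev (resol H₂ z i i)]
    exact norm_sub_le_norm_sub_add_norm_sub _ _ _
  have e4 := norm_sub_le (resol H₁ z k k) (resol H₂ z k k)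
  have e5 := norm_resol_le h₁ hz k
  have e6 := norm_resol_le h₂ hz k
  have : (4 : ℝ) / z.im = 1 / z.im + 1 / z.im + 1 / z.im + 1 / z.im := by ring
  linarith

theorem norm_trace_resol_sub_zeroSet_le {H : Matrix n n ℝ} (hH : H.IsSymm) {z : ℂ}
    (hz : 0 < z.im) (I : Finset n) :
    ‖(resol H z).trace - (resol (zeroSet H I) z).trace‖ ≤ 4 / z.im * I.card := by
  induction I using Finset.induction_on with
  | empty =>
    have : zeroSet H ∅ = H := by ext i j; simp [zeroSet]
    simp [this]
  | insert k I hk ih =>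
    have h1 : zeroSet (zeroSet H I) {k} = zeroSet H (insert k I) := by
      rw [zeroSet_zeroSet, Finset.insert_eq]
    have h2 : zeroSet (zeroSet H I) {k} = zeroSet (zeroSet H (insert k I)) {k} := by
      rw [zeroSet_zeroSet, zeroSet_zeroSet, Finset.insert_eq, ← Finset.union_assoc,
        Finset.union_self]
    have h3 := sum_norm_resol_sub_le (zeroSet_isSymm hH I) (zeroSet_isSymm hH (insert k I)) hz h2
    have h4 : ‖(resol (zeroSet H I) z).trace - (resol (zeroSet H (insert k I)) z).trace‖ ≤
        4 / z.im := by
      refine le_trans ?_ h3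
      rw [Matrix.trace, Matrix.trace, ← Finset.sum_sub_distrib]
      exact norm_sum_le _ _
    rw [Finset.card_insert_of_notMem hk]
    push_cast
    have := norm_sub_le_norm_sub_add_norm_sub (resol H z).trace (resol (zeroSet H I) z).trace
      (resol (zeroSet H (insert k I)) z).trace
    linarith

/-- By cyclicity the difference is tr((H - H') R R'). Cauchy–Schwarz separates H - H' from R R', and
each column of R R' has norm at most (Im z)⁻². -/
theorem norm_trace_resol_sub_le_frobenius {H H' : Matrix n n ℝ} (hH : H.IsSymm) (hH' : H'.IsSymm)
    {z : ℂ} (hz : 0 < z.im) :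
    ‖(resol H' z).trace - (resol H z).trace‖ ^ 2 ≤
      Fintype.card n / z.im ^ 4 * ∑ i, ∑ j, (H i j - H' i j) ^ 2 := by
  rw [← Matrix.trace_sub, resol_sub_resol hH hH' hz, mul_assoc, Matrix.trace_mul_comm, mul_assoc,
    Matrix.trace]
  have h1 : ∑ i, ((H - H').map Complex.ofReal * (resol H z * resol H' z)).diag i =
      ∑ p : n × n, ((H p.1 p.2 - H' p.1 p.2 : ℝ) : ℂ) * (resol H z * resol H' z) p.2 p.1 := by
    rw [Fintype.sum_prod_type]
    refine Finset.sum_congr rfl fun i _ => ?_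
    rw [Matrix.diag_apply, Matrix.mul_apply]
    rfl
  rw [h1]
  refine (norm_dotProduct_le (m := n × n) (fun p => ((H p.1 p.2 - H' p.1 p.2 : ℝ) : ℂ))
    (fun p => (resol H z * resol H' z) p.2 p.1)).trans ?_
  rw [mul_comm]
  refine mul_le_mul ?_ ?_ (Finset.sum_nonneg fun _ _ => by positivity) (by positivity)
  · rw [Fintype.sum_prod_type]
    have : ∀ i : n, ∑ j, ‖(resol H z * resol H' z) j i‖ ^ 2 ≤ 1 / z.im ^ 4 := by
      intro i
      have e1 := sum_norm_resol_mulVec_sq_le hH hz ((resol H' z).col i)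
      have e2 := sum_norm_resol_col_sq_le hH' hz i
      refine (le_of_eq_of_le ?_ e1).trans ?_
      · refine Finset.sum_congr rfl fun j _ => ?_
        rw [Matrix.mul_apply]
        rfl
      · rw [div_le_div_iff₀ (by positivity) (by positivity)]
        rw [le_div_iff₀ (by positivity)] at e2
        calc _ = (∑ x, ‖resol H' z x i‖ ^ 2) * z.im ^ 2 * z.im ^ 2 := by
              simp only [Matrix.col_apply]; ring
          _ ≤ 1 * z.im ^ 2 := by gcongr
    refine (Finset.sum_le_sum fun i _ => this i).trans (le_of_eq ?_)
    simp [div_eq_mul_inv]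
  · rw [Fintype.sum_prod_type]
    simp only [Complex.norm_real, Real.norm_eq_abs, sq_abs, le_refl]

/-! #### Regularity -/

theorem continuous_resol {T : Type*} [TopologicalSpace T] {H : T → Matrix n n ℝ} {z : T → ℂ}
    (hH : Continuous H) (hz : Continuous z) (hs : ∀ t, (H t).IsSymm) (hz0 : ∀ t, 0 < (z t).im)
    (i j : n) : Continuous fun t => resol (H t) (z t) i j := by
  have h1 : Continuous fun t => (H t).map Complex.ofReal - z t • (1 : Matrix n n ℂ) :=
    (hH.matrix_map Complex.continuous_ofReal).sub (hz.smul continuous_const)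
  have h2 : ∀ t, ((H t).map Complex.ofReal - z t • (1 : Matrix n n ℂ)).det ≠ 0 := fun t =>
    (isUnit_det_shift (hs t) (hz0 t)).ne_zero
  simp only [resol, Matrix.inv_def, Ring.inverse_eq_inv', Matrix.smul_apply]
  exact (h1.matrix_det.inv₀ h2).smul (h1.matrix_adjugate.matrix_elem i j)

/-- The resolvent identity exhibits the difference quotient as an entry of R(w)R(z), so continuity
in z is enough. -/
theorem differentiableOn_resol {H : Matrix n n ℝ} (hH : H.IsSymm) (i j : n) :
    DifferentiableOn ℂ (fun z => resol H z i j) upperHalf := by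
  intro w hw
  have hw' : 0 < w.im := hw
  have hid : ∀ z ∈ upperHalf, resol H z i j - resol H w i j =
      (z - w) * (resol H w * resol H z) i j := by
    intro z hz
    have hz' : 0 < z.im := hz
    have h1 : (z - w) • (1 : Matrix n n ℂ) = (H.map Complex.ofReal - w • (1 : Matrix n n ℂ)) -
        (H.map Complex.ofReal - z • (1 : Matrix n n ℂ)) := by
      rw [sub_smul]; abel
    have h2 : resol H z - resol H w = resol H w * ((z - w) • (1 : Matrix n n ℂ)) * resol H z := by
      rw [h1, mul_sub, sub_mul, resol_mul_shift hH hw', one_mul, mul_assoc, shift_mul_resol hH hz',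
        mul_one]
    have h3 := congrFun (congrFun h2 i) j
    rw [Matrix.sub_apply, mul_smul_comm, mul_one, smul_mul_assoc, Matrix.smul_apply,
      smul_eq_mul] at h3
    exact h3
  have hcont : ∀ a b, ContinuousOn (fun z => resol H z a b) upperHalf := by
    intro a b
    rw [continuousOn_iff_continuous_domRestrict]
    exact continuous_resol (T := upperHalf) (H := fun _ => H) (z := fun t => (t : ℂ))
      continuous_const continuous_subtype_val (fun _ => hH) (fun t => t.2) a b
  have hc2 : ContinuousOn (fun z => (resol H w * resol H z) i j) upperHalf := by
    simp only [Matrix.mul_apply]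
    exact continuousOn_finsetSum _ fun l _ => continuousOn_const.mul (hcont l j)
  refine HasDerivWithinAt.differentiableWithinAt (f' := (resol H w * resol H w) i j) ?_
  rw [hasDerivWithinAt_iff_tendsto_slope]
  refine ((hc2 w hw).mono sdiff_subset).congr' ?_
  filter_upwards [self_mem_nhdsWithin] with z hz
  have hne : z - w ≠ 0 := sub_ne_zero.2 hz.2
  rw [slope_def_field, hid z hz.1, mul_div_cancel_left₀ _ hne]

end Resolvent

/-! ### Resampling coordinates in a product measure -/

section Resample

set_option linter.unusedSectionVars false

theorem sq_integral_le {Ω : Type*} [MeasurableSpace Ω] {P : Measure Ω} [IsProbabilityMeasure P]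
    {f : Ω → ℝ} (hf : Integrable f P) (hf2 : Integrable (fun x => f x ^ 2) P) :
    (∫ x, f x ∂P) ^ 2 ≤ ∫ x, f x ^ 2 ∂P := by
  set m := ∫ x, f x ∂P with hm
  have h : 0 ≤ ∫ x, (f x - m) ^ 2 ∂P := integral_nonneg fun x => by positivity
  have e : ∀ x, (f x - m) ^ 2 = f x ^ 2 - 2 * m * f x + m ^ 2 := fun x => by ring
  simp only [e] at h
  have hi : Integrable (fun x => f x ^ 2 - 2 * m * f x) P := hf2.sub (hf.const_mul _)
  rw [integral_add hi (integrable_const _), integral_sub hf2 (hf.const_mul _), integral_const_mul, ← hm] at h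
  simp only [integral_const, probReal_univ, one_smul] at h
  nlinarith

variable {ι : Type*} [Fintype ι] [DecidableEq ι] (μ : ι → Measure ℝ)
  [∀ i, IsProbabilityMeasure (μ i)]

theorem measurable_piecewise_prod (S : Finset ι) :
    Measurable fun p : (ι → ℝ) × (ι → ℝ) => S.piecewise p.1 p.2 := by
  refine measurable_pi_lambda _ fun i => ?_
  by_cases hi : i ∈ S
  · simp only [Finset.piecewise, hi, if_true]
    fun_prop
  · simp only [Finset.piecewise, hi, if_false]
    fun_prop

/-- Substituting the coordinates in S from an independent copy preserves a product law. This is how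
conditioning on the coordinates outside S is expressed. -/
theorem measurePreserving_piecewise (S : Finset ι) :
    MeasurePreserving (fun p : (ι → ℝ) × (ι → ℝ) => S.piecewise p.1 p.2)
      ((Measure.pi μ).prod (Measure.pi μ)) (Measure.pi μ) := by
  refine ⟨measurable_piecewise_prod S, ?_⟩
  refine (Measure.pi_eq fun s hs => ?_).symm
  rw [Measure.map_apply (measurable_piecewise_prod S) (MeasurableSet.univ_pi hs)]
  have h : (fun p : (ι → ℝ) × (ι → ℝ) => S.piecewise p.1 p.2) ⁻¹' univ.pi s =
      (univ.pi fun i => if i ∈ S then s i else univ) ×ˢ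
        (univ.pi fun i => if i ∈ S then univ else s i) := by
    ext p
    simp only [mem_preimage, Set.mem_pi, mem_univ, true_implies, mem_prod, ← forall_and]
    refine forall_congr' fun i => ?_
    by_cases hi : i ∈ S <;> simp [Finset.piecewise, hi]
  rw [h, Measure.prod_prod, Measure.pi_pi, Measure.pi_pi, ← Finset.prod_mul_distrib]
  refine Finset.prod_congr rfl fun i _ => ?_
  by_cases hi : i ∈ S <;> simp [hi]

/-- Average of `F` over the coordinates in `S`. -/
def avg (S : Finset ι) (F : (ι → ℝ) → ℂ) (x : ι → ℝ) : ℂ :=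
  ∫ y, F (S.piecewise y x) ∂Measure.pi μ

variable {F G : (ι → ℝ) → ℂ} {C : ℝ}

theorem integrable_of_bdd (hF : Measurable F) (hC : ∀ x, ‖F x‖ ≤ C) :
    Integrable F (Measure.pi μ) :=
  Integrable.of_bound hF.aestronglyMeasurable C (Eventually.of_forall hC)

theorem integral_eq_integral_piecewise (S : Finset ι) (hF : Measurable F)
    (hC : ∀ x, ‖F x‖ ≤ C) :
    ∫ x, F x ∂Measure.pi μ =
      ∫ x, ∫ y, F (S.piecewise y x) ∂Measure.pi μ ∂Measure.pi μ := by
  rw [← (measurePreserving_piecewise μ S).map_eq, integral_map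
    (measurable_piecewise_prod S).aemeasurable hF.aestronglyMeasurable, integral_prod_symm,
    (measurePreserving_piecewise μ S).map_eq]
  exact Integrable.of_bound (hF.comp (measurable_piecewise_prod S)).aestronglyMeasurable C
    (Eventually.of_forall fun _ => hC _)

theorem integral_avg (S : Finset ι) (hF : Measurable F) (hC : ∀ x, ‖F x‖ ≤ C) :
    ∫ x, avg μ S F x ∂Measure.pi μ = ∫ x, F x ∂Measure.pi μ :=
  (integral_eq_integral_piecewise μ S hF hC).symm

theorem measurable_avg (S : Finset ι) (hF : Measurable F) : Measurable (avg μ S F) := by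
  have h : StronglyMeasurable fun p : (ι → ℝ) × (ι → ℝ) => F (S.piecewise p.2 p.1) :=
    (hF.comp ((measurable_piecewise_prod S).comp measurable_swap)).stronglyMeasurable
  exact h.integral_prod_right'.measurable

theorem norm_avg_le (S : Finset ι) (hC : ∀ x, ‖F x‖ ≤ C) (x : ι → ℝ) : ‖avg μ S F x‖ ≤ C := by
  refine (norm_integral_le_of_norm_le_const (Eventually.of_forall fun y => hC _)).trans ?_
  simp

theorem piecewise_piecewise_left (S : Finset ι) (y w x : ι → ℝ) :
    S.piecewise y (S.piecewise w x) = S.piecewise y x := by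
  ext i
  by_cases hi : i ∈ S <;> simp [Finset.piecewise, hi]

theorem avg_piecewise (S : Finset ι) (y x : ι → ℝ) :
    avg μ S F (S.piecewise y x) = avg μ S F x := by
  simp only [avg, piecewise_piecewise_left]

theorem integral_mul_conj_avg (S : Finset ι) {C' : ℝ} (hF : Measurable F) (hC : ∀ x, ‖F x‖ ≤ C)
    (hG : Measurable G) (hC' : ∀ x, ‖G x‖ ≤ C') :
    ∫ x, F x * starRingEnd ℂ (avg μ S G x) ∂Measure.pi μ =
      ∫ x, avg μ S F x * starRingEnd ℂ (avg μ S G x) ∂Measure.pi μ := by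
  have hm : Measurable fun x => F x * starRingEnd ℂ (avg μ S G x) :=
    hF.mul (Complex.continuous_conj.measurable.comp (measurable_avg μ S hG))
  rw [integral_eq_integral_piecewise μ S hm (C := C * C')]
  · refine integral_congr_ae (Eventually.of_forall fun x => ?_)
    simp only [avg_piecewise]
    rw [integral_mul_const]
    rfl
  · intro x
    rw [norm_mul, RCLike.norm_conj]
    exact mul_le_mul (hC x) (norm_avg_le μ S hC' x) (norm_nonneg _) ((norm_nonneg _).trans (hC x))

/-- Averaging over S is the orthogonal projection onto functions that do not depend on the
coordinates in S, so F minus its average is orthogonal to any such average. -/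
theorem integral_norm_sq_pythagoras (S : Finset ι) {C' : ℝ} (hF : Measurable F)
    (hC : ∀ x, ‖F x‖ ≤ C) (hG : Measurable G) (hC' : ∀ x, ‖G x‖ ≤ C') :
    ∫ x, ‖F x - avg μ S F x + avg μ S G x‖ ^ 2 ∂Measure.pi μ =
      ∫ x, ‖F x - avg μ S F x‖ ^ 2 ∂Measure.pi μ + ∫ x, ‖avg μ S G x‖ ^ 2 ∂Measure.pi μ := by
  have hmF := measurable_avg μ S hF
  have hmG := measurable_avg μ S hG
  have hbF : ∀ x, ‖F x - avg μ S F x‖ ≤ C + C := fun x =>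
    (norm_sub_le _ _).trans (add_le_add (hC x) (norm_avg_le μ S hC x))
  have hsq : ∀ {K : (ι → ℝ) → ℂ} {c : ℝ}, Measurable K → (∀ x, ‖K x‖ ≤ c) →
      Integrable (fun x => ‖K x‖ ^ 2) (Measure.pi μ) := fun {K c} hK hc =>
    Integrable.of_bound (hK.norm.pow_const 2).aestronglyMeasurable (c ^ 2)
      (Eventually.of_forall fun x => by
        rw [Real.norm_of_nonneg (by positivity)]
        gcongr
        exact hc x)
  have hconj : Measurable fun x => starRingEnd ℂ (avg μ S G x) :=
    Complex.continuous_conj.measurable.comp hmG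
  have hbG : ∀ x, ‖starRingEnd ℂ (avg μ S G x)‖ ≤ C' := fun x => by
    rw [RCLike.norm_conj]; exact norm_avg_le μ S hC' x
  have hmul : ∀ {K : (ι → ℝ) → ℂ} {c : ℝ}, Measurable K → (∀ x, ‖K x‖ ≤ c) →
      Integrable (fun x => K x * starRingEnd ℂ (avg μ S G x)) (Measure.pi μ) :=
    fun {K c} hK hc => integrable_of_bdd μ (C := c * C') (hK.mul hconj) fun x => by
      rw [norm_mul]
      exact mul_le_mul (hc x) (hbG x) (norm_nonneg _) ((norm_nonneg _).trans (hc x))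
  have hexp : ∀ x, ‖F x - avg μ S F x + avg μ S G x‖ ^ 2 = ‖F x - avg μ S F x‖ ^ 2 +
      ‖avg μ S G x‖ ^ 2 + 2 * ((F x - avg μ S F x) * starRingEnd ℂ (avg μ S G x)).re := by
    intro x
    rw [← Complex.normSq_eq_norm_sq, ← Complex.normSq_eq_norm_sq, ← Complex.normSq_eq_norm_sq,
      Complex.normSq_add]
  have hi : Integrable (fun x => (F x - avg μ S F x) * starRingEnd ℂ (avg μ S G x))
      (Measure.pi μ) := hmul (hF.sub hmF) hbF
  have hi2 : Integrable (fun x => 2 * ((F x - avg μ S F x) * starRingEnd ℂ (avg μ S G x)).re)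
      (Measure.pi μ) := hi.re.const_mul 2
  have hi3 : Integrable (fun x => ‖F x - avg μ S F x‖ ^ 2) (Measure.pi μ) := hsq (hF.sub hmF) hbF
  have hi4 := hsq hmG (norm_avg_le μ S hC')
  have hi5 : Integrable (fun x => ‖F x - avg μ S F x‖ ^ 2 + ‖avg μ S G x‖ ^ 2)
      (Measure.pi μ) := hi3.add hi4
  have hzero : ∫ x, ((F x - avg μ S F x) * starRingEnd ℂ (avg μ S G x)).re ∂Measure.pi μ = 0 := by
    have h1 := integral_re hi
    simp only [RCLike.re_to_complex] at h1
    rw [h1]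
    simp only [sub_mul]
    rw [integral_sub (hmul hF hC) (hmul hmF (norm_avg_le μ S hC)),
      integral_mul_conj_avg μ S hF hC hG hC', sub_self, Complex.zero_re]
  simp only [hexp]
  rw [integral_add hi5 hi2, integral_add hi3 hi4, integral_const_mul, hzero, mul_zero, add_zero]

theorem integral_norm_avg_sq_le (S : Finset ι) (hF : Measurable F) (hC : ∀ x, ‖F x‖ ≤ C) :
    ∫ x, ‖avg μ S F x‖ ^ 2 ∂Measure.pi μ ≤ ∫ x, ‖F x‖ ^ 2 ∂Measure.pi μ := by
  have h := integral_norm_sq_pythagoras μ S hF hC hF hC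
  simp only [sub_add_cancel] at h
  rw [h]
  have : 0 ≤ ∫ x, ‖F x - avg μ S F x‖ ^ 2 ∂Measure.pi μ := integral_nonneg fun _ => by positivity
  linarith

theorem avg_avg (S S' : Finset ι) (hF : Measurable F) (hC : ∀ x, ‖F x‖ ≤ C) :
    avg μ S (avg μ S' F) = avg μ (S ∪ S') F := by
  ext x
  have hm : Measurable fun u : ι → ℝ => F ((S ∪ S').piecewise u x) :=
    hF.comp ((measurable_piecewise_prod (S ∪ S')).comp (measurable_id.prodMk measurable_const))
  simp only [avg]
  rw [integral_eq_integral_piecewise μ S' hm fun _ => hC _]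
  refine integral_congr_ae (Eventually.of_forall fun y => ?_)
  refine integral_congr_ae (Eventually.of_forall fun w => ?_)
  beta_reduce
  congr 1
  ext i
  by_cases hi : i ∈ S <;> by_cases hi' : i ∈ S' <;> simp [Finset.piecewise, hi, hi']

theorem avg_sub (S : Finset ι) {C' : ℝ} (hF : Measurable F) (hC : ∀ x, ‖F x‖ ≤ C)
    (hG : Measurable G) (hC' : ∀ x, ‖G x‖ ≤ C') (x : ι → ℝ) :
    avg μ S (fun x => F x - G x) x = avg μ S F x - avg μ S G x := by
  have hm : Measurable fun u : ι → ℝ => S.piecewise u x :=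
    (measurable_piecewise_prod S).comp (measurable_id.prodMk measurable_const)
  exact integral_sub (integrable_of_bdd μ (hF.comp hm) fun _ => hC _)
    (integrable_of_bdd μ (hG.comp hm) fun _ => hC' _)

/-- Write E_S for the average over S and U for the union of the blocks in T. Then F - E_{B ∪ U} F =
(F - E_B F) + E_B (F - E_U F) is an orthogonal sum, and E_B contracts L². Induction on the number of
blocks needs no disjointness. -/
theorem integral_norm_sub_avg_biUnion_le {κ : Type*} [DecidableEq κ] (B : κ → Finset ι)
    (T : Finset κ) (hF : Measurable F) (hC : ∀ x, ‖F x‖ ≤ C) :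
    ∫ x, ‖F x - avg μ (T.biUnion B) F x‖ ^ 2 ∂Measure.pi μ ≤
      ∑ k ∈ T, ∫ x, ‖F x - avg μ (B k) F x‖ ^ 2 ∂Measure.pi μ := by
  induction T using Finset.induction_on with
  | empty =>
    have : avg μ ∅ F = F := by ext x; simp [avg]
    simp [this]
  | insert k T hk ih =>
    rw [Finset.biUnion_insert, Finset.sum_insert hk, ← avg_avg μ _ _ hF hC]
    set U := T.biUnion B
    have hmU := measurable_avg μ U hF
    have hbU := norm_avg_le μ U hC
    have hb2 : ∀ x, ‖F x - avg μ U F x‖ ≤ C + C := fun x =>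
      (norm_sub_le _ _).trans (add_le_add (hC x) (hbU x))
    have h1 : ∀ x, F x - avg μ (B k) (avg μ U F) x =
        F x - avg μ (B k) F x + avg μ (B k) (fun x => F x - avg μ U F x) x := by
      intro x
      rw [avg_sub μ (B k) hF hC hmU hbU]
      ring
    simp only [h1]
    rw [integral_norm_sq_pythagoras μ (B k) hF hC (G := fun x => F x - avg μ U F x)
      (hF.sub hmU) hb2]
    gcongr
    exact (integral_norm_avg_sq_le μ (B k) (hF.sub hmU) hb2).trans ih

/-- The **Efron–Stein inequality**; the blocks may overlap. -/
theorem integral_norm_sub_integral_sq_le {κ : Type*} [Fintype κ] [DecidableEq κ]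
    (B : κ → Finset ι) (hB : ∀ i, ∃ k, i ∈ B k) (hF : Measurable F) (hC : ∀ x, ‖F x‖ ≤ C) :
    ∫ x, ‖F x - ∫ y, F y ∂Measure.pi μ‖ ^ 2 ∂Measure.pi μ ≤
      ∑ k, ∫ x, ‖F x - avg μ (B k) F x‖ ^ 2 ∂Measure.pi μ := by
  have h := integral_norm_sub_avg_biUnion_le μ B Finset.univ hF hC
  have hU : Finset.univ.biUnion B = Finset.univ := by
    ext i
    simpa using hB i
  rw [hU] at h
  simpa [avg] using h

/-- With the rows of an N × N matrix as blocks this yields fluctuations of order c√N, negligible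
against a normalisation by N. -/
theorem integral_norm_sub_integral_sq_le_of_bdd_diff {κ : Type*} [Fintype κ] [DecidableEq κ]
    (B : κ → Finset ι) (hB : ∀ i, ∃ k, i ∈ B k) (hF : Measurable F) (hC : ∀ x, ‖F x‖ ≤ C) {c : ℝ}
    (hc : ∀ k x y, ‖F x - F ((B k).piecewise y x)‖ ≤ c) :
    ∫ x, ‖F x - ∫ y, F y ∂Measure.pi μ‖ ^ 2 ∂Measure.pi μ ≤ Fintype.card κ * c ^ 2 := by
  refine (integral_norm_sub_integral_sq_le μ B hB hF hC).trans ?_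
  refine (Finset.sum_le_sum (g := fun _ => c ^ 2) fun k _ => ?_).trans (by simp)
  have hpt : ∀ x, ‖F x - avg μ (B k) F x‖ ≤ c := by
    intro x
    have hm : Measurable fun u : ι → ℝ => (B k).piecewise u x :=
      (measurable_piecewise_prod (B k)).comp (measurable_id.prodMk measurable_const)
    have h1 : F x - avg μ (B k) F x = ∫ y, (F x - F ((B k).piecewise y x)) ∂Measure.pi μ := by
      have hi : Integrable (fun y => F ((B k).piecewise y x)) (Measure.pi μ) :=
        integrable_of_bdd μ (hF.comp hm) fun _ => hC _
      rw [integral_sub (integrable_const _) hi]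
      simp [avg]
    rw [h1]
    refine (norm_integral_le_of_norm_le_const (Eventually.of_forall fun y => hc k x y)).trans ?_
    simp
  have hi : Integrable (fun x => ‖F x - avg μ (B k) F x‖ ^ 2) (Measure.pi μ) := by
    refine Integrable.of_bound (C := c ^ 2) ?_ (Eventually.of_forall fun x => ?_)
    · exact ((hF.sub (measurable_avg μ (B k) hF)).norm.pow_const 2).aestronglyMeasurable
    · rw [Real.norm_of_nonneg (by positivity)]
      gcongr
      exact hpt x
  calc _ ≤ ∫ _, c ^ 2 ∂Measure.pi μ := by
        refine integral_mono hi (integrable_const _) fun x => ?_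
        exact pow_le_pow_left₀ (norm_nonneg _) (hpt x) 2
    _ = c ^ 2 := by simp

end Resample

/-! ### Regularly varying tails -/

section Tail

set_option linter.unusedSectionVars false

/-- The tail `u ↦ ν(|x| ≥ u)`. -/
def tail (ν : Measure ℝ) (u : ℝ) : ℝ := ν.real {t | u ≤ |t|}

variable {α : ℝ} {ν : Measure ℝ} [IsProbabilityMeasure ν]

theorem tail_antitone : Antitone (tail ν) := fun _ _ h =>
  measureReal_mono fun _ ht => h.trans ht

theorem tail_nonneg (u : ℝ) : 0 ≤ tail ν u := measureReal_nonneg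

theorem tail_le_one (u : ℝ) : tail ν u ≤ 1 := measureReal_le_one

theorem tail_pos (hν : HeavyTailed α ν) (u : ℝ) : 0 < tail ν u := by
  obtain ⟨L, ⟨hL, -⟩, h⟩ := hν
  obtain ⟨w, hw, hw1, hw2⟩ := (hL.and ((eventually_ge_atTop u).and (eventually_gt_atTop 0))).exists
  refine lt_of_lt_of_le ?_ (tail_antitone hw1)
  rw [tail, h w hw2]
  positivity

theorem tail_ratio (hν : HeavyTailed α ν) {c : ℝ} (hc : 0 < c) :
    Tendsto (fun u => tail ν (c * u) / tail ν u) atTop (𝓝 (c ^ (-α))) := by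
  obtain ⟨L, ⟨-, hL⟩, h⟩ := hν
  have h1 := (hL c hc).mul_const (c ^ (-α))
  rw [one_mul] at h1
  refine h1.congr' ?_
  filter_upwards [eventually_gt_atTop 0] with u hu
  have : u ^ (-α) ≠ 0 := (Real.rpow_pos_of_pos hu _).ne'
  rw [tail, tail, h u hu, h (c * u) (by positivity), Real.mul_rpow hc.le hu.le]
  field_simp

theorem tail_tendsto_zero : Tendsto (tail ν) atTop (𝓝 0) := by
  have hm : ∀ n : ℕ, NullMeasurableSet {t : ℝ | (n : ℝ) ≤ |t|} ν := fun n =>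
    (measurableSet_le measurable_const measurable_id.abs).nullMeasurableSet
  have h := tendsto_measure_iInter_atTop (μ := ν) (s := fun n : ℕ => {t : ℝ | (n : ℝ) ≤ |t|}) hm
    (fun a b hab t ht => le_trans (by exact_mod_cast hab : (a : ℝ) ≤ b) ht) ⟨0, measure_ne_top _ _⟩
  have hemp : ⋂ n : ℕ, {t : ℝ | (n : ℝ) ≤ |t|} = ∅ := by
    ext t
    simp only [mem_iInter, mem_empty_iff_false, iff_false, not_forall]
    obtain ⟨n, hn⟩ := exists_nat_gt |t|
    exact ⟨n, not_le.2 hn⟩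
  rw [hemp, measure_empty] at h
  have h2 := (ENNReal.tendsto_toReal ENNReal.zero_ne_top).comp h
  have h3 : Tendsto (fun n : ℕ => tail ν n) atTop (𝓝 0) := h2
  rw [Metric.tendsto_atTop] at h3 ⊢
  intro ε hε
  obtain ⟨n, hn⟩ := h3 ε hε
  refine ⟨n, fun u hu => ?_⟩
  have := hn n le_rfl
  rw [Real.dist_eq, sub_zero, abs_of_nonneg (tail_nonneg _)] at this ⊢
  exact (tail_antitone hu).trans_lt this

/-- Left continuity of the tail, which uses that it is defined with ≥. It transfers the lower bound
1/N to the point a_N itself. -/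
theorem le_tail_of_forall_lt {a r : ℝ} (h : ∀ u < a, r ≤ tail ν u) : r ≤ tail ν a := by
  have hm : ∀ n : ℕ, NullMeasurableSet {t : ℝ | a - 1 / ((n : ℝ) + 1) ≤ |t|} ν := fun n =>
    (measurableSet_le measurable_const measurable_id.abs).nullMeasurableSet
  have h1 := tendsto_measure_iInter_atTop (μ := ν)
    (s := fun n : ℕ => {t : ℝ | a - 1 / ((n : ℝ) + 1) ≤ |t|}) hm
    (fun m n hmn t ht => by
      have : 1 / ((n : ℝ) + 1) ≤ 1 / ((m : ℝ) + 1) := by gcongr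
      have ht' : a - 1 / ((n : ℝ) + 1) ≤ |t| := ht
      change a - 1 / ((m : ℝ) + 1) ≤ |t|
      linarith) ⟨0, measure_ne_top _ _⟩
  have heq : ⋂ n : ℕ, {t : ℝ | a - 1 / ((n : ℝ) + 1) ≤ |t|} = {t | a ≤ |t|} := by
    ext t
    simp only [mem_iInter, mem_ofPred_eq]
    refine ⟨fun ht => ?_, fun ht n => ?_⟩
    · refine le_of_forall_pos_le_add fun ε hε => ?_
      obtain ⟨n, hn⟩ := exists_nat_one_div_lt hε
      linarith [ht n]
    · have : 0 < 1 / ((n : ℝ) + 1) := by positivity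
      linarith
  rw [heq] at h1
  have h2 : Tendsto (fun n : ℕ => tail ν (a - 1 / ((n : ℝ) + 1))) atTop (𝓝 (tail ν a)) :=
    (ENNReal.tendsto_toReal (measure_ne_top _ _)).comp h1
  refine ge_of_tendsto h2 (Eventually.of_forall fun n => h _ ?_)
  have : 0 < 1 / ((n : ℝ) + 1) := by positivity
  linarith

/-- For N ≥ 2 negative u are excluded, the tail being 1 there. For N = 1 the set is the whole line
and `sInf` takes a default value, hence the restriction on N. -/
theorem scale_set_bddBelow {N : ℕ} (hN : 2 ≤ N) :
    BddBelow {u : ℝ | tail ν u ≤ 1 / (N : ℝ)} := by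
  refine ⟨0, fun u hu => ?_⟩
  by_contra hneg
  have h1 : tail ν u = 1 := by
    have : {t : ℝ | u ≤ |t|} = univ := by
      ext t
      simp only [mem_ofPred_eq, mem_univ, iff_true]
      linarith [abs_nonneg t]
    rw [tail, this, probReal_univ]
  have h2 : tail ν u ≤ 1 / (N : ℝ) := hu
  rw [h1, le_div_iff₀ (by positivity), one_mul] at h2
  have : (2 : ℝ) ≤ N := by exact_mod_cast hN
  linarith

theorem lt_tail_of_lt_scale {N : ℕ} (hN : 2 ≤ N) {u : ℝ} (hu : u < scale ν N) :
    1 / (N : ℝ) < tail ν u := by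
  by_contra h
  exact absurd (csInf_le (scale_set_bddBelow hN) (not_lt.1 h)) (not_le.2 hu)

theorem tail_le_of_scale_lt {N : ℕ} (hN : 2 ≤ N) {u : ℝ} (hu : scale ν N < u) :
    tail ν u ≤ 1 / (N : ℝ) := by
  have hne : {u : ℝ | tail ν u ≤ 1 / (N : ℝ)}.Nonempty := by
    have hpos : (0 : ℝ) < 1 / N := by positivity
    obtain ⟨w, hw⟩ := ((tail_tendsto_zero (ν := ν)).eventually (Iio_mem_nhds hpos)).exists
    exact ⟨w, le_of_lt hw⟩
  obtain ⟨w, hw, hwu⟩ := (csInf_lt_iff (scale_set_bddBelow hN) hne).1 hu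
  exact (tail_antitone hwu.le).trans hw

theorem scale_tendsto_atTop (hν : HeavyTailed α ν) : Tendsto (scale ν) atTop atTop := by
  refine tendsto_atTop.2 fun M => ?_
  have h1 := tail_pos hν M
  obtain ⟨n, hn⟩ := exists_nat_gt (1 / tail ν M)
  filter_upwards [eventually_ge_atTop (max n 2)] with N hN
  by_contra h
  have h2 := tail_le_of_scale_lt (le_of_max_le_right hN) (not_le.1 h)
  have h3 : (n : ℝ) ≤ N := by exact_mod_cast le_of_max_le_left hN
  have hN0 : (0 : ℝ) < N := by
    have := le_of_max_le_right hN
    positivity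
  rw [le_div_iff₀ hN0] at h2
  rw [div_lt_iff₀ h1] at hn
  nlinarith

/-- Left continuity gives N ν(|x| ≥ a_N) ≥ 1, while N ν(|x| ≥ c a_N) ≤ 1 for c > 1. Regular
variation makes the ratio of the two tend to c^α, and c may be taken close to 1. -/
theorem mul_tail_scale_tendsto_one (hν : HeavyTailed α ν) :
    Tendsto (fun N : ℕ => (N : ℝ) * tail ν (scale ν N)) atTop (𝓝 1) := by
  have hs := scale_tendsto_atTop hν
  rw [Metric.tendsto_atTop']
  intro ε hε
  obtain ⟨c, hc1, hcε⟩ : ∃ c : ℝ, 1 < c ∧ c ^ α < 1 + ε := by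
    have hcont : Tendsto (fun c : ℝ => c ^ α) (𝓝[>] 1) (𝓝 (1 ^ α)) :=
      ((Real.continuousAt_rpow_const 1 α (Or.inl one_ne_zero)).tendsto).mono_left
        nhdsWithin_le_nhds
    rw [Real.one_rpow] at hcont
    obtain ⟨c, h1, h2⟩ := ((hcont.eventually (Iio_mem_nhds (by linarith : (1 : ℝ) < 1 + ε))).and
      self_mem_nhdsWithin).exists
    exact ⟨c, h2, h1⟩
  have hc0 : 0 < c := by linarith
  have h1 := ((tail_ratio hν hc0).comp hs).inv₀ (Real.rpow_pos_of_pos hc0 _).ne'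
  rw [← Real.rpow_neg hc0.le, neg_neg] at h1
  have h2 := h1.eventually (Iio_mem_nhds hcε)
  obtain ⟨n, hn⟩ := eventually_atTop.1 (h2.and ((hs.eventually_gt_atTop 0).and
    (eventually_ge_atTop 2)))
  refine ⟨n, fun N hN => ?_⟩
  obtain ⟨e1, e2, e3⟩ := hn N (le_of_lt hN)
  simp only [Function.comp_apply, inv_div] at e1
  have hN0 : (0 : ℝ) < N := by positivity
  have e4 : 1 ≤ (N : ℝ) * tail ν (scale ν N) := by
    have := le_tail_of_forall_lt (ν := ν) (a := scale ν N) (r := 1 / (N : ℝ))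
      fun u hu => (lt_tail_of_lt_scale e3 hu).le
    rwa [div_le_iff₀' hN0] at this
  have e5 : (N : ℝ) * tail ν (c * scale ν N) ≤ 1 := by
    have := tail_le_of_scale_lt (ν := ν) e3 (u := c * scale ν N) (by nlinarith)
    rwa [le_div_iff₀' hN0] at this
  have e6 : (N : ℝ) * tail ν (scale ν N) < 1 + ε := by
    have hp := tail_pos hν (c * scale ν N)
    rw [div_lt_iff₀ hp] at e1
    calc (N : ℝ) * tail ν (scale ν N) < N * ((1 + ε) * tail ν (c * scale ν N)) := by gcongr
      _ = (1 + ε) * (N * tail ν (c * scale ν N)) := by ring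
      _ ≤ (1 + ε) * 1 := by gcongr
      _ = _ := by ring
  rw [Real.dist_eq, abs_lt]
  constructor <;> linarith

theorem mul_tail_tendsto (hν : HeavyTailed α ν) {v : ℝ} (hv : 0 < v) :
    Tendsto (fun N : ℕ => (N : ℝ) * tail ν (v * scale ν N)) atTop (𝓝 (v ^ (-α))) := by
  have h := (mul_tail_scale_tendsto_one hν).mul
    ((tail_ratio hν hv).comp (scale_tendsto_atTop hν))
  rw [one_mul] at h
  refine h.congr fun N => ?_
  have := (tail_pos hν (scale ν N)).ne'
  simp only [Function.comp_apply]
  field_simp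

/-- As 2^α < 2^θ, halving u multiplies the tail by at most 2^θ once u is large. Iterating from u
down to w gives the power of u/w; the additional factor 2^θ pays for the last, incomplete halving.
-/
theorem exists_potter_bound (hν : HeavyTailed α ν) {θ : ℝ} (hθ : α < θ) (hα : 0 < α) :
    ∃ u₀ > 0, ∀ w u : ℝ, u₀ ≤ w → w ≤ u → tail ν w ≤ 2 ^ θ * (u / w) ^ θ * tail ν u := by
  have hr := tail_ratio hν (c := 1 / 2) (by norm_num)
  have hlt : ((1 : ℝ) / 2) ^ (-α) < 2 ^ θ := by
    rw [one_div, Real.inv_rpow (by norm_num), Real.rpow_neg (by norm_num), inv_inv]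
    exact Real.rpow_lt_rpow_of_exponent_lt (by norm_num) hθ
  obtain ⟨u₀, hu₀⟩ := eventually_atTop.1 ((hr.eventually (Iio_mem_nhds hlt)).and
    (eventually_gt_atTop 0))
  refine ⟨u₀, (hu₀ u₀ le_rfl).2, fun w u hw hwu => ?_⟩
  have hw0 : 0 < w := (hu₀ u₀ le_rfl).2.trans_le hw
  have hhalf : ∀ u, u₀ ≤ u → tail ν (u / 2) ≤ 2 ^ θ * tail ν u := by
    intro u hu
    have h1 := (hu₀ u hu).1
    have h2 := tail_pos hν u
    rw [div_lt_iff₀ h2] at h1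
    rw [show u / 2 = 1 / 2 * u by ring]
    exact h1.le
  have key : ∀ n : ℕ, ∀ u, w ≤ u → u ≤ 2 ^ n * w →
      tail ν w ≤ 2 ^ θ * (u / w) ^ θ * tail ν u := by
    intro n
    induction n with
    | zero =>
      intro u h1 h2
      have : u = w := le_antisymm (by simpa using h2) h1
      subst this
      rw [div_self hw0.ne', Real.one_rpow, mul_one]
      have := tail_nonneg (ν := ν) u
      have h3 : (1 : ℝ) ≤ 2 ^ θ := Real.one_le_rpow (by norm_num) (by linarith)
      nlinarith
    | succ n ih =>
      intro u h1 h2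
      have hu0 : 0 < u := hw0.trans_le h1
      rcases le_total u (2 * w) with h | h
      · have h3 : tail ν w ≤ tail ν (u / 2) := tail_antitone (by linarith)
        have h4 := hhalf u (hw.trans h1)
        have h5 : 1 ≤ (u / w) ^ θ :=
          Real.one_le_rpow ((one_le_div hw0).2 h1) (by linarith)
        have h6 : 0 ≤ 2 ^ θ * tail ν u := by have := tail_nonneg (ν := ν) u; positivity
        nlinarith
      · have h3 := ih (u / 2) (by linarith) (by rw [pow_succ] at h2; linarith)
        have h4 := hhalf u (hw.trans h1)
        have e : (u / 2 / w) ^ θ * 2 ^ θ = (u / w) ^ θ := by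
          rw [← Real.mul_rpow (by positivity) (by norm_num)]
          congr 1
          field_simp
        calc tail ν w ≤ _ := h3
          _ ≤ 2 ^ θ * (u / 2 / w) ^ θ * (2 ^ θ * tail ν u) := by gcongr
          _ = 2 ^ θ * ((u / 2 / w) ^ θ * 2 ^ θ) * tail ν u := by ring
          _ = _ := by rw [e]
  obtain ⟨n, hn⟩ := pow_unbounded_of_one_lt (u / w) (by norm_num : (1 : ℝ) < 2)
  exact key n u hwu (by rw [div_lt_iff₀ hw0] at hn; exact hn.le)

/-- If v a_N is above the threshold u₀ the Potter bound applies between v a_N and a_N. Otherwise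
a_N/u₀ ≤ 1/v, the tail is bounded by 1, and the Potter bound from u₀ to a_N controls N itself. -/
theorem exists_mul_tail_le (hν : HeavyTailed α ν) (hα : 0 < α) {θ : ℝ} (hθ : α < θ) :
    ∃ C, 0 < C ∧ ∀ᶠ N : ℕ in atTop, ∀ v, 0 < v → v ≤ 1 →
      (N : ℝ) * tail ν (v * scale ν N) ≤ C * v ^ (-θ) := by
  obtain ⟨u₀, hu₀, hP⟩ := exists_potter_bound hν hθ hα
  have hG := tail_pos hν u₀
  refine ⟨2 * 2 ^ θ / tail ν u₀, by positivity, ?_⟩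
  have h1 := (mul_tail_scale_tendsto_one hν).eventually (Iio_mem_nhds (by norm_num : (1 : ℝ) < 2))
  filter_upwards [h1, (scale_tendsto_atTop hν).eventually_ge_atTop u₀] with N hN ha v hv hv1
  set a := scale ν N with hadef
  have ha0 : 0 < a := hu₀.trans_le ha
  have hN2 : (N : ℝ) * tail ν a ≤ 2 := le_of_lt hN
  have hN0 : (0 : ℝ) ≤ N := N.cast_nonneg
  have hθ0 : 0 ≤ θ := by linarith
  rcases le_total u₀ (v * a) with h | h
  · have h2 := hP (v * a) a h (by nlinarith)
    have e : (a / (v * a)) ^ θ = v ^ (-θ) := by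
      rw [Real.rpow_neg hv.le, ← Real.inv_rpow hv.le]
      congr 1
      field_simp
    rw [e] at h2
    calc (N : ℝ) * tail ν (v * a) ≤ N * (2 ^ θ * v ^ (-θ) * tail ν a) := by gcongr
      _ = 2 ^ θ * v ^ (-θ) * (N * tail ν a) := by ring
      _ ≤ 2 ^ θ * v ^ (-θ) * 2 := by gcongr
      _ = 2 * 2 ^ θ / 1 * v ^ (-θ) := by ring
      _ ≤ 2 * 2 ^ θ / tail ν u₀ * v ^ (-θ) := by
          gcongr
          exact tail_le_one _
  · have h2 := hP u₀ a le_rfl ha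
    have h3 : (a / u₀) ^ θ ≤ v ^ (-θ) := by
      rw [Real.rpow_neg hv.le, ← Real.inv_rpow hv.le]
      gcongr
      rw [div_le_iff₀ hu₀, inv_mul_eq_div, le_div_iff₀ hv]
      linarith
    calc (N : ℝ) * tail ν (v * a) ≤ N * 1 := by gcongr; exact tail_le_one _
      _ = N * tail ν u₀ / tail ν u₀ := by field_simp
      _ ≤ N * (2 ^ θ * (a / u₀) ^ θ * tail ν a) / tail ν u₀ := by gcongr
      _ = 2 ^ θ * (a / u₀) ^ θ * (N * tail ν a) / tail ν u₀ := by ring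
      _ ≤ 2 ^ θ * v ^ (-θ) * 2 / tail ν u₀ := by
          have : 0 ≤ (N : ℝ) * tail ν a := mul_nonneg hN0 (tail_nonneg _)
          gcongr
      _ = _ := by ring

end Tail

/-! ### Truncated moments of regularly varying laws -/

section Moments

set_option linter.unusedSectionVars false

variable {α : ℝ} {ν : Measure ℝ} [IsProbabilityMeasure ν]

theorem measurableSet_le_abs (u : ℝ) : MeasurableSet {t : ℝ | u ≤ |t|} :=
  measurableSet_le measurable_const measurable_id.abs

/-- Layer cake formula: v ≤ (t/a)² means √v a ≤ |t|, so Fubini turns the inner integral into an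
integral against the tail. -/
theorem integral_integral_min_eq (ν : Measure ℝ) [IsProbabilityMeasure ν] {φ : ℝ → ℂ}
    (hφ : Continuous φ) {a B : ℝ} (ha : 0 < a) :
    ∫ t, (∫ v in Ioc 0 (min ((t / a) ^ 2) B), φ v) ∂ν =
      ∫ v in Ioc 0 B, φ v * (tail ν (√v * a) : ℂ) := by
  have hset : MeasurableSet {q : ℝ × ℝ | q.2 ≤ (q.1 / a) ^ 2} :=
    measurableSet_le (by fun_prop) (by fun_prop)
  have h1 : ∀ t : ℝ, ∫ v in Ioc 0 (min ((t / a) ^ 2) B), φ v =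
      ∫ v in Ioc 0 B, {q : ℝ × ℝ | q.2 ≤ (q.1 / a) ^ 2}.indicator (fun q => φ q.2) (t, v) := by
    intro t
    have : Ioc 0 (min ((t / a) ^ 2) B) = Ioc 0 B ∩ Iic ((t / a) ^ 2) := by
      rw [Ioc_inter_Iic, min_comm]
    rw [this, ← setIntegral_indicator measurableSet_Iic]
    rfl
  simp only [h1]
  rw [integral_integral_swap]
  · refine setIntegral_congr_fun measurableSet_Ioc fun v hv => ?_
    have hv0 : 0 < v := hv.1
    have h2 : ∀ t : ℝ, {q : ℝ × ℝ | q.2 ≤ (q.1 / a) ^ 2}.indicator (fun q => φ q.2) (t, v) =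
        {t : ℝ | √v * a ≤ |t|}.indicator (fun _ => φ v) t := by
      intro t
      have : v ≤ (t / a) ^ 2 ↔ √v * a ≤ |t| := by
        rw [← le_div_iff₀ ha, ← abs_of_pos ha, ← abs_div, abs_of_pos ha,
          Real.sqrt_le_left (abs_nonneg _), sq_abs]
      by_cases h : v ≤ (t / a) ^ 2
      · rw [indicator_of_mem (show (t, v) ∈ {q : ℝ × ℝ | q.2 ≤ (q.1 / a) ^ 2} from h),
          indicator_of_mem (show t ∈ {t : ℝ | √v * a ≤ |t|} from this.1 h)]
      · rw [indicator_of_notMem (show (t, v) ∉ {q : ℝ × ℝ | q.2 ≤ (q.1 / a) ^ 2} from h),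
          indicator_of_notMem (show t ∉ {t : ℝ | √v * a ≤ |t|} from fun h' => h (this.2 h'))]
    simp only [h2]
    rw [integral_indicator_const _ (measurableSet_le_abs _),
      Complex.real_smul, mul_comm]
    rfl
  · obtain ⟨M, hM⟩ := (isCompact_Icc (a := (0 : ℝ)) (b := B)).exists_bound_of_continuousOn
      hφ.continuousOn
    have : IsFiniteMeasure (volume.restrict (Ioc (0 : ℝ) B)) := ⟨by simp⟩
    refine Integrable.of_bound (C := M) ?_ ?_
    · exact ((hφ.measurable.comp measurable_snd).indicator hset).aestronglyMeasurable
    · have hae : ∀ᵐ q ∂ν.prod (volume.restrict (Ioc (0 : ℝ) B)), q.2 ∈ Ioc 0 B :=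
        Measure.quasiMeasurePreserving_snd.ae (ae_restrict_mem measurableSet_Ioc)
      filter_upwards [hae] with q hq
      exact (norm_indicator_le_norm_self (fun q : ℝ × ℝ => φ q.2) q).trans
        (hM q.2 ⟨hq.1.le, hq.2⟩)

/-- `N ν(x² ≥ v a_N²)`. -/
def wtail (ν : Measure ℝ) (N : ℕ) (v : ℝ) : ℝ := N * tail ν (√v * scale ν N)

theorem wtail_nonneg (N : ℕ) (v : ℝ) : 0 ≤ wtail ν N v :=
  mul_nonneg N.cast_nonneg measureReal_nonneg

theorem wtail_tendsto (hν : HeavyTailed α ν) {v : ℝ} (hv : 0 < v) :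
    Tendsto (fun N => wtail ν N v) atTop (𝓝 (v ^ (-(α / 2)))) := by
  have h := mul_tail_tendsto hν (Real.sqrt_pos.2 hv)
  rw [Real.sqrt_eq_rpow, ← Real.rpow_mul hv.le] at h
  rw [show -(α / 2) = 1 / 2 * -α by ring]
  simpa only [wtail, Real.sqrt_eq_rpow] using h

theorem exists_wtail_le (hν : HeavyTailed α ν) (hα : 0 < α) (hα2 : α < 2) :
    ∃ C κ : ℝ, 0 < C ∧ 0 < κ ∧ κ < 1 ∧ ∀ᶠ N : ℕ in atTop, 0 < scale ν N ∧ ∀ v, 0 < v →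
      wtail ν N v ≤ C * (v ^ (-κ) + 1) := by
  -- θ is the midpoint of α and 2. Passing to squares halves the exponent, so κ = θ/2 < 1 and v^{-κ}
  -- is integrable at 0. The summand 1 in the bound takes care of v ≥ 1, by monotonicity.
  obtain ⟨C, hC, h⟩ := exists_mul_tail_le hν hα (θ := (α + 2) / 2) (by linarith)
  refine ⟨C, (α + 2) / 4, hC, by linarith, by linarith, ?_⟩
  filter_upwards [h, (scale_tendsto_atTop hν).eventually_gt_atTop 0] with N hN ha
  refine ⟨ha, fun v hv => ?_⟩
  rcases le_total v 1 with h1 | h1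
  · have h2 := hN (√v) (Real.sqrt_pos.2 hv) (Real.sqrt_le_one.2 h1)
    rw [Real.sqrt_eq_rpow, ← Real.rpow_mul hv.le, ← Real.sqrt_eq_rpow,
      show 1 / 2 * -((α + 2) / 2) = -((α + 2) / 4) by ring] at h2
    refine h2.trans ?_
    gcongr
    linarith
  · have h2 := hN 1 one_pos le_rfl
    rw [Real.one_rpow, mul_one] at h2
    have h3 : wtail ν N v ≤ N * tail ν (1 * scale ν N) := by
      rw [wtail]
      gcongr
      refine tail_antitone ?_
      gcongr
      exact Real.one_le_sqrt.2 h1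
    have h4 : 0 < v ^ (-((α + 2) / 4)) := by positivity
    nlinarith

theorem integral_min_eq {a B : ℝ} (ha : 0 < a) (hB : 0 ≤ B) :
    ∫ t, min ((t / a) ^ 2) B ∂ν = ∫ v in Ioc 0 B, tail ν (√v * a) := by
  have h := integral_integral_min_eq ν (φ := fun _ => 1) continuous_const (B := B) ha
  have h1 : ∀ t : ℝ, ∫ _ in Ioc 0 (min ((t / a) ^ 2) B), (1 : ℂ) =
      ((min ((t / a) ^ 2) B : ℝ) : ℂ) := by
    intro t
    have : 0 ≤ min ((t / a) ^ 2) B := le_min (by positivity) hB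
    simp [this]
  simp only [h1, one_mul] at h
  rw [integral_complex_ofReal, integral_complex_ofReal] at h
  exact_mod_cast h

theorem integrable_tail_sqrt (ν : Measure ℝ) [IsProbabilityMeasure ν] (a B : ℝ) :
    IntegrableOn (fun v => tail ν (√v * a)) (Ioc 0 B) := by
  have : IsFiniteMeasure (volume.restrict (Ioc (0 : ℝ) B)) := ⟨by simp⟩
  refine Integrable.of_bound (C := 1) ?_ (Eventually.of_forall fun v => ?_)
  · exact ((tail_antitone (ν := ν)).measurable.comp (by fun_prop)).aestronglyMeasurable
  · rw [Real.norm_of_nonneg (tail_nonneg _)]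
    exact tail_le_one _

theorem integrableOn_rpow_neg {κ : ℝ} (hκ : κ < 1) (B : ℝ) :
    IntegrableOn (fun v : ℝ => v ^ (-κ)) (Ioc 0 B) := by
  rcases le_total 0 B with hB | hB
  · exact (intervalIntegrable_iff_integrableOn_Ioc_of_le hB).1
      (intervalIntegral.intervalIntegrable_rpow' (by linarith))
  · simp [Ioc_eq_empty (not_lt.2 hB)]

/-- The small entries carry little of the truncated second moment, uniformly in N: by the layer cake
formula the quantity is ∫₀^δ of N times the tail, which is dominated by an integrable function. -/
theorem exists_integral_min_le (hν : HeavyTailed α ν) (hα : 0 < α) (hα2 : α < 2) :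
    ∃ m : ℝ → ℝ, Tendsto m (𝓝[>] 0) (𝓝 0) ∧ (∀ δ > 0, 0 ≤ m δ) ∧
      ∀ᶠ N : ℕ in atTop, ∀ δ > 0, N * ∫ t, min ((t / scale ν N) ^ 2) δ ∂ν ≤ m δ := by
  obtain ⟨C, κ, hC, hκ0, hκ1, h⟩ := exists_wtail_le hν hα hα2
  refine ⟨fun δ => C * (δ ^ (1 - κ) / (1 - κ) + δ), ?_, ?_, ?_⟩
  · have h1 : Tendsto (fun δ : ℝ => C * (δ ^ (1 - κ) / (1 - κ) + δ)) (𝓝 0)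
        (𝓝 (C * ((0 : ℝ) ^ (1 - κ) / (1 - κ) + 0))) := by
      refine Continuous.tendsto ?_ 0
      have : Continuous fun δ : ℝ => δ ^ (1 - κ) :=
        Real.continuous_rpow_const (by linarith)
      fun_prop
    rw [Real.zero_rpow (by linarith), zero_div, add_zero, mul_zero] at h1
    exact h1.mono_left nhdsWithin_le_nhds
  · intro δ hδ
    have : 0 < 1 - κ := by linarith
    positivity
  · filter_upwards [h] with N hN δ hδ
    rw [integral_min_eq hN.1 hδ.le, ← integral_const_mul]
    have hi : IntegrableOn (fun v : ℝ => C * (v ^ (-κ) + 1)) (Ioc 0 δ) :=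
      ((integrableOn_rpow_neg hκ1 δ).add (by simp)).const_mul C
    calc ∫ v in Ioc 0 δ, N * tail ν (√v * scale ν N)
        ≤ ∫ v in Ioc 0 δ, C * (v ^ (-κ) + 1) := by
          refine setIntegral_mono_on ((integrable_tail_sqrt ν _ δ).const_mul _) hi
            measurableSet_Ioc fun v hv => hN.2 v hv.1
      _ = C * (δ ^ (1 - κ) / (1 - κ) + δ) := by
          rw [integral_const_mul, integral_add (integrableOn_rpow_neg hκ1 δ) (by simp),
            ← intervalIntegral.integral_of_le hδ.le, integral_rpow (Or.inl (by linarith)),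
            Real.zero_rpow (by linarith)]
          simp [hδ.le]
          left
          ring_nf

theorem integrable_min_sq (a : ℝ) {δ : ℝ} (hδ : 0 ≤ δ) :
    Integrable (fun t => min ((t / a) ^ 2) δ) ν := by
  refine Integrable.of_bound (C := δ) (by fun_prop) (Eventually.of_forall fun t => ?_)
  rw [Real.norm_of_nonneg (le_min (by positivity) hδ)]
  exact min_le_right _ _

/-- `(x/a) 1_{|x| < B a}`. -/
def trunc (a B t : ℝ) : ℝ := if |t| < B * a then t / a else 0

theorem measurable_trunc (a B : ℝ) : Measurable (trunc a B) :=
  Measurable.ite (measurableSet_lt measurable_id.abs measurable_const) (by fun_prop)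
    measurable_const

theorem abs_trunc_le {a B : ℝ} (ha : 0 < a) (hB : 0 ≤ B) (t : ℝ) : |trunc a B t| ≤ B := by
  rw [trunc]
  split_ifs with h
  · rw [abs_div, abs_of_pos ha, div_le_iff₀ ha]
    exact h.le
  · simpa using hB

theorem trunc_sq_le {a B : ℝ} (ha : 0 < a) (hB : 0 ≤ B) (t : ℝ) :
    trunc a B t ^ 2 ≤ min ((t / a) ^ 2) (B ^ 2) := by
  refine le_min ?_ ?_
  · rw [trunc]
    split_ifs
    · exact le_rfl
    · rw [zero_pow two_ne_zero]; positivity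
  · rw [← sq_abs]
    exact pow_le_pow_left₀ (abs_nonneg _) (abs_trunc_le ha hB t) 2

theorem integrable_trunc {a B : ℝ} (ha : 0 < a) (hB : 0 ≤ B) : Integrable (trunc a B) ν :=
  Integrable.of_bound (C := B) (measurable_trunc a B).aestronglyMeasurable
    (Eventually.of_forall fun t => abs_trunc_le ha hB t)

theorem integrable_trunc_sq {a B : ℝ} (ha : 0 < a) (hB : 0 ≤ B) :
    Integrable (fun t => trunc a B t ^ 2) ν :=
  Integrable.of_bound (C := B ^ 2) ((measurable_trunc a B).pow_const 2).aestronglyMeasurable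
    (Eventually.of_forall fun t => by
      rw [Real.norm_of_nonneg (by positivity), ← sq_abs]
      exact pow_le_pow_left₀ (abs_nonneg _) (abs_trunc_le ha hB t) 2)

theorem integral_trunc_sq_le {a B : ℝ} (ha : 0 < a) (hB : 0 ≤ B) :
    ∫ t, trunc a B t ^ 2 ∂ν ≤ ∫ t, min ((t / a) ^ 2) (B ^ 2) ∂ν :=
  integral_mono (integrable_trunc_sq ha hB) (integrable_min_sq a (by positivity))
    fun t => trunc_sq_le ha hB t

theorem integral_indicator_tail (u : ℝ) :
    ∫ t, ({t | u ≤ |t|} : Set ℝ).indicator (fun _ => (1 : ℝ)) t ∂ν = tail ν u := by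
  rw [integral_indicator_const _ (measurableSet_le_abs _), smul_eq_mul,
    mul_one, tail]

theorem integrable_indicator_tail (u : ℝ) :
    Integrable (({t | u ≤ |t|} : Set ℝ).indicator (fun _ => (1 : ℝ))) ν :=
  (integrable_const 1).indicator (measurableSet_le_abs _)

/-- The entries are not centred, so the truncated mean has to be shown to be o(N^{-1/2}). Below
level √δ the square of the mean is at most the truncated second moment, of order m(δ)/N; above it
the mean is at most B times a tail, hence O(1/N). -/
theorem mul_sq_integral_trunc_tendsto (hν : HeavyTailed α ν) (hα : 0 < α) (hα2 : α < 2) {B : ℝ}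
    (hB : 0 < B) :
    Tendsto (fun N : ℕ => (N : ℝ) * (∫ t, trunc (scale ν N) B t ∂ν) ^ 2) atTop (𝓝 0) := by
  obtain ⟨m, hm, hm0, h⟩ := exists_integral_min_le hν hα hα2
  rw [Metric.tendsto_atTop']
  intro ε hε
  obtain ⟨δ, hδε, hδ⟩ : ∃ δ, m δ < ε / 4 ∧ 0 < δ :=
    ((hm.eventually (Iio_mem_nhds (by positivity : (0 : ℝ) < ε / 4))).and
      self_mem_nhdsWithin).exists
  have h1 : Tendsto (fun N : ℕ => 2 * B ^ 2 * wtail ν N δ ^ 2 * (N : ℝ)⁻¹) atTop (𝓝 0) := by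
    have := (((wtail_tendsto hν hδ).pow 2).const_mul (2 * B ^ 2)).mul
      (tendsto_inv_atTop_nhds_zero_nat (𝕜 := ℝ))
    simpa using this
  obtain ⟨n, hn⟩ := eventually_atTop.1 ((h1.eventually (Iio_mem_nhds
    (by positivity : (0 : ℝ) < ε / 2))).and (h.and
    (((scale_tendsto_atTop hν).eventually_gt_atTop 0).and (eventually_ge_atTop 1))))
  refine ⟨n, fun N hN => ?_⟩
  obtain ⟨e1, e2, e3, e4⟩ := hn N (le_of_lt hN)
  set a := scale ν N with ha
  have hN0 : (0 : ℝ) < N := by positivity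
  have hpt : ∀ t, |trunc a B t| ≤ √(min ((t / a) ^ 2) δ) +
      B * ({t | √δ * a ≤ |t|} : Set ℝ).indicator (fun _ => (1 : ℝ)) t := by
    intro t
    by_cases ht : √δ * a ≤ |t|
    · rw [indicator_of_mem (show t ∈ {t | √δ * a ≤ |t|} from ht), mul_one]
      have := abs_trunc_le e3 hB.le t
      have := Real.sqrt_nonneg (min ((t / a) ^ 2) δ)
      linarith
    · rw [indicator_of_notMem (show t ∉ {t | √δ * a ≤ |t|} from ht), mul_zero, add_zero]
      have ht : (t / a) ^ 2 < δ := by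
        rw [not_le, ← div_lt_iff₀ e3, Real.lt_sqrt (by positivity), div_pow, sq_abs,
          ← div_pow] at ht
        exact ht
      rw [min_eq_left ht.le, Real.sqrt_sq_eq_abs, trunc]
      split_ifs
      · exact le_rfl
      · simp
  have hmin0 : ∀ t, 0 ≤ min ((t / a) ^ 2) δ := fun t => le_min (by positivity) hδ.le
  have hi1 : Integrable (fun t => √(min ((t / a) ^ 2) δ)) ν := by
    refine Integrable.of_bound (C := √δ) (by fun_prop) (Eventually.of_forall fun t => ?_)
    rw [Real.norm_of_nonneg (Real.sqrt_nonneg _)]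
    exact Real.sqrt_le_sqrt (min_le_right _ _)
  have hi2 := (integrable_indicator_tail (ν := ν) (√δ * a)).const_mul B
  have h2 : |∫ t, trunc a B t ∂ν| ≤ ∫ t, √(min ((t / a) ^ 2) δ) ∂ν + B * tail ν (√δ * a) := by
    refine (abs_integral_le_integral_abs).trans ?_
    rw [← integral_indicator_tail, ← integral_const_mul, ← integral_add hi1 hi2]
    exact integral_mono (integrable_trunc e3 hB.le).abs (hi1.add hi2) hpt
  have h3 : (∫ t, √(min ((t / a) ^ 2) δ) ∂ν) ^ 2 ≤ ∫ t, min ((t / a) ^ 2) δ ∂ν := by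
    have hs : ∀ t, √(min ((t / a) ^ 2) δ) ^ 2 = min ((t / a) ^ 2) δ := fun t =>
      Real.sq_sqrt (hmin0 t)
    have := sq_integral_le hi1 (by simpa only [hs] using integrable_min_sq a hδ.le)
    simpa only [hs] using this
  have h4 : (∫ t, trunc a B t ∂ν) ^ 2 ≤
      2 * ∫ t, min ((t / a) ^ 2) δ ∂ν + 2 * (B * tail ν (√δ * a)) ^ 2 := by
    rw [← sq_abs]
    refine (pow_le_pow_left₀ (abs_nonneg _) h2 2).trans (add_sq_le.trans ?_)
    linarith
  have h5 : (N : ℝ) * (∫ t, trunc a B t ∂ν) ^ 2 < ε := by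
    calc (N : ℝ) * (∫ t, trunc a B t ∂ν) ^ 2
        ≤ N * (2 * ∫ t, min ((t / a) ^ 2) δ ∂ν + 2 * (B * tail ν (√δ * a)) ^ 2) := by gcongr
      _ = 2 * (N * ∫ t, min ((t / a) ^ 2) δ ∂ν) + 2 * B ^ 2 * wtail ν N δ ^ 2 * (N : ℝ)⁻¹ := by
          rw [wtail, ← ha]
          generalize ∫ t, min ((t / a) ^ 2) δ ∂ν = x
          field_simp
      _ < 2 * m δ + ε / 2 := add_lt_add_of_le_of_lt (by linarith [e2 δ hδ]) e1
      _ < ε := by linarith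
  rw [Real.dist_eq, sub_zero, abs_of_nonneg (by positivity)]
  exact h5

/-- This disposes of the single heavy tailed entry on the diagonal, which is divided by a_N → ∞. -/
theorem integral_min_one_tendsto (hν : HeavyTailed α ν) {K : ℝ} (hK : 0 ≤ K) :
    Tendsto (fun N : ℕ => ∫ t, min 1 (K * |t| / scale ν N) ∂ν) atTop (𝓝 0) := by
  have h0 : Tendsto (fun N : ℕ => ∫ t, min 1 (K * |t| / scale ν N) ∂ν) atTop
      (𝓝 (∫ _, (0 : ℝ) ∂ν)) := by
    refine tendsto_integral_filter_of_dominated_convergence (fun _ => 1)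
      (Eventually.of_forall fun N => by fun_prop) ?_ (integrable_const _)
      (Eventually.of_forall fun t => ?_)
    · filter_upwards [(scale_tendsto_atTop hν).eventually_gt_atTop 0] with N hN
      refine Eventually.of_forall fun t => ?_
      rw [Real.norm_of_nonneg (le_min zero_le_one (by positivity))]
      exact min_le_left _ _
    · have h1 : Tendsto (fun N => K * |t| / scale ν N) atTop (𝓝 0) :=
        Tendsto.const_div_atTop (scale_tendsto_atTop hν) _
      have := (tendsto_const_nhds (x := (1 : ℝ))).min h1
      simpa using this
  simpa using h0

end Moments

/-! ### Laplace transforms of regularly varying laws -/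

section LaplaceAsymptotics

theorem integral_Ioc_mul_exp (p : ℂ) {m : ℝ} (hm : 0 ≤ m) :
    ∫ v in Ioc 0 m, p * Complex.exp (-(v : ℂ) * p) = 1 - Complex.exp (-(m : ℂ) * p) := by
  rw [← intervalIntegral.integral_of_le hm]
  have hd : ∀ v ∈ uIcc 0 m, HasDerivAt (fun v : ℝ => -Complex.exp (-(v : ℂ) * p))
      (p * Complex.exp (-(v : ℂ) * p)) v := by
    intro v _
    have h1 : HasDerivAt (fun v : ℝ => -(v : ℂ) * p) (-1 * p) v :=
      (Complex.ofRealCLM.hasDerivAt (x := v)).neg.mul_const p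
    convert! h1.cexp.neg using 1
    ring
  rw [intervalIntegral.integral_eq_sub_of_hasDerivAt hd]
  · simp
    ring
  · exact Continuous.intervalIntegrable (by fun_prop) _ _

theorem cpow_eq_mul_inv_cpow (γ : ℝ) {p : ℂ} (hp : 0 < p.re) :
    p * p⁻¹ ^ ((1 - γ : ℝ) : ℂ) = p ^ (γ : ℂ) := by
  have hp0 : p ≠ 0 := by rintro rfl; simp at hp
  have harg : p.arg ≠ Real.pi := by
    have := Complex.abs_arg_lt_pi_div_two_iff.2 (Or.inl hp)
    have h2 := (abs_lt.1 this).2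
    have := Real.pi_pos
    intro h
    linarith
  rw [Complex.inv_cpow _ _ harg]
  push_cast
  rw [Complex.cpow_sub _ _ hp0, Complex.cpow_one]
  field_simp

/-- Integration by parts removes the factor p. The boundary term and the remaining integral of γ
v^{-γ-1} are each at most B^{-γ}, so the bound is uniform even when Re p is close to 0. -/
theorem norm_integral_Ioi_le {γ : ℝ} (hγ0 : 0 < γ) (hγ1 : γ < 1) {p : ℂ} (hp : 0 < p.re) {B : ℝ}
    (hB : 0 < B) :
    ‖∫ v in Ioi B, p * Complex.exp (-(v : ℂ) * p) * ((v ^ (-γ) : ℝ) : ℂ)‖ ≤ 2 * B ^ (-γ) := by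
  have hnorm : ∀ v : ℝ, ‖Complex.exp (-(v : ℂ) * p)‖ = Real.exp (-p.re * v) := by
    intro v
    rw [Complex.norm_exp]
    congr 1
    simp
    ring
  have hle1 : ∀ v : ℝ, 0 ≤ v → ‖Complex.exp (-(v : ℂ) * p)‖ ≤ 1 := by
    intro v hv
    rw [hnorm, Real.exp_le_one_iff]
    have : 0 ≤ p.re * v := by positivity
    linarith
  have hi1 : IntegrableOn (fun v : ℝ => p * Complex.exp (-(v : ℂ) * p) * ((v ^ (-γ) : ℝ) : ℂ))
      (Ioi B) := by
    have h := (integrableOn_laplace_integrand (β := 1 - γ) (γ := 1) (by linarith) hp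
      (Y := 0) le_rfl).mono_set (Ioi_subset_Ioi hB.le)
    refine (h.const_mul p).congr (Eventually.of_forall fun v => ?_)
    simp
    ring
  have hi2' : IntegrableOn (fun v : ℝ => γ * v ^ (-γ - 1)) (Ioi B) :=
    (integrableOn_Ioi_rpow_of_lt (by linarith) hB).const_mul γ
  have hbound : ∀ v ∈ Ioi B, ‖Complex.exp (-(v : ℂ) * p) * ((-γ * v ^ (-γ - 1) : ℝ) : ℂ)‖ ≤
      γ * v ^ (-γ - 1) := by
    intro v hv
    have hv0 : 0 < v := hB.trans hv
    rw [norm_mul, Complex.norm_real, norm_mul, norm_neg, Real.norm_of_nonneg hγ0.le,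
      Real.norm_of_nonneg (by positivity)]
    exact mul_le_of_le_one_left (by positivity) (hle1 v hv0.le)
  have hi2 : IntegrableOn (fun v : ℝ => Complex.exp (-(v : ℂ) * p) *
      ((-γ * v ^ (-γ - 1) : ℝ) : ℂ)) (Ioi B) := by
    refine hi2'.mono' (by fun_prop) ?_
    filter_upwards [ae_restrict_mem measurableSet_Ioi] with v hv using hbound v hv
  have key := integral_Ioi_of_hasDerivAt_of_tendsto' (a := B) (m := 0)
    (f := fun v : ℝ => Complex.exp (-(v : ℂ) * p) * ((v ^ (-γ) : ℝ) : ℂ))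
    (f' := fun v : ℝ => -(p * Complex.exp (-(v : ℂ) * p) * ((v ^ (-γ) : ℝ) : ℂ)) +
      Complex.exp (-(v : ℂ) * p) * ((-γ * v ^ (-γ - 1) : ℝ) : ℂ)) ?_ (hi1.neg.add hi2) ?_
  · have e1 : ∫ v in Ioi B, (-(p * Complex.exp (-(v : ℂ) * p) * ((v ^ (-γ) : ℝ) : ℂ)) +
        Complex.exp (-(v : ℂ) * p) * ((-γ * v ^ (-γ - 1) : ℝ) : ℂ)) =
        -(∫ v in Ioi B, p * Complex.exp (-(v : ℂ) * p) * ((v ^ (-γ) : ℝ) : ℂ)) +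
        ∫ v in Ioi B, Complex.exp (-(v : ℂ) * p) * ((-γ * v ^ (-γ - 1) : ℝ) : ℂ) := by
      have hi1' : IntegrableOn (fun v : ℝ => -(p * Complex.exp (-(v : ℂ) * p) *
          ((v ^ (-γ) : ℝ) : ℂ))) (Ioi B) := hi1.neg
      rw [integral_add hi1' hi2, integral_neg]
    rw [e1, zero_sub, neg_add_eq_iff_eq_add, ← sub_eq_iff_eq_add, sub_neg_eq_add] at key
    rw [← key]
    refine (norm_add_le _ _).trans ?_
    have e2 : ‖∫ v in Ioi B, Complex.exp (-(v : ℂ) * p) * ((-γ * v ^ (-γ - 1) : ℝ) : ℂ)‖ ≤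
        B ^ (-γ) := by
      refine (norm_integral_le_of_norm_le hi2' ?_).trans (le_of_eq ?_)
      · filter_upwards [ae_restrict_mem measurableSet_Ioi] with v hv using hbound v hv
      · rw [integral_const_mul, integral_Ioi_rpow_of_lt (by linarith) hB]
        rw [sub_add_cancel]
        field_simp
    have e3 : ‖Complex.exp (-(B : ℂ) * p) * ((B ^ (-γ) : ℝ) : ℂ)‖ ≤ B ^ (-γ) := by
      rw [norm_mul, Complex.norm_real, Real.norm_of_nonneg (by positivity)]
      exact mul_le_of_le_one_left (by positivity) (hle1 B hB.le)
    linarith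
  · intro v hv
    have hv0 : 0 < v := hB.trans_le hv
    have h1 : HasDerivAt (fun v : ℝ => -(v : ℂ) * p) (-1 * p) v :=
      (Complex.ofRealCLM.hasDerivAt (x := v)).neg.mul_const p
    have h2 : HasDerivAt (fun v : ℝ => ((v ^ (-γ) : ℝ) : ℂ)) ((-γ * v ^ (-γ - 1) : ℝ) : ℂ) v :=
      (Real.hasDerivAt_rpow_const (Or.inl hv0.ne')).ofReal_comp
    convert! h1.cexp.mul h2 using 1
    ring
  · rw [tendsto_zero_iff_norm_tendsto_zero]
    have h0 := tendsto_rpow_neg_atTop hγ0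
    refine squeeze_zero' (Eventually.of_forall fun _ => norm_nonneg _) ?_ h0
    filter_upwards [eventually_ge_atTop 0] with v hv
    rw [norm_mul, Complex.norm_real, Real.norm_of_nonneg (by positivity)]
    exact mul_le_of_le_one_left (by positivity) (hle1 v hv)

/-- The integral over the whole half line equals Γ(1-γ) p^γ, so the error is the tail integral
beyond B. -/
theorem norm_integral_Ioc_sub_le {γ : ℝ} (hγ0 : 0 < γ) (hγ1 : γ < 1) {p : ℂ} (hp : 0 < p.re)
    {B : ℝ} (hB : 0 < B) :
    ‖(∫ v in Ioc 0 B, p * Complex.exp (-(v : ℂ) * p) * ((v ^ (-γ) : ℝ) : ℂ)) -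
      Real.Gamma (1 - γ) * p ^ (γ : ℂ)‖ ≤ 2 * B ^ (-γ) := by
  have h1 : ∫ v in Ioi (0 : ℝ), p * Complex.exp (-(v : ℂ) * p) * ((v ^ (-γ) : ℝ) : ℂ) =
      Real.Gamma (1 - γ) * p ^ (γ : ℂ) := by
    rw [← cpow_eq_mul_inv_cpow γ hp, mul_comm, mul_assoc,
      ← laplaceInt_zero_right 1 (by linarith : 0 < 1 - γ) hp, laplaceInt, ← integral_const_mul]
    refine setIntegral_congr_fun measurableSet_Ioi fun v _ => ?_
    simp
    ring
  have hi : IntegrableOn (fun v : ℝ => p * Complex.exp (-(v : ℂ) * p) * ((v ^ (-γ) : ℝ) : ℂ))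
      (Ioi 0) := by
    refine ((integrableOn_laplace_integrand (β := 1 - γ) (γ := 1) (by linarith) hp
      (Y := 0) le_rfl).const_mul p).congr (Eventually.of_forall fun v => ?_)
    simp
    ring
  have h2 := norm_integral_Ioi_le hγ0 hγ1 hp hB
  rw [← h1, ← Ioc_union_Ioi_eq_Ioi hB.le, setIntegral_union (Ioc_disjoint_Ioi le_rfl)
    measurableSet_Ioi (hi.mono_set Ioc_subset_Ioi_self) (hi.mono_set (Ioi_subset_Ioi hB.le)),
    sub_add_cancel_left, norm_neg]
  exact h2

variable {α : ℝ} {ν : Measure ℝ} [IsProbabilityMeasure ν]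

theorem norm_exp_neg_ofReal_mul_le_one {u : ℝ} (hu : 0 ≤ u) {p : ℂ} (hp : 0 ≤ p.re) :
    ‖Complex.exp (-(u : ℂ) * p)‖ ≤ 1 := by
  rw [Complex.norm_exp, Real.exp_le_one_iff]
  have : 0 ≤ u * p.re := by positivity
  simpa using this

theorem integrable_exp_neg_mul {f : ℝ → ℝ} (hf : Measurable f) (hf0 : ∀ t, 0 ≤ f t) {p : ℂ}
    (hp : 0 ≤ p.re) : Integrable (fun t => Complex.exp (-(f t : ℂ) * p)) ν :=
  Integrable.of_bound (C := 1) (Measurable.aestronglyMeasurable (by fun_prop))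
    (Eventually.of_forall fun t => norm_exp_neg_ofReal_mul_le_one (hf0 t) hp)

theorem integral_abs_wtail_sub_tendsto (hν : HeavyTailed α ν) (hα : 0 < α) (hα2 : α < 2) (B : ℝ) :
    Tendsto (fun N => ∫ v in Ioc 0 B, |wtail ν N v - v ^ (-(α / 2))|) atTop (𝓝 0) := by
  obtain ⟨C, κ, hC, hκ0, hκ1, h⟩ := exists_wtail_le hν hα hα2
  have h0 : Tendsto (fun N => ∫ v in Ioc 0 B, |wtail ν N v - v ^ (-(α / 2))|) atTop
      (𝓝 (∫ v in Ioc 0 B, (0 : ℝ))) := by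
    refine tendsto_integral_filter_of_dominated_convergence
      (fun v => C * (v ^ (-κ) + 1) + v ^ (-(α / 2))) (Eventually.of_forall fun N => ?_) ?_ ?_ ?_
    · have : Measurable fun v => wtail ν N v :=
        ((tail_antitone (ν := ν)).measurable.comp (by fun_prop)).const_mul _
      exact Measurable.aestronglyMeasurable (by fun_prop)
    · filter_upwards [h] with N hN
      filter_upwards [ae_restrict_mem measurableSet_Ioc] with v hv
      rw [Real.norm_eq_abs, abs_abs]
      have h1 := hN.2 v hv.1
      have h2 := wtail_nonneg (ν := ν) N v
      have h3 : 0 < v ^ (-(α / 2)) := Real.rpow_pos_of_pos hv.1 _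
      rw [abs_le]
      have h4 : 0 < v ^ (-κ) := Real.rpow_pos_of_pos hv.1 _
      have h5 : 0 < C * (v ^ (-κ) + 1) := by positivity
      constructor <;> linarith
    · exact (((integrableOn_rpow_neg hκ1 B).add (by simp)).const_mul C).add
        (integrableOn_rpow_neg (by linarith) B)
    · filter_upwards [ae_restrict_mem measurableSet_Ioc] with v hv
      have := ((wtail_tendsto hν hv.1).sub_const (v ^ (-(α / 2)))).abs
      simpa using this
  simpa using h0

/-- The three terms are the cost of capping (x/a_N)² at B, of replacing the normalised tail by its
limit v^{-α/2} on (0, B], and of extending the integral beyond B. The value of p enters only through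
its norm, which gives uniformity on bounded sets. -/
theorem norm_laplace_sub_le (hα : 0 < α) (hα2 : α < 2) {N : ℕ} (ha : 0 < scale ν N)
    {B : ℝ} (hB : 0 < B) {p : ℂ} (hp : 0 < p.re) :
    ‖(N : ℂ) * (1 - ∫ t, Complex.exp (-((t / scale ν N) ^ 2 : ℝ) * p) ∂ν) -
      Real.Gamma (1 - α / 2) * p ^ ((α / 2 : ℝ) : ℂ)‖ ≤
      2 * wtail ν N B + ‖p‖ * (∫ v in Ioc 0 B, |wtail ν N v - v ^ (-(α / 2))|) +
        2 * B ^ (-(α / 2)) := by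
  set a := scale ν N with hadef
  have hmin0 : ∀ t : ℝ, 0 ≤ min ((t / a) ^ 2) B := fun t => le_min (by positivity) hB.le
  have hi1 : Integrable (fun t => Complex.exp (-((t / a) ^ 2 : ℝ) * p)) ν :=
    integrable_exp_neg_mul (f := fun t => (t / a) ^ 2) (by fun_prop) (fun t => by positivity) hp.le
  have hi2 : Integrable (fun t => Complex.exp (-(min ((t / a) ^ 2) B : ℝ) * p)) ν :=
    integrable_exp_neg_mul (f := fun t => min ((t / a) ^ 2) B) (by fun_prop) hmin0 hp.le
  have e1 : (N : ℂ) * (1 - ∫ t, Complex.exp (-(min ((t / a) ^ 2) B : ℝ) * p) ∂ν) =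
      ∫ v in Ioc 0 B, p * Complex.exp (-(v : ℂ) * p) * (wtail ν N v : ℂ) := by
    have h := integral_integral_min_eq ν (φ := fun v => p * Complex.exp (-(v : ℂ) * p))
      (by fun_prop) (B := B) ha
    simp only [fun t => integral_Ioc_mul_exp p (hmin0 t)] at h
    rw [integral_sub (integrable_const _) hi2] at h
    simp only [integral_const, probReal_univ, one_smul] at h
    rw [h, ← integral_const_mul]
    refine setIntegral_congr_fun measurableSet_Ioc fun v _ => ?_
    simp only [wtail]
    push_cast
    ring
  have e2 : ‖(N : ℂ) * ((∫ t, Complex.exp (-(min ((t / a) ^ 2) B : ℝ) * p) ∂ν) -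
      ∫ t, Complex.exp (-((t / a) ^ 2 : ℝ) * p) ∂ν)‖ ≤ 2 * wtail ν N B := by
    rw [← integral_sub hi2 hi1, norm_mul, Complex.norm_natCast, wtail]
    have : ‖∫ t, (Complex.exp (-(min ((t / a) ^ 2) B : ℝ) * p) -
        Complex.exp (-((t / a) ^ 2 : ℝ) * p)) ∂ν‖ ≤ 2 * tail ν (√B * a) := by
      rw [← integral_indicator_tail, ← integral_const_mul]
      refine norm_integral_le_of_norm_le
        ((integrable_indicator_tail (ν := ν) (√B * a)).const_mul 2) (Eventually.of_forall fun t => ?_)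
      by_cases ht : √B * a ≤ |t|
      · rw [indicator_of_mem (show t ∈ {t | √B * a ≤ |t|} from ht)]
        refine (norm_sub_le _ _).trans ?_
        have h1 := norm_exp_neg_ofReal_mul_le_one (hmin0 t) hp.le
        have h2 := norm_exp_neg_ofReal_mul_le_one (u := (t / a) ^ 2) (by positivity) hp.le
        linarith
      · rw [indicator_of_notMem (show t ∉ {t | √B * a ≤ |t|} from ht)]
        have ht : (t / a) ^ 2 < B := by
          rw [not_le, ← div_lt_iff₀ ha, Real.lt_sqrt (by positivity), div_pow, sq_abs,
            ← div_pow] at ht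
          exact ht
        rw [min_eq_left ht.le]
        simp
    calc _ ≤ (N : ℝ) * (2 * tail ν (√B * a)) := by gcongr
      _ = _ := by ring
  have hiw : IntegrableOn (fun v => wtail ν N v) (Ioc 0 B) :=
    (integrable_tail_sqrt ν _ B).const_mul _
  have hir : IntegrableOn (fun v : ℝ => v ^ (-(α / 2))) (Ioc 0 B) :=
    integrableOn_rpow_neg (by linarith) B
  have hbd : ∀ v ∈ Ioc 0 B, ‖p * Complex.exp (-(v : ℂ) * p)‖ ≤ ‖p‖ := fun v hv => by
    rw [norm_mul]
    exact mul_le_of_le_one_right (norm_nonneg _) (norm_exp_neg_ofReal_mul_le_one hv.1.le hp.le)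
  have him : ∀ {f : ℝ → ℝ}, IntegrableOn f (Ioc 0 B) →
      IntegrableOn (fun v : ℝ => p * Complex.exp (-(v : ℂ) * p) * (f v : ℂ)) (Ioc 0 B) := by
    intro f hf
    refine Integrable.bdd_mul (c := ‖p‖) hf.ofReal
      (Measurable.aestronglyMeasurable (by fun_prop)) ?_
    filter_upwards [ae_restrict_mem measurableSet_Ioc] with v hv using hbd v hv
  have e3 : ‖(∫ v in Ioc 0 B, p * Complex.exp (-(v : ℂ) * p) * (wtail ν N v : ℂ)) -
      ∫ v in Ioc 0 B, p * Complex.exp (-(v : ℂ) * p) * ((v ^ (-(α / 2)) : ℝ) : ℂ)‖ ≤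
      ‖p‖ * ∫ v in Ioc 0 B, |wtail ν N v - v ^ (-(α / 2))| := by
    rw [← integral_sub (him hiw) (him hir), ← integral_const_mul]
    refine norm_integral_le_of_norm_le ((hiw.sub hir).abs.const_mul _) ?_
    filter_upwards [ae_restrict_mem measurableSet_Ioc] with v hv
    rw [← mul_sub, norm_mul, ← Complex.ofReal_sub, Complex.norm_real, Real.norm_eq_abs]
    gcongr
    exact hbd v hv
  have e4 := norm_integral_Ioc_sub_le (γ := α / 2) (by linarith) (by linarith) hp hB
  have e5 : (N : ℂ) * (1 - ∫ t, Complex.exp (-((t / a) ^ 2 : ℝ) * p) ∂ν) -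
      Real.Gamma (1 - α / 2) * p ^ ((α / 2 : ℝ) : ℂ) =
      (N : ℂ) * ((∫ t, Complex.exp (-(min ((t / a) ^ 2) B : ℝ) * p) ∂ν) -
        ∫ t, Complex.exp (-((t / a) ^ 2 : ℝ) * p) ∂ν) +
      ((∫ v in Ioc 0 B, p * Complex.exp (-(v : ℂ) * p) * (wtail ν N v : ℂ)) -
        ∫ v in Ioc 0 B, p * Complex.exp (-(v : ℂ) * p) * ((v ^ (-(α / 2)) : ℝ) : ℂ)) +
      ((∫ v in Ioc 0 B, p * Complex.exp (-(v : ℂ) * p) * ((v ^ (-(α / 2)) : ℝ) : ℂ)) -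
        Real.Gamma (1 - α / 2) * p ^ ((α / 2 : ℝ) : ℂ)) := by
    rw [← e1]
    ring
  rw [e5]
  refine (norm_add_le _ _).trans (add_le_add ((norm_add_le _ _).trans (add_le_add e2 e3)) e4)

theorem norm_cpow_ofReal_le {p : ℂ} {γ K : ℝ} (hγ : 0 < γ) (hp : ‖p‖ ≤ K) :
    ‖p ^ (γ : ℂ)‖ ≤ K ^ γ := by
  rw [Complex.norm_cpow_real]
  gcongr

/-- The Laplace transform of `(x / a_N)²` is `exp(-Γ(1-α/2) p^{α/2} / N)` up to `o(1/N)`. -/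
theorem eventually_norm_laplace_sub_exp_le (hν : HeavyTailed α ν) (hα : 0 < α) (hα2 : α < 2)
    (K : ℝ) {ε : ℝ} (hε : 0 < ε) :
    ∀ᶠ N : ℕ in atTop, ∀ p : ℂ, p = 0 ∨ 0 < p.re → ‖p‖ ≤ K →
      N * ‖(∫ t, Complex.exp (-((t / scale ν N) ^ 2 : ℝ) * p) ∂ν) -
        Complex.exp (-(Real.Gamma (1 - α / 2) * p ^ ((α / 2 : ℝ) : ℂ)) / N)‖ ≤ ε := by
  obtain ⟨B, hBε, hB⟩ : ∃ B : ℝ, B ^ (-(α / 2)) < ε / 16 ∧ 0 < B :=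
    (((tendsto_rpow_neg_atTop (by linarith : 0 < α / 2)).eventually
      (Iio_mem_nhds (by positivity : (0 : ℝ) < ε / 16))).and (eventually_gt_atTop 0)).exists
  set c := Real.Gamma (1 - α / 2) with hc
  have hc0 : 0 < c := Real.Gamma_pos_of_pos (by linarith)
  set M := c * |K| ^ (α / 2) with hM
  have hM0 : 0 ≤ M := by positivity
  have h1 := (wtail_tendsto hν hB).eventually (Iio_mem_nhds hBε)
  have h2 : ∀ᶠ N in atTop, |K| * ∫ v in Ioc 0 B, |wtail ν N v - v ^ (-(α / 2))| < ε / 4 := by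
    have := (integral_abs_wtail_sub_tendsto hν hα hα2 B).const_mul |K|
    rw [mul_zero] at this
    exact this.eventually (Iio_mem_nhds (by positivity : (0 : ℝ) < ε / 4))
  have h3 : ∀ᶠ N : ℕ in atTop, M ^ 2 / (N : ℝ) < ε / 4 :=
    (tendsto_const_div_atTop_nhds_zero_nat _).eventually
      (Iio_mem_nhds (by positivity : (0 : ℝ) < ε / 4))
  have h4 : ∀ᶠ N : ℕ in atTop, M / (N : ℝ) < 1 :=
    (tendsto_const_div_atTop_nhds_zero_nat _).eventually (Iio_mem_nhds one_pos)
  filter_upwards [h1, h2, h3, h4, (scale_tendsto_atTop hν).eventually_gt_atTop 0,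
    eventually_ge_atTop 1] with N h1 h2 h3 h4 ha hN p hp hpK
  have hN0 : (0 : ℝ) < N := by positivity
  have hNc : (N : ℂ) ≠ 0 := by exact_mod_cast hN0.ne'
  -- The value p = 0 occurs when a weight of the row vanishes; both exponentials are then 1.
  rcases hp with rfl | hp
  · have : (((α / 2 : ℝ) : ℂ)) ≠ 0 := by
      norm_cast
      linarith
    rw [Complex.zero_cpow this]
    simp [hε.le]
  set E := ∫ t, Complex.exp (-((t / scale ν N) ^ 2 : ℝ) * p) ∂ν with hE
  set y := c * p ^ ((α / 2 : ℝ) : ℂ) with hy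
  have hyM : ‖y‖ ≤ M := by
    rw [hy, norm_mul, Complex.norm_real, Real.norm_of_nonneg hc0.le]
    exact mul_le_mul_of_nonneg_left
      (norm_cpow_ofReal_le (by linarith) (hpK.trans (le_abs_self K))) hc0.le
  have e1 := norm_laplace_sub_le hα hα2 ha hB hp
  rw [← hE, ← hc, ← hy] at e1
  have e2 : ‖Complex.exp (-y / N) - 1 - (-y / N)‖ ≤ ‖-y / N‖ ^ 2 := by
    refine Complex.norm_exp_sub_one_sub_id_le ?_
    rw [norm_div, norm_neg, Complex.norm_natCast]
    exact (div_le_div_of_nonneg_right hyM hN0.le).trans h4.le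
  have e3 : (N : ℝ) * ‖E - Complex.exp (-y / N)‖ ≤
      ‖(N : ℂ) * (1 - E) - y‖ + N * ‖Complex.exp (-y / N) - 1 - (-y / N)‖ := by
    have : (N : ℂ) * (E - Complex.exp (-y / N)) =
        -((N : ℂ) * (1 - E) - y) - N * (Complex.exp (-y / N) - 1 - (-y / N)) := by
      field_simp
      ring
    rw [← Complex.norm_natCast, ← norm_mul, this]
    refine (norm_sub_le _ _).trans ?_
    rw [norm_neg, norm_mul]
  have e4 : (N : ℝ) * ‖Complex.exp (-y / N) - 1 - (-y / N)‖ ≤ M ^ 2 / N := by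
    calc (N : ℝ) * ‖Complex.exp (-y / N) - 1 - (-y / N)‖ ≤ N * ‖-y / N‖ ^ 2 := by gcongr
      _ = ‖y‖ ^ 2 / N := by
          rw [norm_div, norm_neg, Complex.norm_natCast]
          field_simp
      _ ≤ _ := by gcongr
  have e5 : ‖p‖ * ∫ v in Ioc 0 B, |wtail ν N v - v ^ (-(α / 2))| ≤
      |K| * ∫ v in Ioc 0 B, |wtail ν N v - v ^ (-(α / 2))| := by
    have := hpK.trans (le_abs_self K)
    have : 0 ≤ ∫ v in Ioc 0 B, |wtail ν N v - v ^ (-(α / 2))| :=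
      integral_nonneg fun _ => abs_nonneg _
    gcongr
  have h1' : wtail ν N B < ε / 16 := h1
  linarith

end LaplaceAsymptotics

/-! ### Quadratic forms in independent variables -/

section QuadraticForm

set_option linter.unusedSectionVars false

open Matrix

variable {n : Type*} [Fintype n] [DecidableEq n]

/-- The quadratic form `∑ u_i M_{ij} u_j` of a real vector. -/
def quad (M : Matrix n n ℂ) (u : n → ℝ) : ℂ :=
  (fun i => (u i : ℂ)) ⬝ᵥ M.mulVec fun i => (u i : ℂ)

theorem quad_eq_sum (M : Matrix n n ℂ) (u : n → ℝ) :
    quad M u = ∑ i, ∑ j, (u i : ℂ) * (M i j * u j) := by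
  simp only [quad, dotProduct, mulVec, Finset.mul_sum]

theorem quad_add_single {M : Matrix n n ℂ} (hM : M.IsSymm) {i : n} (hi : M i i = 0) (u : n → ℝ)
    (δ : ℝ) :
    quad M (u + Pi.single i δ) = quad M u + 2 * δ * M.mulVec (fun j => (u j : ℂ)) i := by
  have h : (fun j => (((u + Pi.single i δ : n → ℝ) j : ℝ) : ℂ)) =
      (fun j => (u j : ℂ)) + Pi.single i (δ : ℂ) := by
    ext j
    by_cases hj : j = i
    · subst hj; simp
    · simp [hj]
  have h2 : (fun j => (u j : ℂ)) ⬝ᵥ M.mulVec (Pi.single i (δ : ℂ)) =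
      δ * M.mulVec (fun j => (u j : ℂ)) i := by
    rw [dotProduct_mulVec, ← mulVec_transpose, hM.eq, dotProduct_single, mul_comm]
  rw [quad, h, mulVec_add, add_dotProduct, dotProduct_add, dotProduct_add, h2, single_dotProduct,
    single_dotProduct]
  simp [quad, hi, mulVec_single]
  ring

theorem norm_quad_le {M : Matrix n n ℂ} {Λ : ℝ} (hΛ : 0 ≤ Λ)
    (hM : ∀ u : n → ℝ, ∑ i, ‖M.mulVec (fun j => (u j : ℂ)) i‖ ^ 2 ≤ Λ ^ 2 * ∑ i, u i ^ 2)
    (u : n → ℝ) : ‖quad M u‖ ≤ Λ * ∑ i, u i ^ 2 := by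
  have h1 := norm_dotProduct_le (fun i => (u i : ℂ)) (M.mulVec fun i => (u i : ℂ))
  have h3 : ∑ i, ‖(u i : ℂ)‖ ^ 2 = ∑ i, u i ^ 2 := by simp
  rw [h3] at h1
  have h0 : 0 ≤ ∑ i, u i ^ 2 := Finset.sum_nonneg fun _ _ => by positivity
  have h2 := mul_le_mul_of_nonneg_left (hM u) h0
  refine abs_le_of_sq_le_sq' ?_ (by positivity) |>.2
  rw [quad]
  nlinarith

variable (ν : Measure ℝ) [IsProbabilityMeasure ν]

theorem integral_eq_integral_piecewise_real (μ : n → Measure ℝ) [∀ i, IsProbabilityMeasure (μ i)]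
    (S : Finset n) {F : (n → ℝ) → ℝ} {C : ℝ} (hF : Measurable F) (hC : ∀ x, |F x| ≤ C) :
    ∫ x, F x ∂Measure.pi μ =
      ∫ x, ∫ y, F (S.piecewise y x) ∂Measure.pi μ ∂Measure.pi μ := by
  have h := integral_eq_integral_piecewise μ S (F := fun x => (F x : ℂ)) (C := C)
    (Complex.measurable_ofReal.comp hF) (fun x => by simpa using hC x)
  simp only [integral_complex_ofReal] at h
  exact_mod_cast h

/-- Second moment as variance plus squared mean. The diagonal of M vanishes, so resampling
coordinate i changes the form by twice its increment times (Mu)_i, and Efron–Stein with ∑ |(Mu)_i|²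
≤ Λ² ∑ u_i² bounds the variance. By independence the mean is the form evaluated at the means, which
is present because f is not centred. -/
theorem integral_sq_norm_quad_le {M : Matrix n n ℂ} (hM : M.IsSymm) (hM0 : ∀ i, M i i = 0) {Λ : ℝ}
    (hΛ : 0 ≤ Λ)
    (hMΛ : ∀ u : n → ℝ, ∑ i, ‖M.mulVec (fun j => (u j : ℂ)) i‖ ^ 2 ≤ Λ ^ 2 * ∑ i, u i ^ 2)
    {s : n → ℝ} {K : ℝ} (hs : ∀ i, |s i| ≤ K) {f : ℝ → ℝ} (hf : Measurable f) {B : ℝ}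
    (hB : ∀ t, |f t| ≤ B) :
    ∫ x, ‖quad M fun i => s i * f (x i)‖ ^ 2 ∂Measure.pi (fun _ : n => ν) ≤
      8 * K ^ 4 * Λ ^ 2 * Fintype.card n * (∫ t, f t ^ 2 ∂ν) ^ 2 +
        2 * (Λ * K ^ 2 * (Fintype.card n * (∫ t, f t ∂ν) ^ 2)) ^ 2 := by
  set μ : n → Measure ℝ := fun _ => ν
  set m := ∫ t, f t ∂ν with hm
  set V := ∫ t, f t ^ 2 ∂ν with hV
  set u : (n → ℝ) → n → ℝ := fun x i => s i * f (x i) with hu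
  set F : (n → ℝ) → ℂ := fun x => quad M (u x) with hF
  have hub : ∀ x i, |u x i| ≤ K * B := fun x i => by
    rw [hu, abs_mul]
    exact mul_le_mul (hs i) (hB _) (abs_nonneg _) ((abs_nonneg _).trans (hs i))
  have hub2 : ∀ x i, u x i ^ 2 ≤ (K * B) ^ 2 := fun x i => sq_le_sq' (neg_le_of_abs_le (hub x i))
    (le_of_abs_le (hub x i))
  have hum : ∀ i, Measurable fun x => u x i := fun i => by
    simp only [hu]; fun_prop
  have husq : ∀ x, ∑ i, u x i ^ 2 ≤ Fintype.card n * (K * B) ^ 2 := fun x =>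
    (Finset.sum_le_sum fun i _ => hub2 x i).trans (by simp)
  have hFm : Measurable F := by
    simp only [hF, quad_eq_sum]
    fun_prop
  have hMum : ∀ i, Measurable fun x => M.mulVec (fun j => (u x j : ℂ)) i := fun i => by
    simp only [mulVec, dotProduct]
    fun_prop
  set C := Λ * (Fintype.card n * (K * B) ^ 2)
  have hFC : ∀ x, ‖F x‖ ≤ C := fun x => (norm_quad_le hΛ hMΛ _).trans (mul_le_mul_of_nonneg_left (husq x) hΛ)
  have hfi : Integrable f ν := Integrable.of_bound hf.aestronglyMeasurable B (Eventually.of_forall hB)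
  have hf2i : Integrable (fun t => f t ^ 2) ν :=
    Integrable.of_bound (hf.pow_const 2).aestronglyMeasurable (B ^ 2) (Eventually.of_forall fun t => by
      rw [Real.norm_eq_abs, abs_pow]; gcongr; exact hB t)
  have hV0 : 0 ≤ V := integral_nonneg fun t => sq_nonneg _
  have heval : ∀ (g : ℝ → ℝ) (i : n), Measurable g →
      ∫ x, g (x i) ∂Measure.pi μ = ∫ t, g t ∂ν := fun g i hg =>
    integral_comp_eval (μ := μ) (i := i) hg.aestronglyMeasurable
  have hmean : ∫ x, F x ∂Measure.pi μ = quad M fun i => s i * m := by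
    have hInt : ∀ i j, Integrable (fun x => (u x i : ℂ) * (M i j * u x j)) (Measure.pi μ) := by
      intro i j
      refine Integrable.of_bound (C := K * B * (‖M i j‖ * (K * B))) ?_ (Eventually.of_forall fun x => ?_)
      · exact ((Complex.measurable_ofReal.comp (hum i)).mul ((Complex.measurable_ofReal.comp
          (hum j)).const_mul _)).aestronglyMeasurable
      · rw [norm_mul, norm_mul, Complex.norm_real, Complex.norm_real]
        exact mul_le_mul (hub x i) (mul_le_mul_of_nonneg_left (hub x j) (norm_nonneg _))
          (by positivity) ((abs_nonneg _).trans (hub x i))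
    simp only [hF, quad_eq_sum]
    rw [integral_finsetSum _ fun i _ => integrable_finsetSum _ fun j _ => hInt i j]
    refine Finset.sum_congr rfl fun i _ => ?_
    rw [integral_finsetSum _ fun j _ => hInt i j]
    refine Finset.sum_congr rfl fun j _ => ?_
    by_cases hij : i = j
    · subst hij; simp [hM0]
    have hind : IndepFun (fun x : n → ℝ => f (x i)) (fun x => f (x j)) (Measure.pi μ) :=
      (iIndepFun_pi (μ := μ) (X := fun _ => f) (fun _ => hf.aemeasurable)).indepFun hij
    have h1 := hind.integral_fun_mul_eq_mul_integral (hf.comp (measurable_pi_apply i)).aestronglyMeasurable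
      (hf.comp (measurable_pi_apply j)).aestronglyMeasurable
    rw [heval f i hf, heval f j hf] at h1
    have h2 : ∀ x : n → ℝ, (u x i : ℂ) * (M i j * u x j) =
        (s i * s j * M i j) * ((f (x i) * f (x j) : ℝ) : ℂ) := fun x => by
      simp only [hu]; push_cast; ring
    simp only [h2]
    rw [integral_const_mul, integral_complex_ofReal, h1]
    push_cast
    ring
  have hmeanb : ‖∫ x, F x ∂Measure.pi μ‖ ≤ Λ * K ^ 2 * (Fintype.card n * m ^ 2) := by
    rw [hmean]
    refine (norm_quad_le hΛ hMΛ _).trans ?_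
    rw [mul_assoc Λ]
    gcongr
    calc ∑ i, (s i * m) ^ 2 ≤ ∑ _i : n, K ^ 2 * m ^ 2 := by
          refine Finset.sum_le_sum fun i _ => ?_
          rw [mul_pow]
          gcongr ?_ * _
          rw [← sq_abs]
          exact pow_le_pow_left₀ (abs_nonneg _) (hs i) 2
      _ = _ := by simp; ring
  have hpw : ∀ i x y, u (({i} : Finset n).piecewise y x) =
      u x + Pi.single i (s i * f (y i) - u x i) := by
    intro i x y
    ext j
    by_cases hj : j = i
    · subst hj; simp [hu]
    · simp [hu, hj]
  have havg : ∀ i x, F x - avg μ {i} F x =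
      2 * (u x i - s i * m : ℝ) * M.mulVec (fun j => (u x j : ℂ)) i := by
    intro i x
    have h1 : ∀ y, F (({i} : Finset n).piecewise y x) =
        F x + (2 * M.mulVec (fun j => (u x j : ℂ)) i) * ((s i * f (y i) - u x i : ℝ) : ℂ) := by
      intro y
      simp only [hF, hpw, quad_add_single hM (hM0 i)]
      ring
    have hi1 : Integrable (fun y : n → ℝ => s i * f (y i)) (Measure.pi μ) :=
      (integrable_comp_eval (μ := μ) (i := i) hfi).const_mul _
    have hi2 : Integrable (fun y : n → ℝ => s i * f (y i) - u x i) (Measure.pi μ) :=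
      hi1.sub (integrable_const _)
    have h2 : ∫ y : n → ℝ, (s i * f (y i) - u x i) ∂Measure.pi μ = s i * m - u x i := by
      rw [integral_sub hi1 (integrable_const _), integral_const_mul, heval f i hf, ← hm]
      simp
    simp only [avg, h1]
    rw [integral_add (integrable_const _) (hi2.ofReal.const_mul _), integral_const_mul,
      integral_complex_ofReal, h2]
    simp
    ring
  have hMint : ∀ i, Integrable (fun x => ‖M.mulVec (fun j => (u x j : ℂ)) i‖ ^ 2) (Measure.pi μ) := by
    intro i
    refine Integrable.of_bound (C := Λ ^ 2 * (Fintype.card n * (K * B) ^ 2))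
      ((hMum i).norm.pow_const 2).aestronglyMeasurable (Eventually.of_forall fun x => ?_)
    rw [Real.norm_of_nonneg (by positivity)]
    refine (Finset.single_le_sum (f := fun i => ‖M.mulVec (fun j => (u x j : ℂ)) i‖ ^ 2)
      (fun _ _ => by positivity) (Finset.mem_univ i)).trans ((hMΛ _).trans ?_)
    gcongr
    exact husq x
  have hblock : ∀ i, ∫ x, ‖F x - avg μ {i} F x‖ ^ 2 ∂Measure.pi μ ≤
      4 * (K ^ 2 * V) * ∫ x, ‖M.mulVec (fun j => (u x j : ℂ)) i‖ ^ 2 ∂Measure.pi μ := by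
    intro i
    have h1 : ∀ x, ‖F x - avg μ {i} F x‖ ^ 2 =
        4 * (s i * f (x i) - s i * m) ^ 2 * ‖M.mulVec (fun j => (u x j : ℂ)) i‖ ^ 2 := by
      intro x
      rw [havg, norm_mul, norm_mul, Complex.norm_real, mul_pow, mul_pow, Real.norm_eq_abs, sq_abs]
      norm_num [hu]
    -- (Mu)_i does not involve coordinate i because M has zero diagonal; conditionally on the other
    -- coordinates it is a constant.
    have hMi : ∀ x y, M.mulVec (fun j => (u (({i} : Finset n).piecewise y x) j : ℂ)) i =
        M.mulVec (fun j => (u x j : ℂ)) i := by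
      intro x y
      simp only [mulVec, dotProduct]
      refine Finset.sum_congr rfl fun j _ => ?_
      by_cases hj : j = i
      · subst hj; simp [hM0]
      · simp [hpw, hj]
    have hbound : ∀ x, |‖F x - avg μ {i} F x‖ ^ 2| ≤ (C + C) ^ 2 := fun x => by
      rw [abs_of_nonneg (by positivity)]
      gcongr
      exact (norm_sub_le _ _).trans (add_le_add (hFC x) (norm_avg_le μ {i} hFC x))
    rw [integral_eq_integral_piecewise_real μ {i} (F := fun x => ‖F x - avg μ {i} F x‖ ^ 2)
      ((hFm.sub (measurable_avg μ {i} hFm)).norm.pow_const 2) hbound]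
    rw [← integral_const_mul]
    have hi3 : Integrable (fun t => f t ^ 2 - 2 * m * f t) ν := hf2i.sub (hfi.const_mul _)
    have hvar : ∫ t, (s i * f t - s i * m) ^ 2 ∂ν ≤ K ^ 2 * V := by
      have e : ∀ t, (s i * f t - s i * m) ^ 2 = s i ^ 2 * (f t ^ 2 - 2 * m * f t + m ^ 2) := fun t => by
        ring
      simp only [e]
      rw [integral_const_mul, integral_add hi3 (integrable_const _),
        integral_sub hf2i (hfi.const_mul _), integral_const_mul, ← hm, ← hV]
      simp only [integral_const, probReal_univ, one_smul]
      have : s i ^ 2 ≤ K ^ 2 := by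
        rw [← sq_abs]; exact pow_le_pow_left₀ (abs_nonneg _) (hs i) 2
      refine mul_le_mul this ?_ ?_ (sq_nonneg _)
      · nlinarith [sq_nonneg m]
      · have : 0 ≤ ∫ t, (f t - m) ^ 2 ∂ν := integral_nonneg fun t => sq_nonneg _
        have e : ∀ t, (f t - m) ^ 2 = (f t ^ 2 - 2 * m * f t + m ^ 2) := fun t => by ring
        simp only [e] at this
        rw [integral_add hi3 (integrable_const _),
          integral_sub hf2i (hfi.const_mul _), integral_const_mul, ← hm, ← hV] at this
        simpa using this
    have hpt : ∀ x, ∫ y, ‖F (({i} : Finset n).piecewise y x) -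
        avg μ {i} F (({i} : Finset n).piecewise y x)‖ ^ 2 ∂Measure.pi μ ≤
          4 * (K ^ 2 * V) * ‖M.mulVec (fun j => (u x j : ℂ)) i‖ ^ 2 := by
      intro x
      simp only [h1, hMi]
      rw [integral_mul_const, integral_const_mul]
      gcongr
      simp only [Finset.piecewise_singleton, Function.update_self]
      rw [heval (fun t => (s i * f t - s i * m) ^ 2) i (by fun_prop)]
      exact hvar
    refine integral_mono_of_nonneg (Eventually.of_forall fun x => integral_nonneg fun y => by positivity)
      ?_ (Eventually.of_forall hpt)
    exact (hMint i).const_mul _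
  have husqi : ∀ i, Integrable (fun x => u x i ^ 2) (Measure.pi μ) := fun i =>
    Integrable.of_bound ((hum i).pow_const 2).aestronglyMeasurable ((K * B) ^ 2)
      (Eventually.of_forall fun x => by rw [Real.norm_of_nonneg (by positivity)]; exact hub2 x i)
  have hsum : ∑ i, ∫ x, ‖M.mulVec (fun j => (u x j : ℂ)) i‖ ^ 2 ∂Measure.pi μ ≤
      Λ ^ 2 * (Fintype.card n * (K ^ 2 * V)) := by
    rw [← integral_finsetSum _ fun i _ => hMint i]
    calc _ ≤ ∫ x, Λ ^ 2 * ∑ i, u x i ^ 2 ∂Measure.pi μ :=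
          integral_mono (integrable_finsetSum _ fun i _ => hMint i)
            ((integrable_finsetSum _ fun i _ => husqi i).const_mul _) fun x => hMΛ _
      _ = Λ ^ 2 * ∑ i, ∫ x, u x i ^ 2 ∂Measure.pi μ := by
          rw [integral_const_mul, integral_finsetSum _ fun i _ => husqi i]
      _ ≤ Λ ^ 2 * ∑ _i : n, K ^ 2 * V := by
          gcongr with i _
          simp only [hu, mul_pow]
          rw [integral_const_mul, heval (fun t => f t ^ 2) i (hf.pow_const 2)]
          gcongr ?_ * _
          rw [← sq_abs]; exact pow_le_pow_left₀ (abs_nonneg _) (hs i) 2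
      _ = _ := by simp
  have hES := integral_norm_sub_integral_sq_le μ (fun i : n => ({i} : Finset n))
    (fun i => ⟨i, by simp⟩) hFm hFC
  have hES2 : ∫ x, ‖F x - ∫ y, F y ∂Measure.pi μ‖ ^ 2 ∂Measure.pi μ ≤
      4 * (K ^ 2 * V) * (Λ ^ 2 * (Fintype.card n * (K ^ 2 * V))) := by
    refine hES.trans ((Finset.sum_le_sum fun i _ => hblock i).trans ?_)
    rw [← Finset.mul_sum]
    gcongr
  set e := ∫ y, F y ∂Measure.pi μ with he
  have hi1 : Integrable (fun x => ‖F x - e‖ ^ 2) (Measure.pi μ) := by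
    refine Integrable.of_bound (C := (C + ‖e‖) ^ 2)
      ((hFm.sub_const e).norm.pow_const 2).aestronglyMeasurable (Eventually.of_forall fun x => ?_)
    rw [Real.norm_of_nonneg (by positivity)]
    gcongr
    exact (norm_sub_le _ _).trans (by gcongr; exact hFC x)
  calc ∫ x, ‖F x‖ ^ 2 ∂Measure.pi μ ≤ ∫ x, (2 * ‖F x - e‖ ^ 2 + 2 * ‖e‖ ^ 2) ∂Measure.pi μ := by
        refine integral_mono_of_nonneg (Eventually.of_forall fun x => by positivity)
          ((hi1.const_mul 2).add (integrable_const _)) (Eventually.of_forall fun x => ?_)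
        have : ‖F x‖ ≤ ‖F x - e‖ + ‖e‖ := by
          simpa using norm_add_le (F x - e) e
        have h2 := pow_le_pow_left₀ (norm_nonneg _) this 2
        simp only
        nlinarith [sq_nonneg (‖F x - e‖ - ‖e‖)]
    _ = 2 * (∫ x, ‖F x - e‖ ^ 2 ∂Measure.pi μ) + 2 * ‖e‖ ^ 2 := by
        rw [integral_add (hi1.const_mul 2) (integrable_const _), integral_const_mul]
        simp
    _ ≤ 2 * (4 * (K ^ 2 * V) * (Λ ^ 2 * (Fintype.card n * (K ^ 2 * V)))) +
        2 * (Λ * K ^ 2 * (Fintype.card n * m ^ 2)) ^ 2 := by gcongr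
    _ = _ := by ring

/-- The off-diagonal part of the resolvent. -/
def offResol (H : Matrix n n ℝ) (z : ℂ) : Matrix n n ℂ :=
  resol H z - Matrix.diagonal fun i => resol H z i i

theorem offResol_isSymm {H : Matrix n n ℝ} (hH : H.IsSymm) (z : ℂ) : (offResol H z).IsSymm := by
  rw [offResol, Matrix.IsSymm, transpose_sub, resol_transpose hH, diagonal_transpose]

theorem offResol_diag (H : Matrix n n ℝ) (z : ℂ) (i : n) : offResol H z i i = 0 := by
  simp [offResol]

theorem quad_resol (H : Matrix n n ℝ) (z : ℂ) (u : n → ℝ) :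
    quad (resol H z) u = ∑ i, (u i : ℂ) ^ 2 * resol H z i i + quad (offResol H z) u := by
  have h : resol H z = (Matrix.diagonal fun i => resol H z i i) + offResol H z := by
    simp [offResol]
  conv_lhs => rw [h]
  rw [quad, add_mulVec, dotProduct_add, quad]
  congr 1
  simp only [dotProduct, mulVec_diagonal]
  exact Finset.sum_congr rfl fun i _ => by ring

/-- The resolvent and its diagonal part both have operator norm at most 1/η, whence the constant 2/η
for the difference. -/
theorem sum_norm_offResol_mulVec_sq_le {H : Matrix n n ℝ} (hH : H.IsSymm) {z : ℂ} {η : ℝ}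
    (hη : 0 < η) (hz : η ≤ z.im) (u : n → ℝ) :
    ∑ i, ‖(offResol H z).mulVec (fun j => (u j : ℂ)) i‖ ^ 2 ≤ (2 / η) ^ 2 * ∑ i, u i ^ 2 := by
  have hz0 : 0 < z.im := hη.trans_le hz
  have h1 := sum_norm_resol_mulVec_sq_le hH hz0 fun j => (u j : ℂ)
  have h3 : ∑ i, ‖(u i : ℂ)‖ ^ 2 = ∑ i, u i ^ 2 := by simp
  rw [h3] at h1
  have h0 : 0 ≤ ∑ i, u i ^ 2 := Finset.sum_nonneg fun _ _ => by positivity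
  have h2 : ∑ i, ‖resol H z i i * u i‖ ^ 2 ≤ (∑ i, u i ^ 2) / z.im ^ 2 := by
    rw [Finset.sum_div]
    refine Finset.sum_le_sum fun i _ => ?_
    rw [norm_mul, mul_pow, Complex.norm_real, Real.norm_eq_abs, sq_abs, div_eq_inv_mul]
    gcongr
    have := pow_le_pow_left₀ (norm_nonneg _) (norm_resol_le hH hz0 i) 2
    simpa using this
  have h4 : ∀ i, ‖(offResol H z).mulVec (fun j => (u j : ℂ)) i‖ ^ 2 ≤
      2 * ‖(resol H z).mulVec (fun j => (u j : ℂ)) i‖ ^ 2 + 2 * ‖resol H z i i * u i‖ ^ 2 := by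
    intro i
    rw [offResol, sub_mulVec, Pi.sub_apply, mulVec_diagonal]
    have := pow_le_pow_left₀ (norm_nonneg _) (norm_sub_le ((resol H z).mulVec (fun j => (u j : ℂ)) i)
      (resol H z i i * u i)) 2
    nlinarith [sq_nonneg (‖(resol H z).mulVec (fun j => (u j : ℂ)) i‖ - ‖resol H z i i * u i‖)]
  have h5 : (∑ i, u i ^ 2) / z.im ^ 2 ≤ (∑ i, u i ^ 2) / η ^ 2 := by gcongr
  refine (Finset.sum_le_sum fun i _ => h4 i).trans ?_
  rw [Finset.sum_add_distrib, ← Finset.mul_sum, ← Finset.mul_sum]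
  have h6 : (2 / η) ^ 2 * ∑ i, u i ^ 2 = 4 * ((∑ i, u i ^ 2) / η ^ 2) := by
    field_simp
    ring
  linarith

end QuadraticForm

/-! ### Regularised powers -/

section RegularisedPower

/-- On the right half plane |q + s| ≥ s, so the derivative along the real direction is at most γ
s^{γ-1}, which integrates to ε^γ regardless of how close q is to 0. -/
theorem norm_add_cpow_sub_cpow_le {γ : ℝ} (hγ : 0 < γ) (hγ1 : γ < 1) {q : ℂ} (hq : 0 < q.re) {ε : ℝ}
    (hε : 0 ≤ ε) : ‖(q + ε) ^ (γ : ℂ) - q ^ (γ : ℂ)‖ ≤ ε ^ γ := by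
  have hre : ∀ s : ℝ, 0 ≤ s → 0 < (q + s).re := fun s hs => by simp; linarith
  have hd : ∀ s ∈ uIcc 0 ε, HasDerivAt (fun s : ℝ => (q + s) ^ (γ : ℂ))
      (γ * (q + s) ^ ((γ : ℂ) - 1)) s := by
    intro s hs
    rw [uIcc_of_le hε] at hs
    have h1 : HasDerivAt (fun w : ℂ => (q + w) ^ (γ : ℂ)) (γ * (q + s) ^ ((γ : ℂ) - 1) * 1) (s : ℂ) :=
      ((hasDerivAt_id (s : ℂ)).const_add q).cpow_const (Or.inl (hre s hs.1))
    rw [mul_one] at h1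
    exact h1.comp_ofReal
  have hc : ContinuousOn (fun s : ℝ => (γ : ℂ) * (q + s) ^ ((γ : ℂ) - 1)) (uIcc 0 ε) := by
    intro s hs
    rw [uIcc_of_le hε] at hs
    refine ContinuousAt.continuousWithinAt (ContinuousAt.const_mul ?_ _)
    exact ContinuousAt.cpow (by fun_prop) continuousAt_const (Or.inl (hre s hs.1))
  have h := intervalIntegral.integral_eq_sub_of_hasDerivAt hd hc.intervalIntegrable
  have h' : (q + ε) ^ (γ : ℂ) - q ^ (γ : ℂ) = ∫ s in (0 : ℝ)..ε, γ * (q + s) ^ ((γ : ℂ) - 1) := by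
    rw [h]; simp
  rw [h']
  have hInt : ∫ s in (0 : ℝ)..ε, γ * s ^ (γ - 1) = ε ^ γ := by
    rw [intervalIntegral.integral_const_mul, integral_rpow (Or.inl (by linarith))]
    simp [hγ.ne']
    field_simp
  rw [← hInt]
  refine intervalIntegral.norm_integral_le_of_norm_le hε (Eventually.of_forall fun s hs => ?_)
    ((intervalIntegral.intervalIntegrable_rpow' (by linarith)).const_mul _)
  have h3 : (γ : ℂ) - 1 = ((γ - 1 : ℝ) : ℂ) := by push_cast; ring
  rw [norm_mul, h3, Complex.norm_cpow_real, Complex.norm_real, Real.norm_of_nonneg hγ.le]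
  refine mul_le_mul_of_nonneg_left ?_ hγ.le
  refine Real.rpow_le_rpow_of_nonpos hs.1 ?_ (by linarith)
  refine le_trans ?_ (Complex.re_le_norm _)
  simp; linarith

/-- The power w^γ is not Lipschitz near 0. After a shift by ε it is, and the previous lemma prices
the shift. -/
theorem norm_add_cpow_sub_add_cpow_le {γ : ℝ} (hγ : 0 < γ) (hγ1 : γ < 1) {q q' : ℂ} (hq : 0 ≤ q.re)
    (hq' : 0 ≤ q'.re) {ε : ℝ} (hε : 0 < ε) :
    ‖(q + ε) ^ (γ : ℂ) - (q' + ε) ^ (γ : ℂ)‖ ≤ γ * ε ^ (γ - 1) * ‖q - q'‖ := by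
  have hconv : Convex ℝ {w : ℂ | ε ≤ w.re} := convex_halfSpace_re_ge ε
  have h := hconv.norm_image_sub_le_of_norm_hasDerivWithin_le
    (f := fun w : ℂ => w ^ (γ : ℂ)) (f' := fun w => γ * w ^ ((γ : ℂ) - 1)) (C := γ * ε ^ (γ - 1))
    (x := q' + ε) (y := q + ε) (fun w hw => ?_) (fun w hw => ?_) (by simpa using hq')
    (by simpa using hq)
  · simpa using h
  · have hw' : ε ≤ w.re := hw
    exact (by simpa using ((hasDerivAt_id w).cpow_const (c := (γ : ℂ))
      (Or.inl (by simp; linarith))).hasDerivWithinAt)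
  · have hw' : ε ≤ w.re := hw
    have h3 : (γ : ℂ) - 1 = ((γ - 1 : ℝ) : ℂ) := by push_cast; ring
    rw [norm_mul, h3, Complex.norm_cpow_real, Complex.norm_real, Real.norm_of_nonneg hγ.le]
    refine mul_le_mul_of_nonneg_left ?_ hγ.le
    exact Real.rpow_le_rpow_of_nonpos hε (hw'.trans (Complex.re_le_norm _)) (by linarith)

end RegularisedPower

/-! ### One row of the matrix, given the others -/

section Row

open Matrix

variable {α : ℝ} {ν : Measure ℝ} [IsProbabilityMeasure ν]

theorem cpow_re_nonneg {γ : ℝ} (hγ : 0 ≤ γ) (hγ1 : γ ≤ 1) {p : ℂ} (hp : 0 < p.re) :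
    0 ≤ (p ^ (γ : ℂ)).re := by
  have hp0 : p ≠ 0 := by rintro rfl; simp at hp
  rw [Complex.cpow_def_of_ne_zero hp0, Complex.exp_re]
  refine mul_nonneg (Real.exp_pos _).le (Real.cos_nonneg_of_neg_pi_div_two_le_of_le ?_ ?_) <;>
  · have h := abs_le.1 (Complex.abs_arg_le_pi_div_two_iff.2 hp.le)
    simp only [Complex.mul_im, Complex.log_im, Complex.ofReal_re, Complex.ofReal_im, mul_zero,
      zero_add]
    nlinarith [Real.pi_pos, h.1, h.2]

theorem norm_prod_sub_prod_le_sum {ι : Type*} (s : Finset ι) {f g : ι → ℂ} (hf : ∀ i, ‖f i‖ ≤ 1)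
    (hg : ∀ i, ‖g i‖ ≤ 1) : ‖∏ i ∈ s, f i - ∏ i ∈ s, g i‖ ≤ ∑ i ∈ s, ‖f i - g i‖ := by
  classical
  induction s using Finset.induction_on with
  | empty => simp
  | insert i s hi ih =>
    rw [Finset.prod_insert hi, Finset.prod_insert hi, Finset.sum_insert hi]
    have e : f i * ∏ j ∈ s, f j - g i * ∏ j ∈ s, g j =
        (f i - g i) * ∏ j ∈ s, f j + g i * (∏ j ∈ s, f j - ∏ j ∈ s, g j) := by ring
    rw [e]
    have h1 : ‖∏ j ∈ s, f j‖ ≤ 1 :=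
      (Finset.norm_prod_le _ _).trans (Finset.prod_le_one (fun _ _ => norm_nonneg _) fun i _ => hf i)
    calc _ ≤ ‖f i - g i‖ * ‖∏ j ∈ s, f j‖ + ‖g i‖ * ‖∏ j ∈ s, f j - ∏ j ∈ s, g j‖ :=
          (norm_add_le _ _).trans (by rw [norm_mul, norm_mul])
      _ ≤ ‖f i - g i‖ * 1 + 1 * ‖∏ j ∈ s, f j - ∏ j ∈ s, g j‖ := by gcongr; exact hg i
      _ ≤ _ := by rw [mul_one, one_mul]; gcongr

/-- Entries beyond B a_N occur with probability about B^{-α}, absorbed by the minimum with 1. For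
the truncated row the second moment is O(1/N) from the variance plus a vanishing term from the
truncated mean. B is fixed before N. -/
theorem eventually_integral_min_quad_le (hν : HeavyTailed α ν) (hα : 0 < α) (hα2 : α < 2) {K η ε : ℝ}
    (hη : 0 < η) (hε : 0 < ε) :
    ∀ᶠ N : ℕ in atTop, ∀ H : Matrix (Fin N) (Fin N) ℝ, H.IsSymm → ∀ z : ℂ, η ≤ z.im →
      ∀ s : Fin N → ℝ, (∀ i, |s i| ≤ K) →
        ∫ x, min 1 ‖quad (offResol H z) fun i => s i * (x i / scale ν N)‖
          ∂Measure.pi (fun _ : Fin N => ν) ≤ ε := by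
  obtain ⟨B, hB1, hB⟩ : ∃ B : ℝ, 0 < B ∧ B ^ (-α) < ε / 2 := by
    have h := (tendsto_rpow_neg_atTop hα).eventually_lt_const (half_pos hε)
    obtain ⟨B, h1, h2⟩ := (h.and (eventually_gt_atTop 0)).exists
    exact ⟨B, h2, h1⟩
  obtain ⟨m, -, -, hm⟩ := exists_integral_min_le hν hα hα2
  have h1 := (mul_tail_tendsto hν hB1).eventually_lt_const hB
  have hbound : Tendsto (fun N : ℕ => 8 * K ^ 4 * (2 / η) ^ 2 * (m (B ^ 2) ^ 2 * (1 / (N : ℝ))) +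
      2 * (2 / η * K ^ 2 * ((N : ℝ) * (∫ t, trunc (scale ν N) B t ∂ν) ^ 2)) ^ 2) atTop (𝓝 0) := by
    have e1 := (tendsto_one_div_atTop_nhds_zero_nat (𝕜 := ℝ)).const_mul (m (B ^ 2) ^ 2)
      |>.const_mul (8 * K ^ 4 * (2 / η) ^ 2)
    have e2 := (((mul_sq_integral_trunc_tendsto hν hα hα2 hB1).const_mul (2 / η * K ^ 2)).pow
      2).const_mul 2
    simpa using e1.add e2
  have h2 := hbound.eventually_lt_const (show 0 < (ε / 2) ^ 2 by positivity)
  filter_upwards [h1, h2, hm, (scale_tendsto_atTop hν).eventually_gt_atTop 0,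
    eventually_gt_atTop 0] with N h1 h2 hm ha hN H hH z hz s hs
  set a := scale ν N with hadef
  set M := offResol H z with hM
  set V := ∫ t, trunc a B t ^ 2 ∂ν
  have hNr : (0 : ℝ) < N := by exact_mod_cast hN
  have hV0 : 0 ≤ V := integral_nonneg fun t => sq_nonneg _
  have hNV : N * V ≤ m (B ^ 2) := le_trans (by gcongr; exact integral_trunc_sq_le ha hB1.le)
    (hm (B ^ 2) (by positivity))
  have hq := integral_sq_norm_quad_le ν (offResol_isSymm hH z) (offResol_diag H z)
    (show 0 ≤ 2 / η by positivity) (sum_norm_offResol_mulVec_sq_le hH hη hz) hs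
    (measurable_trunc a B) (abs_trunc_le ha hB1.le)
  rw [Fintype.card_fin, ← hM] at hq
  have hNV2 : N * V ^ 2 ≤ m (B ^ 2) ^ 2 * (1 / (N : ℝ)) := by
    rw [mul_one_div, le_div_iff₀ hNr]
    calc N * V ^ 2 * N = (N * V) ^ 2 := by ring
      _ ≤ _ := by gcongr
  have hq2 : ∫ x, ‖quad M fun i => s i * trunc a B (x i)‖ ^ 2 ∂Measure.pi (fun _ : Fin N => ν) ≤
      (ε / 2) ^ 2 := by
    refine hq.trans (le_trans ?_ h2.le)
    have : 8 * K ^ 4 * (2 / η) ^ 2 * N * V ^ 2 = 8 * K ^ 4 * (2 / η) ^ 2 * (N * V ^ 2) := by ring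
    rw [this]
    gcongr
  have hmeas : ∀ f : ℝ → ℝ, Measurable f →
      Measurable fun x : Fin N → ℝ => quad M fun i => s i * f (x i) := fun f hf => by
    simp only [quad_eq_sum]; fun_prop
  have hbd : ∀ x : Fin N → ℝ, ‖quad M fun i => s i * trunc a B (x i)‖ ≤
      2 / η * ∑ i : Fin N, (s i ^ 2 * B ^ 2) := fun x => by
    refine (norm_quad_le (by positivity) (sum_norm_offResol_mulVec_sq_le hH hη hz) _).trans ?_
    gcongr with i _
    rw [mul_pow, ← sq_abs (trunc a B (x i))]
    gcongr
    exact abs_trunc_le ha hB1.le _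
  have hi1 : Integrable (fun x => ‖quad M fun i => s i * trunc a B (x i)‖)
      (Measure.pi (fun _ : Fin N => ν)) :=
    Integrable.of_bound (hmeas _ (measurable_trunc a B)).norm.aestronglyMeasurable _
      (Eventually.of_forall fun x => by rw [norm_norm]; exact hbd x)
  have hi2 : Integrable (fun x => ‖quad M fun i => s i * trunc a B (x i)‖ ^ 2)
      (Measure.pi (fun _ : Fin N => ν)) :=
    Integrable.of_bound ((hmeas _ (measurable_trunc a B)).norm.pow_const 2).aestronglyMeasurable
      ((2 / η * ∑ i : Fin N, (s i ^ 2 * B ^ 2)) ^ 2)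
      (Eventually.of_forall fun x => by
        rw [Real.norm_of_nonneg (by positivity)]; exact pow_le_pow_left₀ (norm_nonneg _) (hbd x) 2)
  have hq3 : ∫ x, ‖quad M fun i => s i * trunc a B (x i)‖ ∂Measure.pi (fun _ : Fin N => ν) ≤ ε / 2 :=
    (abs_le_of_sq_le_sq' ((sq_integral_le hi1 hi2).trans hq2) (by positivity)).2
  have hi3 : ∀ i, Integrable (fun x : Fin N → ℝ =>
      ({t | B * a ≤ |t|} : Set ℝ).indicator (fun _ => (1 : ℝ)) (x i))
      (Measure.pi (fun _ : Fin N => ν)) := fun i =>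
    integrable_comp_eval (μ := fun _ : Fin N => ν) (i := i) (integrable_indicator_tail _)
  have hpt : ∀ x : Fin N → ℝ, min 1 ‖quad M fun i => s i * (x i / a)‖ ≤
      ∑ i, ({t | B * a ≤ |t|} : Set ℝ).indicator (fun _ => (1 : ℝ)) (x i) +
        ‖quad M fun i => s i * trunc a B (x i)‖ := by
    intro x
    have hnn : ∀ i, 0 ≤ ({t | B * a ≤ |t|} : Set ℝ).indicator (fun _ => (1 : ℝ)) (x i) := fun i =>
      indicator_nonneg (fun _ _ => zero_le_one) _
    by_cases hx : ∃ i, B * a ≤ |x i|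
    · obtain ⟨i, hi⟩ := hx
      refine (min_le_left _ _).trans (le_add_of_le_of_nonneg ?_ (norm_nonneg _))
      refine le_trans ?_ (Finset.single_le_sum (f := fun i =>
        ({t | B * a ≤ |t|} : Set ℝ).indicator (fun _ => (1 : ℝ)) (x i)) (fun i _ => hnn i)
        (Finset.mem_univ i))
      rw [indicator_of_mem (show x i ∈ {t | B * a ≤ |t|} from hi)]
    · push Not at hx
      refine (min_le_right _ _).trans (le_add_of_nonneg_of_le (Finset.sum_nonneg fun i _ => hnn i) ?_)
      simp only [trunc, hx, if_true]
      exact le_rfl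
  calc _ ≤ ∫ x, (∑ i, ({t | B * a ≤ |t|} : Set ℝ).indicator (fun _ => (1 : ℝ)) (x i) +
        ‖quad M fun i => s i * trunc a B (x i)‖) ∂Measure.pi (fun _ : Fin N => ν) :=
        integral_mono_of_nonneg (Eventually.of_forall fun x => by positivity)
          ((integrable_finsetSum _ fun i _ => hi3 i).add hi1) (Eventually.of_forall hpt)
    _ = N * tail ν (B * a) +
        ∫ x, ‖quad M fun i => s i * trunc a B (x i)‖ ∂Measure.pi (fun _ : Fin N => ν) := by
        rw [integral_add (integrable_finsetSum _ fun i _ => hi3 i) hi1,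
          integral_finsetSum _ fun i _ => hi3 i]
        congr 1
        rw [Finset.sum_congr rfl fun i _ => (integral_comp_eval (μ := fun _ : Fin N => ν) (i := i)
          (integrable_indicator_tail (ν := ν) (B * a)).aestronglyMeasurable).trans
          (integral_indicator_tail (B * a))]
        simp
    _ ≤ ε := by linarith

/-- The Laplace transform of `∑ (s_j x_j / a)² q_j`. -/
theorem integral_inv_cpow_eq {N : ℕ} {β γ : ℝ} (hβ : 0 < β) {p : ℂ} (hp : 0 < p.re) {q : Fin N → ℂ}
    (hq : ∀ j, 0 ≤ (q j).re) (s : Fin N → ℝ) (a : ℝ) :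
    (∫ x, (p + ∑ j, (((s j * (x j / a)) ^ 2 : ℝ) : ℂ) * q j)⁻¹ ^ (β : ℂ)
      ∂Measure.pi (fun _ : Fin N => ν)) * Real.Gamma β =
      ∫ t in Ioi (0 : ℝ), ((t ^ (β - 1) : ℝ) : ℂ) * Complex.exp (-(t : ℂ) * p) *
        ∏ j, ∫ y, Complex.exp (-((y / a) ^ 2 : ℝ) * (t * s j ^ 2 * q j)) ∂ν := by
  have hre : ∀ x : Fin N → ℝ, p.re ≤ (p + ∑ j, (((s j * (x j / a)) ^ 2 : ℝ) : ℂ) * q j).re := by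
    intro x
    rw [Complex.add_re, Complex.re_sum]
    refine le_add_of_nonneg_right (Finset.sum_nonneg fun j _ => ?_)
    rw [Complex.re_ofReal_mul]
    exact mul_nonneg (sq_nonneg _) (hq j)
  have h1 : ∀ x : Fin N → ℝ, (p + ∑ j, (((s j * (x j / a)) ^ 2 : ℝ) : ℂ) * q j)⁻¹ ^ (β : ℂ) *
      Real.Gamma β = ∫ t in Ioi (0 : ℝ), ((t ^ (β - 1) : ℝ) : ℂ) *
        Complex.exp (-(t : ℂ) * (p + ∑ j, (((s j * (x j / a)) ^ 2 : ℝ) : ℂ) * q j)) := by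
    intro x
    rw [← laplaceInt_zero_right γ hβ (hp.trans_le (hre x)), laplaceInt]
    simp
  rw [← integral_mul_const]
  simp only [h1]
  rw [integral_integral_swap]
  · refine setIntegral_congr_fun measurableSet_Ioi fun t ht => ?_
    rw [integral_const_mul, mul_assoc, ← integral_fintype_prod_eq_prod (𝕜 := ℂ)
      (f := fun (j : Fin N) (y : ℝ) => Complex.exp (-((y / a) ^ 2 : ℝ) * (t * s j ^ 2 * q j))),
      ← integral_const_mul (Complex.exp (-(t : ℂ) * p))]
    congr 2
    ext x
    rw [← Complex.exp_sum, ← Complex.exp_add]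
    congr 1
    rw [mul_add, Finset.mul_sum]
    congr 1
    refine Finset.sum_congr rfl fun j _ => ?_
    push_cast
    ring
  · have hb : Integrable (fun w : (Fin N → ℝ) × ℝ => w.2 ^ (β - 1) * Real.exp (-p.re * w.2))
        ((Measure.pi (fun _ : Fin N => ν)).prod (volume.restrict (Ioi 0))) :=
      Integrable.comp_snd (integrableOn_rpow_mul_exp hβ hp) _
    refine Integrable.mono' hb ?_ ?_
    · refine Measurable.aestronglyMeasurable ?_
      simp only [Function.uncurry_def]
      fun_prop
    · have hset : ∀ᵐ w : (Fin N → ℝ) × ℝ ∂((Measure.pi (fun _ : Fin N => ν)).prod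
          (volume.restrict (Ioi 0))), w.2 ∈ Ioi (0 : ℝ) :=
        Measure.quasiMeasurePreserving_snd.ae (ae_restrict_mem measurableSet_Ioi)
      filter_upwards [hset] with w hw
      have hw' : 0 < w.2 := hw
      simp only [Function.uncurry_def]
      rw [norm_mul, Complex.norm_real, Real.norm_of_nonneg (Real.rpow_nonneg hw'.le _),
        Complex.norm_exp]
      gcongr
      rw [← Complex.ofReal_neg, Complex.re_ofReal_mul]
      nlinarith [hre w.1]

theorem cpow_ofReal_mul {r : ℝ} (hr : 0 ≤ r) {γ : ℝ} (hγ : 0 < γ) (q : ℂ) :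
    ((r : ℂ) * q) ^ (γ : ℂ) = ((r ^ γ : ℝ) : ℂ) * q ^ (γ : ℂ) := by
  have hγ' : (γ : ℂ) ≠ 0 := by exact_mod_cast hγ.ne'
  rcases eq_or_lt_of_le hr with rfl | hr
  · simp [Complex.zero_cpow hγ', Real.zero_rpow hγ.ne']
  by_cases hq : q = 0
  · simp [hq, Complex.zero_cpow hγ']
  have hr' : (r : ℂ) ≠ 0 := by exact_mod_cast hr.ne'
  rw [Complex.ofReal_cpow hr.le, Complex.cpow_def_of_ne_zero (mul_ne_zero hr' hq),
    Complex.cpow_def_of_ne_zero hr', Complex.cpow_def_of_ne_zero hq, Complex.log_ofReal_mul hr hq,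
    add_mul, Complex.exp_add, Complex.ofReal_log hr.le]

theorem cpow_ofReal_mul_sq_mul {γ t : ℝ} (hγ : 0 < γ) (ht : 0 ≤ t) (s : ℝ) (q : ℂ) :
    (t * s ^ 2 * q) ^ (γ : ℂ) = ((t ^ γ : ℝ) : ℂ) * (((|s| ^ (2 * γ) : ℝ) : ℂ) * q ^ (γ : ℂ)) := by
  have h1 : (t * s ^ 2 * q : ℂ) = ((t * |s| ^ 2 : ℝ) : ℂ) * q := by
    rw [sq_abs]; push_cast; ring
  rw [h1, cpow_ofReal_mul (by positivity) hγ,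
    Real.mul_rpow ht (by positivity), Real.rpow_mul (abs_nonneg s), Real.rpow_two]
  push_cast
  ring

/-- The Laplace representation and independence produce a product of one-variable Laplace
transforms. Each is exp(-Γ(1-α/2) (t s_j² q_j)^{α/2} / N) up to o(1/N), uniformly for t ≤ T, and the
product of these exponentials is exp(-t^{α/2} Y). -/
theorem eventually_norm_integral_inv_cpow_sub_le (hν : HeavyTailed α ν) (hα : 0 < α) (hα2 : α < 2)
    {β : ℝ} (hβ : 0 < β) {K η ε : ℝ} (hη : 0 < η) (hε : 0 < ε) :
    ∀ᶠ N : ℕ in atTop, ∀ q : Fin N → ℂ, (∀ j, 0 < (q j).re) → (∀ j, ‖q j‖ ≤ 1 / η) →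
      ∀ s : Fin N → ℝ, (∀ j, |s j| ≤ K) → ∀ p : ℂ, η ≤ p.re →
        ‖(∫ x, (p + ∑ j, (((s j * (x j / scale ν N)) ^ 2 : ℝ) : ℂ) * q j)⁻¹ ^ (β : ℂ)
          ∂Measure.pi (fun _ : Fin N => ν)) - laplaceInt β (α / 2) p
            (((Real.Gamma (1 - α / 2) / N : ℝ) : ℂ) *
              ∑ j, ((|s j| ^ α : ℝ) : ℂ) * q j ^ ((α / 2 : ℝ) : ℂ)) / Real.Gamma β‖ ≤ ε := by
  have hG := Real.Gamma_pos_of_pos hβ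
  obtain ⟨T, hT0, hT⟩ : ∃ T : ℝ, 0 < T ∧ 2 * Real.exp (-(T * (η / 2))) * (η / 2) ^ (-β) < ε / 2 := by
    have h1 : Tendsto (fun T : ℝ => 2 * Real.exp (-(T * (η / 2))) * (η / 2) ^ (-β)) atTop (𝓝 0) := by
      have h2 : Tendsto (fun T : ℝ => Real.exp (-(T * (η / 2)))) atTop (𝓝 0) :=
        Real.tendsto_exp_neg_atTop_nhds_zero.comp (tendsto_id.atTop_mul_const (by positivity))
      simpa using (h2.const_mul 2).mul_const ((η / 2) ^ (-β))
    obtain ⟨T, h2, h3⟩ := ((h1.eventually_lt_const (half_pos hε)).and (eventually_gt_atTop 0)).exists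
    exact ⟨T, h3, h2⟩
  -- Normalised so that ε₁ ∫ t^{β-1} e^{-ηt} dt = Γ(β) ε/2.
  set ε₁ := ε / 2 * η ^ β with hε₁
  have hε₁0 : 0 < ε₁ := by positivity
  filter_upwards [eventually_norm_laplace_sub_exp_le hν hα hα2 (T * K ^ 2 * (1 / η)) hε₁0,
    eventually_gt_atTop 0] with N hN hN0 q hq hqη s hs p hp
  have hNr : (0 : ℝ) < N := by exact_mod_cast hN0
  have hp0 : 0 < p.re := hη.trans_le hp
  set a := scale ν N
  set Y := (((Real.Gamma (1 - α / 2) / N : ℝ) : ℂ) *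
    ∑ j, ((|s j| ^ α : ℝ) : ℂ) * q j ^ ((α / 2 : ℝ) : ℂ)) with hY
  have hc : 0 < Real.Gamma (1 - α / 2) := Real.Gamma_pos_of_pos (by linarith)
  set φ : ℝ → Fin N → ℂ := fun t j =>
    ∫ y, Complex.exp (-((y / a) ^ 2 : ℝ) * (t * s j ^ 2 * q j)) ∂ν with hφ
  set e : ℝ → Fin N → ℂ := fun t j => Complex.exp (-(Real.Gamma (1 - α / 2) *
    (t * s j ^ 2 * q j) ^ ((α / 2 : ℝ) : ℂ)) / N) with he
  have hre : ∀ t : ℝ, 0 ≤ t → ∀ j, 0 ≤ (t * s j ^ 2 * q j : ℂ).re := fun t ht j => by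
    have : (t * s j ^ 2 * q j : ℂ) = ((t * s j ^ 2 : ℝ) : ℂ) * q j := by push_cast; ring
    rw [this, Complex.re_ofReal_mul]
    exact mul_nonneg (by positivity) (hq j).le
  have hφ1 : ∀ t : ℝ, 0 ≤ t → ∀ j, ‖φ t j‖ ≤ 1 := fun t ht j => by
    refine (norm_integral_le_of_norm_le_const (Eventually.of_forall fun y =>
      norm_exp_neg_ofReal_mul_le_one (sq_nonneg _) (hre t ht j))).trans ?_
    simp
  have hsumY : ∀ t : ℝ, 0 ≤ t → ∏ j, e t j = Complex.exp (-((t ^ (α / 2) : ℝ) : ℂ) * Y) := by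
    intro t ht
    simp only [he]
    rw [← Complex.exp_sum, hY, Finset.mul_sum, Finset.mul_sum]
    congr 1
    refine Finset.sum_congr rfl fun j _ => ?_
    rw [cpow_ofReal_mul_sq_mul (by positivity) ht, mul_div_cancel₀ _ (two_ne_zero)]
    push_cast
    ring
  have hterm : ∀ j, 0 ≤ (((|s j| ^ α : ℝ) : ℂ) * q j ^ ((α / 2 : ℝ) : ℂ)).re := fun j => by
    rw [Complex.re_ofReal_mul]
    exact mul_nonneg (by positivity) (cpow_re_nonneg (by positivity) (by linarith) (hq j))
  have hYre : 0 ≤ Y.re := by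
    rw [hY, Complex.re_ofReal_mul, Complex.re_sum]
    exact mul_nonneg (by positivity) (Finset.sum_nonneg fun j _ => hterm j)
  have he1 : ∀ t : ℝ, 0 ≤ t → ∀ j, ‖e t j‖ ≤ 1 := fun t ht j => by
    simp only [he]
    rw [cpow_ofReal_mul_sq_mul (by positivity) ht, mul_div_cancel₀ _ (two_ne_zero)]
    have : -(Real.Gamma (1 - α / 2) * (((t ^ (α / 2) : ℝ) : ℂ) *
        (((|s j| ^ α : ℝ) : ℂ) * q j ^ ((α / 2 : ℝ) : ℂ)))) / N =
        -((Real.Gamma (1 - α / 2) * t ^ (α / 2) / N : ℝ) : ℂ) *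
          (((|s j| ^ α : ℝ) : ℂ) * q j ^ ((α / 2 : ℝ) : ℂ)) := by
      push_cast; ring
    rw [this]
    exact norm_exp_neg_ofReal_mul_le_one (by positivity) (hterm j)
  have hprod1 : ∀ t : ℝ, 0 ≤ t → ‖∏ j, φ t j‖ ≤ 1 := fun t ht =>
    (Finset.norm_prod_le _ _).trans (Finset.prod_le_one (fun _ _ => norm_nonneg _)
      fun j _ => hφ1 t ht j)
  -- For t > T the trivial bound 2 is below 2 e^{(t-T)η/2}. Half of the decay e^{-ηt} then suffices
  -- for integrability, and the factor e^{-Tη/2} makes the contribution small.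
  have hdiff : ∀ t : ℝ, 0 < t → ‖∏ j, φ t j - Complex.exp (-((t ^ (α / 2) : ℝ) : ℂ) * Y)‖ ≤
      ε₁ + 2 * Real.exp (-(T * (η / 2))) * Real.exp (t * (η / 2)) := by
    intro t ht
    rcases le_or_gt t T with htT | htT
    · refine le_add_of_le_of_nonneg ?_ (by positivity)
      rw [← hsumY t ht.le]
      refine (norm_prod_sub_prod_le_sum _ (hφ1 t ht.le) (he1 t ht.le)).trans ?_
      calc ∑ j, ‖φ t j - e t j‖ ≤ ∑ _j : Fin N, ε₁ / N := by
            refine Finset.sum_le_sum fun j _ => ?_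
            rw [le_div_iff₀ hNr, mul_comm]
            refine hN _ ?_ ?_
            · by_cases hsj : s j = 0
              · left; simp [hsj]
              · right
                have : (t * s j ^ 2 * q j : ℂ) = ((t * s j ^ 2 : ℝ) : ℂ) * q j := by push_cast; ring
                rw [this, Complex.re_ofReal_mul]
                exact mul_pos (by positivity) (hq j)
            · rw [norm_mul, norm_mul, Complex.norm_real, norm_pow, Complex.norm_real,
                Real.norm_of_nonneg ht.le, Real.norm_eq_abs]
              gcongr
              · exact hs j
              · exact hqη j
        _ = ε₁ := by simp; field_simp
    · refine le_add_of_nonneg_of_le hε₁0.le ?_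
      have h1 : ‖Complex.exp (-((t ^ (α / 2) : ℝ) : ℂ) * Y)‖ ≤ 1 :=
        norm_exp_neg_ofReal_mul_le_one (by positivity) hYre
      have h2 : 1 ≤ Real.exp (-(T * (η / 2))) * Real.exp (t * (η / 2)) := by
        rw [← Real.exp_add]
        refine Real.one_le_exp ?_
        nlinarith
      refine (norm_sub_le _ _).trans ?_
      have := hprod1 t ht.le
      linarith
  have hφm : ∀ j, Measurable fun t : ℝ => φ t j := fun j => by
    have h : StronglyMeasurable fun w : ℝ × ℝ =>
        Complex.exp (-((w.2 / a) ^ 2 : ℝ) * (w.1 * s j ^ 2 * q j)) :=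
      Measurable.stronglyMeasurable (by fun_prop)
    exact h.integral_prod_right'.measurable
  have hlapφ : IntegrableOn (fun t : ℝ => ((t ^ (β - 1) : ℝ) : ℂ) * Complex.exp (-(t : ℂ) * p) *
      ∏ j, φ t j) (Ioi 0) := by
    refine Integrable.mono' (integrableOn_rpow_mul_exp hβ hp0) ?_ ?_
    · refine Measurable.aestronglyMeasurable ?_
      have := Finset.measurable_prod Finset.univ fun j _ => hφm j
      fun_prop
    · filter_upwards [ae_restrict_mem measurableSet_Ioi] with t ht
      have ht' : 0 < t := ht
      rw [norm_mul, norm_mul, Complex.norm_real, Real.norm_of_nonneg (Real.rpow_nonneg ht'.le _),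
        Complex.norm_exp, ← Complex.ofReal_neg, Complex.re_ofReal_mul]
      refine (mul_le_of_le_one_right (by positivity) (hprod1 t ht'.le)).trans (le_of_eq ?_)
      congr 2
      ring
  have hmain := integral_inv_cpow_eq (ν := ν) (γ := α / 2) hβ hp0 (fun j => (hq j).le) s a
  have hsub : ‖(∫ t in Ioi (0 : ℝ), ((t ^ (β - 1) : ℝ) : ℂ) * Complex.exp (-(t : ℂ) * p) *
      ∏ j, φ t j) - laplaceInt β (α / 2) p Y‖ ≤ Real.Gamma β * ε := by
    rw [laplaceInt, ← integral_sub hlapφ (integrableOn_laplace_integrand hβ hp0 hYre)]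
    have hb : IntegrableOn (fun t : ℝ => ε₁ * (t ^ (β - 1) * Real.exp (-η * t)) +
        2 * Real.exp (-(T * (η / 2))) * (t ^ (β - 1) * Real.exp (-(η / 2) * t))) (Ioi 0) :=
      ((integrableOn_rpow_mul_exp hβ hη).const_mul _).add
        ((integrableOn_rpow_mul_exp hβ (half_pos hη)).const_mul _)
    refine (norm_integral_le_of_norm_le hb ?_).trans ?_
    · filter_upwards [ae_restrict_mem measurableSet_Ioi] with t ht
      have ht' : 0 < t := ht
      rw [← mul_sub, norm_mul, norm_mul, Complex.norm_real,
        Real.norm_of_nonneg (Real.rpow_nonneg ht'.le _), Complex.norm_exp, ← Complex.ofReal_neg,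
        Complex.re_ofReal_mul]
      have h1 : Real.exp (-t * p.re) ≤ Real.exp (-η * t) := Real.exp_le_exp.2 (by nlinarith)
      calc _ ≤ t ^ (β - 1) * Real.exp (-η * t) *
            (ε₁ + 2 * Real.exp (-(T * (η / 2))) * Real.exp (t * (η / 2))) := by
            gcongr
            exact hdiff t ht'
        _ = _ := by
            have : Real.exp (-(η / 2) * t) = Real.exp (-η * t) * Real.exp (t * (η / 2)) := by
              rw [← Real.exp_add]; congr 1; ring
            rw [this]
            ring
    · rw [integral_add ((integrableOn_rpow_mul_exp hβ hη).const_mul _)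
        ((integrableOn_rpow_mul_exp hβ (half_pos hη)).const_mul _), integral_const_mul,
        integral_const_mul, integral_rpow_mul_exp hβ hη, integral_rpow_mul_exp hβ (half_pos hη)]
      have h1 : ε₁ * (Real.Gamma β * η ^ (-β)) = Real.Gamma β * (ε / 2) := by
        rw [hε₁, Real.rpow_neg hη.le]
        field_simp
      have h2 := mul_le_mul_of_nonneg_left hT.le hG.le
      rw [h1]
      nlinarith
  have hGc : (Real.Gamma β : ℂ) ≠ 0 := by exact_mod_cast hG.ne'
  rw [← hmain] at hsub
  rw [← mul_le_mul_iff_right₀ hG]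
  refine le_trans (le_of_eq ?_) hsub
  rw [← Real.norm_of_nonneg hG.le, ← Complex.norm_real, ← norm_mul]
  simp only [Complex.norm_real, Real.norm_of_nonneg hG.le]
  congr 1
  field_simp

/-- The exact Schur denominator p is replaced by p', which keeps d and the diagonal part of the
quadratic form only. Both have real part at least η, where w^{-β} is bounded and Lipschitz, so the
error is governed by the diagonal entry and the off-diagonal form, each capped at 1. -/
theorem eventually_norm_integral_row_sub_le (hν : HeavyTailed α ν) (hα : 0 < α) (hα2 : α < 2)
    {β : ℝ} (hβ : 0 < β) {K η ε : ℝ} (hK : 0 ≤ K) (hη : 0 < η) (hε : 0 < ε) :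
    ∀ᶠ N : ℕ in atTop, ∀ H : Matrix (Fin N) (Fin N) ℝ, H.IsSymm → ∀ s : Fin N → ℝ,
      (∀ j, |s j| ≤ K) → ∀ s₀ : ℝ, |s₀| ≤ K → ∀ (k : Fin N) (z : ℂ), η ≤ z.im → ∀ d : ℝ,
        ‖(∫ x, (Complex.I * ((d + s₀ * (x k / scale ν N) : ℝ) - z - quad (resol H z)
          fun j => s j * (x j / scale ν N)))⁻¹ ^ (β : ℂ) ∂Measure.pi (fun _ : Fin N => ν)) -
          laplaceInt β (α / 2) (Complex.I * (d - z))
            (((Real.Gamma (1 - α / 2) / N : ℝ) : ℂ) *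
              ∑ j, ((|s j| ^ α : ℝ) : ℂ) * qres H z j ^ ((α / 2 : ℝ) : ℂ)) / Real.Gamma β‖ ≤ ε := by
  -- C dominates both twice the supremum of |w^{-β}| on Re w ≥ η and its Lipschitz constant there,
  -- so the same constant serves whether or not the minima are attained at 1.
  set C := 2 * η ^ (-β) + β * η ^ (-(β + 1)) with hC
  have hC0 : 0 < C := by positivity
  have hδ : 0 < ε / (4 * C) := by positivity
  filter_upwards [eventually_norm_integral_inv_cpow_sub_le hν hα hα2 hβ (K := K) hη (half_pos hε),
    eventually_integral_min_quad_le hν hα hα2 (K := K) hη hδ,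
    (integral_min_one_tendsto hν hK).eventually_lt_const hδ,
    (scale_tendsto_atTop hν).eventually_gt_atTop 0] with N h1 h2 h3 ha H hH s hs s₀ hs₀ k z hz d
  have hz0 : 0 < z.im := hη.trans_le hz
  set a := scale ν N
  have hq : ∀ j, 0 < (qres H z j).re := qres_re_pos hH hz0
  have hqη : ∀ j, ‖qres H z j‖ ≤ 1 / η := fun j =>
    (norm_qres_le hH hz0 j).trans (one_div_le_one_div_of_le hη hz)
  have hpre : η ≤ (Complex.I * ((d : ℂ) - z)).re := by rw [I_mul_sub_re]; exact hz
  specialize h1 _ hq hqη s hs _ hpre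
  specialize h2 H hH z hz s hs
  set p : (Fin N → ℝ) → ℂ := fun x => Complex.I * ((d + s₀ * (x k / a) : ℝ) - z - quad (resol H z)
          fun j => s j * (x j / a)) with hp
  set p' : (Fin N → ℝ) → ℂ := fun x => Complex.I * ((d : ℂ) - z) +
    ∑ j, (((s j * (x j / a)) ^ 2 : ℝ) : ℂ) * qres H z j with hp'
  have hpη : ∀ x, η ≤ (p x).re := fun x => by
    have := im_dotProduct_resol hH hz0 fun j => s j * (x j / a)
    have h0 : 0 ≤ z.im * ∑ i, ‖(resol H z).mulVec (fun i => ((s i * (x i / a) : ℝ) : ℂ)) i‖ ^ 2 := by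
      positivity
    rw [← this] at h0
    simp only [hp, Complex.I_mul_re, Complex.sub_im, Complex.ofReal_im, quad]
    linarith
  have hp'η : ∀ x, η ≤ (p' x).re := fun x => by
    simp only [hp', Complex.add_re, Complex.re_sum, Complex.re_ofReal_mul]
    exact le_add_of_le_of_nonneg hpre (Finset.sum_nonneg fun j _ =>
      mul_nonneg (sq_nonneg _) (hq j).le)
  have hpp' : ∀ x, p x - p' x = Complex.I * ((s₀ * (x k / a) : ℝ) -
      quad (offResol H z) fun j => s j * (x j / a)) := fun x => by
    simp only [hp, hp', quad_resol, qres]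
    push_cast
    have : ∑ j, ((s j : ℂ) * (x j / a)) ^ 2 * (-Complex.I * resol H z j j) =
        -Complex.I * ∑ j, ((s j : ℂ) * (x j / a)) ^ 2 * resol H z j j := by
      rw [Finset.mul_sum]
      exact Finset.sum_congr rfl fun j _ => by ring
    rw [this]
    ring
  have hpow : ∀ w : ℂ, η ≤ w.re → ‖w⁻¹ ^ (β : ℂ)‖ ≤ η ^ (-β) := fun w hw =>
    (norm_inv_cpow_le hβ (hη.trans_le hw)).trans
      (Real.rpow_le_rpow_of_nonpos hη hw (by linarith))
  have hpt : ∀ x, ‖(p x)⁻¹ ^ (β : ℂ) - (p' x)⁻¹ ^ (β : ℂ)‖ ≤ C * (min 1 (K * |x k| / a) +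
      min 1 ‖quad (offResol H z) fun j => s j * (x j / a)‖) := by
    intro x
    have e1 : ‖(p x)⁻¹ ^ (β : ℂ) - (p' x)⁻¹ ^ (β : ℂ)‖ ≤ C * 1 := by
      refine (norm_sub_le _ _).trans ?_
      have := hpow _ (hpη x)
      have := hpow _ (hp'η x)
      have : 0 < β * η ^ (-(β + 1)) := by positivity
      rw [hC]
      linarith
    have e2 : ‖(p x)⁻¹ ^ (β : ℂ) - (p' x)⁻¹ ^ (β : ℂ)‖ ≤ C * (K * |x k| / a +
        ‖quad (offResol H z) fun j => s j * (x j / a)‖) := by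
      refine (norm_inv_cpow_sub_le hβ hη (hpη x) (hp'η x)).trans ?_
      have e3 : ‖p x - p' x‖ ≤ K * |x k| / a + ‖quad (offResol H z) fun j => s j * (x j / a)‖ := by
        rw [hpp', norm_mul, Complex.norm_I, one_mul]
        refine (norm_sub_le _ _).trans (add_le_add_left ?_ _)
        rw [Complex.norm_real, Real.norm_eq_abs, abs_mul, abs_div, abs_of_pos ha, mul_div_assoc]
        gcongr
      refine mul_le_mul ?_ e3 (norm_nonneg _) hC0.le
      rw [hC]
      have : 0 < η ^ (-β) := by positivity
      linarith
    rcases min_choice 1 (K * |x k| / a) with h | h <;>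
      rcases min_choice 1 ‖quad (offResol H z) fun j => s j * (x j / a)‖ with h' | h'
    · rw [h, h']; nlinarith
    · rw [h]; exact e1.trans (by gcongr; exact le_add_of_nonneg_right (by positivity))
    · rw [h']
      refine e1.trans (mul_le_mul_of_nonneg_left ?_ hC0.le)
      exact le_add_of_nonneg_left (by positivity)
    · rw [h, h']; exact e2
  have hquadm : ∀ M : Matrix (Fin N) (Fin N) ℂ, Measurable fun x : Fin N → ℝ =>
      quad M fun j => s j * (x j / a) := fun M => by
    simp only [quad_eq_sum]; fun_prop
  have hpm : Measurable p := by
    have := hquadm (resol H z)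
    simp only [hp]; fun_prop
  have hp'm : Measurable p' := by simp only [hp']; fun_prop
  have hpi : ∀ w : (Fin N → ℝ) → ℂ, Measurable w → (∀ x, η ≤ (w x).re) →
      Integrable (fun x => (w x)⁻¹ ^ (β : ℂ)) (Measure.pi (fun _ : Fin N => ν)) := fun w hw hw' =>
    Integrable.of_bound (hw.inv.pow_const _).aestronglyMeasurable _
      (Eventually.of_forall fun x => hpow _ (hw' x))
  have hm1 : Integrable (fun x : Fin N → ℝ => min 1 (K * |x k| / a))
      (Measure.pi (fun _ : Fin N => ν)) := by
    refine Integrable.of_bound (C := 1) (Measurable.aestronglyMeasurable (by fun_prop))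
      (Eventually.of_forall fun x => ?_)
    rw [Real.norm_of_nonneg (by positivity)]
    exact min_le_left _ _
  have hm2 : Integrable (fun x : Fin N → ℝ => min 1 ‖quad (offResol H z) fun j => s j * (x j / a)‖)
      (Measure.pi (fun _ : Fin N => ν)) := by
    have := hquadm (offResol H z)
    refine Integrable.of_bound (C := 1) (Measurable.aestronglyMeasurable (by fun_prop))
      (Eventually.of_forall fun x => ?_)
    rw [Real.norm_of_nonneg (by positivity)]
    exact min_le_left _ _
  have hdrop : ‖(∫ x, (p x)⁻¹ ^ (β : ℂ) ∂Measure.pi (fun _ : Fin N => ν)) -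
      ∫ x, (p' x)⁻¹ ^ (β : ℂ) ∂Measure.pi (fun _ : Fin N => ν)‖ ≤ ε / 2 := by
    rw [← integral_sub (hpi p hpm hpη) (hpi p' hp'm hp'η)]
    refine (norm_integral_le_of_norm_le ((hm1.add hm2).const_mul C)
      (Eventually.of_forall hpt)).trans ?_
    simp only [Pi.add_apply]
    rw [integral_const_mul, integral_add hm1 hm2]
    have e4 : ∫ x : Fin N → ℝ, min 1 (K * |x k| / a) ∂Measure.pi (fun _ : Fin N => ν) =
        ∫ t, min 1 (K * |t| / a) ∂ν :=
      integral_comp_eval (μ := fun _ : Fin N => ν) (i := k) (f := fun t => min 1 (K * |t| / a))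
        (Measurable.aestronglyMeasurable (by fun_prop))
    rw [e4]
    calc _ ≤ C * (ε / (4 * C) + ε / (4 * C)) := by gcongr
      _ = ε / 2 := by field_simp; ring
  have := norm_sub_le_norm_sub_add_norm_sub (∫ x, (p x)⁻¹ ^ (β : ℂ) ∂Measure.pi (fun _ : Fin N => ν))
    (∫ x, (p' x)⁻¹ ^ (β : ℂ) ∂Measure.pi (fun _ : Fin N => ν))
    (laplaceInt β (α / 2) (Complex.I * (d - z))
            (((Real.Gamma (1 - α / 2) / N : ℝ) : ℂ) *
              ∑ j, ((|s j| ^ α : ℝ) : ℂ) * qres H z j ^ ((α / 2 : ℝ) : ℂ)) / Real.Gamma β)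
  linarith

end Row

/-! ### The ensemble on its canonical product space -/

section Ensemble

open Matrix

/-- The index set of the independent entries: the unordered pairs for the heavy tailed entries and
the indices for the diagonal perturbation. -/
abbrev EnsIdx (N : ℕ) : Type := Sym2 (Fin N) ⊕ Fin N

/-- The laws of the independent entries. -/
def ensLaw (ν μD : Measure ℝ) (N : ℕ) : EnsIdx N → Measure ℝ := Sum.elim (fun _ => ν) fun _ => μD

/-- The random matrix as a function of its independent entries. -/
def ens {N : ℕ} (s : Matrix (Fin N) (Fin N) ℝ) (a : ℝ) (ω : EnsIdx N → ℝ) :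
    Matrix (Fin N) (Fin N) ℝ :=
  Matrix.of (fun i j => a⁻¹ * (s i j * ω (Sum.inl s(i, j)))) + Matrix.diagonal fun i => ω (Sum.inr i)

/-- The entries in row or column `k`. -/
def rowBlock {N : ℕ} (k : Fin N) : Finset (EnsIdx N) :=
  (Finset.univ.filter fun e => k ∈ e).disjSum {k}

variable {N : ℕ} {s : Matrix (Fin N) (Fin N) ℝ}

theorem inl_mem_rowBlock {k : Fin N} {e : Sym2 (Fin N)} : Sum.inl e ∈ rowBlock k ↔ k ∈ e := by
  simp [rowBlock]

theorem inr_mem_rowBlock {k i : Fin N} : Sum.inr i ∈ rowBlock k ↔ i = k := by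
  simp [rowBlock]

theorem exists_mem_rowBlock (e : EnsIdx N) : ∃ k, e ∈ rowBlock k := by
  rcases e with e | i
  · induction e using Sym2.ind with
    | _ i j => exact ⟨i, by simp [inl_mem_rowBlock]⟩
  · exact ⟨i, by simp [inr_mem_rowBlock]⟩

theorem ens_isSymm (hs : s.IsSymm) (a : ℝ) (ω : EnsIdx N → ℝ) : (ens s a ω).IsSymm := by
  rw [ens, Matrix.IsSymm, transpose_add, diagonal_transpose]
  congr 1
  ext i j
  simp [hs.apply i j, Sym2.eq_swap]

theorem continuous_ens (s : Matrix (Fin N) (Fin N) ℝ) (a : ℝ) : Continuous (ens s a) := by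
  unfold ens
  refine Continuous.add ?_ ?_
  · exact continuous_matrix fun i j => by simp only [of_apply]; fun_prop
  · exact Continuous.matrix_diagonal (by fun_prop)

theorem continuous_qres_ens (hs : s.IsSymm) (a : ℝ) {z : ℂ} (hz : 0 < z.im) (k : Fin N) :
    Continuous fun ω => qres (ens s a ω) z k :=
  continuous_const.mul (continuous_resol (continuous_ens s a) continuous_const
    (fun ω => ens_isSymm hs a ω) (fun _ => hz) k k)

/-- The matrix without row k does not depend on the entries of that row: this is the independence
used in the cavity argument, and also what bounds the effect of resampling a row. -/
theorem zeroSet_ens_piecewise (s : Matrix (Fin N) (Fin N) ℝ) (a : ℝ) (k : Fin N)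
    (y x : EnsIdx N → ℝ) :
    zeroSet (ens s a ((rowBlock k).piecewise y x)) {k} = zeroSet (ens s a x) {k} := by
  ext i j
  simp only [zeroSet, of_apply, Finset.mem_singleton]
  split_ifs with h
  · rfl
  · push Not at h
    have h1 : Sum.inl s(i, j) ∉ rowBlock k := by
      rw [inl_mem_rowBlock, Sym2.mem_iff]
      push Not
      exact ⟨h.1.symm, h.2.symm⟩
    have h2 : ∀ l, l ≠ k → Sum.inr l ∉ rowBlock k := fun l hl => by
      rwa [inr_mem_rowBlock]
    simp only [ens, Matrix.add_apply, of_apply, diagonal_apply,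
      Finset.piecewise_eq_of_notMem _ _ _ h1, Finset.piecewise_eq_of_notMem _ _ _ (h2 i h.1)]

/-- Schur's formula after resampling row k: the row comes from y, while the resolvent of the
remaining matrix comes from x and is frozen. -/
theorem qres_ens_piecewise (hs : s.IsSymm) (a : ℝ) {z : ℂ} (hz : 0 < z.im) (k : Fin N)
    (y x : EnsIdx N → ℝ) :
    qres (ens s a ((rowBlock k).piecewise y x)) z k =
      (Complex.I * ((y (Sum.inr k) + s k k * (y (Sum.inl s(k, k)) / a) : ℝ) - z -
        quad (resol (zeroSet (ens s a x) {k}) z) fun j =>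
          (if j = k then 0 else s k j) * (y (Sum.inl s(k, j)) / a)))⁻¹ := by
  have h := resol_diag_schur (ens_isSymm hs a ((rowBlock k).piecewise y x)) hz k
  have h1 : ∀ j, Sum.inl s(k, j) ∈ rowBlock k := fun j => by simp [inl_mem_rowBlock]
  have h2 : Sum.inr k ∈ rowBlock k := inr_mem_rowBlock.2 rfl
  have hoff : offRow (ens s a ((rowBlock k).piecewise y x)) k = fun j =>
      (if j = k then 0 else s k j) * (y (Sum.inl s(k, j)) / a) := by
    ext j
    by_cases hj : j = k
    · simp [offRow, hj]
    · simp only [offRow, hj, if_false, ens, Matrix.add_apply, of_apply,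
        Finset.piecewise_eq_of_mem _ _ _ (h1 j), diagonal_apply_ne' _ hj]
      ring
  have hkk : ens s a ((rowBlock k).piecewise y x) k k =
      y (Sum.inr k) + s k k * (y (Sum.inl s(k, k)) / a) := by
    simp only [ens, Matrix.add_apply, of_apply, Finset.piecewise_eq_of_mem _ _ _ (h1 k),
      diagonal_apply_eq, Finset.piecewise_eq_of_mem _ _ _ h2]
    ring
  rw [zeroSet_ens_piecewise, hkk, hoff] at h
  rw [mul_inv, Complex.inv_I, qres]
  congr 1
  exact eq_inv_of_mul_eq_one_left h

variable (ν μD : Measure ℝ) [IsProbabilityMeasure ν] [IsProbabilityMeasure μD]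

instance isProbabilityMeasure_ensLaw (e : EnsIdx N) : IsProbabilityMeasure (ensLaw ν μD N e) := by
  rcases e with e | i
  · exact ‹IsProbabilityMeasure ν›
  · exact ‹IsProbabilityMeasure μD›

theorem measurePreserving_comp_injective {ι κ : Type*} [Fintype ι] [Fintype κ] (μ : ι → Measure ℝ)
    [∀ i, IsProbabilityMeasure (μ i)] {f : κ → ι} (hf : Function.Injective f) :
    MeasurePreserving (fun (y : ι → ℝ) j => y (f j)) (Measure.pi μ) (Measure.pi fun j => μ (f j)) := by
  classical
  have hm : Measurable fun (y : ι → ℝ) j => y (f j) := by fun_prop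
  refine ⟨hm, (Measure.pi_eq fun t ht => ?_).symm⟩
  rw [Measure.map_apply hm (MeasurableSet.univ_pi ht)]
  have h : (fun (y : ι → ℝ) j => y (f j)) ⁻¹' univ.pi t =
      univ.pi fun i => ⋂ j, ⋂ (_ : f j = i), t j := by
    ext y
    simp only [mem_preimage, Set.mem_pi, mem_univ, true_implies, mem_iInter]
    exact ⟨fun h i j hj => hj ▸ h j, fun h j => h _ j rfl⟩
  rw [h, Measure.pi_pi]
  rw [← Finset.prod_subset (Finset.subset_univ (Finset.univ.map ⟨f, hf⟩)), Finset.prod_map]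
  · refine Finset.prod_congr rfl fun j _ => ?_
    congr 1
    ext x
    simp only [mem_iInter, Function.Embedding.coeFn_mk]
    exact ⟨fun h => h j rfl, fun h j' hj' => hf hj' ▸ h⟩
  · intro i _ hi
    have : (⋂ j, ⋂ (_ : f j = i), t j) = univ := by
      ext x
      simp only [mem_iInter, mem_univ, iff_true]
      intro j hj
      exact absurd (by simp [← hj]) hi
    rw [this, measure_univ]

/-- The map j ↦ {k, j} is injective, so the entries of one row are genuinely i.i.d. of law ν, and
they are independent of the diagonal perturbation. -/
theorem integral_row_eq (k : Fin N) {G : (Fin N → ℝ) → ℝ → ℂ}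
    (hG : Measurable (Function.uncurry G)) {C : ℝ} (hC : ∀ x d, ‖G x d‖ ≤ C) :
    ∫ y, G (fun j => y (Sum.inl s(k, j))) (y (Sum.inr k)) ∂Measure.pi (ensLaw ν μD N) =
      ∫ d, ∫ x, G x d ∂Measure.pi (fun _ : Fin N => ν) ∂μD := by
  classical
  have hGm : Measurable fun y : EnsIdx N → ℝ => G (fun j => y (Sum.inl s(k, j))) (y (Sum.inr k)) := by
    have h : Measurable fun y : EnsIdx N → ℝ =>
        ((fun j => y (Sum.inl s(k, j)) : Fin N → ℝ), y (Sum.inr k)) := by fun_prop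
    exact hG.comp h
  have hinj : Function.Injective fun j : Fin N => (Sum.inl s(k, j) : EnsIdx N) := by
    intro i j hij
    have := Sum.inl.inj hij
    exact Sym2.congr_right.1 this
  have hmp := measurePreserving_comp_injective (ensLaw ν μD N) hinj
  rw [integral_eq_integral_piecewise (ensLaw ν μD N) {Sum.inr k} hGm fun _ => hC _ _]
  have h1 : ∀ x y : EnsIdx N → ℝ, G (fun j => ({Sum.inr k} : Finset (EnsIdx N)).piecewise y x
      (Sum.inl s(k, j))) (({Sum.inr k} : Finset (EnsIdx N)).piecewise y x (Sum.inr k)) =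
      G (fun j => x (Sum.inl s(k, j))) (y (Sum.inr k)) := by
    intro x y
    simp
  simp only [h1]
  have h2 : ∀ x : EnsIdx N → ℝ, ∫ y : EnsIdx N → ℝ, G (fun j => x (Sum.inl s(k, j))) (y (Sum.inr k))
      ∂Measure.pi (ensLaw ν μD N) = ∫ d, G (fun j => x (Sum.inl s(k, j))) d ∂μD := fun x =>
    integral_comp_eval (μ := ensLaw ν μD N) (i := Sum.inr k)
      (f := fun d => G (fun j => x (Sum.inl s(k, j))) d)
      (hG.comp (measurable_const.prodMk measurable_id)).aestronglyMeasurable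
  simp only [h2]
  have h3 : StronglyMeasurable fun x : Fin N → ℝ => ∫ d, G x d ∂μD :=
    hG.stronglyMeasurable.integral_prod_right
  have h4 := integral_map (φ := fun (y : EnsIdx N → ℝ) (j : Fin N) => y (Sum.inl s(k, j)))
    (μ := Measure.pi (ensLaw ν μD N)) hmp.measurable.aemeasurable
    (f := fun x => ∫ d, G x d ∂μD) h3.aestronglyMeasurable
  rw [hmp.map_eq] at h4
  rw [← h4]
  exact integral_integral_swap (Integrable.of_bound hG.aestronglyMeasurable C
    (Eventually.of_forall fun _ => hC _ _))

/-- Concentration of weighted sums of powers. Resampling a row moves the q_j by at most 4/η in ℓ¹,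
hence the sum of the powers regularised by δ by a constant, and Efron–Stein over the N rows gives
the √N term. Removing the regularisation costs δ^γ for each sample value and each mean, whence the
first term. -/
theorem integral_norm_mean_cpow_sub_le (hs : s.IsSymm) (a : ℝ) (hN : 0 < N) {γ : ℝ} (hγ : 0 < γ)
    (hγ1 : γ < 1) {z : ℂ} {η : ℝ} (hη : 0 < η) (hz : η ≤ z.im) {w : Fin N → ℝ} {W : ℝ}
    (hw : ∀ j, |w j| ≤ W) {δ : ℝ} (hδ : 0 < δ) :
    ∫ x, ‖∑ j, (w j : ℂ) * (qres (ens s a x) z j ^ (γ : ℂ) -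
      ∫ y, qres (ens s a y) z j ^ (γ : ℂ) ∂Measure.pi (ensLaw ν μD N))‖
        ∂Measure.pi (ensLaw ν μD N) ≤
      N * (2 * W * δ ^ γ) + W * (γ * δ ^ (γ - 1)) * (4 / η) * √N := by
  have hz0 : 0 < z.im := hη.trans_le hz
  have hW : 0 ≤ W := (abs_nonneg _).trans (hw ⟨0, hN⟩)
  set P := Measure.pi (ensLaw ν μD N) with hP
  set Q : Fin N → (EnsIdx N → ℝ) → ℂ := fun j x => qres (ens s a x) z j with hQ
  have hQre : ∀ j x, 0 < (Q j x).re := fun j x => qres_re_pos (ens_isSymm hs a x) hz0 j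
  have hQn : ∀ j x, ‖Q j x‖ ≤ 1 / η := fun j x => (norm_qres_le (ens_isSymm hs a x) hz0 j).trans
    (one_div_le_one_div_of_le hη hz)
  have hQm : ∀ j, Measurable (Q j) := fun j => (continuous_qres_ens hs a hz0 j).measurable
  have hbd : ∀ j x, ‖(Q j x + δ) ^ (γ : ℂ)‖ ≤ (1 / η + δ) ^ γ := fun j x =>
    norm_cpow_ofReal_le hγ ((norm_add_le _ _).trans (by
      rw [Complex.norm_real, Real.norm_of_nonneg hδ.le]
      linarith [hQn j x]))
  have hbd0 : ∀ j x, ‖Q j x ^ (γ : ℂ)‖ ≤ (1 / η) ^ γ := fun j x => norm_cpow_ofReal_le hγ (hQn j x)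
  have hint0 : ∀ j, Integrable (fun x => Q j x ^ (γ : ℂ)) P := fun j =>
    Integrable.of_bound ((hQm j).pow_const _).aestronglyMeasurable _ (Eventually.of_forall (hbd0 j))
  have hIntδ : ∀ j, Integrable (fun x => (Q j x + δ) ^ (γ : ℂ)) P := fun j =>
    Integrable.of_bound (((hQm j).add_const _).pow_const _).aestronglyMeasurable _
      (Eventually.of_forall (hbd j))
  set F : (EnsIdx N → ℝ) → ℂ := fun x => ∑ j, (w j : ℂ) * (Q j x + δ) ^ (γ : ℂ) with hF
  have hFm : Measurable F := Finset.measurable_sum _ fun j _ =>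
    (((hQm j).add_const _).pow_const _).const_mul _
  have hFC : ∀ x, ‖F x‖ ≤ ∑ _j : Fin N, W * (1 / η + δ) ^ γ := fun x =>
    (norm_sum_le _ _).trans (Finset.sum_le_sum fun j _ => by
      rw [norm_mul, Complex.norm_real]
      exact mul_le_mul (hw j) (hbd j x) (norm_nonneg _) hW)
  set c := W * (γ * δ ^ (γ - 1)) * (4 / η) with hc
  have hc0 : 0 ≤ c := by positivity
  have hdiff : ∀ (k : Fin N) (x y : EnsIdx N → ℝ), ‖F x - F ((rowBlock k).piecewise y x)‖ ≤ c := by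
    intro k x y
    have h1 := sum_norm_resol_sub_le (ens_isSymm hs a x)
      (ens_isSymm hs a ((rowBlock k).piecewise y x)) hz0 (zeroSet_ens_piecewise s a k y x).symm
    have h2 : ∑ j, ‖Q j x - Q j ((rowBlock k).piecewise y x)‖ ≤ 4 / η := by
      refine le_trans (le_of_eq (Finset.sum_congr rfl fun j _ => ?_))
        (h1.trans (div_le_div_of_nonneg_left (by norm_num) hη hz))
      simp only [hQ, qres]
      rw [← mul_sub, norm_mul]
      simp
    simp only [hF]
    rw [← Finset.sum_sub_distrib]
    refine (norm_sum_le _ _).trans ?_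
    calc _ ≤ ∑ j, W * (γ * δ ^ (γ - 1) * ‖Q j x - Q j ((rowBlock k).piecewise y x)‖) := by
          refine Finset.sum_le_sum fun j _ => ?_
          rw [← mul_sub, norm_mul, Complex.norm_real]
          exact mul_le_mul (hw j) (norm_add_cpow_sub_add_cpow_le hγ hγ1 (hQre _ _).le (hQre _ _).le hδ)
            (norm_nonneg _) hW
      _ = W * (γ * δ ^ (γ - 1)) * ∑ j, ‖Q j x - Q j ((rowBlock k).piecewise y x)‖ := by
          rw [← Finset.mul_sum, ← Finset.mul_sum]; ring
      _ ≤ c := by rw [hc]; gcongr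
  have hES := integral_norm_sub_integral_sq_le_of_bdd_diff (ensLaw ν μD N) rowBlock
    exists_mem_rowBlock hFm hFC hdiff
  rw [Fintype.card_fin] at hES
  have hEFm : Measurable fun x => ‖F x - ∫ y, F y ∂P‖ := (hFm.sub_const _).norm
  have hEFb : ∀ x, ‖F x - ∫ y, F y ∂P‖ ≤ (∑ _j : Fin N, W * (1 / η + δ) ^ γ) + ‖∫ y, F y ∂P‖ :=
    fun x => (norm_sub_le _ _).trans (by gcongr; exact hFC x)
  have hEi : Integrable (fun x => ‖F x - ∫ y, F y ∂P‖) P :=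
    Integrable.of_bound hEFm.aestronglyMeasurable _ (Eventually.of_forall fun x => by
      rw [norm_norm]; exact hEFb x)
  have hEi2 : Integrable (fun x => ‖F x - ∫ y, F y ∂P‖ ^ 2) P :=
    Integrable.of_bound (hEFm.pow_const 2).aestronglyMeasurable _ (Eventually.of_forall fun x => by
      rw [Real.norm_of_nonneg (by positivity)]
      exact pow_le_pow_left₀ (norm_nonneg _) (hEFb x) 2)
  have hconc : ∫ x, ‖F x - ∫ y, F y ∂P‖ ∂P ≤ c * √N := by
    refine (abs_le_of_sq_le_sq' ((sq_integral_le hEi hEi2).trans (hES.trans (le_of_eq ?_)))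
      (by positivity)).2
    rw [mul_pow c, Real.sq_sqrt (by positivity)]
    ring
  have hEF : ∫ y, F y ∂P = ∑ j, (w j : ℂ) * ∫ y, (Q j y + δ) ^ (γ : ℂ) ∂P := by
    simp only [hF]
    rw [integral_finsetSum _ fun j _ => (hIntδ j).const_mul _]
    simp only [integral_const_mul]
  have hreg : ∀ j x, ‖(Q j x + δ) ^ (γ : ℂ) - Q j x ^ (γ : ℂ)‖ ≤ δ ^ γ := fun j x =>
    norm_add_cpow_sub_cpow_le hγ hγ1 (hQre j x) hδ.le
  have hregE : ∀ j, ‖(∫ y, (Q j y + δ) ^ (γ : ℂ) ∂P) - ∫ y, Q j y ^ (γ : ℂ) ∂P‖ ≤ δ ^ γ := fun j => by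
    rw [← integral_sub (hIntδ j) (hint0 j)]
    refine (norm_integral_le_of_norm_le_const (Eventually.of_forall (hreg j))).trans ?_
    simp
  have hpt : ∀ x, ‖∑ j, (w j : ℂ) * (Q j x ^ (γ : ℂ) - ∫ y, Q j y ^ (γ : ℂ) ∂P)‖ ≤
      ‖F x - ∫ y, F y ∂P‖ + N * (2 * W * δ ^ γ) := by
    intro x
    have e : ∑ j, (w j : ℂ) * (Q j x ^ (γ : ℂ) - ∫ y, Q j y ^ (γ : ℂ) ∂P) =
        (F x - ∫ y, F y ∂P) + ∑ j, (w j : ℂ) * (((∫ y, (Q j y + δ) ^ (γ : ℂ) ∂P) -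
          ∫ y, Q j y ^ (γ : ℂ) ∂P) - ((Q j x + δ) ^ (γ : ℂ) - Q j x ^ (γ : ℂ))) := by
      rw [hEF]
      simp only [hF]
      rw [← Finset.sum_sub_distrib, ← Finset.sum_add_distrib]
      exact Finset.sum_congr rfl fun j _ => by ring
    rw [e]
    refine (norm_add_le _ _).trans (add_le_add_right ?_ _)
    refine (norm_sum_le _ _).trans ((Finset.sum_le_sum (g := fun _ => 2 * W * δ ^ γ)
      fun j _ => ?_).trans (by simp))
    rw [norm_mul, Complex.norm_real]
    calc _ ≤ W * (δ ^ γ + δ ^ γ) := mul_le_mul (hw j)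
          ((norm_sub_le _ _).trans (add_le_add (hregE j) (hreg j x))) (norm_nonneg _) hW
      _ = _ := by ring
  calc _ ≤ ∫ x, (‖F x - ∫ y, F y ∂P‖ + N * (2 * W * δ ^ γ)) ∂P :=
        integral_mono_of_nonneg (Eventually.of_forall fun x => norm_nonneg _)
          (hEi.add (integrable_const _)) (Eventually.of_forall hpt)
    _ = (∫ x, ‖F x - ∫ y, F y ∂P‖ ∂P) + N * (2 * W * δ ^ γ) := by
        rw [integral_add hEi (integrable_const _)]
        simp
    _ ≤ _ := by linarith

end Ensemble

/-! ### The approximate fixed point equation -/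

section Cavity

open Matrix

variable {α : ℝ} {ν : Measure ℝ} [IsProbabilityMeasure ν]

/-- A Hölder type estimate with a free parameter: δ is kept fixed while the ℓ¹ sum of the
differences is divided by N, and is sent to 0 only afterwards. -/
theorem norm_cpow_sub_cpow_le {γ : ℝ} (hγ : 0 < γ) (hγ1 : γ < 1) {q q' : ℂ} (hq : 0 < q.re)
    (hq' : 0 < q'.re) {δ : ℝ} (hδ : 0 < δ) :
    ‖q ^ (γ : ℂ) - q' ^ (γ : ℂ)‖ ≤ 2 * δ ^ γ + γ * δ ^ (γ - 1) * ‖q - q'‖ := by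
  have h1 := norm_add_cpow_sub_cpow_le hγ hγ1 hq hδ.le
  have h2 := norm_add_cpow_sub_cpow_le hγ hγ1 hq' hδ.le
  have h3 := norm_add_cpow_sub_add_cpow_le hγ hγ1 hq.le hq'.le hδ
  have e : q ^ (γ : ℂ) - q' ^ (γ : ℂ) = -((q + δ) ^ (γ : ℂ) - q ^ (γ : ℂ)) +
      ((q + δ) ^ (γ : ℂ) - (q' + δ) ^ (γ : ℂ)) + ((q' + δ) ^ (γ : ℂ) - q' ^ (γ : ℂ)) := by ring
  rw [e]
  refine (norm_add₃_le).trans ?_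
  rw [norm_neg]
  linarith

/-- The expectation of a power of a diagonal resolvent entry of the ensemble. -/
def meanPow (ν μD : Measure ℝ) {N : ℕ} (s : Matrix (Fin N) (Fin N) ℝ) (β : ℝ) (z : ℂ) (k : Fin N) : ℂ :=
  ∫ ω, qres (ens s (scale ν N) ω) z k ^ (β : ℂ) ∂Measure.pi (ensLaw ν μD N)

variable {N : ℕ} {s : Matrix (Fin N) (Fin N) ℝ}

theorem integrable_qres_cpow (μD : Measure ℝ) [IsProbabilityMeasure μD] (hs : s.IsSymm) (a : ℝ)
    {β : ℝ} (hβ : 0 < β) {z : ℂ} (hz : 0 < z.im) (k : Fin N) :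
    Integrable (fun ω => qres (ens s a ω) z k ^ (β : ℂ)) (Measure.pi (ensLaw ν μD N)) :=
  Integrable.of_bound ((continuous_qres_ens hs a hz k).measurable.pow_const _).aestronglyMeasurable
    ((1 / z.im) ^ β) (Eventually.of_forall fun ω =>
      norm_cpow_ofReal_le hβ (norm_qres_le (ens_isSymm hs a ω) hz k))

theorem norm_meanPow_le (μD : Measure ℝ) [IsProbabilityMeasure μD] (hs : s.IsSymm)
    {β : ℝ} (hβ : 0 < β) {z : ℂ} (hz : 0 < z.im) (k : Fin N) :
    ‖meanPow ν μD s β z k‖ ≤ (1 / z.im) ^ β := by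
  refine (norm_integral_le_of_norm_le_const (Eventually.of_forall fun ω =>
      norm_cpow_ofReal_le hβ (norm_qres_le (ens_isSymm hs _ ω) hz k))).trans ?_
  simp

theorem meanPow_re_nonneg (μD : Measure ℝ) [IsProbabilityMeasure μD] (hs : s.IsSymm)
    {β : ℝ} (hβ : 0 < β) (hβ1 : β ≤ 1) {z : ℂ} (hz : 0 < z.im) (k : Fin N) :
    0 ≤ (meanPow ν μD s β z k).re := by
  have h : (meanPow ν μD s β z k).re = ∫ ω, (qres (ens s (scale ν N) ω) z k ^ (β : ℂ)).re
      ∂Measure.pi (ensLaw ν μD N) := (integral_re (integrable_qres_cpow μD hs _ hβ hz k)).symm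
  rw [h]
  exact integral_nonneg fun ω => cpow_re_nonneg hβ.le hβ1 (qres_re_pos (ens_isSymm hs _ ω) hz k)

/-- The argument of `psi` in the approximate fixed point equation. -/
def cavityField (α : ℝ) (ν μD : Measure ℝ) {N : ℕ} (s : Matrix (Fin N) (Fin N) ℝ) (z : ℂ)
    (k : Fin N) : ℂ :=
  ((Real.Gamma (1 - α / 2) / N : ℝ) : ℂ) * ∑ j, ((|s k j| ^ α : ℝ) : ℂ) * meanPow ν μD s (α / 2) z j

theorem cavityField_re_nonneg (hα : 0 < α) (hα2 : α < 2) (μD : Measure ℝ) [IsProbabilityMeasure μD]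
    (hs : s.IsSymm) {z : ℂ} (hz : 0 < z.im) (k : Fin N) : 0 ≤ (cavityField α ν μD s z k).re := by
  have hc : 0 < Real.Gamma (1 - α / 2) := Real.Gamma_pos_of_pos (by linarith)
  rw [cavityField, Complex.re_ofReal_mul, Complex.re_sum]
  refine mul_nonneg (by positivity) (Finset.sum_nonneg fun j _ => ?_)
  rw [Complex.re_ofReal_mul]
  exact mul_nonneg (by positivity) (meanPow_re_nonneg μD hs (by positivity) (by linarith) hz j)

/-- Three replacements lead from the random field of the matrix without row k to its deterministic
counterpart: putting back the index k, putting back row k in the resolvent, and passing to the mean.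
The last two use the regularisation by δ, each contributing 2δ^{α/2}. -/
theorem integral_norm_cavity_sub_le (hα : 0 < α) (hα2 : α < 2) (μD : Measure ℝ)
    [IsProbabilityMeasure μD] (hs : s.IsSymm) {K : ℝ} (hK : ∀ i j, |s i j| ≤ K) {z : ℂ} {η : ℝ}
    (hη : 0 < η) (hz : η ≤ z.im) (k : Fin N) {δ : ℝ} (hδ : 0 < δ) :
    Integrable (fun x => ‖((Real.Gamma (1 - α / 2) / N : ℝ) : ℂ) *
      (∑ j, ((|if j = k then 0 else s k j| ^ α : ℝ) : ℂ) *
        qres (zeroSet (ens s (scale ν N) x) {k}) z j ^ ((α / 2 : ℝ) : ℂ)) -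
        cavityField α ν μD s z k‖) (Measure.pi (ensLaw ν μD N)) ∧
    ∫ x, ‖((Real.Gamma (1 - α / 2) / N : ℝ) : ℂ) *
      (∑ j, ((|if j = k then 0 else s k j| ^ α : ℝ) : ℂ) *
        qres (zeroSet (ens s (scale ν N) x) {k}) z j ^ ((α / 2 : ℝ) : ℂ)) -
        cavityField α ν μD s z k‖ ∂Measure.pi (ensLaw ν μD N) ≤
      Real.Gamma (1 - α / 2) * K ^ α * (4 * δ ^ (α / 2) +
        (α / 2 * δ ^ (α / 2 - 1) / η + (1 / η) ^ (α / 2)) * (1 / N) +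
        α / 2 * δ ^ (α / 2 - 1) * (4 / η) * (√N)⁻¹) := by
  have hc : 0 < Real.Gamma (1 - α / 2) := Real.Gamma_pos_of_pos (by linarith)
  set c := Real.Gamma (1 - α / 2)
  set γ := α / 2 with hγdef
  have hγ : 0 < γ := by positivity
  have hγ1 : γ < 1 := by linarith
  have hz0 : 0 < z.im := hη.trans_le hz
  have hN : 0 < N := k.pos
  have hNr : (0 : ℝ) < N := by exact_mod_cast hN
  have hK0 : 0 ≤ K := (abs_nonneg _).trans (hK k k)
  set P := Measure.pi (ensLaw ν μD N) with hP
  set a := scale ν N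
  set Q : Fin N → (EnsIdx N → ℝ) → ℂ := fun j x => qres (ens s a x) z j with hQ
  set Q' : Fin N → (EnsIdx N → ℝ) → ℂ := fun j x => qres (zeroSet (ens s a x) {k}) z j with hQ'
  set w : Fin N → ℝ := fun j => |s k j| ^ α with hw
  have hwK : ∀ j, |w j| ≤ K ^ α := fun j => by
    rw [abs_of_nonneg (by positivity)]
    exact Real.rpow_le_rpow (abs_nonneg _) (hK k j) hα.le
  have hw0 : ∀ j, 0 ≤ w j := fun j => by positivity
  have hS : ∀ x, (ens s a x).IsSymm := ens_isSymm hs a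
  have hQre : ∀ j x, 0 < (Q j x).re := fun j x => qres_re_pos (hS x) hz0 j
  have hQ're : ∀ j x, 0 < (Q' j x).re := fun j x => qres_re_pos (zeroSet_isSymm (hS x) _) hz0 j
  have hQn : ∀ j x, ‖Q j x‖ ≤ 1 / η := fun j x => (norm_qres_le (hS x) hz0 j).trans
    (one_div_le_one_div_of_le hη hz)
  have hQ'n : ∀ j x, ‖Q' j x‖ ≤ 1 / η := fun j x => (norm_qres_le (zeroSet_isSymm (hS x) _) hz0 j).trans
    (one_div_le_one_div_of_le hη hz)
  have hzc : Continuous fun x => zeroSet (ens s a x) {k} := by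
    refine continuous_matrix fun i j => ?_
    simp only [zeroSet, of_apply]
    split_ifs
    · exact continuous_const
    · exact (continuous_ens s a).matrix_elem i j
  have hQm : ∀ j, Measurable (Q j) := fun j => (continuous_qres_ens hs a hz0 j).measurable
  have hQ'm : ∀ j, Measurable (Q' j) := fun j => (continuous_const.mul (continuous_resol hzc
    continuous_const (fun x => zeroSet_isSymm (hS x) _) (fun _ => hz0) j j)).measurable
  have hconc := integral_norm_mean_cpow_sub_le ν μD hs a hN hγ hγ1 hη hz hwK hδ
  set m : Fin N → ℂ := fun j => ∫ y, Q j y ^ (γ : ℂ) ∂P with hm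
  set b : (EnsIdx N → ℝ) → ℝ := fun x => ‖∑ j, (w j : ℂ) * (Q j x ^ (γ : ℂ) - m j)‖ with hb
  have hbi : Integrable b P := by
    refine Integrable.norm (integrable_finsetSum _ fun j _ => Integrable.const_mul ?_ _)
    exact (integrable_qres_cpow μD hs a hγ hz0 j).sub (integrable_const _)
  set e := K ^ α * (N * (2 * δ ^ γ) + γ * δ ^ (γ - 1) * (1 / η) + (1 / η) ^ γ) with he
  have hpt : ∀ x, ‖((c / N : ℝ) : ℂ) * (∑ j, ((|if j = k then 0 else s k j| ^ α : ℝ) : ℂ) *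
      Q' j x ^ (γ : ℂ)) - cavityField α ν μD s z k‖ ≤ c / N * (b x + e) := by
    intro x
    have e1 : ((c / N : ℝ) : ℂ) * (∑ j, ((|if j = k then 0 else s k j| ^ α : ℝ) : ℂ) *
        Q' j x ^ (γ : ℂ)) - cavityField α ν μD s z k =
        ((c / N : ℝ) : ℂ) * ((∑ j, (w j : ℂ) * (Q j x ^ (γ : ℂ) - m j)) +
          (∑ j ∈ Finset.univ.erase k, (w j : ℂ) * (Q' j x ^ (γ : ℂ) - Q j x ^ (γ : ℂ)) -
            w k * Q k x ^ (γ : ℂ))) := by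
      rw [cavityField, ← mul_sub]
      congr 1
      have : ∑ j, ((|if j = k then 0 else s k j| ^ α : ℝ) : ℂ) * Q' j x ^ (γ : ℂ) =
          ∑ j ∈ Finset.univ.erase k, (w j : ℂ) * Q' j x ^ (γ : ℂ) := by
        rw [← Finset.add_sum_erase _ _ (Finset.mem_univ k)]
        simp only [if_true, abs_zero, Real.zero_rpow hα.ne', Complex.ofReal_zero, zero_mul, zero_add]
        refine Finset.sum_congr rfl fun j hj => ?_
        rw [if_neg (Finset.ne_of_mem_erase hj)]
      rw [this]
      simp only [mul_sub, Finset.sum_sub_distrib]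
      rw [← Finset.add_sum_erase _ (fun j => (w j : ℂ) * Q j x ^ (γ : ℂ)) (Finset.mem_univ k)]
      simp only [hw, hm, meanPow, hQ]
      ring
    rw [e1, norm_mul, Complex.norm_real, Real.norm_of_nonneg (by positivity)]
    refine mul_le_mul_of_nonneg_left ((norm_add_le _ _).trans (add_le_add_right ?_ _)) (by positivity)
    refine (norm_sub_le _ _).trans ?_
    have e2 : ‖(w k : ℂ) * Q k x ^ (γ : ℂ)‖ ≤ K ^ α * (1 / η) ^ γ := by
      rw [norm_mul, Complex.norm_real]
      exact mul_le_mul (hwK k) (norm_cpow_ofReal_le hγ (hQn k x)) (norm_nonneg _) (by positivity)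
    have e3 : ‖∑ j ∈ Finset.univ.erase k, (w j : ℂ) * (Q' j x ^ (γ : ℂ) - Q j x ^ (γ : ℂ))‖ ≤
        K ^ α * (N * (2 * δ ^ γ) + γ * δ ^ (γ - 1) * (1 / η)) := by
      refine (norm_sum_le _ _).trans ?_
      calc _ ≤ ∑ j ∈ Finset.univ.erase k, K ^ α * (2 * δ ^ γ + γ * δ ^ (γ - 1) *
            ‖resol (ens s a x) z j j - resol (zeroSet (ens s a x) {k}) z j j‖) := by
            refine Finset.sum_le_sum fun j _ => ?_
            rw [norm_mul, Complex.norm_real]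
            refine mul_le_mul (hwK j) ((norm_cpow_sub_cpow_le hγ hγ1 (hQ're j x) (hQre j x) hδ).trans
              (le_of_eq ?_)) (norm_nonneg _) (by positivity)
            rw [norm_sub_rev]
            simp only [hQ, hQ', qres]
            rw [← mul_sub, norm_mul]
            simp
        _ = K ^ α * ((Finset.univ.erase k).card * (2 * δ ^ γ) + γ * δ ^ (γ - 1) *
            ∑ j ∈ Finset.univ.erase k,
              ‖resol (ens s a x) z j j - resol (zeroSet (ens s a x) {k}) z j j‖) := by
            rw [← Finset.mul_sum, Finset.sum_add_distrib, Finset.sum_const, nsmul_eq_mul,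
              ← Finset.mul_sum]
        _ ≤ _ := by
            have h1 := (sum_norm_resol_sub_zeroSet_le (hS x) hz0 k).trans
              (one_div_le_one_div_of_le hη hz)
            gcongr
            exact (Finset.card_le_univ _).trans (by simp)
    rw [he]
    nlinarith
  have hci : Integrable (fun x => ‖((c / N : ℝ) : ℂ) *
      (∑ j, ((|if j = k then 0 else s k j| ^ α : ℝ) : ℂ) * Q' j x ^ (γ : ℂ)) -
      cavityField α ν μD s z k‖) P := by
    refine Integrable.norm (Integrable.sub (Integrable.const_mul (integrable_finsetSum _ fun j _ =>
      Integrable.const_mul ?_ _) _) (integrable_const _))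
    exact Integrable.of_bound ((hQ'm j).pow_const _).aestronglyMeasurable ((1 / η) ^ γ)
      (Eventually.of_forall fun x => norm_cpow_ofReal_le hγ (hQ'n j x))
  refine ⟨hci, ?_⟩
  calc _ ≤ ∫ x, c / N * (b x + e) ∂P := integral_mono hci
        ((hbi.add (integrable_const _)).const_mul _) hpt
    _ = c / N * ((∫ x, b x ∂P) + e) := by
        rw [integral_const_mul, integral_add hbi (integrable_const _)]
        simp
    _ ≤ c / N * (N * (2 * K ^ α * δ ^ γ) + K ^ α * (γ * δ ^ (γ - 1)) * (4 / η) * √N + e) := by gcongr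
    _ = _ := by
        have hsq : √(N : ℝ) ≠ 0 := (Real.sqrt_pos.2 hNr).ne'
        have : (√(N : ℝ))⁻¹ = √N / N := by
          rw [eq_div_iff hNr.ne', inv_mul_eq_div, Real.div_sqrt]
        rw [he, this]
        field_simp
        ring

/-- The approximate fixed point equation for the expected powers of the diagonal entries of the
resolvent. -/
theorem eventually_norm_meanPow_sub_psi_le (hν : HeavyTailed α ν) (hα : 0 < α) (hα2 : α < 2)
    (μD : Measure ℝ) [IsProbabilityMeasure μD] {β : ℝ} (hβ : 0 < β) {K η ε : ℝ} (hK : 0 ≤ K)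
    (hη : 0 < η) (hε : 0 < ε) :
    ∀ᶠ N : ℕ in atTop, ∀ s : Matrix (Fin N) (Fin N) ℝ, s.IsSymm → (∀ i j, |s i j| ≤ K) →
      ∀ z : ℂ, η ≤ z.im → ∀ k,
        ‖meanPow ν μD s β z k - psi β (α / 2) μD z (cavityField α ν μD s z k) / Real.Gamma β‖ ≤ ε := by
  have hG := Real.Gamma_pos_of_pos hβ
  have hG' := Real.Gamma_pos_of_pos (show 0 < β + α / 2 by positivity)
  have hc : 0 < Real.Gamma (1 - α / 2) := Real.Gamma_pos_of_pos (by linarith)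
  set γ := α / 2 with hγdef
  have hγ : 0 < γ := by positivity
  set L := Real.Gamma (β + γ) * η ^ (-(β + γ)) / Real.Gamma β with hL
  have hL0 : 0 < L := by positivity
  set A := L * (Real.Gamma (1 - γ) * K ^ α) with hA
  obtain ⟨δ, hδ0, hδ⟩ : ∃ δ : ℝ, 0 < δ ∧ A * (4 * δ ^ γ) < ε / 4 := by
    have h : Tendsto (fun δ : ℝ => A * (4 * δ ^ γ)) (𝓝[>] 0) (𝓝 0) := by
      have h1 : Tendsto (fun δ : ℝ => δ ^ γ) (𝓝[>] 0) (𝓝 0) := by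
        have := (Real.continuousAt_rpow_const 0 γ (Or.inr hγ.le)).tendsto
        rw [Real.zero_rpow hγ.ne'] at this
        exact this.mono_left nhdsWithin_le_nhds
      simpa using (h1.const_mul 4).const_mul A
    obtain ⟨δ, h1, h2⟩ := ((h.eventually_lt_const (show (0 : ℝ) < ε / 4 by positivity)).and
      self_mem_nhdsWithin).exists
    exact ⟨δ, h2, h1⟩
  have hlim : Tendsto (fun N : ℕ => A * ((γ * δ ^ (γ - 1) / η + (1 / η) ^ γ) * (1 / (N : ℝ)) +
      γ * δ ^ (γ - 1) * (4 / η) * (√(N : ℝ))⁻¹)) atTop (𝓝 0) := by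
    have h1 := (tendsto_one_div_atTop_nhds_zero_nat (𝕜 := ℝ)).const_mul
      (γ * δ ^ (γ - 1) / η + (1 / η) ^ γ)
    have h2 : Tendsto (fun N : ℕ => (√(N : ℝ))⁻¹) atTop (𝓝 0) :=
      tendsto_inv_atTop_zero.comp (Real.tendsto_sqrt_atTop.comp tendsto_natCast_atTop_atTop)
    simpa using (h1.add (h2.const_mul (γ * δ ^ (γ - 1) * (4 / η)))).const_mul A
  filter_upwards [eventually_norm_integral_row_sub_le hν hα hα2 hβ hK hη (half_pos hε),
    hlim.eventually_lt_const (show (0 : ℝ) < ε / 4 by positivity)] with N hrow hlim s hs hsK z hz k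
  have hz0 : 0 < z.im := hη.trans_le hz
  set P := Measure.pi (ensLaw ν μD N) with hP
  set a := scale ν N with ha
  set s' : Fin N → ℝ := fun j => if j = k then 0 else s k j with hs'
  have hs'K : ∀ j, |s' j| ≤ K := fun j => by
    simp only [hs']
    split_ifs
    · simpa using hK
    · exact hsK k j
  set Y' : (EnsIdx N → ℝ) → ℂ := fun x => ((Real.Gamma (1 - γ) / N : ℝ) : ℂ) *
      ∑ j, ((|s' j| ^ α : ℝ) : ℂ) * qres (zeroSet (ens s a x) {k}) z j ^ (γ : ℂ) with hY'
  set Y := cavityField α ν μD s z k with hY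
  obtain ⟨hci, hcav⟩ := integral_norm_cavity_sub_le (ν := ν) hα hα2 μD hs hsK hη hz k hδ0
  have hYre : 0 ≤ Y.re := cavityField_re_nonneg hα hα2 μD hs hz0 k
  have hS : ∀ x, (zeroSet (ens s a x) {k}).IsSymm := fun x => zeroSet_isSymm (ens_isSymm hs a x) _
  have hY're : ∀ x, 0 ≤ (Y' x).re := fun x => by
    simp only [hY']
    rw [Complex.re_ofReal_mul, Complex.re_sum]
    refine mul_nonneg (by positivity) (Finset.sum_nonneg fun j _ => ?_)
    rw [Complex.re_ofReal_mul]
    exact mul_nonneg (by positivity) (cpow_re_nonneg hγ.le (by linarith) (qres_re_pos (hS x) hz0 j))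
  set F : (EnsIdx N → ℝ) → ℂ := fun x => qres (ens s a x) z k ^ (β : ℂ) with hF
  have hFm : Measurable F := (continuous_qres_ens hs a hz0 k).measurable.pow_const _
  have hFb : ∀ x, ‖F x‖ ≤ (1 / z.im) ^ β := fun x =>
    norm_cpow_ofReal_le hβ (norm_qres_le (ens_isSymm hs a x) hz0 k)
  -- With the other rows frozen, the average over row k is the one-row problem, applied for each
  -- value d of the perturbation and then integrated over d.
  have hinner : ∀ x, ‖avg (ensLaw ν μD N) (rowBlock k) F x - psi β γ μD z (Y' x) / Real.Gamma β‖ ≤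
      ε / 2 := by
    intro x
    set H := zeroSet (ens s a x) {k} with hH
    set G : (Fin N → ℝ) → ℝ → ℂ := fun v d => (Complex.I * ((d + s k k * (v k / a) : ℝ) - z -
      quad (resol H z) fun j => s' j * (v j / a)))⁻¹ ^ (β : ℂ) with hG
    have hGm : Measurable (Function.uncurry G) := by
      simp only [hG, Function.uncurry_def, quad_eq_sum]
      fun_prop
    have hGb : ∀ v d, ‖G v d‖ ≤ η ^ (-β) := by
      intro v d
      have hre : η ≤ (Complex.I * ((d + s k k * (v k / a) : ℝ) - z -
          quad (resol H z) fun j => s' j * (v j / a))).re := by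
        have := im_dotProduct_resol (hS x) hz0 fun j => s' j * (v j / a)
        have h0 : 0 ≤ z.im * ∑ i, ‖(resol H z).mulVec
            (fun i => ((s' i * (v i / a) : ℝ) : ℂ)) i‖ ^ 2 := by
          positivity
        rw [← this] at h0
        simp only [Complex.I_mul_re, Complex.sub_im, Complex.ofReal_im, quad]
        linarith
      exact (norm_inv_cpow_le hβ (hη.trans_le hre)).trans
        (Real.rpow_le_rpow_of_nonpos hη hre (by linarith))
    have e1 : avg (ensLaw ν μD N) (rowBlock k) F x =
        ∫ d, ∫ v, G v d ∂Measure.pi (fun _ : Fin N => ν) ∂μD := by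
      rw [← integral_row_eq ν μD k hGm hGb]
      simp only [avg, hF, hG, qres_ens_piecewise hs a hz0]
      rfl
    have hGi : Integrable (fun d => ∫ v, G v d ∂Measure.pi (fun _ : Fin N => ν)) μD := by
      have h1 : StronglyMeasurable fun d => ∫ v, G v d ∂Measure.pi (fun _ : Fin N => ν) :=
        hGm.stronglyMeasurable.integral_prod_left
      refine Integrable.of_bound h1.aestronglyMeasurable (η ^ (-β)) (Eventually.of_forall fun d => ?_)
      refine (norm_integral_le_of_norm_le_const (Eventually.of_forall fun v => hGb v d)).trans ?_
      simp
    have hli := (integrable_laplaceInt_sub γ hβ μD hz0 (hY're x)).div_const (Real.Gamma β : ℂ)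
    rw [e1, psi, ← integral_div, ← integral_sub hGi hli]
    refine (norm_integral_le_of_norm_le_const (C := ε / 2) (Eventually.of_forall fun d => ?_)).trans
      (by simp)
    exact hrow H (hS x) s' hs'K (s k k) (hsK k k) k z hz d
  have hpsi : ∀ x, ‖psi β γ μD z (Y' x) / Real.Gamma β - psi β γ μD z Y / Real.Gamma β‖ ≤
      L * ‖Y' x - Y‖ := by
    intro x
    rw [← sub_div, norm_div, Complex.norm_real, Real.norm_of_nonneg hG.le, hL, div_mul_eq_mul_div]
    refine div_le_div_of_nonneg_right ?_ hG.le
    refine (norm_psi_sub_le hβ hγ μD hz0 (hY're x) hYre).trans ?_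
    have : z.im ^ (-(β + γ)) ≤ η ^ (-(β + γ)) := Real.rpow_le_rpow_of_nonpos hη hz (by linarith)
    gcongr
  have havi : Integrable (avg (ensLaw ν μD N) (rowBlock k) F) P :=
    integrable_of_bdd _ (measurable_avg _ _ hFm) (norm_avg_le _ _ hFb)
  -- Averaging over row k first does not change the expectation.
  have hmean : meanPow ν μD s β z k - psi β γ μD z Y / Real.Gamma β =
      ∫ x, (avg (ensLaw ν μD N) (rowBlock k) F x - psi β γ μD z Y / Real.Gamma β) ∂P := by
    rw [integral_sub havi (integrable_const _), integral_avg _ _ hFm hFb]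
    simp [meanPow, hF, hP, ha]
  rw [hmean]
  refine (norm_integral_le_of_norm_le ((integrable_const (ε / 2)).add (hci.const_mul L))
    (Eventually.of_forall fun x => ?_)).trans ?_
  · exact (norm_sub_le_norm_sub_add_norm_sub _ (psi β γ μD z (Y' x) / Real.Gamma β) _).trans
      (add_le_add (hinner x) (hpsi x))
  · simp only [Pi.add_apply]
    rw [integral_add (integrable_const _) (hci.const_mul L), integral_const_mul]
    have h1 := mul_le_mul_of_nonneg_left hcav hL0.le
    simp only [integral_const, probReal_univ, one_smul]
    have h2 : L * (Real.Gamma (1 - γ) * K ^ α * (4 * δ ^ γ +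
        (γ * δ ^ (γ - 1) / η + (1 / η) ^ γ) * (1 / N) + γ * δ ^ (γ - 1) * (4 / η) * (√N)⁻¹)) =
        A * (4 * δ ^ γ) + A * ((γ * δ ^ (γ - 1) / η + (1 / η) ^ γ) * (1 / (N : ℝ)) +
          γ * δ ^ (γ - 1) * (4 / η) * (√(N : ℝ))⁻¹) := by
      rw [hA]; ring
    have h3 := h1.trans_eq h2
    linarith

end Cavity

/-! ### Comparison of two variance profiles -/

section Comparison

open Matrix

variable {α : ℝ} {ν : Measure ℝ} [IsProbabilityMeasure ν]

/-- The expected normalised trace of the resolvent of the ensemble. -/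
def meanRes (ν μD : Measure ℝ) {N : ℕ} (s : Matrix (Fin N) (Fin N) ℝ) (z : ℂ) : ℂ :=
  (N : ℂ)⁻¹ * ∫ ω, (resol (ens s (scale ν N) ω) z).trace ∂Measure.pi (ensLaw ν μD N)

variable {N : ℕ} {s t : Matrix (Fin N) (Fin N) ℝ}

theorem trace_resol_eq_sum_qres (H : Matrix (Fin N) (Fin N) ℝ) (z : ℂ) :
    (resol H z).trace = Complex.I * ∑ k, qres H z k := by
  simp only [Matrix.trace, diag_apply, qres, Finset.mul_sum]
  refine Finset.sum_congr rfl fun k _ => ?_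
  rw [← mul_assoc]
  simp

theorem meanRes_eq_sum_meanPow (μD : Measure ℝ) [IsProbabilityMeasure μD] (hs : s.IsSymm) {z : ℂ}
    (hz : 0 < z.im) :
    meanRes ν μD s z = (N : ℂ)⁻¹ * (Complex.I * ∑ k, meanPow ν μD s 1 z k) := by
  simp only [meanRes, meanPow, trace_resol_eq_sum_qres]
  congr 1
  rw [integral_const_mul, integral_finsetSum]
  · simp
  · intro k _
    simpa using integrable_qres_cpow (ν := ν) μD hs (scale ν N) one_pos hz k

/-- All rows containing an entry of size at least B a are zeroed in both matrices. Each such row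
costs 4/η in either trace, and there are at most as many as large entries. What is left has
truncated entries and is compared in Frobenius norm. -/
theorem norm_trace_resol_ens_sub_le (hs : s.IsSymm) (ht : t.IsSymm) {a B : ℝ} {z : ℂ}
    {η : ℝ} (hη : 0 < η) (hz : η ≤ z.im) (ω : EnsIdx N → ℝ) :
    ‖(resol (ens s a ω) z).trace - (resol (ens t a ω) z).trace‖ ≤
      8 / η * (∑ i : Fin N, ∑ j : Fin N, ({u | B * a ≤ |u|} : Set ℝ).indicator (fun _ => (1 : ℝ))
        (ω (Sum.inl s(i, j)))) +
      √(N / η ^ 4 * ∑ i, ∑ j, (s i j - t i j) ^ 2 * trunc a B (ω (Sum.inl s(i, j))) ^ 2) := by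
  classical
  have hz0 : 0 < z.im := hη.trans_le hz
  set I : Finset (Fin N) := Finset.univ.filter fun i => ∃ j, B * a ≤ |ω (Sum.inl s(i, j))| with hI
  set J := ∑ i : Fin N, ∑ j : Fin N, ({u | B * a ≤ |u|} : Set ℝ).indicator (fun _ => (1 : ℝ))
        (ω (Sum.inl s(i, j))) with hJ
  have hnn : ∀ u : ℝ, 0 ≤ ({u | B * a ≤ |u|} : Set ℝ).indicator (fun _ => (1 : ℝ)) u := fun u =>
      indicator_nonneg (fun _ _ => zero_le_one) _
  have hcard : (I.card : ℝ) ≤ J := by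
    rw [Finset.card_eq_sum_ones, Nat.cast_sum]
    refine (Finset.sum_le_sum fun i hi => ?_).trans (Finset.sum_le_univ_sum_of_nonneg
      fun i => Finset.sum_nonneg fun j _ => hnn _)
    obtain ⟨j, hj⟩ := (Finset.mem_filter.1 hi).2
    refine le_trans ?_ (Finset.single_le_sum (f := fun j : Fin N => ({u | B * a ≤ |u|} : Set ℝ).indicator
      (fun _ => (1 : ℝ)) (ω (Sum.inl s(i, j)))) (fun j _ => hnn _) (Finset.mem_univ j))
    rw [indicator_of_mem (show ω (Sum.inl s(i, j)) ∈ {u | B * a ≤ |u|} from hj)]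
    simp
  have hSs := ens_isSymm hs a ω
  have hSt := ens_isSymm ht a ω
  have hstep : ∀ H : Matrix (Fin N) (Fin N) ℝ, H.IsSymm →
      ‖(resol H z).trace - (resol (zeroSet H I) z).trace‖ ≤ 4 / η * J := fun H hH =>
    (norm_trace_resol_sub_zeroSet_le hH hz0 I).trans (by gcongr)
  have hfrob : ‖(resol (zeroSet (ens s a ω) I) z).trace - (resol (zeroSet (ens t a ω) I) z).trace‖ ≤
      √(N / η ^ 4 * ∑ i, ∑ j, (s i j - t i j) ^ 2 * trunc a B (ω (Sum.inl s(i, j))) ^ 2) := by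
    refine Real.le_sqrt_of_sq_le ?_
    refine (norm_trace_resol_sub_le_frobenius (zeroSet_isSymm hSt I) (zeroSet_isSymm hSs I) hz0).trans ?_
    rw [Fintype.card_fin]
    have h4 : η ^ 4 ≤ z.im ^ 4 := pow_le_pow_left₀ hη.le hz 4
    gcongr with i _ j _
    simp only [zeroSet, of_apply]
    split_ifs with h
    · simp; positivity
    · push Not at h
      have hi : |ω (Sum.inl s(i, j))| < B * a := by
        by_contra hcon
        exact h.1 (Finset.mem_filter.2 ⟨Finset.mem_univ _, j, not_lt.1 hcon⟩)
      refine le_of_eq ?_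
      simp only [ens, Matrix.add_apply, of_apply, trunc, hi, if_true]
      ring
  calc _ ≤ ‖(resol (ens s a ω) z).trace - (resol (zeroSet (ens s a ω) I) z).trace‖ +
        ‖(resol (zeroSet (ens s a ω) I) z).trace - (resol (zeroSet (ens t a ω) I) z).trace‖ +
        ‖(resol (zeroSet (ens t a ω) I) z).trace - (resol (ens t a ω) z).trace‖ := by
        refine le_trans (le_of_eq ?_) norm_add₃_le
        congr 1
        ring
    _ ≤ 4 / η * J + √(N / η ^ 4 * ∑ i, ∑ j, (s i j - t i j) ^ 2 *
        trunc a B (ω (Sum.inl s(i, j))) ^ 2) + 4 / η * J := by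
        refine add_le_add (add_le_add (hstep _ hSs) hfrob) ?_
        rw [norm_sub_rev]
        exact hstep _ hSt
    _ = _ := by ring

/-- Expectation of the pathwise bound, with Jensen's inequality for the square root. After division
by N, both terms stay bounded: N times the tail and N times the truncated second moment have finite
limits or bounds. -/
theorem norm_meanRes_sub_le (μD : Measure ℝ) [IsProbabilityMeasure μD] (hN : 0 < N) (hs : s.IsSymm)
    (ht : t.IsSymm) (ha : 0 < scale ν N) {B : ℝ} (hB : 0 ≤ B) {z : ℂ} {η : ℝ} (hη : 0 < η)
    (hz : η ≤ z.im) :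
    ‖meanRes ν μD s z - meanRes ν μD t z‖ ≤ 8 / η * (N * tail ν (B * scale ν N)) +
      √((N * ∫ u, trunc (scale ν N) B u ^ 2 ∂ν) / η ^ 4 *
        (((N : ℝ) ^ 2)⁻¹ * ∑ i, ∑ j, (s i j - t i j) ^ 2)) := by
  have hz0 : 0 < z.im := hη.trans_le hz
  have hNr : (0 : ℝ) < N := by exact_mod_cast hN
  set a := scale ν N
  set P := Measure.pi (ensLaw ν μD N) with hP
  set V := ∫ u, trunc a B u ^ 2 ∂ν with hV
  have hV0 : 0 ≤ V := integral_nonneg fun t => sq_nonneg _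
  have hInt : ∀ r : Matrix (Fin N) (Fin N) ℝ, r.IsSymm →
      Integrable (fun ω => (resol (ens r a ω) z).trace) P := by
    intro r hr
    simp only [trace_resol_eq_sum_qres]
    refine Integrable.const_mul (integrable_finsetSum _ fun k _ => ?_) _
    simpa using integrable_qres_cpow (ν := ν) μD hr a one_pos hz0 k
  have heval : ∀ (g : ℝ → ℝ) (e : Sym2 (Fin N)), Integrable g ν →
      Integrable (fun ω : EnsIdx N → ℝ => g (ω (Sum.inl e))) P ∧
      ∫ ω, g (ω (Sum.inl e)) ∂P = ∫ u, g u ∂ν := fun g e hg =>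
    ⟨integrable_comp_eval (μ := ensLaw ν μD N) (i := Sum.inl e) (f := g) hg,
      integral_comp_eval (μ := ensLaw ν μD N) (i := Sum.inl e) (f := g) hg.aestronglyMeasurable⟩
  set f : (EnsIdx N → ℝ) → ℝ := fun ω => ∑ i : Fin N, ∑ j : Fin N,
    ({u | B * a ≤ |u|} : Set ℝ).indicator (fun _ => (1 : ℝ)) (ω (Sum.inl s(i, j))) with hf
  have hfi0 : ∀ i j : Fin N, Integrable (fun ω : EnsIdx N → ℝ =>
      ({u | B * a ≤ |u|} : Set ℝ).indicator (fun _ => (1 : ℝ)) (ω (Sum.inl s(i, j)))) P :=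
    fun i j => (heval _ _ (integrable_indicator_tail _)).1
  have hfi : Integrable f P :=
    integrable_finsetSum _ fun i _ => integrable_finsetSum _ fun j _ => hfi0 i j
  have hfint : ∫ ω, f ω ∂P = N * (N * tail ν (B * a)) := by
    simp only [hf]
    rw [integral_finsetSum _ fun i _ => integrable_finsetSum _ fun j _ => hfi0 i j]
    have : ∀ i : Fin N, ∫ ω : EnsIdx N → ℝ, ∑ j : Fin N, ({u | B * a ≤ |u|} : Set ℝ).indicator
        (fun _ => (1 : ℝ)) (ω (Sum.inl s(i, j))) ∂P = N * tail ν (B * a) := fun i => by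
      rw [integral_finsetSum _ fun j _ => hfi0 i j, Finset.sum_congr rfl fun j _ =>
        (heval _ _ (integrable_indicator_tail _)).2.trans (integral_indicator_tail _)]
      simp
    simp [this]
  set g : (EnsIdx N → ℝ) → ℝ := fun ω => N / η ^ 4 *
    ∑ i, ∑ j, (s i j - t i j) ^ 2 * trunc a B (ω (Sum.inl s(i, j))) ^ 2 with hg
  have hgi0 : ∀ i j : Fin N, Integrable (fun ω : EnsIdx N → ℝ =>
      (s i j - t i j) ^ 2 * trunc a B (ω (Sum.inl s(i, j))) ^ 2) P := fun i j =>
    ((heval _ _ (integrable_trunc_sq ha hB)).1).const_mul _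
  have hgi : Integrable g P :=
    (integrable_finsetSum _ fun i _ => integrable_finsetSum _ fun j _ => hgi0 i j).const_mul _
  have hg0 : ∀ ω, 0 ≤ g ω := fun ω => by simp only [hg]; positivity
  have hgint : ∫ ω, g ω ∂P = N / η ^ 4 * (V * ∑ i, ∑ j, (s i j - t i j) ^ 2) := by
    simp only [hg]
    rw [integral_const_mul,
      integral_finsetSum _ fun i _ => integrable_finsetSum _ fun j _ => hgi0 i j,
      Finset.mul_sum (a := V)]
    congr 1
    refine Finset.sum_congr rfl fun i _ => ?_
    rw [integral_finsetSum _ fun j _ => hgi0 i j, Finset.mul_sum (a := V)]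
    refine Finset.sum_congr rfl fun j _ => ?_
    rw [integral_const_mul, (heval _ _ (integrable_trunc_sq ha hB)).2, mul_comm]
  have hsi : Integrable (fun ω => √(g ω)) P := by
    refine Integrable.mono' (hgi.add (integrable_const 1))
      (hgi.1.aemeasurable.sqrt).aestronglyMeasurable (Eventually.of_forall fun ω => ?_)
    rw [Real.norm_of_nonneg (Real.sqrt_nonneg _)]
    simp only [Pi.add_apply]
    nlinarith [Real.sq_sqrt (hg0 ω), sq_nonneg (√(g ω) - 1)]
  have hsint : ∫ ω, √(g ω) ∂P ≤ √(∫ ω, g ω ∂P) := by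
    refine Real.le_sqrt_of_sq_le ?_
    have h := sq_integral_le hsi (by simpa only [Real.sq_sqrt (hg0 _)] using hgi)
    simpa only [Real.sq_sqrt (hg0 _)] using h
  rw [meanRes, meanRes, ← mul_sub, ← integral_sub (hInt s hs) (hInt t ht), norm_mul, norm_inv,
    Complex.norm_natCast]
  have hmain : ‖∫ ω, ((resol (ens s a ω) z).trace - (resol (ens t a ω) z).trace) ∂P‖ ≤
      8 / η * (N * (N * tail ν (B * a))) + √(N / η ^ 4 * (V * ∑ i, ∑ j, (s i j - t i j) ^ 2)) := by
    refine (norm_integral_le_of_norm_le ((hfi.const_mul (8 / η)).add hsi)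
      (Eventually.of_forall fun ω => norm_trace_resol_ens_sub_le hs ht hη hz ω)).trans ?_
    simp only [Pi.add_apply]
    rw [integral_add (hfi.const_mul (8 / η)) hsi, integral_const_mul, hfint, ← hgint]
    gcongr
  calc _ ≤ (N : ℝ)⁻¹ * (8 / η * (N * (N * tail ν (B * a))) +
        √(N / η ^ 4 * (V * ∑ i, ∑ j, (s i j - t i j) ^ 2))) := by gcongr
    _ = _ := by
        rw [mul_add]
        congr 1
        · field_simp
        · rw [← Real.sqrt_sq (inv_nonneg.2 hNr.le), ← Real.sqrt_mul (sq_nonneg _)]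
          congr 1
          field_simp

/-- B is fixed first, to make the contribution of the large entries small; δ is then taken small
relative to the truncated second moment at level B. -/
theorem exists_norm_meanRes_sub_le (hν : HeavyTailed α ν) (hα : 0 < α) (hα2 : α < 2)
    (μD : Measure ℝ) [IsProbabilityMeasure μD] {η ε : ℝ} (hη : 0 < η) (hε : 0 < ε) :
    ∃ δ > 0, ∀ᶠ N : ℕ in atTop, ∀ s t : Matrix (Fin N) (Fin N) ℝ, s.IsSymm → t.IsSymm →
      ((N : ℝ) ^ 2)⁻¹ * ∑ i, ∑ j, (s i j - t i j) ^ 2 ≤ δ → ∀ z : ℂ, η ≤ z.im →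
        ‖meanRes ν μD s z - meanRes ν μD t z‖ ≤ ε := by
  obtain ⟨B, hB0, hB⟩ : ∃ B : ℝ, 0 < B ∧ 8 / η * B ^ (-α) < ε / 2 := by
    have h := ((tendsto_rpow_neg_atTop hα).const_mul (8 / η)).eventually_lt_const
      (show 8 / η * 0 < ε / 2 by rw [mul_zero]; positivity)
    obtain ⟨B, h1, h2⟩ := (h.and (eventually_gt_atTop 0)).exists
    exact ⟨B, h2, h1⟩
  obtain ⟨m, -, hm0, hm⟩ := exists_integral_min_le hν hα hα2
  have hmB := hm0 (B ^ 2) (by positivity)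
  refine ⟨(ε / 2) ^ 2 * η ^ 4 / (m (B ^ 2) + 1), by positivity, ?_⟩
  filter_upwards [((mul_tail_tendsto hν hB0).const_mul (8 / η)).eventually_lt_const hB, hm,
    (scale_tendsto_atTop hν).eventually_gt_atTop 0, eventually_gt_atTop 0]
    with N h1 hm ha hN s t hs ht hst z hz
  refine (norm_meanRes_sub_le μD hN hs ht ha hB0.le hη hz).trans ?_
  have h2 : √((N * ∫ u, trunc (scale ν N) B u ^ 2 ∂ν) / η ^ 4 *
        (((N : ℝ) ^ 2)⁻¹ * ∑ i, ∑ j, (s i j - t i j) ^ 2)) ≤ ε / 2 := by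
    refine Real.sqrt_le_iff.2 ⟨by positivity, ?_⟩
    have hV : N * ∫ u, trunc (scale ν N) B u ^ 2 ∂ν ≤ m (B ^ 2) + 1 :=
      le_trans (mul_le_mul_of_nonneg_left (integral_trunc_sq_le ha hB0.le) (Nat.cast_nonneg _))
        ((hm (B ^ 2) (by positivity)).trans (by linarith))
    calc _ ≤ (m (B ^ 2) + 1) / η ^ 4 * ((ε / 2) ^ 2 * η ^ 4 / (m (B ^ 2) + 1)) := by
          gcongr
      _ = _ := by field_simp
  linarith

end Comparison

/-! ### The Pareto law -/

section Pareto

/-- The law of `U^{-1/α}` for `U` uniform on `(0,1]`. -/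
def pareto (α : ℝ) : Measure ℝ := unitMeasure.map fun u => u ^ (-(1 / α))

instance isProbabilityMeasure_unitMeasure : IsProbabilityMeasure unitMeasure :=
  ⟨by simp⟩

instance isProbabilityMeasure_pareto (α : ℝ) : IsProbabilityMeasure (pareto α) :=
  Measure.isProbabilityMeasure_map (by fun_prop)

theorem pareto_tail {α : ℝ} (hα : 0 < α) {u : ℝ} (hu : 1 ≤ u) :
    (pareto α).real {t | u ≤ |t|} = u ^ (-α) := by
  have hu0 : 0 < u := one_pos.trans_le hu
  have hle : u ^ (-α) ≤ 1 := Real.rpow_le_one_of_one_le_of_nonpos hu (by linarith)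
  rw [pareto, map_measureReal_apply (by fun_prop) (measurableSet_le_abs u), measureReal_restrict_apply
    ((measurableSet_le_abs u).preimage (by fun_prop))]
  have h : (fun v : ℝ => v ^ (-(1 / α))) ⁻¹' {t | u ≤ |t|} ∩ Ioc 0 1 = Ioc 0 (u ^ (-α)) := by
    ext v
    simp only [mem_inter_iff, mem_preimage, mem_ofPred_eq, mem_Ioc]
    have key : 0 < v → (u ≤ |v ^ (-(1 / α))| ↔ v ≤ u ^ (-α)) := fun hv => by
      rw [abs_of_pos (Real.rpow_pos_of_pos hv _), 
        show -(1 / α) = (-α)⁻¹ by rw [inv_neg, one_div],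
        Real.le_rpow_inv_iff_of_neg hu0 hv (by linarith)]
    constructor
    · rintro ⟨h1, h2, -⟩
      exact ⟨h2, (key h2).1 h1⟩
    · rintro ⟨h1, h2⟩
      exact ⟨(key h1).2 h2, h1, h2.trans hle⟩
  rw [h, Real.volume_real_Ioc_of_le (by positivity), sub_zero]

/-- A concrete law of the required type is needed in order to construct the solution and the limit
measure before any law of the entries is given. Its slowly varying factor equals 1 on [1, ∞). -/
theorem heavyTailed_pareto {α : ℝ} (hα : 0 < α) : HeavyTailed α (pareto α) := by
  have hL : ∀ u : ℝ, 1 ≤ u → (pareto α).real {t | u ≤ |t|} * u ^ α = 1 := fun u hu => by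
    have hu0 : 0 < u := one_pos.trans_le hu
    rw [pareto_tail hα hu, ← Real.rpow_add hu0, neg_add_cancel, Real.rpow_zero]
  refine ⟨fun u => (pareto α).real {t | u ≤ |t|} * u ^ α, ⟨?_, fun c hc => ?_⟩, fun u hu => ?_⟩
  · filter_upwards [eventually_ge_atTop 1] with u hu
    rw [hL u hu]
    exact one_pos
  · refine tendsto_const_nhds.congr' ?_
    filter_upwards [eventually_ge_atTop 1, eventually_ge_atTop (1 / c)] with u hu hcu
    rw [hL u hu, hL (c * u) (by rw [div_le_iff₀ hc] at hcu; linarith), div_one]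
  · rw [mul_assoc, ← Real.rpow_add hu, add_neg_cancel, Real.rpow_zero, mul_one]

end Pareto

/-! ### Partitions of the unit interval -/

section Partition

variable {q : ℕ} {b : Fin (q + 1) → ℝ}

theorem exists_mem_step (h0 : b 0 = 0) (h1 : b (Fin.last q) = 1) {x : ℝ}
    (hx : x ∈ Ioc (0 : ℝ) 1) : ∃ r : Fin q, x ∈ Ioc (b r.castSucc) (b r.succ) := by
  classical
  have hne : (Finset.univ.filter fun i => x ≤ b i).Nonempty :=
    ⟨Fin.last q, by simp [h1, hx.2]⟩
  set i := (Finset.univ.filter fun i => x ≤ b i).min' hne with hi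
  have hmem : x ≤ b i := (Finset.mem_filter.1 ((Finset.univ.filter fun i => x ≤ b i).min'_mem hne)).2
  have hi0 : i ≠ 0 := by
    intro h
    rw [h, h0] at hmem
    exact absurd hx.1 (not_lt.2 hmem)
  obtain ⟨r, hr⟩ := Fin.exists_succ_eq.2 hi0
  refine ⟨r, ?_, hr ▸ hmem⟩
  by_contra hcon
  have := Finset.min'_le (Finset.univ.filter fun i => x ≤ b i) r.castSucc
    (Finset.mem_filter.2 ⟨Finset.mem_univ _, not_lt.1 hcon⟩)
  rw [← hi, ← hr] at this
  exact absurd this (not_le.2 Fin.castSucc_lt_succ)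

theorem eq_of_mem_step (hb : StrictMono b) {x : ℝ} {r t : Fin q}
    (hr : x ∈ Ioc (b r.castSucc) (b r.succ)) (ht : x ∈ Ioc (b t.castSucc) (b t.succ)) : r = t := by
  have key : ∀ r t : Fin q, x ∈ Ioc (b r.castSucc) (b r.succ) →
      x ∈ Ioc (b t.castSucc) (b t.succ) → ¬ r < t := by
    intro r t hr ht hlt
    have : b r.succ ≤ b t.castSucc := hb.monotone (Fin.succ_le_castSucc_iff.2 hlt)
    exact absurd (hr.2.trans this) (not_le.2 ht.1)
  exact le_antisymm (not_lt.1 (key t r ht hr)) (not_lt.1 (key r t hr ht))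

theorem step_subset (hb : StrictMono b) (h0 : b 0 = 0) (h1 : b (Fin.last q) = 1) (r : Fin q) :
    Ioc (b r.castSucc) (b r.succ) ⊆ Ioc 0 1 := by
  refine Ioc_subset_Ioc ?_ ?_
  · rw [← h0]; exact hb.monotone (Fin.zero_le _)
  · rw [← h1]; exact hb.monotone (Fin.le_last _)

theorem mem_unit_grid {N : ℕ} (i : Fin N) : (((i : ℕ) + 1 : ℝ) / N) ∈ Ioc (0 : ℝ) 1 := by
  have hi : ((i : ℕ) + 1 : ℝ) ≤ N := by exact_mod_cast i.2
  have hN : (0 : ℝ) < N := lt_of_lt_of_le (by positivity) hi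
  exact ⟨by positivity, (div_le_one hN).2 hi⟩

open Classical in
/-- The proportion of grid points `(i+1)/N` in a set. -/
def gridFrac (N : ℕ) (A : Set ℝ) : ℝ :=
  ((Finset.univ.filter fun i : Fin N => (((i : ℕ) + 1 : ℝ) / N) ∈ A).card : ℝ) / N

/-- The grid points in (c, d] correspond to the integers in (cN, dN], so the count is a difference
of two floors. -/
theorem gridFrac_Ioc_tendsto {c d : ℝ} (hc : 0 ≤ c) (hcd : c ≤ d) (hd : d ≤ 1) :
    Tendsto (fun N : ℕ => gridFrac N (Ioc c d)) atTop (𝓝 (d - c)) := by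
  classical
  have hd0 : 0 ≤ d := hc.trans hcd
  have hcard : ∀ N : ℕ, 0 < N → gridFrac N (Ioc c d) = ((⌊d * N⌋₊ : ℝ) - (⌊c * N⌋₊ : ℝ)) / N := by
    intro N hN
    have hNr : (0 : ℝ) < N := by exact_mod_cast hN
    have hle : ⌊c * N⌋₊ ≤ ⌊d * N⌋₊ := Nat.floor_le_floor (by gcongr)
    have h : (Finset.univ.filter fun i : Fin N => (((i : ℕ) + 1 : ℝ) / N) ∈ Ioc c d).card =
        (Finset.Ioc ⌊c * N⌋₊ ⌊d * N⌋₊).card := by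
      refine Finset.card_bij (fun i _ => (i : ℕ) + 1) ?_ ?_ ?_
      · intro i hi
        obtain ⟨h1, h2⟩ := (Finset.mem_filter.1 hi).2
        rw [lt_div_iff₀ hNr] at h1
        rw [div_le_iff₀ hNr] at h2
        rw [Finset.mem_Ioc, Nat.floor_lt (by positivity), Nat.le_floor_iff (by positivity)]
        push_cast
        exact ⟨h1, h2⟩
      · intro i _ j _ hij
        exact Fin.ext (by simpa using hij)
      · intro k hk
        rw [Finset.mem_Ioc, Nat.floor_lt (by positivity), Nat.le_floor_iff (by positivity)] at hk
        have hk0 : 0 < k := by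
          have : (0 : ℝ) < k := lt_of_le_of_lt (by positivity) hk.1
          exact_mod_cast this
        have hkN : k ≤ N := by
          have : (k : ℝ) ≤ N := hk.2.trans (by nlinarith)
          exact_mod_cast this
        refine ⟨⟨k - 1, by omega⟩, Finset.mem_filter.2 ⟨Finset.mem_univ _, ?_⟩, by simp; omega⟩
        have : ((k - 1 : ℕ) : ℝ) + 1 = k := by
          rw [Nat.cast_sub hk0]; simp
        simp only [this]
        exact ⟨(lt_div_iff₀ hNr).2 hk.1, (div_le_iff₀ hNr).2 hk.2⟩
    rw [gridFrac]
    congr 1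
    rw [← Nat.cast_sub hle, ← Nat.card_Ioc, ← h]
    congr!
  have hlim : ∀ e : ℝ, 0 ≤ e → Tendsto (fun N : ℕ => (⌊e * N⌋₊ : ℝ) / N) atTop (𝓝 e) := fun e he =>
    (tendsto_nat_floor_mul_div_atTop he).comp tendsto_natCast_atTop_atTop
  refine ((hlim d (hc.trans hcd)).sub (hlim c hc)).congr' ?_
  filter_upwards [eventually_gt_atTop 0] with N hN
  rw [hcard N hN, sub_div]

end Partition

/-! ### The cone -/

section Cone

/-- The cone `|arg w| ≤ απ/4`. -/
def rotCone (α : ℝ) : Set ℂ :=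
  {w | |w.im| * Real.cos (α * Real.pi / 4) ≤ w.re * Real.sin (α * Real.pi / 4)}

variable {α : ℝ}

/-- The description by linear inequalities makes the sector visibly a closed convex cone, so that
sums, nonnegative multiples, integrals and limits remain in it. -/
theorem isClosed_rotCone (α : ℝ) : IsClosed (rotCone α) :=
  isClosed_le (by fun_prop) (by fun_prop)

theorem cos_pos_of_lt_two (hα : 0 < α) (hα2 : α < 2) : 0 < Real.cos (α * Real.pi / 4) :=
  Real.cos_pos_of_mem_Ioo ⟨by nlinarith [Real.pi_pos], by nlinarith [Real.pi_pos]⟩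

theorem sin_pos_of_lt_two (hα : 0 < α) (hα2 : α < 2) : 0 < Real.sin (α * Real.pi / 4) :=
  Real.sin_pos_of_pos_of_lt_pi (by positivity) (by nlinarith [Real.pi_pos])

theorem re_nonneg_of_mem_rotCone (hα : 0 < α) (hα2 : α < 2) {w : ℂ} (hw : w ∈ rotCone α) :
    0 ≤ w.re := by
  have h : 0 ≤ w.re * Real.sin (α * Real.pi / 4) :=
    (mul_nonneg (abs_nonneg _) (cos_pos_of_lt_two hα hα2).le).trans hw
  exact nonneg_of_mul_nonneg_left h (sin_pos_of_lt_two hα hα2)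

/-- In polar form the defining inequality reads sin(|arg w| - απ/4) ≤ 0. -/
theorem mem_rotCone_iff_arg (hα : 0 < α) (hα2 : α < 2) {w : ℂ} (hw : 0 < w.re) :
    w ∈ rotCone α ↔ |w.arg| ≤ α * Real.pi / 4 := by
  set θ := α * Real.pi / 4 with hθ
  have hθ0 : 0 < θ := by positivity
  have hθ1 : θ < Real.pi / 2 := by rw [hθ]; nlinarith [Real.pi_pos]
  have hw0 : w ≠ 0 := by rintro rfl; simp at hw
  have hn : 0 < ‖w‖ := norm_pos_iff.2 hw0
  have harg : |w.arg| ≤ Real.pi / 2 := Complex.abs_arg_le_pi_div_two_iff.2 hw.le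
  have hcos := cos_pos_of_lt_two hα hα2
  have hre : w.re = ‖w‖ * Real.cos |w.arg| := by rw [Real.cos_abs, Complex.norm_mul_cos_arg]
  have him : |w.im| = ‖w‖ * Real.sin |w.arg| := by
    have h : |w.im| = ‖w‖ * |Real.sin w.arg| := by
      rw [← Complex.norm_mul_sin_arg w, abs_mul, abs_norm]
    rw [h, Real.abs_sin_eq_sin_abs_of_abs_le_pi (harg.trans (by linarith [Real.pi_pos]))]
  have key : w ∈ rotCone α ↔ Real.sin (|w.arg| - θ) ≤ 0 := by
    rw [rotCone, mem_ofPred_eq, hre, him, Real.sin_sub, ← hθ, mul_assoc, mul_assoc,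
      mul_le_mul_iff_right₀ hn]
    constructor <;> intro h <;> linarith
  rw [key]
  constructor
  · intro h
    by_contra hcon
    push Not at hcon
    exact absurd h (not_le.2 (Real.sin_pos_of_pos_of_lt_pi (by linarith)
      (by linarith [Real.pi_pos])))
  · intro h
    exact Real.sin_nonpos_of_nonpos_of_neg_pi_le (by linarith)
      (by linarith [abs_nonneg w.arg, Real.pi_pos])

theorem ofReal_mul_exp_mem_rotCone (hα : 0 < α) (hα2 : α < 2) {ρ φ : ℝ} (hρ : 0 ≤ ρ)
    (hφ : |φ| ≤ α * Real.pi / 4) : (ρ : ℂ) * Complex.exp (Complex.I * φ) ∈ rotCone α := by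
  rcases eq_or_lt_of_le hρ with rfl | hρ
  · simp [rotCone]
  have hφ' : |φ| < Real.pi / 2 := hφ.trans_lt (by nlinarith [Real.pi_pos])
  have hre : 0 < ((ρ : ℂ) * Complex.exp (Complex.I * φ)).re := by
    rw [Complex.re_ofReal_mul, mul_comm Complex.I, Complex.exp_ofReal_mul_I_re]
    exact mul_pos hρ (Real.cos_pos_of_mem_Ioo (abs_lt.1 hφ'))
  rw [mem_rotCone_iff_arg hα hα2 hre, mul_comm Complex.I, Complex.exp_mul_I,
    Complex.arg_mul_cos_add_sin_mul_I hρ ⟨by linarith [(abs_lt.1 hφ').1, Real.pi_pos],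
      by linarith [(abs_lt.1 hφ').2, Real.pi_pos]⟩]
  exact hφ

theorem mem_cone_iff_rotCone (hα : 0 < α) (hα2 : α < 2) {w : ℂ} :
    w ∈ cone α ↔ rot α * w ∈ rotCone α := by
  rw [mem_cone_iff_rot]
  set w' := rot α * w
  have hcos := cos_pos_of_lt_two hα hα2
  have hsin := sin_pos_of_lt_two hα hα2
  constructor
  · rintro ⟨ρ, φ, hρ, hφ, h⟩
    exact h ▸ ofReal_mul_exp_mem_rotCone hα hα2 hρ hφ
  · intro h
    have hre := re_nonneg_of_mem_rotCone hα hα2 h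
    rcases eq_or_lt_of_le hre with h0 | h0
    · have him : w'.im = 0 := by
        have h1 : |w'.im| * Real.cos (α * Real.pi / 4) ≤ 0 := by
          have := h
          rw [rotCone, mem_ofPred_eq, ← h0, zero_mul] at this
          exact this
        exact abs_eq_zero.1 (le_antisymm (nonpos_of_mul_nonpos_left h1 hcos) (abs_nonneg _))
      refine ⟨0, 0, le_rfl, by simp; positivity, ?_⟩
      rw [Complex.ofReal_zero, zero_mul]
      exact Complex.ext h0.symm him
    · refine ⟨‖w'‖, w'.arg, norm_nonneg _, (mem_rotCone_iff_arg hα hα2 h0).1 h, ?_⟩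
      rw [mul_comm Complex.I, Complex.norm_mul_exp_arg_mul_I]

theorem isClosed_cone (hα : 0 < α) (hα2 : α < 2) : IsClosed (cone α) := by
  have : cone α = (fun w => rot α * w) ⁻¹' rotCone α := by
    ext w
    exact mem_cone_iff_rotCone hα hα2
  rw [this]
  exact (isClosed_rotCone α).preimage (by fun_prop)

theorem add_mem_rotCone (hα : 0 < α) (hα2 : α < 2) {w w' : ℂ} (hw : w ∈ rotCone α)
    (hw' : w' ∈ rotCone α) : w + w' ∈ rotCone α := by
  simp only [rotCone, mem_ofPred_eq, Complex.add_im, Complex.add_re] at *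
  nlinarith [abs_add_le w.im w'.im, cos_pos_of_lt_two hα hα2]

theorem ofReal_mul_mem_rotCone {r : ℝ} (hr : 0 ≤ r) {w : ℂ} (hw : w ∈ rotCone α) :
    (r : ℂ) * w ∈ rotCone α := by
  simp only [rotCone, mem_ofPred_eq, Complex.im_ofReal_mul, Complex.re_ofReal_mul, abs_mul,
    abs_of_nonneg hr, mul_assoc] at *
  exact mul_le_mul_of_nonneg_left hw hr

theorem sum_mem_rotCone (hα : 0 < α) (hα2 : α < 2) {ι : Type*} (s : Finset ι) {f : ι → ℂ}
    (hf : ∀ i, f i ∈ rotCone α) : ∑ i ∈ s, f i ∈ rotCone α :=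
  Finset.sum_induction f (· ∈ rotCone α) (fun _ _ => add_mem_rotCone hα hα2) (by simp [rotCone])
    fun i _ => hf i

/-- The power multiplies an argument of modulus at most π/2 by α/2. This is the origin of the cone
in the theorem. -/
theorem cpow_mem_rotCone (hα : 0 < α) (hα2 : α < 2) {p : ℂ} (hp : 0 < p.re) :
    p ^ ((α / 2 : ℝ) : ℂ) ∈ rotCone α := by
  have hp0 : p ≠ 0 := by rintro rfl; simp at hp
  have h : p ^ ((α / 2 : ℝ) : ℂ) = ((Real.exp (Real.log ‖p‖ * (α / 2)) : ℝ) : ℂ) *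
      Complex.exp (Complex.I * ((p.arg * (α / 2) : ℝ) : ℂ)) := by
    rw [Complex.cpow_def_of_ne_zero hp0, Complex.ofReal_exp, ← Complex.exp_add, Complex.log]
    congr 1
    push_cast
    ring
  rw [h]
  refine ofReal_mul_exp_mem_rotCone hα hα2 (Real.exp_pos _).le ?_
  have := Complex.abs_arg_le_pi_div_two_iff.2 hp.le
  rw [abs_mul, abs_of_pos (show 0 < α / 2 by positivity)]
  nlinarith

theorem integral_mem_rotCone (hα : 0 < α) (hα2 : α < 2) {Ω : Type*} [MeasurableSpace Ω]
    {P : Measure Ω} {f : Ω → ℂ} (hf : Integrable f P) (h : ∀ x, f x ∈ rotCone α) :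
    ∫ x, f x ∂P ∈ rotCone α := by
  have hre : (∫ x, f x ∂P).re = ∫ x, (f x).re ∂P := (integral_re hf).symm
  have him : (∫ x, f x ∂P).im = ∫ x, (f x).im ∂P := (integral_im hf).symm
  rw [rotCone, mem_ofPred_eq, hre, him]
  calc _ ≤ (∫ x, |(f x).im| ∂P) * Real.cos (α * Real.pi / 4) := by
        gcongr
        · exact (cos_pos_of_lt_two hα hα2).le
        · exact abs_integral_le_integral_abs
    _ = ∫ x, |(f x).im| * Real.cos (α * Real.pi / 4) ∂P := (integral_mul_const _ _).symm
    _ ≤ ∫ x, (f x).re * Real.sin (α * Real.pi / 4) ∂P :=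
        integral_mono (hf.im.abs.mul_const _) (hf.re.mul_const _) h
    _ = _ := integral_mul_const _ _

end Cone

/-! ### Kernels that are constant on blocks -/

section Step

set_option linter.unusedSectionVars false

open Matrix

variable {α : ℝ} {ν : Measure ℝ} [IsProbabilityMeasure ν]

theorem differentiableOn_meanPow (μD : Measure ℝ) [IsProbabilityMeasure μD] {N : ℕ}
    {s : Matrix (Fin N) (Fin N) ℝ} (hs : s.IsSymm) {β : ℝ} (hβ : 0 < β) (k : Fin N) :
    DifferentiableOn ℂ (fun z => meanPow ν μD s β z k) upperHalf := by
  intro z₀ hz₀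
  have hz₀' : 0 < z₀.im := hz₀
  set U : Set ℂ := {z | z₀.im / 2 < z.im} with hU
  have hUo : IsOpen U := isOpen_lt continuous_const Complex.continuous_im
  have hUu : U ⊆ upperHalf := fun z hz => (half_pos hz₀').trans hz
  have h := differentiableOn_integral_of_bounded (μ := Measure.pi (ensLaw ν μD N))
    (F := fun z ω => qres (ens s (scale ν N) ω) z k ^ (β : ℂ)) hUo
    (integrable_const ((1 / (z₀.im / 2)) ^ β))
    (fun z hz => (integrable_qres_cpow μD hs _ hβ (hUu hz) k).aestronglyMeasurable)
    (Eventually.of_forall fun ω => ?_) (Eventually.of_forall fun ω z hz => ?_)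
  · exact (h.differentiableAt (hUo.mem_nhds (show z₀.im / 2 < z₀.im by linarith))).differentiableWithinAt
  · refine DifferentiableOn.cpow_const ?_ fun z hz =>
      Or.inl (qres_re_pos (ens_isSymm hs _ ω) (hUu hz) k)
    exact ((differentiableOn_resol (ens_isSymm hs _ ω) k k).mono hUu).const_mul _
  · refine norm_cpow_ofReal_le hβ ((norm_qres_le (ens_isSymm hs _ ω) (hUu hz) k).trans ?_)
    exact one_div_le_one_div_of_le (half_pos hz₀') (le_of_lt hz)

/-- The values of a kernel on the grid. -/
def profile (σ : ℝ → ℝ → ℝ) (N : ℕ) : Matrix (Fin N) (Fin N) ℝ :=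
  Matrix.of fun i j => σ (((i : ℕ) + 1 : ℝ) / N) (((j : ℕ) + 1 : ℝ) / N)

variable {σ : ℝ → ℝ → ℝ} {q : ℕ} {b : Fin (q + 1) → ℝ} {s : Matrix (Fin q) (Fin q) ℝ}

theorem profile_isSymm (hσ : ∀ x ∈ Ioc (0 : ℝ) 1, ∀ y ∈ Ioc (0 : ℝ) 1, σ x y = σ y x) (N : ℕ) :
    (profile σ N).IsSymm := by
  ext i j
  exact hσ _ (mem_unit_grid j) _ (mem_unit_grid i)

theorem IsStep.kernel_symm (h : IsStep σ q b s) :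
    ∀ x ∈ Ioc (0 : ℝ) 1, ∀ y ∈ Ioc (0 : ℝ) 1, σ x y = σ y x := by
  intro x hx y hy
  obtain ⟨r, hr⟩ := exists_mem_step h.first h.last hx
  obtain ⟨t, ht⟩ := exists_mem_step h.first h.last hy
  rw [h.value r t x hr y ht, h.value t r y ht x hr, h.symm.apply]

theorem IsStep.length_pos (h : IsStep σ q b s) (r : Fin q) : 0 < b r.succ - b r.castSucc :=
  sub_pos.2 (h.strictMono Fin.castSucc_lt_succ)

theorem IsStep.exists_bound (h : IsStep σ q b s) :
    ∃ K, 0 ≤ K ∧ ∀ x ∈ Ioc (0 : ℝ) 1, ∀ y ∈ Ioc (0 : ℝ) 1, |σ x y| ≤ K := by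
  refine ⟨∑ r, ∑ t, |s r t|, by positivity, fun x hx y hy => ?_⟩
  obtain ⟨r, hr⟩ := exists_mem_step h.first h.last hx
  obtain ⟨t, ht⟩ := exists_mem_step h.first h.last hy
  rw [h.value r t x hr y ht]
  exact (Finset.single_le_sum (f := fun t => |s r t|) (fun _ _ => abs_nonneg _)
    (Finset.mem_univ t)).trans (Finset.single_le_sum (f := fun r => ∑ t, |s r t|)
      (fun _ _ => by positivity) (Finset.mem_univ r))

/-- The grid points in the block `r`. -/
def gridBlock (N : ℕ) (b : Fin (q + 1) → ℝ) (r : Fin q) : Finset (Fin N) :=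
  letI := Classical.decPred fun i : Fin N => (((i : ℕ) + 1 : ℝ) / N) ∈ Ioc (b r.castSucc) (b r.succ)
  Finset.univ.filter fun i : Fin N => (((i : ℕ) + 1 : ℝ) / N) ∈ Ioc (b r.castSucc) (b r.succ)

theorem mem_gridBlock {N : ℕ} {r : Fin q} {i : Fin N} :
    i ∈ gridBlock N b r ↔ (((i : ℕ) + 1 : ℝ) / N) ∈ Ioc (b r.castSucc) (b r.succ) := by
  simp [gridBlock]

theorem card_gridBlock (N : ℕ) (r : Fin q) :
    ((gridBlock N b r).card : ℝ) / N = gridFrac N (Ioc (b r.castSucc) (b r.succ)) := by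
  rw [gridFrac, gridBlock]

theorem IsStep.sum_gridBlock (h : IsStep σ q b s) {N : ℕ} (f : Fin N → ℂ) :
    ∑ i, f i = ∑ r, ∑ i ∈ gridBlock N b r, f i := by
  classical
  choose blk hblk using fun i : Fin N => exists_mem_step h.first h.last (mem_unit_grid i)
  rw [← Finset.sum_fiberwise Finset.univ blk f]
  refine Finset.sum_congr rfl fun r _ => Finset.sum_congr ?_ fun _ _ => rfl
  ext i
  rw [Finset.mem_filter, mem_gridBlock]
  exact ⟨fun hi => hi.2 ▸ hblk i, fun hi => ⟨Finset.mem_univ _, eq_of_mem_step h.strictMono (hblk i) hi⟩⟩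

/-- The block averages entering the fixed point equation of a kernel that is constant on blocks. -/
def stepField (α : ℝ) (ν μD : Measure ℝ) (σ : ℝ → ℝ → ℝ) (b : Fin (q + 1) → ℝ)
    (s : Matrix (Fin q) (Fin q) ℝ) (N : ℕ) (z : ℂ) (r : Fin q) : ℂ :=
  Real.Gamma (1 - α / 2) * ∑ t, ((|s r t| ^ α : ℝ) : ℂ) *
    ((N : ℂ)⁻¹ * ∑ i ∈ gridBlock N b t, meanPow ν μD (profile σ N) (α / 2) z i)

/-- The right hand side of the finite fixed point equation, in rotated coordinates. -/
def stepMap (α : ℝ) (μD : Measure ℝ) (b : Fin (q + 1) → ℝ) (s : Matrix (Fin q) (Fin q) ℝ) (z : ℂ)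
    (Y : Fin q → ℂ) (r : Fin q) : ℂ :=
  ((Real.Gamma (1 - α / 2) / Real.Gamma (α / 2) : ℝ) : ℂ) *
    ∑ t, ((|s r t| ^ α * (b t.succ - b t.castSucc) : ℝ) : ℂ) * psi (α / 2) (α / 2) μD z (Y t)

/-- For a block kernel the field depends on k only through its block, so N approximate equations
collapse to q. -/
theorem IsStep.cavityField_eq (h : IsStep σ q b s) (μD : Measure ℝ) {N : ℕ} (z : ℂ) {r : Fin q}
    {k : Fin N} (hk : k ∈ gridBlock N b r) :
    cavityField α ν μD (profile σ N) z k = stepField α ν μD σ b s N z r := by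
  rw [cavityField, stepField, h.sum_gridBlock, Complex.ofReal_div, div_mul_eq_mul_div, mul_div_assoc,
    Finset.sum_div]
  congr 1
  refine Finset.sum_congr rfl fun t _ => ?_
  rw [Complex.ofReal_natCast, div_eq_inv_mul, mul_left_comm, Finset.mul_sum (a := (N : ℂ)⁻¹),
    Finset.mul_sum, Finset.mul_sum]
  refine Finset.sum_congr rfl fun i hi => ?_
  have : profile σ N k i = s r t :=
    h.value r t _ (mem_gridBlock.1 hk) _ (mem_gridBlock.1 hi)
  rw [this]

theorem IsStep.differentiableOn_stepField (h : IsStep σ q b s) (hα : 0 < α) (μD : Measure ℝ)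
    [IsProbabilityMeasure μD] (N : ℕ) :
    DifferentiableOn ℂ (fun z => stepField α ν μD σ b s N z) upperHalf := by
  refine differentiableOn_pi.2 fun r => ?_
  simp only [stepField]
  refine DifferentiableOn.const_mul (DifferentiableOn.fun_sum fun t _ => DifferentiableOn.const_mul
    (DifferentiableOn.const_mul (DifferentiableOn.fun_sum fun i _ => ?_) _) _) _
  exact differentiableOn_meanPow μD (profile_isSymm h.kernel_symm N) (by positivity) i

theorem IsStep.stepField_mem (h : IsStep σ q b s) (hα : 0 < α) (hα2 : α < 2) (μD : Measure ℝ)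
    [IsProbabilityMeasure μD] (N : ℕ) {z : ℂ} (hz : 0 < z.im) (r : Fin q) :
    stepField α ν μD σ b s N z r ∈ rotCone α := by
  have hc : 0 < Real.Gamma (1 - α / 2) := Real.Gamma_pos_of_pos (by linarith)
  have hs := profile_isSymm h.kernel_symm N
  refine ofReal_mul_mem_rotCone hc.le (sum_mem_rotCone hα hα2 _ fun t =>
    ofReal_mul_mem_rotCone (by positivity) ?_)
  have : ((N : ℂ)⁻¹) = (((N : ℝ)⁻¹ : ℝ) : ℂ) := by push_cast; rfl
  rw [this]
  refine ofReal_mul_mem_rotCone (by positivity) (sum_mem_rotCone hα hα2 _ fun i => ?_)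
  exact integral_mem_rotCone hα hα2 (integrable_qres_cpow μD hs _ (by positivity) hz i) fun ω =>
    cpow_mem_rotCone hα hα2 (qres_re_pos (ens_isSymm hs _ ω) hz i)

theorem norm_average_le {N : ℕ} (S : Finset (Fin N)) {f : Fin N → ℂ} {C : ℝ} (hC : 0 ≤ C)
    (hf : ∀ i ∈ S, ‖f i‖ ≤ C) : ‖(N : ℂ)⁻¹ * ∑ i ∈ S, f i‖ ≤ C := by
  rcases Nat.eq_zero_or_pos N with rfl | hN
  · simpa using hC
  have hNr : (0 : ℝ) < N := by exact_mod_cast hN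
  rw [norm_mul, norm_inv, Complex.norm_natCast, inv_mul_le_iff₀ hNr]
  refine (norm_sum_le _ _).trans ((Finset.sum_le_sum hf).trans ?_)
  rw [Finset.sum_const, nsmul_eq_mul]
  gcongr
  exact (Finset.card_le_univ _).trans (by simp)

/-- The total weight of the block kernel, a bound for its row sums. -/
def stepWeight (α : ℝ) (s : Matrix (Fin q) (Fin q) ℝ) : ℝ := ∑ r, ∑ t, |s r t| ^ α

theorem row_le_stepWeight (α : ℝ) (s : Matrix (Fin q) (Fin q) ℝ) (r : Fin q) :
    ∑ t, |s r t| ^ α ≤ stepWeight α s :=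
  Finset.single_le_sum (f := fun r => ∑ t, |s r t| ^ α) (fun _ _ => by positivity)
    (Finset.mem_univ r)

theorem stepWeight_nonneg (α : ℝ) (s : Matrix (Fin q) (Fin q) ℝ) : 0 ≤ stepWeight α s := by
  unfold stepWeight; positivity

theorem norm_sum_weight_le (α : ℝ) (s : Matrix (Fin q) (Fin q) ℝ) (r : Fin q) {f : Fin q → ℂ} {C : ℝ}
    (hC : 0 ≤ C) (hf : ∀ t, ‖f t‖ ≤ C) :
    ‖∑ t, ((|s r t| ^ α : ℝ) : ℂ) * f t‖ ≤ stepWeight α s * C := by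
  refine (norm_sum_le _ _).trans ?_
  calc _ ≤ ∑ t, |s r t| ^ α * C := by
        refine Finset.sum_le_sum fun t _ => ?_
        rw [norm_mul, Complex.norm_real, Real.norm_of_nonneg (by positivity)]
        gcongr
        exact hf t
    _ ≤ _ := by
        rw [← Finset.sum_mul]
        gcongr
        exact row_le_stepWeight α s r

theorem IsStep.norm_stepField_le (h : IsStep σ q b s) (hα : 0 < α) (hα2 : α < 2) (μD : Measure ℝ)
    [IsProbabilityMeasure μD] (N : ℕ) {z : ℂ} {η : ℝ} (hη : 0 < η) (hz : η ≤ z.im) :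
    ‖stepField α ν μD σ b s N z‖ ≤
      Real.Gamma (1 - α / 2) * (stepWeight α s * (1 / η) ^ (α / 2)) := by
  have hc : 0 < Real.Gamma (1 - α / 2) := Real.Gamma_pos_of_pos (by linarith)
  have hw := stepWeight_nonneg α s
  refine (pi_norm_le_iff_of_nonneg (by positivity)).2 fun r => ?_
  rw [stepField, norm_mul, Complex.norm_real, Real.norm_of_nonneg hc.le]
  gcongr
  refine norm_sum_weight_le α s r (by positivity) fun t => norm_average_le _ (by positivity) fun i _ => ?_
  refine (norm_meanPow_le μD (profile_isSymm h.kernel_symm N) (by positivity) (hη.trans_le hz) i).trans ?_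
  have : 1 / z.im ≤ 1 / η := one_div_le_one_div_of_le hη hz
  have : 0 < 1 / z.im := by have := hη.trans_le hz; positivity
  gcongr

end Step

/-! ### The large N limit for kernels that are constant on blocks -/

section StepLimit

open Matrix

variable {α : ℝ} {ν : Measure ℝ} [IsProbabilityMeasure ν] {σ : ℝ → ℝ → ℝ} {q : ℕ}
  {b : Fin (q + 1) → ℝ} {s : Matrix (Fin q) (Fin q) ℝ}

theorem IsStep.length_le_one (h : IsStep σ q b s) (r : Fin q) : b r.succ - b r.castSucc ≤ 1 := by
  have h0 : b 0 ≤ b r.castSucc := h.strictMono.monotone (Fin.zero_le _)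
  have h1 : b r.succ ≤ b (Fin.last q) := h.strictMono.monotone (Fin.le_last _)
  rw [h.first] at h0
  rw [h.last] at h1
  linarith

theorem IsStep.gridFrac_tendsto (h : IsStep σ q b s) (r : Fin q) :
    Tendsto (fun N => gridFrac N (Ioc (b r.castSucc) (b r.succ))) atTop
      (𝓝 (b r.succ - b r.castSucc)) := by
  have h0 : b 0 ≤ b r.castSucc := h.strictMono.monotone (Fin.zero_le _)
  have h1 : b r.succ ≤ b (Fin.last q) := h.strictMono.monotone (Fin.le_last _)
  rw [h.first] at h0
  rw [h.last] at h1
  exact gridFrac_Ioc_tendsto h0 (h.strictMono Fin.castSucc_lt_succ).le h1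

/-- Within a block all expected powers are close to one common value, and the proportion of grid
points in the block tends to its length. -/
theorem IsStep.eventually_norm_blockMean_sub_le (h : IsStep σ q b s) (hν : HeavyTailed α ν)
    (hα : 0 < α) (hα2 : α < 2) (μD : Measure ℝ) [IsProbabilityMeasure μD] {β : ℝ} (hβ : 0 < β)
    {η ε : ℝ} (hη : 0 < η) (hε : 0 < ε) :
    ∀ᶠ N : ℕ in atTop, ∀ z : ℂ, η ≤ z.im → ∀ t : Fin q,
      ‖(N : ℂ)⁻¹ * ∑ i ∈ gridBlock N b t, meanPow ν μD (profile σ N) β z i -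
        ((b t.succ - b t.castSucc : ℝ) : ℂ) *
          (psi β (α / 2) μD z (stepField α ν μD σ b s N z t) / Real.Gamma β)‖ ≤ ε := by
  have hG := Real.Gamma_pos_of_pos hβ
  obtain ⟨K, hK0, hK⟩ := h.exists_bound
  have hfrac : ∀ᶠ N : ℕ in atTop, ∀ t : Fin q,
      |gridFrac N (Ioc (b t.castSucc) (b t.succ)) - (b t.succ - b t.castSucc)| * η ^ (-β) < ε / 2 := by
    rw [eventually_all]
    intro t
    have h1 := ((h.gridFrac_tendsto t).sub_const (b t.succ - b t.castSucc)).abs.mul_const (η ^ (-β))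
    rw [sub_self, abs_zero, zero_mul] at h1
    exact h1.eventually_lt_const (half_pos hε)
  filter_upwards [eventually_norm_meanPow_sub_psi_le hν hα hα2 μD hβ hK0 hη (half_pos hε), hfrac]
    with N hN hfrac z hz t
  have hz0 : 0 < z.im := hη.trans_le hz
  have hs := profile_isSymm h.kernel_symm N
  set w := psi β (α / 2) μD z (stepField α ν μD σ b s N z t) / Real.Gamma β with hw
  have hwn : ‖w‖ ≤ η ^ (-β) := by
    rw [hw, norm_div, Complex.norm_real, Real.norm_of_nonneg hG.le, div_le_iff₀ hG, mul_comm]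
    refine (norm_psi_le _ hβ μD hz0 (re_nonneg_of_mem_rotCone hα hα2
      (h.stepField_mem hα hα2 μD N hz0 t))).trans ?_
    exact mul_le_mul_of_nonneg_left (Real.rpow_le_rpow_of_nonpos hη hz (by linarith)) hG.le
  have e : (N : ℂ)⁻¹ * ∑ i ∈ gridBlock N b t, meanPow ν μD (profile σ N) β z i -
      ((b t.succ - b t.castSucc : ℝ) : ℂ) * w =
      (N : ℂ)⁻¹ * ∑ i ∈ gridBlock N b t, (meanPow ν μD (profile σ N) β z i - w) +
      ((gridFrac N (Ioc (b t.castSucc) (b t.succ)) - (b t.succ - b t.castSucc) : ℝ) : ℂ) * w := by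
    rw [Finset.sum_sub_distrib, Finset.sum_const, nsmul_eq_mul, ← card_gridBlock]
    push_cast
    ring
  rw [e]
  refine (norm_add_le _ _).trans ?_
  have h1 : ‖(N : ℂ)⁻¹ * ∑ i ∈ gridBlock N b t, (meanPow ν μD (profile σ N) β z i - w)‖ ≤ ε / 2 := by
    refine norm_average_le _ (by positivity) fun i hi => ?_
    have := hN (profile σ N) hs (fun i j => hK _ (mem_unit_grid i) _ (mem_unit_grid j)) z hz i
    rwa [h.cavityField_eq μD z hi] at this
  have h2 : ‖((gridFrac N (Ioc (b t.castSucc) (b t.succ)) - (b t.succ - b t.castSucc) : ℝ) : ℂ) * w‖ ≤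
      ε / 2 := by
    rw [norm_mul, Complex.norm_real, Real.norm_eq_abs]
    exact (mul_le_mul_of_nonneg_left hwn (abs_nonneg _)).trans (hfrac t).le
  linarith

/-- The Lipschitz constant of the fixed point map decays like (Im z)^{-α} and does not depend on μD.
-/
theorem IsStep.norm_stepMap_sub_le (h : IsStep σ q b s) (hα : 0 < α) (hα2 : α < 2) (μD : Measure ℝ)
    [IsProbabilityMeasure μD] {z : ℂ} (hz : 0 < z.im) {Y Y' : Fin q → ℂ} (hY : ∀ r, 0 ≤ (Y r).re)
    (hY' : ∀ r, 0 ≤ (Y' r).re) :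
    ‖stepMap α μD b s z Y - stepMap α μD b s z Y'‖ ≤
      Real.Gamma (1 - α / 2) / Real.Gamma (α / 2) * stepWeight α s * Real.Gamma (α / 2 + α / 2) *
        z.im ^ (-(α / 2 + α / 2)) * ‖Y - Y'‖ := by
  have hc : 0 < Real.Gamma (1 - α / 2) := Real.Gamma_pos_of_pos (by linarith)
  have hG := Real.Gamma_pos_of_pos (show 0 < α / 2 by positivity)
  have hG2 := Real.Gamma_pos_of_pos (show 0 < α / 2 + α / 2 by positivity)
  have hw := stepWeight_nonneg α s
  refine (pi_norm_le_iff_of_nonneg (by positivity)).2 fun r => ?_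
  rw [Pi.sub_apply, stepMap, stepMap, ← mul_sub, ← Finset.sum_sub_distrib, norm_mul,
    Complex.norm_real, Real.norm_of_nonneg (by positivity), mul_assoc, mul_assoc, mul_assoc]
  gcongr
  have e : ∀ t, ((|s r t| ^ α * (b t.succ - b t.castSucc) : ℝ) : ℂ) * psi (α / 2) (α / 2) μD z (Y t) -
      ((|s r t| ^ α * (b t.succ - b t.castSucc) : ℝ) : ℂ) * psi (α / 2) (α / 2) μD z (Y' t) =
      ((|s r t| ^ α : ℝ) : ℂ) * (((b t.succ - b t.castSucc : ℝ) : ℂ) *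
        (psi (α / 2) (α / 2) μD z (Y t) - psi (α / 2) (α / 2) μD z (Y' t))) := fun t => by
    push_cast; ring
  rw [Finset.sum_congr rfl fun t _ => e t]
  refine norm_sum_weight_le α s r (by positivity) fun t => ?_
  rw [norm_mul, Complex.norm_real, Real.norm_of_nonneg (h.length_pos t).le, ← mul_assoc]
  refine (mul_le_of_le_one_left (norm_nonneg _) (h.length_le_one t)).trans ?_
  refine (norm_psi_sub_le (by positivity) (by positivity) μD hz (hY t) (hY' t)).trans ?_
  gcongr
  exact norm_le_pi_norm (Y - Y') t

theorem exists_forall_mul_rpow_neg_le (A : ℝ) {θ : ℝ} (hθ : 0 < θ) :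
    ∃ R > 0, ∀ y : ℝ, R ≤ y → A * y ^ (-θ) ≤ 1 / 2 := by
  have h := ((tendsto_rpow_neg_atTop hθ).const_mul A).eventually_lt_const
    (show A * 0 < 1 / 2 by norm_num)
  obtain ⟨R, hR⟩ := (h.and (eventually_gt_atTop 0)).exists_forall_of_atTop
  exact ⟨R, (hR R le_rfl).2, fun y hy => (hR y hy).1.le⟩

/-- Where the map contracts by 1/2, the distance between two points is at most twice the sum of
their defects. Used both for approximate fixed points (Cauchy property) and for exact ones
(uniqueness). -/
theorem IsStep.exists_contraction (h : IsStep σ q b s) (hα : 0 < α) (hα2 : α < 2) (μD : Measure ℝ)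
    [IsProbabilityMeasure μD] :
    ∃ R > 0, ∀ z : ℂ, R ≤ z.im → ∀ Y Y' : Fin q → ℂ, (∀ r, Y r ∈ rotCone α) →
      (∀ r, Y' r ∈ rotCone α) →
      ‖Y - Y'‖ ≤ 2 * (‖Y - stepMap α μD b s z Y‖ + ‖Y' - stepMap α μD b s z Y'‖) := by
  obtain ⟨R, hR, hR'⟩ := exists_forall_mul_rpow_neg_le (Real.Gamma (1 - α / 2) / Real.Gamma (α / 2) *
    stepWeight α s * Real.Gamma (α / 2 + α / 2)) (show 0 < α / 2 + α / 2 by positivity)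
  refine ⟨R, hR, fun z hz Y Y' hY hY' => ?_⟩
  have h1 := h.norm_stepMap_sub_le hα hα2 μD (hR.trans_le hz)
    (fun r => re_nonneg_of_mem_rotCone hα hα2 (hY r)) fun r => re_nonneg_of_mem_rotCone hα hα2 (hY' r)
  have h2 := mul_le_mul_of_nonneg_right (hR' z.im hz) (norm_nonneg (Y - Y'))
  have e : Y - Y' = (Y - stepMap α μD b s z Y) + (stepMap α μD b s z Y - stepMap α μD b s z Y') -
      (Y' - stepMap α μD b s z Y') := by abel
  have h3 : ‖Y - Y'‖ ≤ ‖Y - stepMap α μD b s z Y‖ +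
      ‖stepMap α μD b s z Y - stepMap α μD b s z Y'‖ + ‖Y' - stepMap α μD b s z Y'‖ := by
    conv_lhs => rw [e]
    exact (norm_sub_le _ _).trans (by gcongr; exact norm_add_le _ _)
  linarith

theorem IsStep.eventually_norm_stepField_sub_le (h : IsStep σ q b s) (hν : HeavyTailed α ν)
    (hα : 0 < α) (hα2 : α < 2) (μD : Measure ℝ) [IsProbabilityMeasure μD] {η ε : ℝ} (hη : 0 < η)
    (hε : 0 < ε) :
    ∀ᶠ N : ℕ in atTop, ∀ z : ℂ, η ≤ z.im →
      ‖stepField α ν μD σ b s N z - stepMap α μD b s z (stepField α ν μD σ b s N z)‖ ≤ ε := by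
  have hc : 0 < Real.Gamma (1 - α / 2) := Real.Gamma_pos_of_pos (by linarith)
  have hw := stepWeight_nonneg α s
  set A := Real.Gamma (1 - α / 2) * (stepWeight α s + 1) with hA
  have hA0 : 0 < A := by positivity
  filter_upwards [h.eventually_norm_blockMean_sub_le hν hα hα2 μD (show 0 < α / 2 by positivity) hη
    (div_pos hε hA0)] with N hN z hz
  refine (pi_norm_le_iff_of_nonneg hε.le).2 fun r => ?_
  have e : stepField α ν μD σ b s N z r - stepMap α μD b s z (stepField α ν μD σ b s N z) r =
      Real.Gamma (1 - α / 2) * ∑ t, ((|s r t| ^ α : ℝ) : ℂ) *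
        ((N : ℂ)⁻¹ * ∑ i ∈ gridBlock N b t, meanPow ν μD (profile σ N) (α / 2) z i -
        ((b t.succ - b t.castSucc : ℝ) : ℂ) *
          (psi (α / 2) (α / 2) μD z (stepField α ν μD σ b s N z t) / Real.Gamma (α / 2))) := by
    conv_lhs => rw [stepField]
    rw [stepMap, Complex.ofReal_div, div_mul_eq_mul_div, mul_div_assoc, Finset.sum_div, ← mul_sub,
      ← Finset.sum_sub_distrib]
    congr 1
    refine Finset.sum_congr rfl fun t _ => ?_
    push_cast
    ring
  rw [Pi.sub_apply, e, norm_mul, Complex.norm_real, Real.norm_of_nonneg hc.le]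
  have h1 := norm_sum_weight_le α s r (div_pos hε hA0).le (hN z hz)
  calc _ ≤ Real.Gamma (1 - α / 2) * (stepWeight α s * (ε / A)) := by gcongr
    _ ≤ Real.Gamma (1 - α / 2) * ((stepWeight α s + 1) * (ε / A)) := by gcongr; linarith
    _ = ε := by rw [← mul_assoc, ← hA]; field_simp

/-- The block averages converge to a solution of the finite fixed point equation. -/
theorem IsStep.exists_limit (h : IsStep σ q b s) (hν : HeavyTailed α ν) (hα : 0 < α) (hα2 : α < 2)
    (μD : Measure ℝ) [IsProbabilityMeasure μD] :
    ∃ Y : ℂ → Fin q → ℂ, DifferentiableOn ℂ Y upperHalf ∧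
      (∀ z ∈ upperHalf, Y z = stepMap α μD b s z (Y z)) ∧
      (∀ z ∈ upperHalf, ∀ r, Y z r ∈ rotCone α) ∧
      ∀ z ∈ upperHalf, Tendsto (fun N => stepField α ν μD σ b s N z) atTop (𝓝 (Y z)) := by
  obtain ⟨R, hR, hcontr⟩ := h.exists_contraction hα hα2 μD
  -- Fields of different sizes n and m are approximate fixed points of the same map, which does not
  -- depend on N.
  have hC : ∀ δ > 0, ∃ N₀, ∀ n ≥ N₀, ∀ m ≥ N₀, ∀ z : ℂ, R ≤ z.im →
      ‖stepField α ν μD σ b s n z - stepField α ν μD σ b s m z‖ ≤ δ := by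
    intro δ hδ
    obtain ⟨N₀, hN₀⟩ := eventually_atTop.1 (h.eventually_norm_stepField_sub_le hν hα hα2 μD hR
      (show 0 < δ / 4 by positivity))
    refine ⟨N₀, fun n hn m hm z hz => ?_⟩
    have hz0 : 0 < z.im := hR.trans_le hz
    have := hcontr z hz _ _ (h.stepField_mem (ν := ν) hα hα2 μD n hz0)
      (h.stepField_mem (ν := ν) hα hα2 μD m hz0)
    linarith [hN₀ n hn z hz, hN₀ m hm z hz]
  obtain ⟨Y, hYd, hY⟩ := exists_differentiableOn_limit (f := fun N z => stepField α ν μD σ b s N z)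
    (B := fun η => Real.Gamma (1 - α / 2) * (stepWeight α s * (1 / η) ^ (α / 2))) (R := R)
    (fun N => h.differentiableOn_stepField hα μD N)
    (fun η hη N z hz => h.norm_stepField_le hα hα2 μD N hη hz) hC
  · have hmem : ∀ z ∈ upperHalf, ∀ r, Y z r ∈ rotCone α := fun z hz r =>
      (isClosed_rotCone α).mem_of_tendsto (tendsto_pi_nhds.1 (hY z hz) r)
        (Eventually.of_forall fun N => h.stepField_mem hα hα2 μD N hz r)
    refine ⟨Y, hYd, fun z hz => ?_, hmem, hY⟩
    have hz0 : 0 < z.im := hz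
    -- The map is Lipschitz at every z, though not contracting at low heights. Together with the
    -- vanishing defect this gives the fixed point equation on the whole half plane.
    have h1 : Tendsto (fun N => stepMap α μD b s z (stepField α ν μD σ b s N z)) atTop
        (𝓝 (stepMap α μD b s z (Y z))) := by
      rw [tendsto_iff_norm_sub_tendsto_zero]
      have h2 := (tendsto_iff_norm_sub_tendsto_zero.1 (hY z hz)).const_mul
        (Real.Gamma (1 - α / 2) / Real.Gamma (α / 2) * stepWeight α s * Real.Gamma (α / 2 + α / 2) *
          z.im ^ (-(α / 2 + α / 2)))
      rw [mul_zero] at h2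
      refine squeeze_zero (fun _ => norm_nonneg _) (fun N => ?_) h2
      exact h.norm_stepMap_sub_le hα hα2 μD hz0 (fun r => re_nonneg_of_mem_rotCone hα hα2
        (h.stepField_mem hα hα2 μD N hz r)) fun r => re_nonneg_of_mem_rotCone hα hα2 (hmem z hz r)
    have h3 : Tendsto (fun N => stepField α ν μD σ b s N z -
        stepMap α μD b s z (stepField α ν μD σ b s N z)) atTop (𝓝 0) := by
      rw [Metric.tendsto_atTop]
      intro ε hε
      obtain ⟨N₀, hN₀⟩ := eventually_atTop.1
        (h.eventually_norm_stepField_sub_le hν hα hα2 μD hz0 (half_pos hε))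
      refine ⟨N₀, fun N hN => ?_⟩
      rw [dist_zero_right]
      exact (hN₀ N hN z le_rfl).trans_lt (half_lt_self hε)
    exact sub_eq_zero.1 (tendsto_nhds_unique ((hY z hz).sub h1) h3)

theorem eqOn_upperHalf_of_eq_large_im {E : Type*} [NormedAddCommGroup E] [NormedSpace ℂ E]
    {f g : ℂ → E} (hf : AnalyticOnNhd ℂ f upperHalf) (hg : AnalyticOnNhd ℂ g upperHalf) {R : ℝ}
    (hR : 0 < R) (h : ∀ z : ℂ, R ≤ z.im → f z = g z) : EqOn f g upperHalf := by
  have hconv : Convex ℝ upperHalf := convex_halfSpace_im_gt 0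
  have hmem : ((R + 1 : ℝ) : ℂ) * Complex.I ∈ upperHalf := by
    simp only [upperHalf, mem_ofPred_eq, Complex.im_ofReal_mul, Complex.I_im]
    linarith
  refine hf.eqOn_of_preconnected_of_eventuallyEq hg hconv.isPreconnected hmem ?_
  have hop : IsOpen {z : ℂ | R < z.im} := isOpen_lt continuous_const Complex.continuous_im
  filter_upwards [hop.mem_nhds (show R < (((R + 1 : ℝ) : ℂ) * Complex.I).im by
    simp only [Complex.im_ofReal_mul, Complex.I_im]; linarith)] with z hz
  exact h z (le_of_lt hz)

/-- Contraction gives uniqueness high up, and the identity theorem extends it to the half plane. -/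
theorem IsStep.eqOn_of_fixed (h : IsStep σ q b s) (hα : 0 < α) (hα2 : α < 2) (μD : Measure ℝ)
    [IsProbabilityMeasure μD] {Y Y' : ℂ → Fin q → ℂ} (hY : DifferentiableOn ℂ Y upperHalf)
    (hYm : ∀ z ∈ upperHalf, ∀ r, Y z r ∈ rotCone α)
    (hYe : ∀ z ∈ upperHalf, Y z = stepMap α μD b s z (Y z))
    (hY' : DifferentiableOn ℂ Y' upperHalf) (hYm' : ∀ z ∈ upperHalf, ∀ r, Y' z r ∈ rotCone α)
    (hYe' : ∀ z ∈ upperHalf, Y' z = stepMap α μD b s z (Y' z)) : EqOn Y Y' upperHalf := by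
  obtain ⟨R, hR, hcontr⟩ := h.exists_contraction hα hα2 μD
  refine eqOn_upperHalf_of_eq_large_im (hY.analyticOnNhd isOpen_upperHalf)
    (hY'.analyticOnNhd isOpen_upperHalf) hR fun z hz => ?_
  have hz0 : z ∈ upperHalf := hR.trans_le hz
  have := hcontr z hz _ _ (hYm z hz0) (hYm' z hz0)
  rw [← hYe z hz0, ← hYe' z hz0, sub_self, sub_self, norm_zero, add_zero, mul_zero] at this
  exact sub_eq_zero.1 (norm_eq_zero.1 (le_antisymm this (norm_nonneg _)))

/-- The case β = 1 of the block estimate, the field being already known to converge. Any analytic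
solution may be inserted on the right, by uniqueness. -/
theorem IsStep.tendsto_meanRes (h : IsStep σ q b s) (hν : HeavyTailed α ν) (hα : 0 < α)
    (hα2 : α < 2) (μD : Measure ℝ) [IsProbabilityMeasure μD] {Y : ℂ → Fin q → ℂ}
    (hY : DifferentiableOn ℂ Y upperHalf) (hYm : ∀ z ∈ upperHalf, ∀ r, Y z r ∈ rotCone α)
    (hYe : ∀ z ∈ upperHalf, Y z = stepMap α μD b s z (Y z)) {z : ℂ} (hz : z ∈ upperHalf) :
    Tendsto (fun N => meanRes ν μD (profile σ N) z) atTop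
      (𝓝 (Complex.I * ∑ t, ((b t.succ - b t.castSucc : ℝ) : ℂ) * psi 1 (α / 2) μD z (Y z t))) := by
  have hz0 : 0 < z.im := hz
  obtain ⟨Y', hY'd, hY'e, hY'm, hlim⟩ := h.exists_limit hν hα hα2 μD
  have hEq := h.eqOn_of_fixed hα hα2 μD hY hYm hYe hY'd hY'm hY'e hz
  have hpsi : ∀ t, Tendsto (fun N => psi 1 (α / 2) μD z (stepField α ν μD σ b s N z t)) atTop
      (𝓝 (psi 1 (α / 2) μD z (Y z t))) := by
    intro t
    rw [hEq, tendsto_iff_norm_sub_tendsto_zero]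
    have h2 := (tendsto_iff_norm_sub_tendsto_zero.1 (tendsto_pi_nhds.1 (hlim z hz) t)).const_mul
      (Real.Gamma (1 + α / 2) * z.im ^ (-(1 + α / 2)))
    rw [mul_zero] at h2
    refine squeeze_zero (fun _ => norm_nonneg _) (fun N => ?_) h2
    exact norm_psi_sub_le one_pos (by positivity) μD hz0 (re_nonneg_of_mem_rotCone hα hα2
        (h.stepField_mem hα hα2 μD N hz t)) (re_nonneg_of_mem_rotCone hα hα2 (hY'm z hz t))
  have hblock : ∀ t, Tendsto (fun N : ℕ => (N : ℂ)⁻¹ *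
      ∑ i ∈ gridBlock N b t, meanPow ν μD (profile σ N) 1 z i) atTop
      (𝓝 (((b t.succ - b t.castSucc : ℝ) : ℂ) * psi 1 (α / 2) μD z (Y z t))) := by
    intro t
    have h3 : Tendsto (fun N : ℕ => (N : ℂ)⁻¹ *
        ∑ i ∈ gridBlock N b t, meanPow ν μD (profile σ N) 1 z i -
        ((b t.succ - b t.castSucc : ℝ) : ℂ) * psi 1 (α / 2) μD z (stepField α ν μD σ b s N z t))
        atTop (𝓝 0) := by
      rw [Metric.tendsto_atTop]
      intro ε hε
      obtain ⟨N₀, hN₀⟩ := eventually_atTop.1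
        (h.eventually_norm_blockMean_sub_le hν hα hα2 μD one_pos hz0 (half_pos hε))
      refine ⟨N₀, fun N hN => ?_⟩
      rw [dist_zero_right]
      have := (hN₀ N hN z le_rfl t).trans_lt (half_lt_self hε)
      simpa using this
    simpa using h3.add ((hpsi t).const_mul ((b t.succ - b t.castSucc : ℝ) : ℂ))
  have hsum := (tendsto_finsetSum Finset.univ fun t _ => hblock t).const_mul Complex.I
  refine hsum.congr fun N => ?_
  rw [meanRes_eq_sum_meanPow μD (profile_isSymm h.kernel_symm N) hz0,
    h.sum_gridBlock (fun i => meanPow ν μD (profile σ N) 1 z i), ← Finset.mul_sum]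
  ring

end StepLimit

/-! ### The fixed point equation in `L^∞` -/

section KernelEquation

variable {α : ℝ} {μD : Measure ℝ} [IsProbabilityMeasure μD]

/-- Almost every row of the kernel is measurable. -/
def RowMeasurable (k : ℝ → ℝ → ℝ) : Prop :=
  ∀ᵐ x ∂unitMeasure, AEStronglyMeasurable (k x) unitMeasure

/-- Almost every row of the kernel has `L¹` norm at most `a`. -/
def RowBound (k : ℝ → ℝ → ℝ) (a : ℝ) : Prop :=
  ∀ᵐ x ∂unitMeasure, ∫⁻ v, ‖k x v‖ₑ ∂unitMeasure ≤ ENNReal.ofReal a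

theorem RowBound.of_opNorm_le {k : ℝ → ℝ → ℝ} {a : ℝ} (h : opNorm k ≤ ENNReal.ofReal a) :
    RowBound k a := by
  filter_upwards [ENNReal.ae_le_essSup fun x => ∫⁻ v, ‖k x v‖ₑ ∂unitMeasure] with x hx
  exact hx.trans h

theorem RowBound.sub {k k' : ℝ → ℝ → ℝ} {a a' : ℝ} (hm : RowMeasurable k) (ha : 0 ≤ a)
    (ha' : 0 ≤ a') (h : RowBound k a) (h' : RowBound k' a') :
    RowBound (fun x v => k x v - k' x v) (a + a') := by
  filter_upwards [hm, h, h'] with x hx h1 h2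
  rw [ENNReal.ofReal_add ha ha']
  refine le_trans ?_ (add_le_add h1 h2)
  rw [← lintegral_add_left' hx.enorm]
  exact lintegral_mono fun v => enorm_sub_le

theorem RowMeasurable.sub {k k' : ℝ → ℝ → ℝ} (h : RowMeasurable k) (h' : RowMeasurable k') :
    RowMeasurable (fun x v => k x v - k' x v) := by
  filter_upwards [h, h'] with x h1 h2
  exact h1.sub h2

theorem RowMeasurable.rpow_abs {σ : ℝ → ℝ → ℝ} (h : AEMeasurable (fun p : ℝ × ℝ => σ p.1 p.2)
    (volume.restrict (Ioc (0 : ℝ) 1 ×ˢ Ioc (0 : ℝ) 1))) (α : ℝ) :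
    RowMeasurable fun x v => |σ x v| ^ α := by
  have h' : AEStronglyMeasurable (fun p : ℝ × ℝ => |σ p.1 p.2| ^ α)
      (unitMeasure.prod unitMeasure) := by
    rw [Measure.prod_restrict]
    exact ((measurable_id.abs.pow_const α).comp_aemeasurable h).aestronglyMeasurable
  exact h'.prodMk_left

/-- The right hand side of the fixed point equation. -/
def kernelMap (α : ℝ) (μD : Measure ℝ) (k : ℝ → ℝ → ℝ) (z : ℂ) (f : ℝ → ℂ) (x : ℝ) : ℂ :=
  starRingEnd ℂ (cConst α) * ∫ v, (k x v : ℂ) * gAverage α μD z (f v) ∂unitMeasure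

/-- Continuity is available only on the closed right half plane, so the function is cut off outside
it. This suffices for compositions with functions taking values in the cone almost everywhere. -/
theorem measurable_indicator_psi {β γ : ℝ} (hβ : 0 < β) (hγ : 0 < γ) {z : ℂ} (hz : 0 < z.im) :
    Measurable ({w : ℂ | 0 ≤ w.re}.indicator (psi β γ μD z)) := by
  classical
  have hs : IsClosed {w : ℂ | 0 ≤ w.re} := isClosed_le continuous_const Complex.continuous_re
  rw [← Set.piecewise_eq_indicator]
  refine ContinuousOn.measurable_piecewise ?_ continuousOn_const hs.measurableSet
  refine LipschitzOnWith.continuousOn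
    (K := ⟨Real.Gamma (β + γ) * z.im ^ (-(β + γ)), mul_nonneg
      (Real.Gamma_pos_of_pos (by positivity)).le (by positivity)⟩) ?_
  refine LipschitzOnWith.of_dist_le_mul fun w hw w' hw' => ?_
  rw [dist_eq_norm, dist_eq_norm]
  exact norm_psi_sub_le hβ hγ μD hz hw hw'

theorem aestronglyMeasurable_psi_comp {β γ : ℝ} (hβ : 0 < β) (hγ : 0 < γ) {z : ℂ} (hz : 0 < z.im)
    {f : ℝ → ℂ} (hf : AEStronglyMeasurable f unitMeasure)
    (hf0 : ∀ᵐ v ∂unitMeasure, 0 ≤ (f v).re) :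
    AEStronglyMeasurable (fun v => psi β γ μD z (f v)) unitMeasure := by
  refine ((measurable_indicator_psi (μD := μD) hβ hγ hz).comp_aemeasurable
    hf.aemeasurable).aestronglyMeasurable.congr ?_
  filter_upwards [hf0] with v hv
  exact Set.indicator_of_mem (s := {w : ℂ | 0 ≤ w.re}) hv _

theorem norm_gAverage_le (hα : 0 < α) (hα2 : α < 2) {z w : ℂ} (hz : 0 < z.im) (hw : w ∈ cone α) :
    ‖gAverage α μD z w‖ ≤ Real.Gamma (α / 2) * z.im ^ (-(α / 2)) := by
  rw [gAverage_eq_psi hα hα2 μD hz hw, norm_mul, norm_rot, one_mul]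
  exact norm_psi_le _ (by positivity) μD hz (rot_mul_re_nonneg hα2 hw)

theorem norm_gAverage_sub_le (hα : 0 < α) (hα2 : α < 2) {z w w' : ℂ} (hz : 0 < z.im)
    (hw : w ∈ cone α) (hw' : w' ∈ cone α) :
    ‖gAverage α μD z w - gAverage α μD z w'‖ ≤
      Real.Gamma (α / 2 + α / 2) * z.im ^ (-(α / 2 + α / 2)) * ‖w - w'‖ := by
  rw [gAverage_eq_psi hα hα2 μD hz hw, gAverage_eq_psi hα hα2 μD hz hw', ← mul_sub, norm_mul,
    norm_rot, one_mul]
  refine (norm_psi_sub_le (by positivity) (by positivity) μD hz (rot_mul_re_nonneg hα2 hw)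
    (rot_mul_re_nonneg hα2 hw')).trans_eq ?_
  rw [← mul_sub, norm_mul, norm_rot, one_mul]

theorem aestronglyMeasurable_gAverage_comp (hα : 0 < α) (hα2 : α < 2) {z : ℂ} (hz : 0 < z.im)
    {f : ℝ → ℂ} (hf : AEStronglyMeasurable f unitMeasure) (hfc : ∀ᵐ v ∂unitMeasure, f v ∈ cone α) :
    AEStronglyMeasurable (fun v => gAverage α μD z (f v)) unitMeasure := by
  refine ((aestronglyMeasurable_psi_comp (μD := μD) (show 0 < α / 2 by positivity)
    (show 0 < α / 2 by positivity) hz (hf.const_mul (rot α)) ?_).const_mul (rot α)).congr ?_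
  · filter_upwards [hfc] with v hv using rot_mul_re_nonneg hα2 hv
  · filter_upwards [hfc] with v hv using (gAverage_eq_psi hα hα2 μD hz hv).symm

theorem norm_integral_row_le {f : ℝ → ℝ} {g : ℝ → ℂ} {a B : ℝ} (ha : 0 ≤ a) (hB : 0 ≤ B)
    (hf : ∫⁻ v, ‖f v‖ₑ ∂unitMeasure ≤ ENNReal.ofReal a) (hg : ∀ᵐ v ∂unitMeasure, ‖g v‖ ≤ B) :
    ‖∫ v, (f v : ℂ) * g v ∂unitMeasure‖ ≤ a * B := by
  have h1 : ‖∫ v, (f v : ℂ) * g v ∂unitMeasure‖ₑ ≤ ENNReal.ofReal (a * B) := by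
    refine (enorm_integral_le_lintegral_enorm _).trans ?_
    rw [ENNReal.ofReal_mul ha]
    refine le_trans ?_ (mul_le_mul_left hf _)
    rw [← lintegral_mul_const' _ _ ENNReal.ofReal_ne_top]
    refine lintegral_mono_ae ?_
    filter_upwards [hg] with v hv
    rw [enorm_mul, ← ofReal_norm (f v : ℂ), Complex.norm_real, ofReal_norm,
      ← ofReal_norm (g v)]
    exact mul_le_mul_right (ENNReal.ofReal_le_ofReal hv) _
  rwa [← ofReal_norm, ENNReal.ofReal_le_ofReal_iff (by positivity)] at h1

theorem integrable_row_mul {f : ℝ → ℝ} {g : ℝ → ℂ} {a B : ℝ}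
    (hfm : AEStronglyMeasurable f unitMeasure) (hgm : AEStronglyMeasurable g unitMeasure)
    (hf : ∫⁻ v, ‖f v‖ₑ ∂unitMeasure ≤ ENNReal.ofReal a) (hg : ∀ᵐ v ∂unitMeasure, ‖g v‖ ≤ B) :
    Integrable (fun v => (f v : ℂ) * g v) unitMeasure := by
  have hfi : Integrable f unitMeasure := ⟨hfm, hf.trans_lt ENNReal.ofReal_lt_top⟩
  exact hfi.ofReal.mul_bdd hgm hg

/-- Stability of the right hand side of the equation in the kernel and in the argument. -/
theorem ae_norm_kernelMap_sub_le (hα : 0 < α) (hα2 : α < 2) {z : ℂ} (hz : 0 < z.im)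
    {k k' : ℝ → ℝ → ℝ} (hk : RowMeasurable k) (hk' : RowMeasurable k') {a d D : ℝ} (ha : 0 ≤ a)
    (hd : 0 ≤ d) (hD : 0 ≤ D) (ha' : RowBound k' a) (hd' : RowBound (fun x v => k x v - k' x v) d)
    {f f' : ℝ → ℂ} (hf : AEStronglyMeasurable f unitMeasure)
    (hf' : AEStronglyMeasurable f' unitMeasure) (hfc : ∀ᵐ v ∂unitMeasure, f v ∈ cone α)
    (hfc' : ∀ᵐ v ∂unitMeasure, f' v ∈ cone α) (hff' : ∀ᵐ v ∂unitMeasure, ‖f v - f' v‖ ≤ D) :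
    ∀ᵐ x ∂unitMeasure, ‖kernelMap α μD k z f x - kernelMap α μD k' z f' x‖ ≤
      Real.Gamma (1 - α / 2) / Real.Gamma (α / 2) *
        (d * (Real.Gamma (α / 2) * z.im ^ (-(α / 2))) +
          a * (Real.Gamma (α / 2 + α / 2) * z.im ^ (-(α / 2 + α / 2)) * D)) := by
  have hG : 0 < Real.Gamma (α / 2) := Real.Gamma_pos_of_pos (by positivity)
  have hG1 : 0 < Real.Gamma (1 - α / 2) := Real.Gamma_pos_of_pos (by linarith)
  have hG2 : 0 < Real.Gamma (α / 2 + α / 2) := Real.Gamma_pos_of_pos (by positivity)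
  have hb : ∀ᵐ v ∂unitMeasure, ‖gAverage α μD z (f v)‖ ≤ Real.Gamma (α / 2) * z.im ^ (-(α / 2)) := by
    filter_upwards [hfc] with v hv using norm_gAverage_le hα hα2 hz hv
  have hb' : ∀ᵐ v ∂unitMeasure,
      ‖gAverage α μD z (f' v)‖ ≤ Real.Gamma (α / 2) * z.im ^ (-(α / 2)) := by
    filter_upwards [hfc'] with v hv using norm_gAverage_le hα hα2 hz hv
  have hbd : ∀ᵐ v ∂unitMeasure, ‖gAverage α μD z (f v) - gAverage α μD z (f' v)‖ ≤
      Real.Gamma (α / 2 + α / 2) * z.im ^ (-(α / 2 + α / 2)) * D := by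
    filter_upwards [hfc, hfc', hff'] with v h1 h2 h3
    exact (norm_gAverage_sub_le hα hα2 hz h1 h2).trans (by gcongr)
  have hm := aestronglyMeasurable_gAverage_comp (μD := μD) hα hα2 hz hf hfc
  have hm' := aestronglyMeasurable_gAverage_comp (μD := μD) hα hα2 hz hf' hfc'
  filter_upwards [hk, hk', ha', hd'] with x h1 h2 h3 h4
  have i1 : Integrable (fun v => ((k x v - k' x v : ℝ) : ℂ) * gAverage α μD z (f v)) unitMeasure :=
    integrable_row_mul (h1.sub h2) hm h4 hb
  have i2 := integrable_row_mul h2 hm h3 hb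
  have i3 := integrable_row_mul h2 hm' h3 hb'
  have i4 : Integrable (fun v => (k' x v : ℂ) * (gAverage α μD z (f v) - gAverage α μD z (f' v)))
      unitMeasure := by
    refine (i2.sub i3).congr (Eventually.of_forall fun v => ?_)
    simp only [Pi.sub_apply]
    ring
  -- The change of kernel acts on the bounded function of f, and the change of argument is
  -- integrated against k'.
  have e : (∫ v, (k x v : ℂ) * gAverage α μD z (f v) ∂unitMeasure) -
      ∫ v, (k' x v : ℂ) * gAverage α μD z (f' v) ∂unitMeasure =
      (∫ v, ((k x v - k' x v : ℝ) : ℂ) * gAverage α μD z (f v) ∂unitMeasure) +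
        ∫ v, (k' x v : ℂ) * (gAverage α μD z (f v) - gAverage α μD z (f' v)) ∂unitMeasure := by
    have i5 : Integrable (fun v => (k x v : ℂ) * gAverage α μD z (f v)) unitMeasure := by
      refine (i1.add i2).congr (Eventually.of_forall fun v => ?_)
      simp only [Pi.add_apply]
      push_cast
      ring
    rw [← integral_add i1 i4, ← integral_sub i5 i3]
    refine integral_congr_ae (Eventually.of_forall fun v => ?_)
    push_cast
    ring
  rw [kernelMap, kernelMap, ← mul_sub, norm_mul, norm_conj_cConst hα hα2, e]
  gcongr
  exact (norm_add_le _ _).trans (add_le_add (norm_integral_row_le hd (by positivity) h4 hb)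
    (norm_integral_row_le ha (by positivity) h3 hbd))

theorem ae_norm_coe_le (f : Lp ℂ ∞ unitMeasure) : ∀ᵐ x ∂unitMeasure, ‖f x‖ ≤ ‖f‖ := by
  filter_upwards [ae_le_eLpNormEssSup (f := f) (μ := unitMeasure)] with x hx
  rw [Lp.norm_def, eLpNorm_exponent_top]
  have hfin := Lp.eLpNorm_ne_top f
  rw [eLpNorm_exponent_top] at hfin
  simpa using ENNReal.toReal_mono hfin hx

theorem norm_le_of_ae_norm_le {f : Lp ℂ ∞ unitMeasure} {C : ℝ} (hC : 0 ≤ C)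
    (h : ∀ᵐ x ∂unitMeasure, ‖f x‖ ≤ C) : ‖f‖ ≤ C := by
  simpa using Lp.norm_le_of_ae_bound hC h

/-- `X` takes values in the cone and solves the equation with kernel `k` at the point `z`. -/
structure SolvesAt (α : ℝ) (μD : Measure ℝ) (k : ℝ → ℝ → ℝ) (z : ℂ) (X : Lp ℂ ∞ unitMeasure) :
    Prop where
  mem_cone : ∀ᵐ x ∂unitMeasure, X x ∈ cone α
  equation : ∀ᵐ x ∂unitMeasure, X x = kernelMap α μD k z X x

theorem ae_norm_coe_sub_le (X X' : Lp ℂ ∞ unitMeasure) :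
    ∀ᵐ x ∂unitMeasure, ‖X x - X' x‖ ≤ ‖X - X'‖ := by
  filter_upwards [ae_norm_coe_le (X - X'), Lp.coeFn_sub X X'] with x h1 h2
  rwa [h2, Pi.sub_apply] at h1

theorem SolvesAt.norm_sub_le (hα : 0 < α) (hα2 : α < 2) {z : ℂ} (hz : 0 < z.im)
    {k k' : ℝ → ℝ → ℝ} (hk : RowMeasurable k) (hk' : RowMeasurable k') {a d : ℝ} (ha : 0 ≤ a)
    (hd : 0 ≤ d) (ha' : RowBound k' a) (hd' : RowBound (fun x v => k x v - k' x v) d)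
    {X X' : Lp ℂ ∞ unitMeasure} (hX : SolvesAt α μD k z X) (hX' : SolvesAt α μD k' z X') :
    ‖X - X'‖ ≤ Real.Gamma (1 - α / 2) / Real.Gamma (α / 2) *
        (d * (Real.Gamma (α / 2) * z.im ^ (-(α / 2))) +
          a * (Real.Gamma (α / 2 + α / 2) * z.im ^ (-(α / 2 + α / 2)) * ‖X - X'‖)) := by
  have hG : 0 < Real.Gamma (α / 2) := Real.Gamma_pos_of_pos (by positivity)
  have hG1 : 0 < Real.Gamma (1 - α / 2) := Real.Gamma_pos_of_pos (by linarith)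
  have hG2 : 0 < Real.Gamma (α / 2 + α / 2) := Real.Gamma_pos_of_pos (by positivity)
  refine norm_le_of_ae_norm_le (by positivity) ?_
  filter_upwards [ae_norm_kernelMap_sub_le (μD := μD) hα hα2 hz hk hk' ha hd (norm_nonneg (X - X'))
    ha' hd' (Lp.aestronglyMeasurable X) (Lp.aestronglyMeasurable X') hX.mem_cone hX'.mem_cone
    (ae_norm_coe_sub_le X X'), hX.equation, hX'.equation, Lp.coeFn_sub X X'] with x h1 h2 h3 h4
  rw [h4, Pi.sub_apply, h2, h3]
  exact h1

theorem SolvesAt.norm_le (hα : 0 < α) (hα2 : α < 2) {z : ℂ} (hz : 0 < z.im)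
    {k : ℝ → ℝ → ℝ} (hk : RowMeasurable k) {a : ℝ} (ha : 0 ≤ a) (ha' : RowBound k a)
    {X : Lp ℂ ∞ unitMeasure} (hX : SolvesAt α μD k z X) :
    ‖X‖ ≤ Real.Gamma (1 - α / 2) * z.im ^ (-(α / 2)) * a := by
  have hG : 0 < Real.Gamma (α / 2) := Real.Gamma_pos_of_pos (by positivity)
  have hG1 : 0 < Real.Gamma (1 - α / 2) := Real.Gamma_pos_of_pos (by linarith)
  -- Comparison with the zero kernel: the kernel distance is a, and the term with the change of
  -- argument disappears.
  have h0 : RowMeasurable fun _ _ => (0 : ℝ) := Eventually.of_forall fun _ =>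
    aestronglyMeasurable_const
  refine norm_le_of_ae_norm_le (by positivity) ?_
  filter_upwards [ae_norm_kernelMap_sub_le (μD := μD) hα hα2 hz hk h0 le_rfl ha
    (norm_nonneg (X - X)) (Eventually.of_forall fun _ => by simp) (by simpa using ha')
    (Lp.aestronglyMeasurable X) (Lp.aestronglyMeasurable X) hX.mem_cone hX.mem_cone
    (ae_norm_coe_sub_le X X), hX.equation] with x h1 h2
  rw [h2]
  simp only [kernelMap, Complex.ofReal_zero, zero_mul, integral_zero, mul_zero, sub_zero,
    add_zero] at h1 ⊢
  refine h1.trans_eq ?_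
  field_simp

/-- Countably many null sets are discarded at once; outside them W n x tends both to X x and, by the
stability estimate with d n → 0, to the right hand side at X. -/
theorem SolvesAt.of_tendsto (hα : 0 < α) (hα2 : α < 2) {z : ℂ} (hz : 0 < z.im)
    {k : ℝ → ℝ → ℝ} {K : ℕ → ℝ → ℝ → ℝ} (hk : RowMeasurable k) (hK : ∀ n, RowMeasurable (K n))
    {a : ℝ} (ha : 0 ≤ a) (ha' : RowBound k a) {d : ℕ → ℝ} (hd : ∀ n, 0 ≤ d n)
    (hd' : ∀ n, RowBound (fun x v => K n x v - k x v) (d n)) (hlim : Tendsto d atTop (𝓝 0))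
    {X : Lp ℂ ∞ unitMeasure} {W : ℕ → Lp ℂ ∞ unitMeasure} (hW : ∀ n, SolvesAt α μD (K n) z (W n))
    (hX : Tendsto W atTop (𝓝 X)) : SolvesAt α μD k z X := by
  have hn := tendsto_iff_norm_sub_tendsto_zero.1 hX
  have hcone : ∀ᵐ x ∂unitMeasure, X x ∈ cone α := by
    filter_upwards [ae_all_iff.2 fun n => ae_norm_coe_sub_le (W n) X,
      ae_all_iff.2 fun n => (hW n).mem_cone] with x h1 h2
    exact (isClosed_cone hα hα2).mem_of_tendsto (tendsto_iff_norm_sub_tendsto_zero.2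
      (squeeze_zero (fun _ => norm_nonneg _) h1 hn)) (Eventually.of_forall h2)
  refine ⟨hcone, ?_⟩
  filter_upwards [ae_all_iff.2 fun n => ae_norm_coe_sub_le (W n) X,
    ae_all_iff.2 fun n => (hW n).equation,
    ae_all_iff.2 fun n => ae_norm_kernelMap_sub_le (μD := μD) hα hα2 hz (hK n) hk ha (hd n)
      (norm_nonneg (W n - X)) ha' (hd' n) (Lp.aestronglyMeasurable (W n))
      (Lp.aestronglyMeasurable X) (hW n).mem_cone hcone (ae_norm_coe_sub_le (W n) X)]
    with x h1 h2 h3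
  have l1 : Tendsto (fun n => W n x) atTop (𝓝 (X x)) :=
    tendsto_iff_norm_sub_tendsto_zero.2 (squeeze_zero (fun _ => norm_nonneg _) h1 hn)
  have l2 : Tendsto (fun n => W n x) atTop (𝓝 (kernelMap α μD k z X x)) := by
    refine tendsto_iff_norm_sub_tendsto_zero.2 (squeeze_zero (fun _ => norm_nonneg _)
      (fun n => (congrArg (fun w => ‖w - kernelMap α μD k z X x‖) (h2 n)).trans_le (h3 n)) ?_)
    have := (((hlim.mul_const (Real.Gamma (α / 2) * z.im ^ (-(α / 2)))).add
      ((hn.const_mul (Real.Gamma (α / 2 + α / 2) * z.im ^ (-(α / 2 + α / 2)))).const_mul a)).const_mul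
        (Real.Gamma (1 - α / 2) / Real.Gamma (α / 2)))
    simpa using this
  exact tendsto_nhds_unique l1 l2

end KernelEquation

/-! ### Solutions of the finite system as elements of L^∞ -/

section StepKernel

set_option linter.unusedSectionVars false

variable {α : ℝ} {μD : Measure ℝ} [IsProbabilityMeasure μD] {τ : ℝ → ℝ → ℝ} {q : ℕ}
  {b : Fin (q + 1) → ℝ} {s : Matrix (Fin q) (Fin q) ℝ}

theorem unitMeasure_eq_sum (hb : StrictMono b) (h0 : b 0 = 0) (h1 : b (Fin.last q) = 1) :
    unitMeasure = ∑ r : Fin q, volume.restrict (Ioc (b r.castSucc) (b r.succ)) := by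
  have hU : Ioc (0 : ℝ) 1 = ⋃ r : Fin q, Ioc (b r.castSucc) (b r.succ) := by
    ext x
    rw [mem_iUnion]
    exact ⟨exists_mem_step h0 h1, fun ⟨r, hr⟩ => step_subset hb h0 h1 r hr⟩
  rw [unitMeasure, hU, Measure.restrict_iUnion _ fun _ => measurableSet_Ioc, Measure.sum_fintype]
  exact fun r t hrt => Set.disjoint_left.2 fun x hr ht => hrt (eq_of_mem_step hb hr ht)

theorem restrict_step_le (hb : StrictMono b) (h0 : b 0 = 0) (h1 : b (Fin.last q) = 1) (r : Fin q) :
    volume.restrict (Ioc (b r.castSucc) (b r.succ)) ≤ unitMeasure :=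
  Measure.restrict_mono (step_subset hb h0 h1 r) le_rfl

theorem integral_step (hb : StrictMono b) (h0 : b 0 = 0) (h1 : b (Fin.last q) = 1) {f : ℝ → ℂ}
    {c : Fin q → ℂ}
    (hf : ∀ r, ∀ᵐ v ∂volume.restrict (Ioc (b r.castSucc) (b r.succ)), f v = c r) :
    ∫ v, f v ∂unitMeasure = ∑ r, ((b r.succ - b r.castSucc : ℝ) : ℂ) * c r := by
  rw [unitMeasure_eq_sum hb h0 h1, integral_finsetSum_measure]
  · refine Finset.sum_congr rfl fun r _ => ?_
    rw [integral_congr_ae (hf r), integral_const, measureReal_restrict_apply_univ,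
      Real.volume_real_Ioc_of_le (hb Fin.castSucc_lt_succ).le, Complex.real_smul]
  · exact fun r _ => (integrable_const (c r)).congr ((hf r).mono fun _ h => h.symm)

theorem IsStep.aemeasurable (h : IsStep τ q b s) : AEMeasurable (fun p : ℝ × ℝ => τ p.1 p.2)
    (volume.restrict (Ioc (0 : ℝ) 1 ×ˢ Ioc (0 : ℝ) 1)) := by
  have hm : Measurable fun p : ℝ × ℝ => ∑ r, ∑ t, (Ioc (b r.castSucc) (b r.succ) ×ˢ
      Ioc (b t.castSucc) (b t.succ)).indicator (fun _ => s r t) p :=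
    Finset.measurable_fun_sum _ fun r _ => Finset.measurable_fun_sum _ fun t _ =>
      measurable_const.indicator (measurableSet_Ioc.prod measurableSet_Ioc)
  refine ⟨_, hm, ?_⟩
  filter_upwards [ae_restrict_mem (measurableSet_Ioc.prod measurableSet_Ioc)] with p hp
  obtain ⟨r, hr⟩ := exists_mem_step h.first h.last hp.1
  obtain ⟨t, ht⟩ := exists_mem_step h.first h.last hp.2
  rw [h.value r t _ hr _ ht, Finset.sum_eq_single r, Finset.sum_eq_single t]
  · rw [Set.indicator_of_mem (show p ∈ _ ×ˢ _ from ⟨hr, ht⟩)]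
  · intro t' _ ht'
    exact Set.indicator_of_notMem (fun hp' => ht' (eq_of_mem_step h.strictMono hp'.2 ht)) _
  · simp
  · intro r' _ hr'
    exact Finset.sum_eq_zero fun t' _ =>
      Set.indicator_of_notMem (fun hp' => hr' (eq_of_mem_step h.strictMono hp'.1 hr)) _
  · simp

/-- The element of `L^∞` which is constant on each interval of a partition. -/
def stepLp (b : Fin (q + 1) → ℝ) (c : Fin q → ℂ) : Lp ℂ ∞ unitMeasure :=
  ∑ r, c r • indicatorConstLp ∞ (measurableSet_Ioc (a := b r.castSucc) (b := b r.succ))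
    (measure_ne_top unitMeasure _) (1 : ℂ)

theorem stepLp_ae_eq (hb : StrictMono b) (h0 : b 0 = 0) (h1 : b (Fin.last q) = 1) (c : Fin q → ℂ)
    (r : Fin q) :
    ∀ᵐ x ∂volume.restrict (Ioc (b r.castSucc) (b r.succ)), stepLp b c x = c r := by
  have h2 : ∀ᵐ x ∂unitMeasure, stepLp b c x =
      ∑ t, c t * (Ioc (b t.castSucc) (b t.succ)).indicator (fun _ => (1 : ℂ)) x := by
    have h3 : ∀ᵐ x ∂unitMeasure, ∀ t : Fin q, (c t • indicatorConstLp ∞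
        (measurableSet_Ioc (a := b t.castSucc) (b := b t.succ))
        (measure_ne_top unitMeasure _) (1 : ℂ) : Lp ℂ ∞ unitMeasure) x =
        c t * (Ioc (b t.castSucc) (b t.succ)).indicator (fun _ => (1 : ℂ)) x := by
      refine ae_all_iff.2 fun t => ?_
      filter_upwards [Lp.coeFn_smul (c t) (indicatorConstLp ∞
        (measurableSet_Ioc (a := b t.castSucc) (b := b t.succ))
        (measure_ne_top unitMeasure _) (1 : ℂ)), indicatorConstLp_coeFn (p := ∞) (μ := unitMeasure)
        (hs := measurableSet_Ioc (a := b t.castSucc) (b := b t.succ))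
        (hμs := measure_ne_top unitMeasure _) (c := (1 : ℂ))] with x h4 h5
      rw [h4, Pi.smul_apply, h5, smul_eq_mul]
    have h6 := Lp.coeFn_finsetSum Finset.univ fun t => (c t • indicatorConstLp ∞
        (measurableSet_Ioc (a := b t.castSucc) (b := b t.succ))
        (measure_ne_top unitMeasure _) (1 : ℂ) : Lp ℂ ∞ unitMeasure)
    filter_upwards [h3, h6] with x h4 h5
    rw [stepLp, h5, Finset.sum_apply]
    exact Finset.sum_congr rfl fun t _ => h4 t
  filter_upwards [(restrict_step_le hb h0 h1 r).absolutelyContinuous.ae_le h2,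
    ae_restrict_mem measurableSet_Ioc] with x h3 hx
  rw [h3, Finset.sum_eq_single r, Set.indicator_of_mem hx, mul_one]
  · intro t _ ht
    rw [Set.indicator_of_notMem (fun hx' => ht (eq_of_mem_step hb hx' hx)), mul_zero]
  · simp

theorem ae_unit_of_forall_step (hb : StrictMono b) (h0 : b 0 = 0) (h1 : b (Fin.last q) = 1)
    {p : ℝ → Prop} (h : ∀ r : Fin q, ∀ᵐ x ∂volume.restrict (Ioc (b r.castSucc) (b r.succ)), p x) :
    ∀ᵐ x ∂unitMeasure, p x := by
  rw [unitMeasure_eq_sum hb h0 h1, ← Measure.sum_fintype]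
  exact Measure.ae_sum_iff.2 h

theorem kernelMap_of_step (h : IsStep τ q b s) (z : ℂ) {f : ℝ → ℂ} {c : Fin q → ℂ}
    (hf : ∀ t, ∀ᵐ v ∂volume.restrict (Ioc (b t.castSucc) (b t.succ)), f v = c t) {r : Fin q} {x : ℝ}
    (hx : x ∈ Ioc (b r.castSucc) (b r.succ)) :
    kernelMap α μD (fun x v => |τ x v| ^ α) z f x = starRingEnd ℂ (cConst α) *
      ∑ t : Fin q, ((|s r t| ^ α * (b t.succ - b t.castSucc) : ℝ) : ℂ) * gAverage α μD z (c t) := by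
  rw [kernelMap, integral_step h.strictMono h.first h.last
    (c := fun t => ((|s r t| ^ α : ℝ) : ℂ) * gAverage α μD z (c t))]
  · congr 1
    refine Finset.sum_congr rfl fun t _ => ?_
    push_cast
    ring
  · intro t
    filter_upwards [hf t, ae_restrict_mem measurableSet_Ioc] with v h1 h2
    rw [h1, h.value r t x hx v h2]

/-- For functions constant on the blocks, the integral equation is the finite system. -/
theorem IsStepSolution.solvesAt {Xs : Fin q → ℂ → ℂ} (h : IsStep τ q b s)
    (hX : IsStepSolution α μD q b s Xs) {z : ℂ} (hz : z ∈ upperHalf) :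
    SolvesAt α μD (fun x v => |τ x v| ^ α) z (stepLp b fun r => Xs r z) := by
  have hs := stepLp_ae_eq h.strictMono h.first h.last fun r => Xs r z
  refine ⟨ae_unit_of_forall_step h.strictMono h.first h.last fun r => ?_,
    ae_unit_of_forall_step h.strictMono h.first h.last fun r => ?_⟩
  · filter_upwards [hs r] with x hx
    rw [hx]
    exact hX.mem_cone r z hz
  · filter_upwards [hs r, ae_restrict_mem measurableSet_Ioc] with x hx hx'
    rw [hx, kernelMap_of_step h z hs hx']
    exact hX.equation r z hz

theorem IsStepSolution.differentiableOn_stepLp {Xs : Fin q → ℂ → ℂ}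
    (hX : IsStepSolution α μD q b s Xs) :
    DifferentiableOn ℂ (fun z => stepLp b fun r => Xs r z) upperHalf := by
  simp only [stepLp]
  exact DifferentiableOn.fun_sum fun r _ => (hX.analytic r).differentiableOn.smul_const _

theorem stepMap_rot (hα : 0 < α) (hα2 : α < 2) {z : ℂ} (hz : 0 < z.im) {c : Fin q → ℂ}
    (hc : ∀ r, c r ∈ cone α) (r : Fin q) :
    stepMap α μD b s z (fun r => rot α * c r) r = rot α * (starRingEnd ℂ (cConst α) *
      ∑ t : Fin q, ((|s r t| ^ α * (b t.succ - b t.castSucc) : ℝ) : ℂ) * gAverage α μD z (c t)) := by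
  have h1 : ∑ t : Fin q, ((|s r t| ^ α * (b t.succ - b t.castSucc) : ℝ) : ℂ) *
      gAverage α μD z (c t) = rot α * ∑ t, ((|s r t| ^ α * (b t.succ - b t.castSucc) : ℝ) : ℂ) *
        psi (α / 2) (α / 2) μD z (rot α * c t) := by
    rw [Finset.mul_sum]
    refine Finset.sum_congr rfl fun t _ => ?_
    rw [gAverage_eq_psi hα hα2 μD hz (hc t)]
    ring
  rw [h1, conj_cConst, stepMap]
  have := rot_ne_zero α
  field_simp

/-- The rotation i^{α/2} translates between the fixed points of `stepMap` and the solutions of the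
system. The last clause holds for every law of the entries because the solution is unique. -/
theorem IsStep.exists_unique_stepSolution (h : IsStep τ q b s) (hα : 0 < α) (hα2 : α < 2) :
    ∃ Xs : Fin q → ℂ → ℂ, IsStepSolution α μD q b s Xs ∧
      (∀ Xs', IsStepSolution α μD q b s Xs' → ∀ r, EqOn (Xs' r) (Xs r) upperHalf) ∧
      ∀ (ν : Measure ℝ) [IsProbabilityMeasure ν], HeavyTailed α ν → ∀ z ∈ upperHalf,
        Tendsto (fun N => meanRes ν μD (profile τ N) z) atTop (𝓝 (Complex.I *
          ∫ v, psi 1 (α / 2) μD z (rot α * stepLp b (fun r => Xs r z) v) ∂unitMeasure)) := by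
  -- The solution is produced as the limit of the ensemble with Pareto entries; this replaces a
  -- fixed point theorem.
  obtain ⟨Y, hYd, hYe, hYm, -⟩ := h.exists_limit (heavyTailed_pareto hα) hα hα2 μD
  have hr0 := rot_ne_zero α
  have hrY : ∀ z r, rot α * ((rot α)⁻¹ * Y z r) = Y z r := fun z r => by
    rw [← mul_assoc, mul_inv_cancel₀ hr0, one_mul]
  have hcone : ∀ z ∈ upperHalf, ∀ r, (rot α)⁻¹ * Y z r ∈ cone α := fun z hz r => by
    rw [mem_cone_iff_rotCone hα hα2, hrY]
    exact hYm z hz r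
  refine ⟨fun r z => (rot α)⁻¹ * Y z r, ⟨fun r => ?_, fun r z hz => hcone z hz r, fun r z hz => ?_⟩,
    fun Xs' hX' r z hz => ?_, fun ν _ hν z hz => ?_⟩
  · exact ((differentiableOn_pi.1 hYd r).const_mul _).analyticOnNhd isOpen_upperHalf
  · have h1 := stepMap_rot (μD := μD) (b := b) (s := s) hα hα2 hz (hcone z hz) r
    simp only [hrY] at h1
    rw [← mul_right_inj' hr0, ← h1, hrY]
    exact congrFun (hYe z hz) r
  · have h1 := h.eqOn_of_fixed hα hα2 μD (Y := fun z r => rot α * Xs' r z)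
      (differentiableOn_pi.2 fun r => (hX'.analytic r).differentiableOn.const_mul _)
      (fun z hz r => (mem_cone_iff_rotCone hα hα2).1 (hX'.mem_cone r z hz))
      (fun z hz => funext fun r => by
        rw [stepMap_rot hα hα2 hz fun r => hX'.mem_cone r z hz, ← hX'.equation r z hz])
      hYd hYm hYe hz
    have h2 : rot α * Xs' r z = Y z r := congrFun h1 r
    change Xs' r z = (rot α)⁻¹ * Y z r
    rw [← h2, inv_mul_cancel_left₀ hr0]
  · rw [integral_step h.strictMono h.first h.last (c := fun t => psi 1 (α / 2) μD z (Y z t))]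
    · exact h.tendsto_meanRes hν hα hα2 μD hYd hYm hYe hz
    · intro t
      filter_upwards [stepLp_ae_eq h.strictMono h.first h.last (fun r => (rot α)⁻¹ * Y z r) t]
        with v hv
      rw [hv, hrY]

theorem IsStepSolution.exists_bound (h : IsStep τ q b s) (hα : 0 < α) (hα2 : α < 2)
    {Xs : Fin q → ℂ → ℂ} (hX : IsStepSolution α μD q b s Xs) :
    ∃ c : ℝ, ∀ r, ∀ z ∈ upperHalf, ‖Xs r z‖ ≤ c * z.im ^ (-(α / 2)) := by
  refine ⟨‖starRingEnd ℂ (cConst α)‖ * (stepWeight α s * Real.Gamma (α / 2)), fun r z hz => ?_⟩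
  have hz0 : 0 < z.im := hz
  have hG : 0 < Real.Gamma (α / 2) := Real.Gamma_pos_of_pos (by positivity)
  rw [hX.equation r z hz, norm_mul, mul_assoc, mul_assoc]
  refine mul_le_mul_of_nonneg_left ?_ (norm_nonneg _)
  have h1 := norm_sum_weight_le α s r
    (f := fun t => ((b t.succ - b t.castSucc : ℝ) : ℂ) * gAverage α μD z (Xs t z))
    (C := Real.Gamma (α / 2) * z.im ^ (-(α / 2))) (by positivity) fun t => ?_
  · refine le_trans (le_of_eq ?_) h1
    congr 1
    refine Finset.sum_congr rfl fun t _ => ?_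
    push_cast
    ring
  · rw [norm_mul, Complex.norm_real, Real.norm_of_nonneg (h.length_pos t).le]
    refine (mul_le_mul (h.length_le_one t) (norm_gAverage_le hα hα2 hz0 (hX.mem_cone t z hz))
      (norm_nonneg _) zero_le_one).trans_eq (one_mul _)

end StepKernel

/-! ### The discretised `L²` norm -/

section Grid

/-- On (i/N, (i+1)/N] the ceiling of Nx is i + 1, in agreement with the index shift of the matrix
rows. -/
theorem lintegral_ceil {N : ℕ} (hN : 0 < N) (g : ℤ → ℝ≥0∞) :
    ∫⁻ x, g ⌈(N : ℝ) * x⌉ ∂unitMeasure = (N : ℝ≥0∞)⁻¹ * ∑ i : Fin N, g ((i : ℕ) + 1) := by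
  have hNr : (0 : ℝ) < N := by exact_mod_cast hN
  rw [unitMeasure_eq_sum (b := fun i : Fin (N + 1) => ((i : ℕ) : ℝ) / N)
    (fun i j hij => div_lt_div_of_pos_right (by exact_mod_cast hij) hNr) (by simp)
    (by simp [hNr.ne']), lintegral_finsetSum_measure, Finset.mul_sum]
  refine Finset.sum_congr rfl fun i _ => ?_
  have h1 : ∀ᵐ x ∂volume.restrict (Ioc (((i.castSucc : Fin (N + 1)) : ℕ) / (N : ℝ))
      (((i.succ : Fin (N + 1)) : ℕ) / (N : ℝ))), g ⌈(N : ℝ) * x⌉ = g ((i : ℕ) + 1) := by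
    filter_upwards [ae_restrict_mem measurableSet_Ioc] with x hx
    have h2 : ⌈(N : ℝ) * x⌉ = ((i : ℕ) : ℤ) + 1 := by
      rw [Int.ceil_eq_iff]
      have h3 := hx.1
      have h4 := hx.2
      rw [div_lt_iff₀ hNr] at h3
      rw [le_div_iff₀ hNr] at h4
      simp only [Fin.val_castSucc, Fin.val_succ] at h3 h4
      push_cast at h4 ⊢
      constructor <;> linarith
    rw [h2]
  rw [lintegral_congr_ae h1, lintegral_const, Measure.restrict_apply_univ, Real.volume_Ioc, mul_comm]
  congr 1
  simp only [Fin.val_castSucc, Fin.val_succ]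
  rw [← sub_div]
  push_cast
  rw [add_sub_cancel_left, one_div, ENNReal.ofReal_inv_of_pos hNr, ENNReal.ofReal_natCast]

/-- The discretised norm is the normalised Frobenius norm of the profile, exactly the quantity that
controls resolvent traces in `exists_norm_meanRes_sub_le`. -/
theorem eLpNorm_grid_sq {N : ℕ} (hN : 0 < N) (f : ℝ → ℝ → ℝ) :
    (eLpNorm (fun p : ℝ × ℝ => f ((⌈(N : ℝ) * p.1⌉ : ℝ) / N) ((⌈(N : ℝ) * p.2⌉ : ℝ) / N)) 2
      (volume.restrict (Ioc (0 : ℝ) 1 ×ˢ Ioc (0 : ℝ) 1))) ^ (2 : ℝ) =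
    ENNReal.ofReal (((N : ℝ) ^ 2)⁻¹ *
      ∑ i : Fin N, ∑ j : Fin N, f (((i : ℕ) + 1 : ℝ) / N) (((j : ℕ) + 1 : ℝ) / N) ^ 2) := by
  have hNr : (0 : ℝ) < N := by exact_mod_cast hN
  set F : ℤ × ℤ → ℝ≥0∞ := fun n => ENNReal.ofReal (f ((n.1 : ℝ) / N) ((n.2 : ℝ) / N) ^ 2)
  have hF : Measurable fun p : ℝ × ℝ => F (⌈(N : ℝ) * p.1⌉, ⌈(N : ℝ) * p.2⌉) :=
    (measurable_of_countable F).comp ((Int.measurable_ceil.comp (by fun_prop)).prodMk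
      (Int.measurable_ceil.comp (by fun_prop)))
  have h1 := eLpNorm_nnreal_pow_eq_lintegral (p := 2) (f := fun p : ℝ × ℝ =>
      f ((⌈(N : ℝ) * p.1⌉ : ℝ) / N) ((⌈(N : ℝ) * p.2⌉ : ℝ) / N))
    (μ := volume.restrict (Ioc (0 : ℝ) 1 ×ˢ Ioc (0 : ℝ) 1)) two_ne_zero
  have h2 : ∀ p : ℝ × ℝ, ‖f ((⌈(N : ℝ) * p.1⌉ : ℝ) / N) ((⌈(N : ℝ) * p.2⌉ : ℝ) / N)‖ₑ ^
      ((2 : NNReal) : ℝ) = F (⌈(N : ℝ) * p.1⌉, ⌈(N : ℝ) * p.2⌉) := by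
    intro p
    rw [← ofReal_norm, ENNReal.ofReal_rpow_of_nonneg (norm_nonneg _) (by norm_num)]
    simp [F]
  simp only [h2] at h1
  have h3 : (volume.restrict (Ioc (0 : ℝ) 1 ×ˢ Ioc (0 : ℝ) 1) : Measure (ℝ × ℝ)) =
      unitMeasure.prod unitMeasure := by
    rw [Measure.prod_restrict]
    rfl
  rw [h3] at h1 ⊢
  rw [lintegral_prod _ hF.aemeasurable] at h1
  have h4 : ∀ m : ℤ, ∫⁻ y, F (m, ⌈(N : ℝ) * y⌉) ∂unitMeasure =
      (N : ℝ≥0∞)⁻¹ * ∑ j : Fin N, F (m, ((j : ℕ) : ℤ) + 1) := fun m =>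
    lintegral_ceil hN fun n => F (m, n)
  simp only [h4] at h1
  rw [lintegral_ceil hN fun m => (N : ℝ≥0∞)⁻¹ * ∑ j : Fin N, F (m, ((j : ℕ) : ℤ) + 1)] at h1
  refine (Eq.trans (by norm_num) h1).trans ?_
  rw [← Finset.mul_sum, ← mul_assoc, ENNReal.ofReal_mul (by positivity), pow_two, mul_inv,
    ENNReal.ofReal_mul (by positivity), ENNReal.ofReal_inv_of_pos hNr, ENNReal.ofReal_natCast,
    ENNReal.ofReal_sum_of_nonneg (fun _ _ => by positivity)]
  congr 1
  refine Finset.sum_congr rfl fun i _ => ?_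
  rw [ENNReal.ofReal_sum_of_nonneg (fun _ _ => by positivity)]
  exact Finset.sum_congr rfl fun j _ => by simp [F]

theorem eventually_sum_sq_le_of_starNorm_lt {f : ℝ → ℝ → ℝ} {δ : ℝ} (hδ : 0 < δ)
    (h : starNorm f < ENNReal.ofReal √δ) : ∀ᶠ N : ℕ in atTop, ((N : ℝ) ^ 2)⁻¹ *
      ∑ i : Fin N, ∑ j : Fin N, f (((i : ℕ) + 1 : ℝ) / N) (((j : ℕ) + 1 : ℝ) / N) ^ 2 ≤ δ := by
  filter_upwards [eventually_lt_of_limsup_lt h, eventually_gt_atTop 0] with N hN hN0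
  rw [← ENNReal.ofReal_le_ofReal_iff hδ.le, ← eLpNorm_grid_sq hN0]
  refine (ENNReal.rpow_le_rpow hN.le zero_le_two).trans_eq ?_
  rw [ENNReal.ofReal_rpow_of_nonneg (Real.sqrt_nonneg _) zero_le_two, Real.rpow_two,
    Real.sq_sqrt hδ.le]

end Grid

/-! ### Kernels of the class 𝓕_α -/

section General

variable {α : ℝ} {σ : ℝ → ℝ → ℝ}

theorem RowBound.of_sub {k k' : ℝ → ℝ → ℝ} {a d : ℝ} (hm : RowMeasurable k') (ha : 0 ≤ a)
    (hd : 0 ≤ d) (h : RowBound (fun x v => k x v - k' x v) d) (h' : RowBound k' a) :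
    RowBound k (a + d) := by
  filter_upwards [hm, h, h'] with x hx h1 h2
  rw [ENNReal.ofReal_add ha hd]
  refine le_trans ?_ (add_le_add h2 h1)
  rw [← lintegral_add_left' hx.enorm]
  refine lintegral_mono fun v => ?_
  have := enorm_add_le (k' x v) (k x v - k' x v)
  rwa [add_sub_cancel] at this

theorem FClass.exists_approx (hσ : FClass α σ) :
    ∃ (τ : ℕ → ℝ → ℝ → ℝ) (d : ℕ → ℝ), (∀ n, PiecewiseConst (τ n)) ∧
      Tendsto (fun n => starNorm fun x v => τ n x v - σ x v) atTop (𝓝 0) ∧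
      (∀ n, 0 ≤ d n) ∧ (∀ n, d n ≤ 1) ∧ Tendsto d atTop (𝓝 0) ∧
      ∀ n, RowBound (fun x v => |τ n x v| ^ α - |σ x v| ^ α) (d n) := by
  obtain ⟨τ, hτ, hs, ho⟩ := hσ.approx
  -- Dropping the first p kernels makes all distances at most 1, in particular finite, so that they
  -- may be handled as real numbers.
  obtain ⟨p, hp⟩ := eventually_atTop.1 (ho.eventually_le_const one_pos)
  refine ⟨fun n => τ (n + p),
    fun n => (opNorm fun x v => |τ (n + p) x v| ^ α - |σ x v| ^ α).toReal, fun n => hτ _,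
    hs.comp (tendsto_add_atTop_nat p), fun _ => ENNReal.toReal_nonneg, fun n => ?_, ?_, fun n => ?_⟩
  · exact ENNReal.toReal_mono ENNReal.one_ne_top (hp _ (Nat.le_add_left p n))
  · exact (ENNReal.tendsto_toReal ENNReal.zero_ne_top).comp (ho.comp (tendsto_add_atTop_nat p))
  · refine RowBound.of_opNorm_le (ENNReal.ofReal_toReal ?_).ge
    exact ((hp _ (Nat.le_add_left p n)).trans_lt ENNReal.one_lt_top).ne

/-- High up, the term with ‖X - X'‖ on the right has a factor at most 1/2 and is absorbed; solutions
then depend Lipschitz continuously on the kernel, uniformly in z. -/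
theorem SolvesAt.norm_sub_le_of_large {μD : Measure ℝ} [IsProbabilityMeasure μD] (hα : 0 < α)
    (hα2 : α < 2) {a R : ℝ} (ha : 0 ≤ a) (hR : 0 < R)
    (hR' : ∀ y : ℝ, R ≤ y → Real.Gamma (1 - α / 2) / Real.Gamma (α / 2) *
      (a * Real.Gamma (α / 2 + α / 2)) * y ^ (-(α / 2 + α / 2)) ≤ 1 / 2) {z : ℂ} (hz : R ≤ z.im)
    {k k' : ℝ → ℝ → ℝ} (hk : RowMeasurable k) (hk' : RowMeasurable k') {d : ℝ}
    (hd : 0 ≤ d) (ha' : RowBound k' a) (hd' : RowBound (fun x v => k x v - k' x v) d)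
    {X X' : Lp ℂ ∞ unitMeasure} (hX : SolvesAt α μD k z X) (hX' : SolvesAt α μD k' z X') :
    ‖X - X'‖ ≤ 2 * Real.Gamma (1 - α / 2) * R ^ (-(α / 2)) * d := by
  have hz0 : 0 < z.im := hR.trans_le hz
  have hG : 0 < Real.Gamma (α / 2) := Real.Gamma_pos_of_pos (by positivity)
  have hG1 : 0 < Real.Gamma (1 - α / 2) := Real.Gamma_pos_of_pos (by linarith)
  have h1 := hX.norm_sub_le hα hα2 hz0 hk hk' ha hd ha' hd' hX'
  have h2 := mul_le_mul_of_nonneg_right (hR' z.im hz) (norm_nonneg (X - X'))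
  have h3 : z.im ^ (-(α / 2)) ≤ R ^ (-(α / 2)) :=
    Real.rpow_le_rpow_of_nonpos hR hz (by linarith)
  have h4 : Real.Gamma (1 - α / 2) / Real.Gamma (α / 2) *
      (d * (Real.Gamma (α / 2) * z.im ^ (-(α / 2)))) = Real.Gamma (1 - α / 2) * d * z.im ^ (-(α / 2)) := by
    field_simp
  have h5 := mul_le_mul_of_nonneg_left h3 (mul_nonneg hG1.le hd)
  rw [mul_add, h4] at h1
  linarith

theorem norm_integral_psi_sub_le {μD : Measure ℝ} [IsProbabilityMeasure μD] (hα : 0 < α)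
    (hα2 : α < 2) {z : ℂ} (hz : 0 < z.im) {X X' : Lp ℂ ∞ unitMeasure}
    (hX : ∀ᵐ x ∂unitMeasure, X x ∈ cone α) (hX' : ∀ᵐ x ∂unitMeasure, X' x ∈ cone α) :
    ‖Complex.I * (∫ v, psi 1 (α / 2) μD z (rot α * X v) ∂unitMeasure) -
      Complex.I * ∫ v, psi 1 (α / 2) μD z (rot α * X' v) ∂unitMeasure‖ ≤
      Real.Gamma (1 + α / 2) * z.im ^ (-(1 + α / 2)) * ‖X - X'‖ := by
  have hInt : ∀ W : Lp ℂ ∞ unitMeasure, (∀ᵐ x ∂unitMeasure, W x ∈ cone α) →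
      Integrable (fun v => psi 1 (α / 2) μD z (rot α * W v)) unitMeasure := by
    intro W hW
    have hre : ∀ᵐ x ∂unitMeasure, 0 ≤ (rot α * W x).re := by
      filter_upwards [hW] with x hx using rot_mul_re_nonneg hα2 hx
    refine Integrable.of_bound (aestronglyMeasurable_psi_comp one_pos (by positivity) hz
      ((Lp.aestronglyMeasurable W).const_mul _) hre) (Real.Gamma 1 * z.im ^ (-1 : ℝ)) ?_
    filter_upwards [hre] with x hx using norm_psi_le _ one_pos μD hz hx
  rw [← mul_sub, norm_mul, Complex.norm_I, one_mul, ← integral_sub (hInt X hX) (hInt X' hX')]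
  have h1 : ∀ᵐ v ∂unitMeasure,
      ‖psi 1 (α / 2) μD z (rot α * X v) - psi 1 (α / 2) μD z (rot α * X' v)‖ ≤
      Real.Gamma (1 + α / 2) * z.im ^ (-(1 + α / 2)) * ‖X - X'‖ := by
    have hG : 0 < Real.Gamma (1 + α / 2) := Real.Gamma_pos_of_pos (by positivity)
    filter_upwards [hX, hX', ae_norm_coe_sub_le X X'] with v h1 h2 h3
    refine (norm_psi_sub_le one_pos (by positivity) μD hz (rot_mul_re_nonneg hα2 h1)
      (rot_mul_re_nonneg hα2 h2)).trans ?_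
    rw [← mul_sub, norm_mul, norm_rot, one_mul]
    gcongr
  simpa using norm_integral_le_of_norm_le_const h1

/-- Existence and uniqueness of the solution, and convergence of the mean resolvent. -/
theorem FClass.exists_solution (hσ : FClass α σ) (hα : 0 < α) (hα2 : α < 2) :
    ∃ R > 0, ∀ (μD : Measure ℝ) [IsProbabilityMeasure μD], ∃ X : ℂ → Lp ℂ ∞ unitMeasure,
      DifferentiableOn ℂ X upperHalf ∧
      (∀ z ∈ upperHalf, SolvesAt α μD (fun x v => |σ x v| ^ α) z (X z)) ∧
      (∃ C : ℝ, ∀ z ∈ upperHalf, ‖X z‖ ≤ C * z.im ^ (-(α / 2))) ∧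
      (∀ z : ℂ, R ≤ z.im → ∀ W, SolvesAt α μD (fun x v => |σ x v| ^ α) z W → W = X z) ∧
      ∀ (ν : Measure ℝ) [IsProbabilityMeasure ν], HeavyTailed α ν → ∀ z ∈ upperHalf,
        Tendsto (fun N => meanRes ν μD (profile σ N) z) atTop (𝓝 (Complex.I *
          ∫ v, psi 1 (α / 2) μD z (rot α * X z v) ∂unitMeasure)) := by
  have hG1 : 0 < Real.Gamma (1 - α / 2) := Real.Gamma_pos_of_pos (by linarith)
  set k : ℝ → ℝ → ℝ := fun x v => |σ x v| ^ α with hk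
  have hkm : RowMeasurable k := RowMeasurable.rpow_abs hσ.aemeasurable α
  obtain ⟨τ, d, hτ, hstar, hd0, hd1, hd, hrow⟩ := hσ.exists_approx
  set a : ℝ := (opNorm k).toReal with ha
  have ha0 : 0 ≤ a := ENNReal.toReal_nonneg
  have hka : RowBound k a := RowBound.of_opNorm_le (ENNReal.ofReal_toReal hσ.opNorm_lt_top.ne).ge
  have hmono : ∀ {k : ℝ → ℝ → ℝ} {c c' : ℝ}, c ≤ c' → RowBound k c → RowBound k c' :=
    fun hc h => h.mono fun x hx => hx.trans (ENNReal.ofReal_le_ofReal hc)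
  have hka1 : RowBound k (a + 1) := hmono (by linarith) hka
  have hKa : ∀ n, RowBound (fun x v => |τ n x v| ^ α) (a + 1) := fun n =>
    hmono (by linarith [hd1 n]) (RowBound.of_sub hkm ha0 (hd0 n) (hrow n) hka)
  -- The number a + 1 bounds the row norms of |σ|^α and of all the approximations at once. R depends
  -- only on it and on α, and is fixed before μD.
  obtain ⟨R, hR, hR'⟩ := exists_forall_mul_rpow_neg_le (Real.Gamma (1 - α / 2) /
    Real.Gamma (α / 2) * ((a + 1) * Real.Gamma (α / 2 + α / 2))) (θ := α / 2 + α / 2) (by positivity)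
  choose q b s hstep using hτ
  have hKm : ∀ n, RowMeasurable fun x v => |τ n x v| ^ α := fun n =>
    RowMeasurable.rpow_abs (hstep n).aemeasurable α
  refine ⟨R, hR, fun μD _ => ?_⟩
  choose Xs hXs _ hlim using fun n => (hstep n).exists_unique_stepSolution (μD := μD) hα hα2
  set W : ℕ → ℂ → Lp ℂ ∞ unitMeasure := fun n z => stepLp (b n) fun r => Xs n r z
  have hW : ∀ n, ∀ z ∈ upperHalf, SolvesAt α μD (fun x v => |τ n x v| ^ α) z (W n z) :=
    fun n z hz => (hXs n).solvesAt (hstep n) hz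
  -- Any two approximating kernels differ by at most d n + d m, so their solutions are uniformly
  -- close for Im z ≥ R.
  have hCauchy : ∀ δ > 0, ∃ N₀, ∀ n ≥ N₀, ∀ m ≥ N₀, ∀ z : ℂ, R ≤ z.im → ‖W n z - W m z‖ ≤ δ := by
    intro δ hδ
    have h1 : Tendsto (fun n => 2 * Real.Gamma (1 - α / 2) * R ^ (-(α / 2)) * d n) atTop (𝓝 0) := by
      simpa using hd.const_mul (2 * Real.Gamma (1 - α / 2) * R ^ (-(α / 2)))
    obtain ⟨N₀, hN₀⟩ := eventually_atTop.1 (h1.eventually_le_const (half_pos hδ))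
    refine ⟨N₀, fun n hn m hm z hz => ?_⟩
    have hz0 : z ∈ upperHalf := hR.trans_le hz
    have h2 : RowBound (fun x v => |τ n x v| ^ α - |τ m x v| ^ α) (d n + d m) := by
      have := RowBound.sub ((hKm n).sub hkm) (hd0 n) (hd0 m) (hrow n) (hrow m)
      simpa only [hk, sub_sub_sub_cancel_right] using this
    have h3 := (hW n z hz0).norm_sub_le_of_large hα hα2 (by linarith) hR hR' hz (hKm n) (hKm m)
      (add_nonneg (hd0 n) (hd0 m)) (hKa m) h2 (hW m z hz0)
    linarith [hN₀ n hn, hN₀ m hm]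
  obtain ⟨X, hXd, hX⟩ := exists_differentiableOn_limit (f := W) (R := R)
    (B := fun ε => Real.Gamma (1 - α / 2) * ε ^ (-(α / 2)) * (a + 1))
    (fun n => (hXs n).differentiableOn_stepLp) (fun ε hε n z hz => by
      refine ((hW n z (hε.trans_le hz)).norm_le hα hα2 (hε.trans_le hz) (hKm n) (by linarith)
        (hKa n)).trans ?_
      have := Real.rpow_le_rpow_of_nonpos hε hz (show -(α / 2) ≤ 0 by linarith)
      gcongr) hCauchy
  have hsol : ∀ z ∈ upperHalf, SolvesAt α μD k z (X z) := fun z hz =>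
    SolvesAt.of_tendsto hα hα2 hz hkm hKm ha0 hka hd0 hrow hd (fun n => hW n z hz) (hX z hz)
  refine ⟨X, hXd, hsol, ⟨Real.Gamma (1 - α / 2) * a, fun z hz => ?_⟩, fun z hz W' hW' => ?_,
    fun ν _ hν z hz => ?_⟩
  · rw [mul_right_comm]
    exact (hsol z hz).norm_le hα hα2 hz hkm ha0 hka
  · have h1 := hW'.norm_sub_le_of_large hα hα2 (by linarith) hR hR' hz hkm hkm le_rfl hka1
      (Eventually.of_forall fun x => by simp) (hsol z (hR.trans_le hz))
    rw [mul_zero] at h1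
    exact sub_eq_zero.1 (norm_eq_zero.1 (le_antisymm h1 (norm_nonneg _)))
  · have hz0 : 0 < z.im := hz
    rw [Metric.tendsto_atTop]
    intro ε hε
    -- Order of choices: δ from the trace comparison, then n such that the kernel is within δ in the
    -- star norm and the solutions are close at z, then N. The three errors are each at most ε/4.
    obtain ⟨δ, hδ, hprop⟩ := exists_norm_meanRes_sub_le hν hα hα2 μD hz0 (show 0 < ε / 4 by positivity)
    have h1 : Tendsto (fun n => Real.Gamma (1 + α / 2) * z.im ^ (-(1 + α / 2)) * ‖W n z - X z‖) atTop
        (𝓝 0) := by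
      simpa using (tendsto_iff_norm_sub_tendsto_zero.1 (hX z hz)).const_mul
        (Real.Gamma (1 + α / 2) * z.im ^ (-(1 + α / 2)))
    obtain ⟨n, hn1, hn2⟩ := ((h1.eventually_le_const (show 0 < ε / 4 by positivity)).and
      (hstar.eventually_lt_const
        (show 0 < ENNReal.ofReal √δ from ENNReal.ofReal_pos.2 (Real.sqrt_pos.2 hδ)))).exists
    have h2 := Metric.tendsto_atTop.1 (hlim n ν hν z hz) (ε / 4) (by positivity)
    obtain ⟨N₁, hN₁⟩ := h2
    obtain ⟨N₂, hN₂⟩ := eventually_atTop.1 (hprop.and (eventually_sum_sq_le_of_starNorm_lt hδ hn2))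
    refine ⟨max N₁ N₂, fun N hN => ?_⟩
    have h3 := hN₁ N (le_of_max_le_left hN)
    obtain ⟨h4, h5⟩ := hN₂ N (le_of_max_le_right hN)
    have h6 := h4 (profile (τ n) N) (profile σ N) (profile_isSymm (hstep n).kernel_symm N)
      (profile_isSymm hσ.symm N) h5 z le_rfl
    have h7 := (norm_integral_psi_sub_le (μD := μD) hα hα2 hz0 (hW n z hz).mem_cone
      (hsol z hz).mem_cone).trans hn1
    rw [dist_eq_norm] at h3 ⊢
    rw [norm_sub_rev] at h6
    have h8 := norm_sub_le_norm_sub_add_norm_sub (meanRes ν μD (profile σ N) z)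
      (meanRes ν μD (profile (τ n) N) z)
      (Complex.I * ∫ v, psi 1 (α / 2) μD z (rot α * X z v) ∂unitMeasure)
    have h9 := norm_sub_le_norm_sub_add_norm_sub (meanRes ν μD (profile (τ n) N) z)
      (Complex.I * ∫ v, psi 1 (α / 2) μD z (rot α * W n z v) ∂unitMeasure)
      (Complex.I * ∫ v, psi 1 (α / 2) μD z (rot α * X z v) ∂unitMeasure)
    linarith

end General

/-! ### Stieltjes transforms and weak convergence -/

section Stieltjes

/-- The Stieltjes transform `∫ (t - z)⁻¹ dμ(t)`. -/
def stieltjes (μ : Measure ℝ) (z : ℂ) : ℂ := ∫ t : ℝ, ((t : ℂ) - z)⁻¹ ∂μ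

theorem ofReal_sub_ne_zero {z : ℂ} (hz : 0 < z.im) (t : ℝ) : (t : ℂ) - z ≠ 0 := by
  intro h
  have := congrArg Complex.im h
  simp at this
  exact hz.ne' this

theorem norm_inv_ofReal_sub_le {z : ℂ} (hz : 0 < z.im) (t : ℝ) : ‖((t : ℂ) - z)⁻¹‖ ≤ 1 / z.im := by
  rw [norm_inv, one_div]
  refine inv_anti₀ hz ?_
  have := Complex.abs_im_le_norm ((t : ℂ) - z)
  simpa [abs_of_pos hz] using this

theorem continuous_inv_ofReal_sub {z : ℂ} (hz : 0 < z.im) :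
    Continuous fun t : ℝ => ((t : ℂ) - z)⁻¹ :=
  (by fun_prop : Continuous fun t : ℝ => (t : ℂ) - z).inv₀ (ofReal_sub_ne_zero hz)

theorem integrable_inv_ofReal_sub (μ : Measure ℝ) [IsFiniteMeasure μ] {z : ℂ} (hz : 0 < z.im) :
    Integrable (fun t : ℝ => ((t : ℂ) - z)⁻¹) μ :=
  Integrable.of_bound (continuous_inv_ofReal_sub hz).aestronglyMeasurable _
    (Eventually.of_forall (norm_inv_ofReal_sub_le hz))

theorem im_inv_ofReal_sub (t : ℝ) (z : ℂ) :
    (((t : ℂ) - z)⁻¹).im = z.im / ((t - z.re) ^ 2 + z.im ^ 2) := by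
  rw [Complex.inv_im, Complex.normSq_apply]
  simp
  ring_nf

theorem im_stieltjes (μ : Measure ℝ) [IsFiniteMeasure μ] {z : ℂ} (hz : 0 < z.im) :
    (stieltjes μ z).im = ∫ t, z.im / ((t - z.re) ^ 2 + z.im ^ 2) ∂μ := by
  have h : (stieltjes μ z).im = ∫ t : ℝ, (((t : ℂ) - z)⁻¹).im ∂μ :=
    (integral_im (integrable_inv_ofReal_sub μ hz)).symm
  simp only [h, im_inv_ofReal_sub]

/-- The substitution x = t + ys. Moving the scale y into the argument of f lets y tend to 0 by
dominated convergence. -/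
theorem integral_mul_poisson (f : ℝ → ℝ) {y : ℝ} (hy : 0 < y) (t : ℝ) :
    ∫ x, f x * (y / ((t - x) ^ 2 + y ^ 2)) = ∫ s, f (t + y * s) * (1 + s ^ 2)⁻¹ := by
  have h1 : ∀ s : ℝ, f (t + y * s) * (1 + s ^ 2)⁻¹ =
      y * (f (t + y * s) * (y / ((t - (t + y * s)) ^ 2 + y ^ 2))) := by
    intro s
    have : (t - (t + y * s)) ^ 2 + y ^ 2 = y ^ 2 * (1 + s ^ 2) := by ring
    have h2 : (1 + s ^ 2) ≠ 0 := by positivity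
    rw [this]
    field_simp
  simp only [h1]
  rw [integral_const_mul,
    Measure.integral_comp_mul_left (fun u => f (t + u) * (y / ((t - (t + u)) ^ 2 + y ^ 2))) y,
    integral_add_left_eq_self (fun u => f u * (y / ((t - u) ^ 2 + y ^ 2))) t, smul_eq_mul,
    abs_of_pos (inv_pos.2 hy), mul_inv_cancel_left₀ hy.ne']

theorem integrable_poisson {y : ℝ} (hy : 0 < y) (t : ℝ) :
    Integrable fun x : ℝ => y / ((t - x) ^ 2 + y ^ 2) := by
  have h := ((integrable_inv_one_add_sq.comp_div hy.ne').comp_sub_left t).const_mul y⁻¹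
  refine h.congr (Eventually.of_forall fun x => ?_)
  have h1 : (t - x) ^ 2 + y ^ 2 = y ^ 2 * (1 + ((t - x) / y) ^ 2) := by
    field_simp
    ring
  have h2 : (1 + ((t - x) / y) ^ 2) ≠ 0 := by positivity
  beta_reduce
  rw [h1]
  field_simp

/-- The imaginary part of the transform is the Poisson integral of μ; Fubini shifts the smoothing
from the measure to f. -/
theorem integral_mul_im_stieltjes (μ : Measure ℝ) [IsFiniteMeasure μ]
    (f : BoundedContinuousFunction ℝ ℝ) {y : ℝ} (hy : 0 < y) :
    ∫ x, f x * (stieltjes μ ((x : ℂ) + y * Complex.I)).im =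
      ∫ p : ℝ × ℝ, f (p.1 + y * p.2) * (1 + p.2 ^ 2)⁻¹ ∂μ.prod volume := by
  have hInt : Integrable (fun p : ℝ × ℝ => f (p.1 + y * p.2) * (1 + p.2 ^ 2)⁻¹)
      (μ.prod volume) := by
    have h : Integrable (fun p : ℝ × ℝ => (1 : ℝ) * (1 + p.2 ^ 2)⁻¹) (μ.prod volume) :=
      (integrable_const (1 : ℝ)).mul_prod integrable_inv_one_add_sq
    simp only [one_mul] at h
    refine h.bdd_mul (c := ‖f‖) (f.continuous.comp (by fun_prop)).aestronglyMeasurable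
      (Eventually.of_forall fun p => f.norm_coe_le_norm _)
  have hden : ∀ x t : ℝ, (t - x) ^ 2 + y ^ 2 ≠ 0 := fun x t => by positivity
  have hcont : Continuous fun p : ℝ × ℝ => f p.2 * (y / ((p.1 - p.2) ^ 2 + y ^ 2)) :=
    (f.continuous.comp continuous_snd).mul (continuous_const.div (by fun_prop) fun p => hden _ _)
  have hInt' : Integrable (fun p : ℝ × ℝ => f p.2 * (y / ((p.1 - p.2) ^ 2 + y ^ 2)))
      (μ.prod volume) := by
    rw [integrable_prod_iff hcont.aestronglyMeasurable]
    refine ⟨Eventually.of_forall fun t => (integrable_poisson hy t).bdd_mul (c := ‖f‖)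
      f.continuous.aestronglyMeasurable (Eventually.of_forall fun p => f.norm_coe_le_norm _), ?_⟩
    refine Integrable.of_bound (C := ‖f‖ * Real.pi)
      hcont.norm.aestronglyMeasurable.integral_prod_right' (Eventually.of_forall fun t => ?_)
    rw [Real.norm_of_nonneg (integral_nonneg fun _ => norm_nonneg _)]
    have h1 := integral_mul_poisson (fun _ => ‖f‖) hy t
    rw [integral_const_mul, integral_const_mul, integral_univ_inv_one_add_sq] at h1
    rw [← h1, ← integral_const_mul]
    refine integral_mono_of_nonneg (Eventually.of_forall fun _ => norm_nonneg _)
      ((integrable_poisson hy t).const_mul _) (Eventually.of_forall fun x => ?_)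
    beta_reduce
    rw [norm_mul, Real.norm_of_nonneg (show 0 ≤ y / ((t - x) ^ 2 + y ^ 2) by positivity)]
    gcongr
    exact f.norm_coe_le_norm _
  rw [integral_prod _ hInt]
  simp only [← integral_mul_poisson f hy]
  rw [integral_integral_swap hInt']
  refine integral_congr_ae (Eventually.of_forall fun x => ?_)
  beta_reduce
  rw [integral_const_mul, im_stieltjes μ (by simpa using hy)]
  simp

/-- Inversion of the Stieltjes transform. -/
theorem tendsto_integral_mul_im_stieltjes (μ : Measure ℝ) [IsFiniteMeasure μ]
    (f : BoundedContinuousFunction ℝ ℝ) :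
    Tendsto (fun n : ℕ => Real.pi⁻¹ * ∫ x, f x *
      (stieltjes μ ((x : ℂ) + ((1 / ((n : ℝ) + 1) : ℝ) : ℂ) * Complex.I)).im) atTop
      (𝓝 (∫ t, f t ∂μ)) := by
  have hlim : ∫ t, f t ∂μ = Real.pi⁻¹ * ∫ p : ℝ × ℝ, f p.1 * (1 + p.2 ^ 2)⁻¹ ∂μ.prod volume := by
    rw [integral_prod_mul (fun t => f t) fun s : ℝ => (1 + s ^ 2)⁻¹, integral_univ_inv_one_add_sq,
      mul_comm (∫ _, _ ∂_), inv_mul_cancel_left₀ Real.pi_ne_zero]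
  have hpos : ∀ n : ℕ, (0 : ℝ) < 1 / ((n : ℝ) + 1) := fun n => by positivity
  simp only [integral_mul_im_stieltjes μ f (hpos _)]
  rw [hlim]
  refine Tendsto.const_mul _ (tendsto_integral_of_dominated_convergence
    (fun p => ‖f‖ * (1 + p.2 ^ 2)⁻¹) (fun n => ?_) ?_ (fun n => Eventually.of_forall fun p => ?_)
    (Eventually.of_forall fun p => ?_))
  · have : Continuous fun p : ℝ × ℝ => (1 + p.2 ^ 2)⁻¹ :=
      (by fun_prop : Continuous fun p : ℝ × ℝ => 1 + p.2 ^ 2).inv₀ fun p => by positivity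
    exact ((f.continuous.comp (by fun_prop)).mul this).aestronglyMeasurable
  · exact (integrable_const ‖f‖).mul_prod integrable_inv_one_add_sq
  · rw [norm_mul, Real.norm_of_nonneg (show 0 ≤ (1 + p.2 ^ 2)⁻¹ by positivity)]
    gcongr
    exact f.norm_coe_le_norm _
  · refine Tendsto.mul_const _ ((f.continuous.tendsto _).comp ?_)
    simpa using (tendsto_one_div_add_atTop_nhds_zero_nat (𝕜 := ℝ)).mul_const p.2 |>.const_add p.1

theorem eq_of_stieltjes_eq {μ μ' : Measure ℝ} [IsFiniteMeasure μ] [IsFiniteMeasure μ']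
    (h : ∀ z ∈ upperHalf, stieltjes μ z = stieltjes μ' z) : μ = μ' := by
  refine ext_of_forall_integral_eq_of_IsFiniteMeasure fun f => ?_
  refine tendsto_nhds_unique (tendsto_integral_mul_im_stieltjes μ f) ?_
  have hz : ∀ (n : ℕ) (x : ℝ),
      (x : ℂ) + ((1 / ((n : ℝ) + 1) : ℝ) : ℂ) * Complex.I ∈ upperHalf := fun n x => by
    have : (0 : ℝ) < 1 / ((n : ℝ) + 1) := by positivity
    simpa only [upperHalf, mem_ofPred_eq, Complex.add_im, Complex.ofReal_im, Complex.im_ofReal_mul,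
      Complex.I_im, mul_one, zero_add] using this
  simp only [h _ (hz _ _)]
  exact tendsto_integral_mul_im_stieltjes μ' f

/-- The function 1 - r²/(t² + r²) is nonnegative and at least 1/2 where |t| ≥ r, so this is Markov's
inequality. It reads tightness off the transform on the imaginary axis. -/
theorem measureReal_lt_norm_le (μ : Measure ℝ) [IsProbabilityMeasure μ] {r : ℝ} (hr : 0 < r) :
    μ.real {t | r < ‖t‖} ≤ 2 * (1 - r * (stieltjes μ ((r : ℂ) * Complex.I)).im) := by
  have hcont : Continuous fun t : ℝ => r / (t ^ 2 + r ^ 2) :=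
    continuous_const.div (by fun_prop) fun t => by positivity
  have hle : ∀ t : ℝ, r * (r / (t ^ 2 + r ^ 2)) ≤ 1 := fun t => by
    rw [← mul_div_assoc, div_le_one (by positivity)]
    nlinarith [sq_nonneg t]
  have hInt : Integrable (fun t : ℝ => r * (r / (t ^ 2 + r ^ 2))) μ := by
    refine Integrable.of_bound (C := 1) (continuous_const.mul hcont).aestronglyMeasurable
      (Eventually.of_forall fun t => ?_)
    rw [Real.norm_of_nonneg (by positivity)]
    exact hle t
  have h1 : ∫ t, (1 - r * (r / (t ^ 2 + r ^ 2))) ∂μ =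
      1 - r * (stieltjes μ ((r : ℂ) * Complex.I)).im := by
    rw [integral_sub (integrable_const _) hInt, integral_const_mul, im_stieltjes μ (by simpa using hr)]
    simp
  have h2 := mul_meas_ge_le_integral_of_nonneg (μ := μ) (f := fun t => 1 - r * (r / (t ^ 2 + r ^ 2)))
    (Eventually.of_forall fun t => sub_nonneg.2 (hle t)) ((integrable_const _).sub hInt) (1 / 2)
  rw [h1] at h2
  have h3 : μ.real {t | r < ‖t‖} ≤ μ.real {t | 1 / 2 ≤ 1 - r * (r / (t ^ 2 + r ^ 2))} := by
    refine measureReal_mono fun t ht => ?_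
    have h4 : r ^ 2 ≤ t ^ 2 := sq_le_sq.2 (by rw [abs_of_pos hr]; exact le_of_lt ht)
    have h5 : r * (r / (t ^ 2 + r ^ 2)) ≤ 1 / 2 := by
      rw [← mul_div_assoc, div_le_iff₀ (by positivity)]
      nlinarith
    simp only [mem_ofPred_eq]
    linarith
  linarith

/-- A pointwise limit of Stieltjes transforms of probability measures which has full mass at
infinity is the Stieltjes transform of the weak limit. -/
theorem exists_weaklyConverges_of_stieltjes {m : ℕ → Measure ℝ} [hm : ∀ n, IsProbabilityMeasure (m n)]
    {S : ℂ → ℂ} (hS : ∀ z ∈ upperHalf, Tendsto (fun n => stieltjes (m n) z) atTop (𝓝 (S z)))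
    (hS1 : Tendsto (fun r : ℝ => r * (S ((r : ℂ) * Complex.I)).im) atTop (𝓝 1)) :
    ∃ μ : Measure ℝ, IsProbabilityMeasure μ ∧ (∀ z ∈ upperHalf, stieltjes μ z = S z) ∧
      WeaklyConverges m μ := by
  -- The limsup of the masses outside [-r, r] is at most 2(1 - r Im S(ir)), which vanishes as r → ∞
  -- by the hypothesis on S.
  have htight : IsTightMeasureSet (Set.range m) := by
    refine isTightMeasureSet_range_of_tendsto_limsup_measure_norm_gt ?_
    have h1 : Tendsto (fun r : ℝ => ENNReal.ofReal (2 * (1 - r * (S ((r : ℂ) * Complex.I)).im)))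
        atTop (𝓝 0) := by
      have := ENNReal.tendsto_ofReal ((hS1.const_sub 1).const_mul 2)
      simpa using this
    refine tendsto_of_tendsto_of_tendsto_of_le_of_le' tendsto_const_nhds h1
      (Eventually.of_forall fun _ => zero_le) ?_
    filter_upwards [eventually_gt_atTop 0] with r hr
    have h2 : Tendsto (fun n => ENNReal.ofReal
        (2 * (1 - r * (stieltjes (m n) ((r : ℂ) * Complex.I)).im))) atTop
        (𝓝 (ENNReal.ofReal (2 * (1 - r * (S ((r : ℂ) * Complex.I)).im)))) :=
      ENNReal.tendsto_ofReal ((((Complex.continuous_im.tendsto _).comp (hS _ (by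
        simpa [upperHalf] using hr))).const_mul r).const_sub 1 |>.const_mul 2)
    rw [← h2.limsup_eq]
    refine limsup_le_limsup (Eventually.of_forall fun n => ?_)
    beta_reduce
    rw [← ENNReal.ofReal_toReal (measure_ne_top (m n) _)]
    exact ENNReal.ofReal_le_ofReal (measureReal_lt_norm_le (m n) hr)
  set M : ℕ → ProbabilityMeasure ℝ := fun n => ⟨m n, hm n⟩
  have hcomp : IsCompact (closure (Set.range M)) := by
    refine isCompact_closure_of_isTightMeasureSet ?_
    convert htight using 1
    ext μ
    exact ⟨fun ⟨_, ⟨n, hn⟩, hμ⟩ => ⟨n, by rw [← hμ, ← hn]; rfl⟩, fun ⟨n, hn⟩ => ⟨M n, ⟨n, rfl⟩, hn⟩⟩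
  -- The test function (t - z)⁻¹ is bounded and continuous, so every limit point has transform S.
  have hst : ∀ (U : Ultrafilter ℕ) (μ : ProbabilityMeasure ℝ), (U : Filter ℕ) ≤ atTop →
      Tendsto M U (𝓝 μ) → ∀ z ∈ upperHalf, stieltjes μ z = S z := by
    intro U μ hU hμ z hz
    rw [ProbabilityMeasure.tendsto_iff_forall_integral_rclike_tendsto ℂ] at hμ
    exact tendsto_nhds_unique (hμ (BoundedContinuousFunction.ofNormedAddCommGroup _
      (continuous_inv_ofReal_sub hz) _ (norm_inv_ofReal_sub_le hz))) ((hS z hz).mono_left hU)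
  have hex : ∀ U : Ultrafilter ℕ, ∃ μ : ProbabilityMeasure ℝ, Tendsto M U (𝓝 μ) := by
    intro U
    obtain ⟨μ, -, hμ⟩ := hcomp.ultrafilter_le_nhds (U.map M)
      (le_trans (by simp) (monotone_principal subset_closure))
    exact ⟨μ, hμ⟩
  obtain ⟨μ, hμ⟩ := hex (Ultrafilter.of atTop)
  have hμS := hst _ μ (Ultrafilter.of_le atTop) hμ
  refine ⟨μ, inferInstance, hμS, fun f => ?_⟩
  -- By compactness every ultrafilter has a limit. All these limits have the same transform, hence
  -- coincide, and the sequence converges.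
  have hconv : Tendsto M atTop (𝓝 μ) := by
    refine (Filter.tendsto_iff_ultrafilter _ _ _).2 fun U hU => ?_
    obtain ⟨μ', hμ'⟩ := hex U
    have h1 : (μ' : Measure ℝ) = μ := eq_of_stieltjes_eq fun z hz => by
      rw [hst U μ' hU hμ' z hz, hμS z hz]
    have h2 : μ' = μ := Subtype.ext h1
    exact h2 ▸ hμ'
  exact ProbabilityMeasure.tendsto_iff_forall_integral_tendsto.1 hconv f

end Stieltjes

/-! ### The mean spectral measure -/

section Spectral

set_option linter.unusedSectionVars false

theorem trace_resol_eq_sum {N : ℕ} {A : Matrix (Fin N) (Fin N) ℝ} (hA : A.IsHermitian) {z : ℂ}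
    (hz : 0 < z.im) : (resol A z).trace = ∑ i, ((hA.eigenvalues i : ℂ) - z)⁻¹ := by
  set U : Matrix (Fin N) (Fin N) ℝ := hA.eigenvectorUnitary.1
  set V := U.map Complex.ofReal
  set W := (star U).map Complex.ofReal
  have hmap : ∀ B C : Matrix (Fin N) (Fin N) ℝ,
      (B * C).map Complex.ofReal = B.map Complex.ofReal * C.map Complex.ofReal := fun B C =>
    Matrix.map_mul (f := Complex.ofRealHom)
  have hone : (1 : Matrix (Fin N) (Fin N) ℝ).map Complex.ofReal = 1 :=
    Matrix.map_one _ Complex.ofReal_zero Complex.ofReal_one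
  have hVW : V * W = 1 := by
    rw [← hmap, Unitary.mul_star_self_of_mem hA.eigenvectorUnitary.2, hone]
  have hWV : W * V = 1 := by
    rw [← hmap, Unitary.star_mul_self_of_mem hA.eigenvectorUnitary.2, hone]
  have hAU : A.map Complex.ofReal =
      V * Matrix.diagonal (fun i => (hA.eigenvalues i : ℂ)) * W := by
    have h1 := hA.spectral_theorem
    rw [Unitary.conjStarAlgAut_apply] at h1
    have h2 := congrArg (fun B => B.map Complex.ofReal) h1
    rw [hmap, hmap, Matrix.diagonal_map Complex.ofReal_zero] at h2
    exact h2
  have hshift : A.map Complex.ofReal - z • (1 : Matrix (Fin N) (Fin N) ℂ) =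
      V * Matrix.diagonal (fun i => (hA.eigenvalues i : ℂ) - z) * W := by
    have h1 : Matrix.diagonal (fun i => (hA.eigenvalues i : ℂ) - z) =
        Matrix.diagonal (fun i => (hA.eigenvalues i : ℂ)) - z • (1 : Matrix (Fin N) (Fin N) ℂ) := by
      rw [Matrix.smul_one_eq_diagonal, Matrix.diagonal_sub]
    rw [h1, mul_sub, sub_mul, ← hAU, mul_smul_comm, mul_one, smul_mul_assoc, hVW]
  have hinv : resol A z = V * Matrix.diagonal (fun i => ((hA.eigenvalues i : ℂ) - z)⁻¹) * W := by
    refine Matrix.inv_eq_right_inv ?_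
    rw [hshift]
    calc _ = V * (Matrix.diagonal (fun i => (hA.eigenvalues i : ℂ) - z) * (W * V) *
          Matrix.diagonal (fun i => ((hA.eigenvalues i : ℂ) - z)⁻¹)) * W := by
          simp only [Matrix.mul_assoc]
      _ = 1 := by
          rw [hWV, mul_one, Matrix.diagonal_mul_diagonal]
          simp only [mul_inv_cancel₀ (ofReal_sub_ne_zero hz _)]
          rw [Matrix.diagonal_one, mul_one, hVW]
  rw [hinv, Matrix.trace_mul_comm, ← mul_assoc, hWV, one_mul, Matrix.trace_diagonal]

theorem stieltjes_spectralMeasure {N : ℕ} {A : Matrix (Fin N) (Fin N) ℝ} (hA : A.IsHermitian) {z : ℂ}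
    (hz : 0 < z.im) : stieltjes (spectralMeasure hA) z = (N : ℂ)⁻¹ * (resol A z).trace := by
  rw [stieltjes, spectralMeasure, integral_smul_measure, integral_finsetSum_measure fun i _ =>
    integrable_inv_ofReal_sub _ hz, trace_resol_eq_sum hA hz, Complex.real_smul]
  simp

instance isProbabilityMeasure_spectralMeasure {N : ℕ} [NeZero N] {A : Matrix (Fin N) (Fin N) ℝ}
    (hA : A.IsHermitian) : IsProbabilityMeasure (spectralMeasure hA) := by
  refine ⟨?_⟩
  have : (N : ℝ≥0∞) ≠ 0 := by exact_mod_cast NeZero.ne N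
  simp [spectralMeasure, ENNReal.inv_mul_cancel this (ENNReal.natCast_ne_top N)]

/-- Closed sets form a generating π-system, and their indicators are limits of bounded continuous
functions. -/
theorem measurable_of_measurable_integral {Ω : Type*} [MeasurableSpace Ω] {κ : Ω → Measure ℝ}
    [∀ ω, IsProbabilityMeasure (κ ω)]
    (h : ∀ f : BoundedContinuousFunction ℝ ℝ, Measurable fun ω => ∫ t, f t ∂κ ω) : Measurable κ := by
  refine Measurable.measure_of_isPiSystem_of_isProbabilityMeasure
    (BorelSpace.measurable_eq.trans borel_eq_generateFrom_isClosed) isPiSystem_isClosed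
    fun F hF => ?_
  have hreal : Measurable fun ω => (κ ω).real F := by
    have hpos : ∀ n : ℕ, (0 : ℝ) < 1 / ((n : ℝ) + 1) := fun n => by positivity
    refine measurable_of_tendsto_metrizable
      (f := fun n ω => ∫ t, (thickenedIndicator (hpos n) F t : ℝ) ∂κ ω) (fun n => ?_)
      (tendsto_pi_nhds.2 fun ω => tendsto_integral_thickenedIndicator_of_isClosed (κ ω) hF hpos
        tendsto_one_div_add_atTop_nhds_zero_nat)
    exact h (BoundedContinuousFunction.ofNormedAddCommGroup
      (fun t => (thickenedIndicator (hpos n) F t : ℝ)) (by fun_prop) 1 fun t => by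
        simpa using thickenedIndicator_le_one (hpos n) F t)
  have e : (fun ω => κ ω F) = fun ω => ENNReal.ofReal ((κ ω).real F) := by
    funext ω
    exact (ENNReal.ofReal_toReal (measure_ne_top (κ ω) F)).symm
  rw [e]
  exact hreal.ennreal_ofReal

theorem ens_isHermitian {N : ℕ} {s : Matrix (Fin N) (Fin N) ℝ} (hs : s.IsSymm) (a : ℝ)
    (w : EnsIdx N → ℝ) : (ens s a w).IsHermitian := by
  rw [Matrix.IsHermitian, Matrix.conjTranspose_eq_transpose_of_trivial]
  exact ens_isSymm hs a w

/-- Measurability of the individual eigenvalues is bypassed: by Stieltjes inversion, integrals of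
test functions are limits of integrals of the trace of the resolvent, which is continuous in the
entries. -/
theorem measurable_spectralMeasure_ens {N : ℕ} [NeZero N] {s : Matrix (Fin N) (Fin N) ℝ}
    (hs : s.IsSymm) (a : ℝ) : Measurable fun w => spectralMeasure (ens_isHermitian hs a w) := by
  refine measurable_of_measurable_integral fun f => measurable_of_tendsto_metrizable
    (f := fun (n : ℕ) w => Real.pi⁻¹ * ∫ x, f x * (stieltjes (spectralMeasure
      (ens_isHermitian hs a w)) ((x : ℂ) + ((1 / ((n : ℝ) + 1) : ℝ) : ℂ) * Complex.I)).im)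
    (fun n => ?_) (tendsto_pi_nhds.2 fun w => tendsto_integral_mul_im_stieltjes _ f)
  set y : ℝ := 1 / ((n : ℝ) + 1) with hy
  have hy0 : 0 < y := by positivity
  have hz : ∀ x : ℝ, 0 < ((x : ℂ) + (y : ℂ) * Complex.I).im := fun x => by simpa using hy0
  have hc : Continuous fun p : (EnsIdx N → ℝ) × ℝ =>
      (resol (ens s a p.1) ((p.2 : ℂ) + (y : ℂ) * Complex.I)).trace := by
    unfold Matrix.trace
    exact continuous_finsetSum _ fun i _ => continuous_resol ((continuous_ens s a).comp continuous_fst)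
      (by fun_prop) (fun p => ens_isSymm hs a p.1) (fun p => hz p.2) i i
  simp only [stieltjes_spectralMeasure _ (hz _)]
  refine (StronglyMeasurable.integral_prod_right (f := fun w x => f x * ((N : ℂ)⁻¹ *
    (resol (ens s a w) ((x : ℂ) + (y : ℂ) * Complex.I)).trace).im) ?_).measurable.const_mul _
  exact ((f.continuous.comp continuous_snd).mul
    (Complex.continuous_im.comp (continuous_const.mul hc))).stronglyMeasurable

/-- The mean spectral measure of the ensemble on its canonical space. -/
def ensSpectral (ν μD : Measure ℝ) {N : ℕ} {s : Matrix (Fin N) (Fin N) ℝ} (hs : s.IsSymm) :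
    Measure ℝ :=
  (Measure.pi (ensLaw ν μD N)).bind fun w => spectralMeasure (ens_isHermitian hs (scale ν N) w)

variable {ν μD : Measure ℝ} [IsProbabilityMeasure ν] [IsProbabilityMeasure μD]

/-- The spectral measure as a Markov kernel. -/
def spectralKernel {N : ℕ} [NeZero N] {s : Matrix (Fin N) (Fin N) ℝ} (hs : s.IsSymm) (a : ℝ) :
    Kernel (EnsIdx N → ℝ) ℝ :=
  ⟨fun w => spectralMeasure (ens_isHermitian hs a w), measurable_spectralMeasure_ens hs a⟩

instance isMarkovKernel_spectralKernel {N : ℕ} [NeZero N] {s : Matrix (Fin N) (Fin N) ℝ}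
    (hs : s.IsSymm) (a : ℝ) : IsMarkovKernel (spectralKernel hs a) :=
  ⟨fun w => isProbabilityMeasure_spectralMeasure (ens_isHermitian hs a w)⟩

theorem ensSpectral_eq {N : ℕ} [NeZero N] {s : Matrix (Fin N) (Fin N) ℝ} (hs : s.IsSymm) :
    ensSpectral ν μD hs =
      (Measure.pi (ensLaw ν μD N)).bind (spectralKernel hs (scale ν N)) := rfl

instance isProbabilityMeasure_ensSpectral {N : ℕ} [NeZero N] {s : Matrix (Fin N) (Fin N) ℝ}
    (hs : s.IsSymm) : IsProbabilityMeasure (ensSpectral ν μD hs) := by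
  rw [ensSpectral_eq]
  infer_instance

theorem stieltjes_ensSpectral {N : ℕ} [NeZero N] {s : Matrix (Fin N) (Fin N) ℝ} (hs : s.IsSymm)
    {z : ℂ} (hz : 0 < z.im) : stieltjes (ensSpectral ν μD hs) z = meanRes ν μD s z := by
  rw [stieltjes, ensSpectral_eq, ← Measure.snd_compProd, Measure.snd,
    integral_map measurable_snd.aemeasurable
      (continuous_inv_ofReal_sub hz).aestronglyMeasurable, Measure.integral_compProd, meanRes,
    ← integral_const_mul]
  · refine integral_congr_ae (Eventually.of_forall fun w => ?_)
    exact stieltjes_spectralMeasure (ens_isHermitian hs (scale ν N) w) hz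
  · exact Integrable.of_bound ((continuous_inv_ofReal_sub hz).comp continuous_snd
      |>.aestronglyMeasurable) _ (Eventually.of_forall fun p => norm_inv_ofReal_sub_le hz p.2)

variable {Ω : Type*} [MeasurableSpace Ω] {P : Measure Ω} [IsProbabilityMeasure P]
  {x : ℕ → ℕ → Ω → ℝ} {D : (N : ℕ) → Fin N → Ω → ℝ}

/-- The position of an unordered pair in the upper triangle. -/
def pairIdx {N : ℕ} (e : Sym2 (Fin N)) : {p : ℕ × ℕ // p.1 ≤ p.2} :=
  ⟨(((Sym2.sortEquiv e).1.1 : ℕ), ((Sym2.sortEquiv e).1.2 : ℕ)), (Sym2.sortEquiv e).2⟩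

theorem pairIdx_injective {N : ℕ} : Function.Injective (pairIdx (N := N)) := by
  intro e e' h
  refine Sym2.sortEquiv.injective (Subtype.ext (Prod.ext (Fin.ext ?_) (Fin.ext ?_)))
  · exact congrArg (fun p => p.1.1) h
  · exact congrArg (fun p => p.1.2) h

/-- The independent entries of the matrix, as a function on the probability space. -/
def entries (x : ℕ → ℕ → Ω → ℝ) (D : (N : ℕ) → Fin N → Ω → ℝ) (N : ℕ) (ω : Ω) : EnsIdx N → ℝ :=
  Sum.elim (fun e => x (pairIdx e).1.1 (pairIdx e).1.2 ω) fun k => D N k ω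

theorem perturbedMatrix_eq_ens (σ : ℝ → ℝ → ℝ) (N : ℕ) (a : ℝ) (x : ℕ → ℕ → Ω → ℝ)
    (D : (N : ℕ) → Fin N → Ω → ℝ) (ω : Ω) :
    perturbedMatrix σ N a (fun i j => x i j ω) (fun k => D N k ω) =
      ens (profile σ N) a (entries x D N ω) := by
  rw [perturbedMatrix, ens]
  congr 1

/-- Selecting one representative of each unordered pair turns the assumptions of the model into a
product law. Every expectation can therefore be computed on the canonical space. -/
theorem Model.map_entries (h : Model P ν μD x D) (N : ℕ) :
    P.map (entries x D N) = Measure.pi (ensLaw ν μD N) := by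
  have hx : Measurable fun ω (e : Sym2 (Fin N)) => x (pairIdx e).1.1 (pairIdx e).1.2 ω :=
    measurable_pi_lambda _ fun e => h.measurable_x _ _ (pairIdx e).2
  have hD : Measurable fun ω k => D N k ω := measurable_pi_lambda _ (h.measurable_D N)
  have h1 : P.map (fun ω (e : Sym2 (Fin N)) => x (pairIdx e).1.1 (pairIdx e).1.2 ω) =
      Measure.pi fun _ => ν := by
    rw [(iIndepFun_iff_map_fun_eq_pi_map fun e =>
      (h.measurable_x _ _ (pairIdx e).2).aemeasurable).1 (h.indep_x.precomp pairIdx_injective)]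
    simp only [h.law_x _ _ (pairIdx _).2]
  have h2 : P.map (fun ω k => D N k ω) = Measure.pi fun _ => μD := by
    rw [(iIndepFun_iff_map_fun_eq_pi_map fun k => (h.measurable_D N k).aemeasurable).1 (h.indep_D N)]
    simp only [h.law_D]
  have h3 := (h.indep_x_D N).comp (φ := fun g (e : Sym2 (Fin N)) => g (pairIdx e)) (ψ := id)
    (by fun_prop) measurable_id
  have h4 := (indepFun_iff_map_prod_eq_prod_map_map hx.aemeasurable hD.aemeasurable).1 h3
  rw [h1, h2] at h4
  have h5 := (measurePreserving_sumPiEquivProdPi_symm (ensLaw ν μD N)).map_eq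
  have h6 : (Measure.pi fun _ : Sym2 (Fin N) => ν).prod (Measure.pi fun _ : Fin N => μD) =
      (Measure.pi fun i => ensLaw ν μD N (Sum.inl i)).prod
        (Measure.pi fun i => ensLaw ν μD N (Sum.inr i)) := rfl
  rw [← h5, ← h6, ← h4, Measure.map_map (MeasurableEquiv.measurable _) (hx.prodMk hD)]
  congr 1

theorem spectralMeasure_congr {N : ℕ} {A B : Matrix (Fin N) (Fin N) ℝ} (hA : A.IsHermitian)
    (hB : B.IsHermitian) (h : A = B) : spectralMeasure hA = spectralMeasure hB := by
  subst h
  rfl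

theorem Model.meanSpectralMeasure_eq (h : Model P ν μD x D) {σ : ℝ → ℝ → ℝ}
    (hσ : ∀ x ∈ Ioc (0 : ℝ) 1, ∀ y ∈ Ioc (0 : ℝ) 1, σ x y = σ y x) (N : ℕ) [NeZero N] :
    meanSpectralMeasure P hσ N (scale ν N) x (D N) = ensSpectral ν μD (profile_isSymm hσ N) := by
  have hm : Measurable (entries x D N) := by
    refine measurable_pi_lambda _ fun e => ?_
    rcases e with e | k
    · exact h.measurable_x _ _ (pairIdx e).2
    · exact h.measurable_D N k
  rw [meanSpectralMeasure, ensSpectral, ← h.map_entries N, Measure.bind, Measure.bind,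
    Measure.map_map (measurable_spectralMeasure_ens (profile_isSymm hσ N) (scale ν N)) hm]
  refine congrArg (fun f => Measure.join (P.map f)) (funext fun ω => ?_)
  exact spectralMeasure_congr _ _ (perturbedMatrix_eq_ens σ N (scale ν N) x D ω)

end Spectral

/-! ### Identification of the limit measure -/

section Limit

set_option linter.unusedSectionVars false

variable {α : ℝ} {μD : Measure ℝ} [IsProbabilityMeasure μD]

/-- With vanishing field only the diagonal perturbation remains, and the transform is that of μD. -/
theorem psi_one_zero (γ : ℝ) {z : ℂ} (hz : 0 < z.im) :
    Complex.I * psi 1 γ μD z 0 = stieltjes μD z := by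
  rw [psi, stieltjes, ← integral_const_mul]
  refine integral_congr_ae (Eventually.of_forall fun l => ?_)
  have hre : 0 < (Complex.I * ((l : ℂ) - z)).re := by rwa [I_mul_sub_re]
  beta_reduce
  rw [laplaceInt_zero_right γ one_pos hre, Real.Gamma_one, Complex.ofReal_one, Complex.cpow_one,
    mul_one, mul_inv, ← mul_assoc, mul_inv_cancel₀ Complex.I_ne_zero, one_mul]

theorem tendsto_mul_im_stieltjes (μ : Measure ℝ) [IsProbabilityMeasure μ] :
    Tendsto (fun r : ℝ => r * (stieltjes μ ((r : ℂ) * Complex.I)).im) atTop (𝓝 1) := by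
  have h1 : Tendsto (fun r : ℝ => ∫ t, r ^ 2 / (t ^ 2 + r ^ 2) ∂μ) atTop (𝓝 (∫ _, (1 : ℝ) ∂μ)) := by
    refine tendsto_integral_filter_of_dominated_convergence (fun _ => 1) ?_ ?_ (integrable_const _) ?_
    · filter_upwards [eventually_gt_atTop 0] with r hr
      exact (continuous_const.div (by fun_prop) fun t => by positivity :
        Continuous fun t : ℝ => r ^ 2 / (t ^ 2 + r ^ 2)).aestronglyMeasurable
    · filter_upwards [eventually_gt_atTop 0] with r hr
      refine Eventually.of_forall fun t => ?_
      rw [Real.norm_of_nonneg (by positivity), div_le_one (by positivity)]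
      nlinarith [sq_nonneg t]
    · refine Eventually.of_forall fun t => ?_
      have h2 : Tendsto (fun r : ℝ => 1 - t ^ 2 / (t ^ 2 + r ^ 2)) atTop (𝓝 (1 - 0)) :=
        tendsto_const_nhds.sub (tendsto_const_nhds.div_atTop
          (tendsto_atTop_add_const_left _ _ (tendsto_pow_atTop two_ne_zero)))
      rw [sub_zero] at h2
      refine h2.congr' ?_
      filter_upwards [eventually_gt_atTop 0] with r hr
      field_simp
      ring
  rw [integral_const, probReal_univ, one_smul] at h1
  refine h1.congr' ?_
  filter_upwards [eventually_gt_atTop 0] with r hr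
  rw [im_stieltjes μ (by simpa using hr), ← integral_const_mul]
  refine integral_congr_ae (Eventually.of_forall fun t => ?_)
  simp
  ring

theorem zero_mem_cone (hα : 0 < α) (hα2 : α < 2) : (0 : ℂ) ∈ cone α := by
  rw [mem_cone_iff_rotCone hα hα2]
  simp [rotCone]

/-- At z = ir the field is O(r^{-α/2}), so after multiplication by r the transform differs from that
of μD by O(r^{-α}). The limit therefore loses no mass at infinity. -/
theorem tendsto_mul_im_of_bound (hα : 0 < α) (hα2 : α < 2) {X : ℂ → Lp ℂ ∞ unitMeasure} {C : ℝ}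
    (hX : ∀ z ∈ upperHalf, ∀ᵐ x ∂unitMeasure, X z x ∈ cone α)
    (hC : ∀ z ∈ upperHalf, ‖X z‖ ≤ C * z.im ^ (-(α / 2))) :
    Tendsto (fun r : ℝ => r * (Complex.I * ∫ v, psi 1 (α / 2) μD ((r : ℂ) * Complex.I)
      (rot α * X ((r : ℂ) * Complex.I) v) ∂unitMeasure).im) atTop (𝓝 1) := by
  have hG : 0 < Real.Gamma (1 + α / 2) := Real.Gamma_pos_of_pos (by positivity)
  have h0 : ∀ᵐ x ∂unitMeasure, (0 : Lp ℂ ∞ unitMeasure) x = 0 := Lp.coeFn_zero ℂ ∞ unitMeasure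
  have hlim : Tendsto (fun r : ℝ => Real.Gamma (1 + α / 2) * C * r ^ (-α)) atTop (𝓝 0) := by
    simpa using (tendsto_rpow_neg_atTop hα).const_mul (Real.Gamma (1 + α / 2) * C)
  have hdiff : Tendsto (fun r : ℝ => r * (Complex.I * ∫ v, psi 1 (α / 2) μD ((r : ℂ) * Complex.I)
      (rot α * X ((r : ℂ) * Complex.I) v) ∂unitMeasure).im -
      r * (stieltjes μD ((r : ℂ) * Complex.I)).im) atTop (𝓝 0) := by
    refine squeeze_zero_norm' ?_ hlim
    filter_upwards [eventually_gt_atTop 0] with r hr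
    set z : ℂ := (r : ℂ) * Complex.I with hz
    have hzim : z.im = r := by simp [hz]
    have hz0 : 0 < z.im := by rwa [hzim]
    have h1 := norm_integral_psi_sub_le (μD := μD) hα hα2 hz0 (hX z hz0)
      (X' := 0) (h0.mono fun x hx => by rw [hx]; exact zero_mem_cone hα hα2)
    have h2 : ∫ v, psi 1 (α / 2) μD z (rot α * (0 : Lp ℂ ∞ unitMeasure) v) ∂unitMeasure =
        psi 1 (α / 2) μD z 0 := by
      rw [integral_congr_ae (g := fun _ => psi 1 (α / 2) μD z 0)
        (h0.mono fun x hx => by beta_reduce; rw [hx, mul_zero])]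
      simp
    rw [h2, psi_one_zero _ hz0, sub_zero, hzim] at h1
    rw [← mul_sub, ← Complex.sub_im, Real.norm_eq_abs, abs_mul, abs_of_pos hr]
    have h3 := (Complex.abs_im_le_norm _).trans (h1.trans
      (mul_le_mul_of_nonneg_left (hC z hz0) (by positivity)))
    refine (mul_le_mul_of_nonneg_left h3 hr.le).trans_eq ?_
    have e : r ^ (-α) = r * r ^ (-(1 + α / 2)) * r ^ (-(α / 2)) := by
      nth_rewrite 2 [← Real.rpow_one r]
      rw [← Real.rpow_add hr, ← Real.rpow_add hr]
      congr 1
      ring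
    rw [hzim, e]
    ring
  simpa using hdiff.add (tendsto_mul_im_stieltjes μD)

theorem norm_inv_mul_hFun_le (hα : 0 < α) (hα2 : α < 2) {z w : ℂ} (hz : 0 < z.im) (hw : w ∈ cone α)
    (l : ℝ) : ‖1 / (z - (l : ℂ)) * hFun α (invPow α ((l : ℂ) - z) * w)‖ ≤ 1 / z.im := by
  have hre : (Complex.I * ((l : ℂ) - z)).re = z.im := I_mul_sub_re l z
  rw [integral_hFun_eq_psi hα hα2 l hz hw, norm_mul, norm_neg, Complex.norm_I, one_mul]
  refine (norm_laplaceInt_le one_pos (by rwa [hre]) (rot_mul_re_nonneg hα2 hw)).trans_eq ?_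
  rw [hre, Real.Gamma_one]
  simp [Real.rpow_neg_one]

/-- Fubini followed by the closed form of the Laplace integral with β = 1. The sign is the
difference between (z - t)⁻¹ and (t - z)⁻¹. -/
theorem integral_hFun_eq (hα : 0 < α) (hα2 : α < 2) {z : ℂ} (hz : 0 < z.im)
    {X : Lp ℂ ∞ unitMeasure} (hX : ∀ᵐ x ∂unitMeasure, X x ∈ cone α) :
    ∫ l : ℝ, 1 / (z - (l : ℂ)) * (∫ v, hFun α (invPow α ((l : ℂ) - z) * X v) ∂unitMeasure) ∂μD =
      -(Complex.I * ∫ v, psi 1 (α / 2) μD z (rot α * X v) ∂unitMeasure) := by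
  have hh : Continuous (hFun α) := by
    have : hFun α = genFun 1 (α / 2) := funext (hFun_eq_genFun α)
    rw [this]
    exact (differentiable_genFun one_pos (by positivity) (by linarith)).continuous
  have hmeas : Measurable fun p : ℝ × ℝ => 1 / (z - (p.1 : ℂ)) *
      hFun α (invPow α ((p.1 : ℂ) - z) * X p.2) := by
    have h1 : Measurable fun p : ℝ × ℝ => invPow α ((p.1 : ℂ) - z) := by
      unfold invPow
      fun_prop
    have h2 : Measurable fun p : ℝ × ℝ => X p.2 :=
      (Lp.stronglyMeasurable X).measurable.comp measurable_snd
    have h3 : Measurable fun p : ℝ × ℝ => 1 / (z - (p.1 : ℂ)) := by fun_prop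
    exact h3.mul (hh.measurable.comp (h1.mul h2))
  have hInt : Integrable (fun p : ℝ × ℝ => 1 / (z - (p.1 : ℂ)) *
      hFun α (invPow α ((p.1 : ℂ) - z) * X p.2)) (μD.prod unitMeasure) := by
    refine Integrable.of_bound (C := 1 / z.im) hmeas.aestronglyMeasurable ?_
    filter_upwards [Measure.quasiMeasurePreserving_snd.ae hX] with p hp
    exact norm_inv_mul_hFun_le hα hα2 hz hp p.1
  simp only [← integral_const_mul]
  rw [integral_integral_swap hInt, ← integral_neg]
  refine integral_congr_ae ?_
  filter_upwards [hX] with v hv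
  simp only [integral_hFun_eq_psi hα hα2 _ hz hv]
  rw [integral_const_mul, psi]
  ring

/-- For N = 0 there are no eigenvalues and the spectral measure is not a probability measure, so
convergence is proved from N = 1 on. -/
theorem weaklyConverges_succ {m : ℕ → Measure ℝ} {μ : Measure ℝ}
    (h : WeaklyConverges (fun N => m (N + 1)) μ) : WeaklyConverges m μ := fun f =>
  (tendsto_add_atTop_iff_nat 1).1 (h f)

theorem Model.isProbabilityMeasure_law {Ω : Type*} [MeasurableSpace Ω] {P : Measure Ω}
    [IsProbabilityMeasure P] {ν : Measure ℝ} {x : ℕ → ℕ → Ω → ℝ} {D : (N : ℕ) → Fin N → Ω → ℝ}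
    (h : Model P ν μD x D) : IsProbabilityMeasure ν := by
  rw [← h.law_x 0 0 le_rfl]
  exact Measure.isProbabilityMeasure_map (h.measurable_x 0 0 le_rfl).aemeasurable

/-- Convergence of the mean spectral measures for every heavy tailed law of the entries. -/
theorem exists_limit_law (hα : 0 < α) {σ : ℝ → ℝ → ℝ}
    (hσ : ∀ x ∈ Ioc (0 : ℝ) 1, ∀ y ∈ Ioc (0 : ℝ) 1, σ x y = σ y x) {S : ℂ → ℂ}
    (hS : ∀ (ν : Measure ℝ) [IsProbabilityMeasure ν], HeavyTailed α ν → ∀ z ∈ upperHalf,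
      Tendsto (fun N => meanRes ν μD (profile σ N) z) atTop (𝓝 (S z)))
    (hS1 : Tendsto (fun r : ℝ => r * (S ((r : ℂ) * Complex.I)).im) atTop (𝓝 1)) :
    ∃ μ : Measure ℝ, IsProbabilityMeasure μ ∧ (∀ z ∈ upperHalf, stieltjes μ z = S z) ∧
      ∀ (ν : Measure ℝ) [IsProbabilityMeasure ν], HeavyTailed α ν →
        WeaklyConverges (fun N => ensSpectral ν μD (profile_isSymm hσ N)) μ := by
  have key : ∀ (ν : Measure ℝ) [IsProbabilityMeasure ν], HeavyTailed α ν →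
      ∃ μ : Measure ℝ, IsProbabilityMeasure μ ∧ (∀ z ∈ upperHalf, stieltjes μ z = S z) ∧
        WeaklyConverges (fun N => ensSpectral ν μD (profile_isSymm hσ N)) μ := by
    intro ν _ hν
    obtain ⟨μ, h1, h2, h3⟩ := exists_weaklyConverges_of_stieltjes
      (m := fun N => ensSpectral ν μD (profile_isSymm hσ (N + 1))) (fun z hz => by
        simp only [stieltjes_ensSpectral _ hz]
        exact (hS ν hν z hz).comp (tendsto_add_atTop_nat 1)) hS1
    exact ⟨μ, h1, h2, weaklyConverges_succ h3⟩
  -- The Pareto law fixes μ. For any other law the limit has the same transform S and is therefore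
  -- the same measure.
  obtain ⟨μ, h1, h2, -⟩ := key (pareto α) (heavyTailed_pareto hα)
  refine ⟨μ, h1, h2, fun ν _ hν => ?_⟩
  obtain ⟨μ', h1', h2', h3'⟩ := key ν hν
  have : μ' = μ := eq_of_stieltjes_eq fun z hz => by rw [h2' z hz, h2 z hz]
  exact this ▸ h3'

end Limit

end HeavyTail

end

/-! ### The theorem -/

theorem mainTheorem4 (α : ℝ) (hα0 : 0 < α) (hα2 : α < 2)
    (σ : ℝ → ℝ → ℝ) (hσ : HeavyTail.FClass α σ) :
    ∃ R : ℝ, 0 < R ∧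
      ∀ (μD : Measure ℝ) [IsProbabilityMeasure μD], Integrable (fun t : ℝ => t ^ 2) μD →
        ∃ X : ℂ → Lp ℂ ∞ HeavyTail.unitMeasure,
          HeavyTail.IsSolution α σ μD R X ∧
          (∀ X' : ℂ → Lp ℂ ∞ HeavyTail.unitMeasure,
            HeavyTail.IsSolution α σ μD R X' → EqOn X' X HeavyTail.upperHalf) ∧
          (∃ μ : Measure ℝ, IsProbabilityMeasure μ ∧
            (∀ z ∈ HeavyTail.upperHalf,
              ∫ t : ℝ, 1 / (z - (t : ℂ)) ∂μ =
                ∫ l : ℝ, 1 / (z - (l : ℂ)) *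
                  (∫ v, HeavyTail.hFun α (HeavyTail.invPow α ((l : ℂ) - z) * X z v)
                    ∂HeavyTail.unitMeasure) ∂μD) ∧
            ∀ {Ω : Type*} [MeasurableSpace Ω] (P : Measure Ω) [IsProbabilityMeasure P]
              (ν : Measure ℝ) (x : ℕ → ℕ → Ω → ℝ) (D : (N : ℕ) → Fin N → Ω → ℝ),
              HeavyTail.HeavyTailed α ν → HeavyTail.Model P ν μD x D →
              HeavyTail.WeaklyConverges
                (fun N => HeavyTail.meanSpectralMeasure P hσ.symm N (HeavyTail.scale ν N) x (D N))
                μ) ∧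
          (∀ (q : ℕ) (b : Fin (q + 1) → ℝ) (s : Matrix (Fin q) (Fin q) ℝ),
            HeavyTail.IsStep σ q b s →
            ∃ Xs : Fin q → ℂ → ℂ,
              HeavyTail.IsStepSolution α μD q b s Xs ∧
              (∀ Xs' : Fin q → ℂ → ℂ, HeavyTail.IsStepSolution α μD q b s Xs' →
                ∀ r, EqOn (Xs' r) (Xs r) HeavyTail.upperHalf) ∧
              (∃ c : ℝ, ∀ r, ∀ z ∈ HeavyTail.upperHalf, ‖Xs r z‖ ≤ c * z.im ^ (-(α / 2))) ∧
              ∀ z ∈ HeavyTail.upperHalf, ∀ r : Fin q,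
                ∀ᵐ x ∂(volume.restrict (Ioc (b r.castSucc) (b r.succ))), X z x = Xs r z) := by
  obtain ⟨R, hR, hmain⟩ := hσ.exists_solution hα0 hα2
  refine ⟨R, hR, fun μD _ _ => ?_⟩
  obtain ⟨X, hXd, hXs, ⟨C, hC⟩, huniq, hlim⟩ := hmain μD
  have hXa : AnalyticOnNhd ℂ X HeavyTail.upperHalf :=
    hXd.analyticOnNhd HeavyTail.isOpen_upperHalf
  have hXc : ∀ z ∈ HeavyTail.upperHalf, ∀ᵐ x ∂HeavyTail.unitMeasure, X z x ∈ HeavyTail.cone α :=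
    fun z hz => (hXs z hz).mem_cone
  refine ⟨X, ⟨hXa, hXc, fun z hz _ => (hXs z hz).equation⟩, fun X' hX' => ?_, ?_,
    fun q b s hstep => ?_⟩
  -- A competitor satisfies the equation only for Im z ≥ R. It agrees with X there, and analyticity
  -- carries the equality to the whole half plane.
  · refine HeavyTail.eqOn_upperHalf_of_eq_large_im hX'.analytic hXa hR fun z hz => ?_
    have hz0 : z ∈ HeavyTail.upperHalf := hR.trans_le hz
    exact huniq z hz _ ⟨hX'.mem_cone z hz0, hX'.equation z hz0 hz⟩
  · obtain ⟨μ, hμ, hμS, hconv⟩ := HeavyTail.exists_limit_law (μD := μD) hα0 hσ.symm hlim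
      (HeavyTail.tendsto_mul_im_of_bound hα0 hα2 hXc hC)
    refine ⟨μ, hμ, fun z hz => ?_, ?_⟩
    · rw [HeavyTail.integral_hFun_eq hα0 hα2 hz (hXc z hz), ← hμS z hz, HeavyTail.stieltjes,
        ← integral_neg]
      refine integral_congr_ae (Eventually.of_forall fun t => ?_)
      beta_reduce
      rw [one_div, ← neg_sub, inv_neg]
    · intro Ω _ P _ ν x D hν hM
      have := hM.isProbabilityMeasure_law
      refine HeavyTail.weaklyConverges_succ ?_
      simp only [hM.meanSpectralMeasure_eq hσ.symm]
      exact fun f => (hconv ν hν f).comp (tendsto_add_atTop_nat 1)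
  · obtain ⟨Xs, hsol, hu, -⟩ := hstep.exists_unique_stepSolution (μD := μD) hα0 hα2
    refine ⟨Xs, hsol, hu, hsol.exists_bound hstep hα0 hα2, fun z hz r => ?_⟩
    -- The finite solution, spread over the blocks, solves the kernel equation. So it equals X high
    -- up, and then everywhere since both are analytic with values in L^∞.
    have hEq : EqOn (fun z => HeavyTail.stepLp b fun r => Xs r z) X HeavyTail.upperHalf :=
      HeavyTail.eqOn_upperHalf_of_eq_large_im
        (hsol.differentiableOn_stepLp.analyticOnNhd HeavyTail.isOpen_upperHalf) hXa hR
        fun w hw => huniq w hw _ (hsol.solvesAt hstep (hR.trans_le hw))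
    filter_upwards [HeavyTail.stepLp_ae_eq hstep.strictMono hstep.first hstep.last
      (fun r => Xs r z) r] with x hx
    rw [← hEq hz]
    exact hx
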